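/- Let $p=(p_1,p_2,p_3)$ with $p_i>0$ and $p_1+p_2+p_3=1$, let $|p|=(p_1^2+p_2^2+p_3^2)^{1/2}$, and let $\Omega=\{v\in\mathbb R^3: |v|=1,\ |v_i|=p_i/|p|\text{ for }i=1,2,3\}$. Let $\vartheta_i$ change the sign of the $i$-th coordinate; for $v\in\Omega$ let $\mathrm m_v$ be the law of the random velocity which equals $\vartheta_i(v)$ with probability $p_i$. For $r>0$ let $\mathcal Q_r=[-r/2,r/2]^3$ and, for $w=\vartheta_k(v)$, let $B(v,w)=\{b\in\mathcal Q_r: b_k=-\tfrac{v_k}{|v_k|}\tfrac r2\}$. Fix $v_0\in\Omega$. *The forgetful process.* It starts at $Z(0)=0$ with velocity $W(0^+)=\tilde w_1=v_0$; the flight times $\tilde\xi_1,\tilde\xi_2,\dots$ are i.i.d. standard exponential, and $\tilde\tau_n=\tilde\xi_1+\dots+\tilde\xi_n$. During $[\tilde\tau_{n-1},\tilde\tau_n)$ the particle moves freely, with elastic reflections on the cubes $Z'_{n-1}+\mathcal Q_r$ and $Z'_{n-2}+\mathcal Q_r$ only. At time $\tilde\tau_n$ it attempts a fresh collision: given the past,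 $\tilde w_{n+1}$ has law $\mathrm m_{W(\tilde\tau_n^-)}$ and $\tilde\beta_n$ is uniform on $-B(W(\tilde\tau_n^-),\tilde w_{n+1})$. If $Z(s)\in Z(\tilde\tau_n)+\tilde\beta_n+\mathcal Q_r$ for some $s\in(\tilde\tau_{n-2},\tilde\tau_{n-1}]$, then the attempt is rejected: no scatterer is placed ($Z'_n$ is a fictitious point at infinity) and the velocity does not change; otherwise $Z'_n=Z(\tilde\tau_n)+\tilde\beta_n$ and $W(\tilde\tau_n^+)=\tilde w_{n+1}$. *Legs.* Condition on $\tilde\xi_1,\tilde\xi_2>1$ and let $$\gamma=\min\{i>1:\ \tilde\xi_{i-1},\tilde\xi_i,\tilde\xi_{i+1},\tilde\xi_{i+2}>1,\ \tilde w_{i+1}=v_0\},\qquad \theta=\tilde\tau_\gamma .$$ A leg is the piece $(Z(t):0\le t\le\theta)$ of this process, with the scatterers $Z'_1,\dots,Z'_\gamma$, started without any scatterer to remember (that is, $Z'_0$ and $Z'_{-1}$ are at infinity in the dynamics of the leg). Let $(Z_n(t):0\le t\le\theta_n)$, $n\ge1$, with $\gamma_n$ attempted collisions and scatterers $Z'_{n,1},\dots,Z'_{n,\gamma_n}$,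 be i.i.d. legs, and put $\Gamma_n=\sum_{k\le n}\gamma_k$, $\Theta_n=\sum_{k\le n}\theta_k$, $\Xi_n=\sum_{k\le n}Z_k(\theta_k)$. The concatenated process is $Z(t)=\Xi_m+Z_{m+1}(t-\Theta_m)$ for $\Theta_m<t\le\Theta_{m+1}$, with the scatterers $Z'_k=\Xi_m+Z'_{m+1,k-\Gamma_m}$ for $\Gamma_m<k\le\Gamma_{m+1}$, and $Z'_0=\beta_0\in-B(u_0,v_0)$ for some $u_0\in\Omega$ that differs from $v_0$ in the sign of one coordinate. For $j\ge1$ let $$\widehat W_j=\{\exists\, 0<t<\Theta_{j-1},\ \Gamma_{j-1}<k\le\Gamma_j:\ Z(t)-Z'_k\in\mathcal Q_r\},$$ $$\widetilde W_j=\{\exists\, 0\le k<\Gamma_{j-1},\ \Theta_{j-1}<t<\Theta_j:\ Z'_k-Z(t)\in\mathcal Q_r\}$$ (scatterers at infinity do not contribute). **Proposition.** There is a constant $C<\infty$, depending only on $p$ and $v_0$, such that for all $r>0$, all $u_0,\beta_0$ as above and all $j\ge1$, $$\mathbb P(\widetilde W_j)\le Cr^2,\qquad \mathbb P(\widehat W_j)\le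 Cr^2 .$$ -/

import Mathlib

open MeasureTheory ProbabilityTheory Set
open scoped ENNReal

noncomputable section

namespace WindTree

/-- Points and velocities in `ℝ³`, in coordinates. -/
abbrev Pt := Fin 3 → ℝ

/-! ### Velocities and scatterers -/

/-- The closed cube of side length `r`, centred at the origin, with faces parallel to the
coordinate planes. -/
def cube (r : ℝ) : Set Pt := {x | ∀ i, |x i| ≤ r / 2}

/-- `p` is a probability vector with positive entries. -/
def IsProbVec (p : Fin 3 → ℝ) : Prop := (∀ i, 0 < p i) ∧ ∑ i, p i = 1

/-- The set of velocities: unit vectors with `|v i| = p i / |p|`. -/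
def velocities (p : Fin 3 → ℝ) : Set Pt :=
  {v | ∑ i, v i ^ 2 = 1 ∧ ∀ i, |v i| = p i / Real.sqrt (∑ k, p k ^ 2)}

/-- Reversal of the `i`-th component of the velocity. -/
def flip (i : Fin 3) (v : Pt) : Pt := Function.update v i (-(v i))

/-- The velocities accessible from `v` by one collision. -/
def accessible (p : Fin 3 → ℝ) (v : Pt) : Set Pt :=
  {w | w ∈ velocities p ∧ ∃ i, w = flip i v}

/-- The face of the cube which a particle of velocity `v` strikes when the `k`-th component of
its velocity gets reversed. -/
def face (r : ℝ) (v : Pt) (k : Fin 3) : Set Pt :=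
  {b | b ∈ cube r ∧ b k = -(v k / |v k|) * (r / 2)}

/-- The face of the cube at which a particle of velocity `v` adopts the velocity `w`. -/
def faceBetween (r : ℝ) (v w : Pt) : Set Pt :=
  {b | ∃ k, w = flip k v ∧ b ∈ face r v k}

/-! ### Mechanical flight among cubes with centres in `S` -/

/-- A particle which is at `y` with velocity `v` strikes a scatterer and has the `i`-th component
of its velocity reversed. -/
def Strikes (r : ℝ) (S : Set Pt) (y v : Pt) (i : Fin 3) : Prop :=
  ∃ c ∈ S, y - c ∈ face r v i

/-- The times at which free motion from `x` with velocity `v` strikes a scatterer. -/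
def hitTimes (r : ℝ) (S : Set Pt) (x v : Pt) : Set ℝ :=
  {t | 0 ≤ t ∧ ∃ i, Strikes r S (x + t • v) v i}

/-- Time, position and (outgoing) velocity at a moment of the flight. -/
structure Phase where
  time : ℝ
  pos : Pt
  vel : Pt

open Classical in
/-- Free motion up to the next impact, and elastic reflection there. -/
def nextImpact (r : ℝ) (S : Set Pt) (q : Phase) : Phase :=
  let h := sInf (hitTimes r S q.pos q.vel)
  let y := q.pos + h • q.vel
  { time := q.time + h
    pos := y
    vel := fun i => if Strikes r S y q.vel i then -(q.vel i) else q.vel i }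

/-- The phase just after the `n`-th impact (the initial one for `n = 0`). -/
def impacts (r : ℝ) (S : Set Pt) (x v : Pt) (n : ℕ) : Phase :=
  (nextImpact r S)^[n] ⟨0, x, v⟩

/-- The number of impacts up to time `t`: the least `n` such that after the `n`-th impact no
further impact occurs by time `t`. -/
def impactCount (r : ℝ) (S : Set Pt) (x v : Pt) (t : ℝ) : ℕ :=
  sInf {n | ∀ h ∈ hitTimes r S (impacts r S x v n).pos (impacts r S x v n).vel,
    t < (impacts r S x v n).time + h}

/-- The last impact phase up to time `t`. -/
def lastImpact (r : ℝ) (S : Set Pt) (x v : Pt) (t : ℝ) : Phase :=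
  impacts r S x v (impactCount r S x v t)

/-- The position at time `t` of a particle which starts at `x` with velocity `v`, and moves freely
with elastic reflections on the cubes of side `r` with centres in `S`. -/
def flightPos (r : ℝ) (S : Set Pt) (x v : Pt) (t : ℝ) : Pt :=
  (lastImpact r S x v t).pos + (t - (lastImpact r S x v t).time) • (lastImpact r S x v t).vel

/-- The velocity of that particle at time `t`. -/
def flightVel (r : ℝ) (S : Set Pt) (x v : Pt) (t : ℝ) : Pt :=
  (lastImpact r S x v t).vel

/-! ### The random data of a leg -/

/-- The data of one attempted fresh collision: the length of the flight before it, the index of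
the velocity component to be reversed, and a point of the unit cube that selects the impact
parameter. -/
abbrev Attempt := ℝ × Fin 3 × (Fin 3 → ℝ)

/-- The law of the index: `i` has probability `p i`. -/
def indexLaw (p : Fin 3 → ℝ) : Measure (Fin 3) := ∑ i, ENNReal.ofReal (p i) • Measure.dirac i

/-- The uniform law on `[-1/2, 1/2]³`. -/
def unitCubeLaw : Measure (Fin 3 → ℝ) :=
  Measure.pi fun _ => (volume : Measure ℝ).restrict (Icc (-(1 / 2)) (1 / 2))

/-- The law of one attempt: a standard exponential flight time, an index with law `p` and a
uniform point, all independent. -/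
def attemptLaw (p : Fin 3 → ℝ) : Measure Attempt :=
  (expMeasure 1).prod ((indexLaw p).prod unitCubeLaw)

/-- The flight time `ξ_i`, for `i ≥ 1`. (The entry of index `0` is never used.) -/
def flightTime (ω : ℕ → Attempt) (i : ℕ) : ℝ := (ω i).1

/-- The law of the data from which one leg is built: independent attempts, conditioned on the
first two flight times being greater than `1`. -/
def legLaw (p : Fin 3 → ℝ) : Measure (ℕ → Attempt) :=
  (Measure.infinitePi fun _ : ℕ => attemptLaw p)[|{ω | 1 < flightTime ω 1 ∧ 1 < flightTime ω 2}]

/-- The impact parameter at a collision in which a particle of velocity `v` has its `k`-th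
component reversed: for `a` uniform in `[-1/2, 1/2]³`, it is uniform on `-(face r v k)`. -/
def impactParam (r : ℝ) (v : Pt) (k : Fin 3) (a : Fin 3 → ℝ) : Pt :=
  fun i => if i = k then (v k / |v k|) * (r / 2) else r * a i

/-! ### The forgetful process in one leg -/

/-- The state of the forgetful process just after its `n`-th attempted fresh collision. The value
`none` stands for the fictitious scatterer at infinity. -/
structure State where
  /-- position at the attempt -/
  pos : Pt
  /-- velocity after the attempt -/
  vel : Pt
  /-- the velocity which the attempt was to produce -/
  attempted : Pt
  /-- the scatterer placed at this attempt -/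
  cur : Option Pt
  /-- the scatterer placed at the preceding attempt -/
  prev : Option Pt
  /-- the path during the flight that ended at this attempt -/
  path : Set Pt

/-- The scatterers which the forgetful process still remembers. -/
def State.scatterers (s : State) : Set Pt := {c | s.cur = some c ∨ s.prev = some c}

/-- The start of a leg, with velocity `v₀`. -/
def State.init (v₀ : Pt) : State := ⟨0, v₀, v₀, none, none, ∅⟩

open Classical in
/-- One flight, on the two remembered scatterers, followed by an attempt of a fresh collision,
which is rejected if the new scatterer would meet the path of the preceding flight. -/
def State.step (r : ℝ) (s : State) (a : Attempt) : State :=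
  let y := flightPos r s.scatterers s.pos s.vel a.1
  let v := flightVel r s.scatterers s.pos s.vel a.1
  let w := flip a.2.1 v
  let c := y + impactParam r v a.2.1 a.2.2
  let shadowed : Prop := ∃ z ∈ s.path, z - c ∈ cube r
  { pos := y
    vel := if shadowed then v else w
    attempted := w
    cur := if shadowed then none else some c
    prev := s.cur
    path := (fun t => flightPos r s.scatterers s.pos s.vel t) '' Ioc 0 a.1 }

/-- The states of the leg after the attempts `0, 1, 2, …`. -/
def state (r : ℝ) (v₀ : Pt) (ω : ℕ → Attempt) : ℕ → State
  | 0 => State.init v₀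
  | n + 1 => (state r v₀ ω n).step r (ω (n + 1))

/-- The time `τ_n` of the `n`-th attempt in the leg. -/
def attemptTime (ω : ℕ → Attempt) (n : ℕ) : ℝ := ∑ i ∈ Finset.Icc 1 n, flightTime ω i

/-- The number `γ` of attempts in the leg: the least `i > 1` such that the flight times of indices
`i - 1, i, i + 1, i + 2` are greater than `1` and the attempted velocity after the `i`-th attempt
is `v₀`. -/
def legCount (r : ℝ) (v₀ : Pt) (ω : ℕ → Attempt) : ℕ :=
  sInf {i | 1 < i ∧ 1 < flightTime ω (i - 1) ∧ 1 < flightTime ω i ∧ 1 < flightTime ω (i + 1) ∧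
    1 < flightTime ω (i + 2) ∧ (state r v₀ ω i).attempted = v₀}

/-- The duration `θ` of the leg. -/
def legDuration (r : ℝ) (v₀ : Pt) (ω : ℕ → Attempt) : ℝ := attemptTime ω (legCount r v₀ ω)

/-- The end point of the leg. -/
def legEnd (r : ℝ) (v₀ : Pt) (ω : ℕ → Attempt) : Pt := (state r v₀ ω (legCount r v₀ ω)).pos

/-- The position at time `t` in the leg. -/
def legPos (r : ℝ) (v₀ : Pt) (ω : ℕ → Attempt) (t : ℝ) : Pt :=
  let n := sSup {n | attemptTime ω n ≤ t}
  let s := state r v₀ ω n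
  flightPos r s.scatterers s.pos s.vel (t - attemptTime ω n)

/-! ### The concatenated process

The data of the legs form a sequence `ϖ`; leg `n`, for `n ≥ 1`, is built from `ϖ n`, and `ϖ 0` is
never used. -/

/-- The law of the data of all legs: independent, each with law `legLaw p`. -/
def processLaw (p : Fin 3 → ℝ) : Measure (ℕ → ℕ → Attempt) :=
  Measure.infinitePi fun _ : ℕ => legLaw p

lemma isProbabilityMeasure_attemptLaw {p : Fin 3 → ℝ} (hp : IsProbVec p) :
    IsProbabilityMeasure (attemptLaw p) := by
  have h1 : IsProbabilityMeasure (expMeasure 1) := isProbabilityMeasure_expMeasure one_pos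
  have h2 : IsProbabilityMeasure (indexLaw p) := ⟨by
    simp only [indexLaw, Measure.coe_finsetSum, Finset.sum_apply, Measure.smul_apply,
      measure_univ, smul_eq_mul, mul_one]
    rw [← ENNReal.ofReal_sum_of_nonneg fun i _ => (hp.1 i).le, hp.2, ENNReal.ofReal_one]⟩
  have h3 : IsProbabilityMeasure ((volume : Measure ℝ).restrict (Icc (-(1 / 2)) (1 / 2))) := ⟨by
    rw [Measure.restrict_apply_univ, Real.volume_Icc]; norm_num⟩
  unfold attemptLaw unitCubeLaw
  infer_instance

lemma isProbabilityMeasure_legLaw {p : Fin 3 → ℝ} (hp : IsProbVec p) :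
    IsProbabilityMeasure (legLaw p) := by
  have h0 := isProbabilityMeasure_attemptLaw hp
  have h1 : IsProbabilityMeasure (expMeasure 1) := isProbabilityMeasure_expMeasure one_pos
  refine cond_isProbabilityMeasure ?_
  have hexp : expMeasure 1 (Ioi 1) ≠ 0 := by
    have h := prob_compl_eq_one_sub (μ := expMeasure 1) (measurableSet_Iic (a := (1 : ℝ)))
    rw [compl_Iic] at h
    rw [h, ← ofReal_cdf, cdf_expMeasure_eq one_pos]
    simp only [zero_le_one, if_true, ne_eq, tsub_eq_zero_iff_le, not_le]
    rw [ENNReal.ofReal_lt_one]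
    simpa using Real.exp_pos (-1)
  have hset : {ω : ℕ → Attempt | 1 < flightTime ω 1 ∧ 1 < flightTime ω 2} =
      Set.pi (({1, 2} : Finset ℕ) : Set ℕ) fun _ => Ioi (1 : ℝ) ×ˢ univ := by
    ext ω; simp [flightTime, Set.pi]
  have hatt : attemptLaw p (Ioi (1 : ℝ) ×ˢ univ) = expMeasure 1 (Ioi 1) := by
    have h2 : IsProbabilityMeasure ((attemptLaw p).map Prod.snd) :=
      Measure.isProbabilityMeasure_map measurable_snd.aemeasurable
    have h3 : (attemptLaw p).map Prod.snd = (indexLaw p).prod unitCubeLaw := by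
      have : SFinite unitCubeLaw := by unfold unitCubeLaw; infer_instance
      simp [attemptLaw, Measure.map_snd_prod]
    rw [h3] at h2
    rw [attemptLaw, Measure.prod_prod, measure_univ, mul_one]
  rw [hset, Measure.infinitePi_pi _ fun _ _ => measurableSet_Ioi.prod MeasurableSet.univ]
  simp [hatt, hexp]

/-- The law of the data is a probability measure. -/
lemma isProbabilityMeasure_processLaw {p : Fin 3 → ℝ} (hp : IsProbVec p) :
    IsProbabilityMeasure (processLaw p) := by
  have h := isProbabilityMeasure_legLaw hp
  unfold processLaw
  infer_instance

/-- `Γ_n`, the number of attempts in the first `n` legs. -/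
def totalCount (r : ℝ) (v₀ : Pt) (ϖ : ℕ → ℕ → Attempt) (n : ℕ) : ℕ :=
  ∑ k ∈ Finset.Icc 1 n, legCount r v₀ (ϖ k)

/-- `Θ_n`, the duration of the first `n` legs. -/
def totalTime (r : ℝ) (v₀ : Pt) (ϖ : ℕ → ℕ → Attempt) (n : ℕ) : ℝ :=
  ∑ k ∈ Finset.Icc 1 n, legDuration r v₀ (ϖ k)

/-- `Ξ_n`, the position at the end of the `n`-th leg. -/
def legsEnd (r : ℝ) (v₀ : Pt) (ϖ : ℕ → ℕ → Attempt) (n : ℕ) : Pt :=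
  ∑ k ∈ Finset.Icc 1 n, legEnd r v₀ (ϖ k)

/-- The position `Z(t)`, `t > 0`, of the concatenated process. -/
def position (r : ℝ) (v₀ : Pt) (ϖ : ℕ → ℕ → Attempt) (t : ℝ) : Pt :=
  let m := sSup {m | totalTime r v₀ ϖ m < t}
  legsEnd r v₀ ϖ m + legPos r v₀ (ϖ (m + 1)) (t - totalTime r v₀ ϖ m)

/-- The position `Z'_k` of the scatterer placed at the `k`-th attempt of the concatenated process
(`none` if that attempt was rejected); `Z'_0 = β₀`. -/
def scatterer (r : ℝ) (v₀ β₀ : Pt) (ϖ : ℕ → ℕ → Attempt) (k : ℕ) : Option Pt :=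
  if k = 0 then some β₀ else
    let m := sSup {m | totalCount r v₀ ϖ m < k}
    (state r v₀ (ϖ (m + 1)) (k - totalCount r v₀ ϖ m)).cur.map (legsEnd r v₀ ϖ m + ·)

/-- A collision during the `j`-th leg is virtually shadowed by the path of an earlier leg. -/
def shadowEvent (r : ℝ) (v₀ β₀ : Pt) (j : ℕ) : Set (ℕ → ℕ → Attempt) :=
  {ϖ | ∃ t k c, 0 < t ∧ t < totalTime r v₀ ϖ (j - 1) ∧
    totalCount r v₀ ϖ (j - 1) < k ∧ k ≤ totalCount r v₀ ϖ j ∧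
    scatterer r v₀ β₀ ϖ k = some c ∧ position r v₀ ϖ t - c ∈ cube r}

/-- During the `j`-th leg the path virtually collides with a scatterer placed before that leg. -/
def recollisionEvent (r : ℝ) (v₀ β₀ : Pt) (j : ℕ) : Set (ℕ → ℕ → Attempt) :=
  {ϖ | ∃ t k c, k < totalCount r v₀ ϖ (j - 1) ∧
    totalTime r v₀ ϖ (j - 1) < t ∧ t < totalTime r v₀ ϖ j ∧
    scatterer r v₀ β₀ ϖ k = some c ∧ c - position r v₀ ϖ t ∈ cube r}

end WindTree

end

/-!
Let `a` be the least modulus of a velocity component. If `41 * r / a ^ 3 ≥ 1`, the bound holds with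
`C = (41 / a ^ 3) ^ 2`, as probabilities are at most `1`. So let `r` be small.

**Geometry of a leg.** Outside of a null set no impact takes place at an edge: by
`impacts_origin_mem` the coordinates of all positions lie in certain countable groups, and almost
surely the impact parameters and flight times satisfy no relation in these groups (`Generic`,
`ae_generic`, `inv_state`). Then a flight among two remembered cubes is simple: while the particle
bounces between them, only one component of its velocity is reversed, and the other two carry it out
of their shadow. Hence the motion is uniform from time `6 * r / a ^ 2` on (`TwoCubes.uniform`), and
a flight stays within `18 * r / a ^ 2` of the straight line through its end
(`GoodFlight.near_line`). A flight that follows a long flight is free, and an attempt after two long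
flights is accepted (`Setting.straight`, `Setting.not_shadowed`).

**Linearity.** An event of either kind forces two moments, in different legs `i < j`, between which
the displacement is at most `40 * r / a ^ 2`. One of them is the moment of an attempt, and the other
one may be taken from a grid of step `r` (`Sample`, `Sample.event`, `encounter`). The displacement
is an affine function of certain flight times, if all other data are fixed: of the first two in each
leg between `i` and `j`, of the last one in leg `i`, of the first one in leg `j`, and in a leg
without short flights of all (`Sample.vec_shift`, `Sample.disp_shift`). The coefficients are the
velocities. If three independent velocities occur, a small displacement determines three flight
times up to an error of order `r`, and has probability `O(r ^ 3)` (`measure_le_of_determined`).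

**Three directions.** The first two flights of a leg have the directions `u` and `flip κ u`, where
`κ` is the first index of the leg. If two different indices `κ`, `κ'` occur in the `m` legs between
`i` and `j`, say `N` and `N'` times, then a small displacement determines three sums, of `m`, `N` and
`N'` flight times. Such a sum of `N` terms has a density of order `1 / √N`
(`measure_sum_fst_le`), so that the probability is of order `r ^ 3 / √(m * N * N')`
(`Sample.measure_words_le`). Its mean over the random indices is `O(r ^ 3 * m ^ (-3 / 2))`
(`sum_words_inv_sqrt_le`), which is summable. If only one index `κ` occurs, which has probability
`p κ ^ m`, two directions are at hand. A third condition is found as follows. If all flights were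
long and had directions in the plane of `u` and `flip κ u`, then the motion in the other two
coordinates would be monotone, and the displacement would not be small.
So there is a short flight, which has probability `O(r)`, or a flight in a transversal direction
(`Sample.exists_short_or_transversal`, `exists_measure_planar_le`).

**Summation.** The number of attempts in a leg has exponential tails, as in each run of eleven
attempts there is a chance that the flights are long and the indices follow a Gray code, in which
case the leg ends (`exists_decay`). These tails are compatible with the other estimates, because
those resample only a bounded number of flight times, or the first two of each leg, which the runs
do not contain. So the bound `O(r ^ 3)` for two given moments
is summable over the leg `i` and the numbers of attempts (`exists_measure_event_le`), and the sum
over the discretized moments gives a factor of order `1 / r` (`exists_measure_encounter_le`).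
-/

noncomputable section

namespace WindTree

/-! ### Flight among at most two cubes -/

/-- `v` arises from the reference velocity `u` by changing signs of components. -/
def IsVel (u v : Pt) : Prop := ∀ i, v i = u i ∨ v i = -(u i)

lemma IsVel.refl (u : Pt) : IsVel u u := fun _ => Or.inl rfl

lemma IsVel.abs_eq {u v : Pt} (h : IsVel u v) (i : Fin 3) : |v i| = |u i| := by
  rcases h i with h | h <;> simp [h]

lemma IsVel.ne_zero {u v : Pt} (h : IsVel u v) (hu : ∀ i, u i ≠ 0) (i : Fin 3) : v i ≠ 0 := by
  rcases h i with h | h <;> simp [h, hu i]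

lemma IsVel.trans {u v w : Pt} (h : IsVel u v) (h' : IsVel v w) : IsVel u w := by
  intro i
  rcases h i with h | h <;> rcases h' i with h' | h' <;> simp [h, h']

lemma isVel_flip (k : Fin 3) (v : Pt) : IsVel v (flip k v) := by
  intro i
  by_cases h : i = k
  · subst h; simp [flip]
  · simp [flip, h]

lemma isVel_nextImpact (r : ℝ) (S : Set Pt) (q : Phase) : IsVel q.vel (nextImpact r S q).vel := by
  intro i
  by_cases h : Strikes r S (q.pos + sInf (hitTimes r S q.pos q.vel) • q.vel) q.vel i
  · right; simp [nextImpact, h]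
  · left; simp [nextImpact, h]

lemma impacts_zero (r : ℝ) (S : Set Pt) (x v : Pt) : impacts r S x v 0 = ⟨0, x, v⟩ := rfl

lemma impacts_succ (r : ℝ) (S : Set Pt) (x v : Pt) (n : ℕ) :
    impacts r S x v (n + 1) = nextImpact r S (impacts r S x v n) := by
  simp [impacts, Function.iterate_succ_apply']

lemma isVel_impacts (r : ℝ) (S : Set Pt) (x v : Pt) (n : ℕ) :
    IsVel v (impacts r S x v n).vel := by
  induction n with
  | zero => exact IsVel.refl v
  | succ n ih => rw [impacts_succ]; exact ih.trans (isVel_nextImpact _ _ _)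

lemma sInf_hitTimes_nonneg (r : ℝ) (S : Set Pt) (x v : Pt) : 0 ≤ sInf (hitTimes r S x v) :=
  Real.sInf_nonneg fun _ h => h.1

lemma bddBelow_hitTimes (r : ℝ) (S : Set Pt) (x v : Pt) : BddBelow (hitTimes r S x v) :=
  ⟨0, fun _ h => h.1⟩

lemma face_coord {r : ℝ} {b v : Pt} {i : Fin 3} (h : b ∈ face r v i) (hv : v i ≠ 0) :
    v i * b i = -(|v i| * (r / 2)) := by
  rw [h.2]
  have : |v i| ≠ 0 := abs_ne_zero.2 hv
  field_simp
  rw [← sq_abs]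

lemma face_abs {r : ℝ} (hr : 0 < r) {b v : Pt} {i : Fin 3} (h : b ∈ face r v i) (hv : v i ≠ 0) :
    |b i| = r / 2 := by
  have := congrArg abs (face_coord h hv)
  rw [abs_mul, abs_neg, abs_mul, abs_abs, abs_of_pos (half_pos hr)] at this
  exact mul_left_cancel₀ (abs_ne_zero.2 hv) this

lemma hitTimes_finite (r : ℝ) {S : Set Pt} (hS : S.Finite) (x : Pt) {v : Pt}
    (hv : ∀ i, v i ≠ 0) : (hitTimes r S x v).Finite := by
  have : hitTimes r S x v ⊆
      ⋃ c ∈ S, ⋃ i : Fin 3, {(c i - x i - v i / |v i| * (r / 2)) / v i} := by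
    rintro t ⟨_, i, c, hc, hf⟩
    simp only [mem_iUnion, mem_singleton_iff, exists_prop]
    refine ⟨c, hc, i, ?_⟩
    have := hf.2
    simp only [Pi.sub_apply, Pi.add_apply, Pi.smul_apply, smul_eq_mul] at this
    rw [eq_div_iff (hv i)]; linarith
  exact (hS.biUnion fun c _ => finite_iUnion fun i => finite_singleton _).subset this

lemma sInf_mem_hitTimes {r : ℝ} {S : Set Pt} (hS : S.Finite) {x : Pt} {v : Pt}
    (hv : ∀ i, v i ≠ 0) (hne : (hitTimes r S x v).Nonempty) :
    sInf (hitTimes r S x v) ∈ hitTimes r S x v :=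
  hne.csInf_mem (hitTimes_finite r hS x hv)

/-- A particle at `x` with velocity `v` cannot strike the cube with centre `c`: it has passed it in
some coordinate, or it touches it in the relative interior of a face that it is leaving. -/
def Clear (r : ℝ) (x v c : Pt) : Prop :=
  (∃ i, |v i| * (r / 2) < v i * (x i - c i)) ∨
    ∃ i, v i * (x i - c i) = |v i| * (r / 2) ∧ ∀ j ≠ i, |x j - c j| < r / 2

lemma notMem_cube_of_lt {r : ℝ} {y v : Pt} {i : Fin 3} (h : |v i| * (r / 2) < v i * y i) :
    y ∉ cube r := by
  intro hy
  have h1 : v i * y i ≤ |v i| * |y i| := (le_abs_self _).trans (abs_mul _ _).le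
  have h2 := mul_le_mul_of_nonneg_left (hy i) (abs_nonneg (v i))
  linarith

lemma notMem_cube_of_touch {r : ℝ} {x v c : Pt} {i : Fin 3} {t : ℝ} (hv : v i ≠ 0) (ht : 0 < t)
    (h : |v i| * (r / 2) ≤ v i * (x i - c i)) : x + t • v - c ∉ cube r := by
  apply notMem_cube_of_lt (v := v) (i := i)
  have : 0 < t * (v i * v i) := mul_pos ht (mul_self_pos.2 hv)
  simp only [Pi.sub_apply, Pi.add_apply, Pi.smul_apply, smul_eq_mul]
  nlinarith

lemma Clear.notMem_face {r : ℝ} (hr : 0 < r) {x v c : Pt} (hv : ∀ i, v i ≠ 0)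
    (h : Clear r x v c) {t : ℝ} (ht : 0 ≤ t) (i : Fin 3) : x + t • v - c ∉ face r v i := by
  intro hf
  rcases ht.eq_or_lt with rfl | ht
  · rw [zero_smul, add_zero] at hf
    rcases h with ⟨k, hk⟩ | ⟨k, hk, hk'⟩
    · exact notMem_cube_of_lt (by simpa using hk) hf.1
    · by_cases hik : i = k
      · subst hik
        have := face_coord hf (hv i)
        simp only [Pi.sub_apply] at this
        have h2 : 0 < |v i| * (r / 2) := mul_pos (abs_pos.2 (hv i)) (half_pos hr)
        linarith
      · have := face_abs hr hf (hv i)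
        exact absurd (hk' i hik) (by simpa using this.ge)
  · rcases h with ⟨k, hk⟩ | ⟨k, hk, _⟩
    · exact notMem_cube_of_touch (hv k) ht hk.le hf.1
    · exact notMem_cube_of_touch (hv k) ht hk.ge hf.1

/-- A particle that has passed every cube in some coordinate, or is leaving it through a face, meets
no cube any more. -/
lemma hitTimes_eq_empty {r : ℝ} (hr : 0 < r) {S : Set Pt} {x v : Pt} (hv : ∀ i, v i ≠ 0)
    (h : ∀ c ∈ S, Clear r x v c) : hitTimes r S x v = ∅ := by
  rw [eq_empty_iff_forall_notMem]
  rintro t ⟨ht, i, c, hc, hf⟩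
  exact (h c hc).notMem_face hr hv ht i hf

lemma impactCount_eq_zero {r : ℝ} {S : Set Pt} {x v : Pt} (h : hitTimes r S x v = ∅) (t : ℝ) :
    impactCount r S x v t = 0 := by
  unfold impactCount
  rw [Nat.sInf_eq_zero]
  left
  intro s hs
  rw [impacts_zero] at hs
  simp [h] at hs

lemma flightPos_of_free {r : ℝ} {S : Set Pt} {x v : Pt} (h : hitTimes r S x v = ∅) (t : ℝ) :
    flightPos r S x v t = x + t • v := by
  simp [flightPos, lastImpact, impactCount_eq_zero h, impacts_zero]

lemma flightVel_of_free {r : ℝ} {S : Set Pt} {x v : Pt} (h : hitTimes r S x v = ∅) (t : ℝ) :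
    flightVel r S x v t = v := by
  simp [flightVel, lastImpact, impactCount_eq_zero h, impacts_zero]

lemma isVel_flightVel (r : ℝ) (S : Set Pt) (x v : Pt) (t : ℝ) :
    IsVel v (flightVel r S x v t) := isVel_impacts _ _ _ _ _

lemma impacts_succ_time (r : ℝ) (S : Set Pt) (x v : Pt) (n : ℕ) :
    (impacts r S x v (n + 1)).time = (impacts r S x v n).time +
      sInf (hitTimes r S (impacts r S x v n).pos (impacts r S x v n).vel) := by
  rw [impacts_succ]; rfl

lemma impacts_succ_pos (r : ℝ) (S : Set Pt) (x v : Pt) (n : ℕ) :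
    (impacts r S x v (n + 1)).pos = (impacts r S x v n).pos +
      sInf (hitTimes r S (impacts r S x v n).pos (impacts r S x v n).vel) •
        (impacts r S x v n).vel := by
  rw [impacts_succ]; rfl

lemma impacts_time_nonneg (r : ℝ) (S : Set Pt) (x v : Pt) (n : ℕ) :
    0 ≤ (impacts r S x v n).time := by
  induction n with
  | zero => exact le_rfl
  | succ n ih => rw [impacts_succ_time]; exact add_nonneg ih (sInf_hitTimes_nonneg _ _ _ _)

lemma abs_impacts_pos_sub_le (r : ℝ) (S : Set Pt) (x v : Pt) (n : ℕ) (i : Fin 3) :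
    |(impacts r S x v n).pos i - x i| ≤ |v i| * (impacts r S x v n).time := by
  induction n with
  | zero => simp [impacts_zero]
  | succ n ih =>
    rw [impacts_succ_time, impacts_succ_pos]
    have h := (isVel_impacts r S x v n).abs_eq i
    have h0 := sInf_hitTimes_nonneg r S (impacts r S x v n).pos (impacts r S x v n).vel
    set s := sInf (hitTimes r S (impacts r S x v n).pos (impacts r S x v n).vel)
    have h1 : |s * (impacts r S x v n).vel i| = |v i| * s := by
      rw [abs_mul, abs_of_nonneg h0, h, mul_comm]
    have h2 := abs_add_le ((impacts r S x v n).pos i - x i) (s * (impacts r S x v n).vel i)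
    simp only [Pi.add_apply, Pi.smul_apply, smul_eq_mul]
    rw [show (impacts r S x v n).pos i + s * (impacts r S x v n).vel i - x i =
      ((impacts r S x v n).pos i - x i) + s * (impacts r S x v n).vel i by ring]
    rw [mul_add]
    linarith

lemma lastImpact_time_le (r : ℝ) (S : Set Pt) (x v : Pt) {t : ℝ} (ht : 0 ≤ t) :
    (lastImpact r S x v t).time ≤ t := by
  unfold lastImpact
  rcases hn : impactCount r S x v t with _ | n
  · exact ht
  · have hlt : n < impactCount r S x v t := by omega
    have := Nat.notMem_of_lt_sInf hlt
    simp only [mem_ofPred_eq, not_forall, not_lt, exists_prop] at this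
    obtain ⟨h, hh, hle⟩ := this
    rw [impacts_succ_time]
    have := csInf_le (bddBelow_hitTimes _ _ _ _) hh
    linarith

lemma abs_flightPos_sub_le (r : ℝ) (S : Set Pt) (x v : Pt) {t : ℝ} (ht : 0 ≤ t) (i : Fin 3) :
    |flightPos r S x v t i - x i| ≤ |v i| * t := by
  have h1 := lastImpact_time_le r S x v ht
  have h2 := abs_impacts_pos_sub_le r S x v (impactCount r S x v t) i
  have h3 := (isVel_impacts r S x v (impactCount r S x v t)).abs_eq i
  change |(lastImpact r S x v t).pos i - x i| ≤ |v i| * (lastImpact r S x v t).time at h2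
  change |(lastImpact r S x v t).vel i| = |v i| at h3
  simp only [flightPos, Pi.add_apply, Pi.smul_apply, smul_eq_mul]
  set q := lastImpact r S x v t
  have h4 : |(t - q.time) * q.vel i| = |v i| * (t - q.time) := by
    rw [abs_mul, abs_of_nonneg (sub_nonneg.2 h1), h3, mul_comm]
  have h5 := abs_add_le (q.pos i - x i) ((t - q.time) * q.vel i)
  rw [show q.pos i + (t - q.time) * q.vel i - x i = (q.pos i - x i) + (t - q.time) * q.vel i by
    ring]
  rw [h4, mul_sub] at h5
  linarith

/-- If no impact occurs after time `B`, the number of impacts does not change any more. (With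
`hitTimes = ∅` the definition of `impacts` repeats the last phase, so that the hypothesis is needed
only for those impacts that do occur.) -/
lemma impactCount_eq_of_le {r : ℝ} {S : Set Pt} {x v : Pt} {B : ℝ}
    (hS : S.Finite) (hv : ∀ i, v i ≠ 0)
    (h : ∀ n, (hitTimes r S (impacts r S x v n).pos (impacts r S x v n).vel).Nonempty →
      (impacts r S x v (n + 1)).time ≤ B) {t : ℝ} (ht : B ≤ t) :
    impactCount r S x v t = impactCount r S x v B := by
  unfold impactCount
  congr 1
  ext n
  simp only [mem_ofPred_eq]
  rcases eq_empty_or_nonempty (hitTimes r S (impacts r S x v n).pos (impacts r S x v n).vel)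
    with he | he
  · simp [he]
  · have h1 := h n he
    have h2 := sInf_mem_hitTimes hS ((isVel_impacts r S x v n).ne_zero hv) he
    rw [impacts_succ_time] at h1
    constructor
    · intro h3; have := h3 _ h2; linarith
    · intro h3; have := h3 _ h2; linarith

/-- If no impact occurs after time `B`, the motion is uniform from then on. -/
lemma flightPos_of_le {r : ℝ} {S : Set Pt} {x v : Pt} {B : ℝ}
    (hS : S.Finite) (hv : ∀ i, v i ≠ 0)
    (h : ∀ n, (hitTimes r S (impacts r S x v n).pos (impacts r S x v n).vel).Nonempty →
      (impacts r S x v (n + 1)).time ≤ B) {s t : ℝ} (hs : B ≤ s) (ht : B ≤ t) :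
    flightPos r S x v t = flightPos r S x v s + (t - s) • flightVel r S x v s ∧
      flightVel r S x v t = flightVel r S x v s := by
  have h1 : lastImpact r S x v t = lastImpact r S x v s := by
    unfold lastImpact
    rw [impactCount_eq_of_le hS hv h ht, impactCount_eq_of_le hS hv h hs]
  simp only [flightPos, flightVel, h1, and_true]
  ext i
  simp only [Pi.add_apply, Pi.smul_apply, smul_eq_mul]
  ring

/-- Tracing the outgoing ray back to time `0` gives a point whose coordinates, after a reflection
in a plane, change by `o ↦ 2 * plane - o`. So they stay in a group that contains the initial ones
and the doubled planes; the impact times do not enter. -/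
lemma impacts_origin_mem {r : ℝ} {S : Set Pt} {x v u : Pt} (hu : ∀ i, u i ≠ 0)
    (hv : IsVel u v) (P : Fin 3 → AddSubgroup ℝ) (hx : ∀ i, x i / u i ∈ P i)
    (hS : ∀ c ∈ S, ∀ i, (2 * c i + r) / u i ∈ P i ∧ (2 * c i - r) / u i ∈ P i) (n : ℕ)
    (i : Fin 3) :
    ((impacts r S x v n).pos i - (impacts r S x v n).time * (impacts r S x v n).vel i) / u i
      ∈ P i := by
  induction n with
  | zero => simpa [impacts_zero] using hx i
  | succ n ih =>
    have hvel := hv.trans (isVel_impacts r S x v n)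
    rw [impacts_succ]
    set q := impacts r S x v n
    simp only [nextImpact]
    set h := sInf (hitTimes r S q.pos q.vel)
    by_cases hst : Strikes r S (q.pos + h • q.vel) q.vel i
    · simp only [hst, if_true]
      obtain ⟨c, hc, hf⟩ := hst
      have h1 := hf.2
      simp only [Pi.sub_apply, Pi.add_apply, Pi.smul_apply, smul_eq_mul] at h1 ⊢
      have h2 : (q.vel i / |q.vel i|) = 1 ∨ (q.vel i / |q.vel i|) = -1 := by
        have hne := hvel.ne_zero hu i
        rcases lt_or_gt_of_ne hne with h | h
        · right; rw [abs_of_neg h, div_neg, div_self hne]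
        · left; rw [abs_of_pos h, div_self hne]
      have key : (q.pos i + h * q.vel i - (q.time + h) * -q.vel i) / u i =
          (2 * (q.pos i + h * q.vel i)) / u i - (q.pos i - q.time * q.vel i) / u i := by ring
      rw [key]
      refine (P i).sub_mem ?_ ih
      have h3 : q.pos i + h * q.vel i = c i - q.vel i / |q.vel i| * (r / 2) := by linarith
      rw [h3]
      rcases h2 with h2 | h2 <;> rw [h2]
      · convert (hS c hc i).2 using 2; ring
      · convert (hS c hc i).1 using 2; ring
    · simp only [hst, if_false, Pi.add_apply, Pi.smul_apply, smul_eq_mul]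
      convert ih using 2
      ring

/-- The position at time `t` is the traced-back origin plus `± t` times the initial velocity; so its
normalised coordinates are in the group of `impacts_origin_mem` up to `± t`. -/
lemma flightPos_mem {r : ℝ} {S : Set Pt} {x v u : Pt} (hu : ∀ i, u i ≠ 0)
    (hv : IsVel u v) (P : Fin 3 → AddSubgroup ℝ) (hx : ∀ i, x i / u i ∈ P i)
    (hS : ∀ c ∈ S, ∀ i, (2 * c i + r) / u i ∈ P i ∧ (2 * c i - r) / u i ∈ P i) (t : ℝ)
    (i : Fin 3) : flightPos r S x v t i / u i - t ∈ P i ∨ flightPos r S x v t i / u i + t ∈ P i := by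
  have h := impacts_origin_mem hu hv P hx hS (impactCount r S x v t) i
  have h2 := (hv.trans (isVel_impacts r S x v (impactCount r S x v t))) i
  change ((lastImpact r S x v t).pos i - (lastImpact r S x v t).time *
    (lastImpact r S x v t).vel i) / u i ∈ P i at h
  change (lastImpact r S x v t).vel i = _ ∨ (lastImpact r S x v t).vel i = _ at h2
  simp only [flightPos, Pi.add_apply, Pi.smul_apply, smul_eq_mul]
  have := hu i
  rcases h2 with h2 | h2
  · left; convert h using 1; rw [h2]; field_simp; ring
  · right; convert h using 1; rw [h2]; field_simp; ring

/-- The phase touches the cube with centre `c` in the relative interior of a face orthogonal to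
the `k`-th axis, and is leaving it. -/
def Touches (r : ℝ) (k : Fin 3) (q : Phase) (c : Pt) : Prop :=
  q.vel k * (q.pos k - c k) = |q.vel k| * (r / 2) ∧ ∀ j ≠ k, |q.pos j - c j| < r / 2

lemma Touches.clear {r : ℝ} {k : Fin 3} {q : Phase} {c : Pt} (h : Touches r k q c) :
    Clear r q.pos q.vel c := Or.inr ⟨k, h⟩

/-- A particle that has just left the cube `c` can only strike the other cube `c'`; if it does not
meet an edge there, exactly one component of the velocity is reversed. -/
lemma impact_other {r : ℝ} (hr : 0 < r) {S : Set Pt} {q : Phase} {c c' : Pt} {k : Fin 3}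
    (hS : S.Finite) (hsub : ∀ z ∈ S, z = c ∨ z = c') (hv : ∀ i, q.vel i ≠ 0)
    (ht : Touches r k q c) (haway : ∀ i, q.pos - c' ∉ face r q.vel i)
    (hne : (hitTimes r S q.pos q.vel).Nonempty)
    (hE : ∀ i j, i ≠ j → |(nextImpact r S q).pos i - c' i| = r / 2 →
      |(nextImpact r S q).pos j - c' j| = r / 2 → False) :
    0 < sInf (hitTimes r S q.pos q.vel) ∧ (nextImpact r S q).pos - c' ∈ cube r ∧
      |q.vel k| * (r / 2) < q.vel k * ((nextImpact r S q).pos k - c k) ∧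
      ∃ i, (nextImpact r S q).vel i = -q.vel i ∧
        (∀ j ≠ i, (nextImpact r S q).vel j = q.vel j) ∧ Touches r i (nextImpact r S q) c' := by
  have hmem := sInf_mem_hitTimes hS hv hne
  set h := sInf (hitTimes r S q.pos q.vel) with hh
  have hpos : (nextImpact r S q).pos = q.pos + h • q.vel := rfl
  rw [hpos] at hE ⊢
  classical
  have hvel : ∀ j, (nextImpact r S q).vel j =
    if Strikes r S (q.pos + h • q.vel) q.vel j then -(q.vel j) else q.vel j := fun j => by
    simp only [nextImpact, ← hh]
  have honly : ∀ j, Strikes r S (q.pos + h • q.vel) q.vel j →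
      q.pos + h • q.vel - c' ∈ face r q.vel j := by
    rintro j ⟨z, hz, hf⟩
    rcases hsub z hz with rfl | rfl
    · exact absurd hf (ht.clear.notMem_face hr hv hmem.1 j)
    · exact hf
  obtain ⟨h0, i, hst⟩ := hmem
  have hf := honly i hst
  have hpos0 : 0 < h := by
    rcases h0.eq_or_lt with h1 | h1
    · rw [← h1, zero_smul, add_zero] at hf
      exact absurd hf (haway i)
    · exact h1
  have hi := face_abs hr hf (hv i)
  have hstj : ∀ j ≠ i, ¬ Strikes r S (q.pos + h • q.vel) q.vel j := fun j hj hs =>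
    hE i j hj.symm hi (face_abs hr (honly j hs) (hv j))
  have hveli : (nextImpact r S q).vel i = -q.vel i := by rw [hvel, if_pos hst]
  refine ⟨hpos0, hf.1, ?_, i, hveli, fun j hj => by rw [hvel, if_neg (hstj j hj)], ?_, ?_⟩
  · have := ht.1
    have h2 : 0 < h * (q.vel k * q.vel k) := mul_pos hpos0 (mul_self_pos.2 (hv k))
    simp only [Pi.add_apply, Pi.smul_apply, smul_eq_mul]
    nlinarith
  · rw [hveli, hpos, abs_neg]
    have := face_coord hf (hv i)
    simp only [Pi.sub_apply] at this
    linarith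
  · intro j hj
    rw [hpos]
    exact lt_of_le_of_ne (hf.1 j) fun h' => hE i j hj.symm hi h'

/-- The two cubes near a flight: the particle starts at `x` with velocity `v` on the face of `c`
orthogonal to the `k`-th axis, leaving it; it is not on a plane that carries a face of `c'`; and no
impact takes place at an edge. -/
structure TwoCubes (r : ℝ) (S : Set Pt) (x v c c' : Pt) (k : Fin 3) : Prop where
  pos : 0 < r
  vel : ∀ i, v i ≠ 0
  sub : ∀ z ∈ S, z = c ∨ z = c'
  start : Touches r k ⟨0, x, v⟩ c
  off : ∀ i, |x i - c' i| ≠ r / 2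
  edge : ∀ n, ∀ z ∈ S, ∀ i j, i ≠ j → |(impacts r S x v (n + 1)).pos i - z i| = r / 2 →
    |(impacts r S x v (n + 1)).pos j - z j| = r / 2 → False

namespace TwoCubes

variable {r : ℝ} {S : Set Pt} {x v c c' : Pt} {k : Fin 3}

lemma finite (h : TwoCubes r S x v c c' k) : S.Finite :=
  ((finite_singleton c').insert c).subset fun z hz => by
    rcases h.sub z hz with rfl | rfl <;> simp

/-- The phase after the `n`-th impact while only the `k`-th component of the velocity has been
reversed; the last cube that was touched is `c` or `c'`, and the time `s` is that of the first
contact with `c'`. -/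
def Live (r : ℝ) (x v c c' : Pt) (k : Fin 3) (n : ℕ) (q : Phase) : Prop :=
  (∀ j ≠ k, q.vel j = v j ∧ q.pos j = x j + q.time * v j) ∧
  ((Touches r k q c ∧ (∀ w i, w i ≠ 0 → q.pos - c' ∉ face r w i) ∧
      (n = 0 ∨ ∃ s, 0 ≤ s ∧ s ≤ q.time ∧ ∀ j ≠ k, |x j + s * v j - c' j| ≤ r / 2)) ∨
    (Touches r k q c' ∧ (n ≠ 0 ∧ ∀ w i, w i ≠ 0 → q.pos - c ∉ face r w i) ∧
      ∃ s, 0 ≤ s ∧ s ≤ q.time ∧ ∀ j ≠ k, |x j + s * v j - c' j| ≤ r / 2))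

lemma live_zero (h : TwoCubes r S x v c c' k) : Live r x v c c' k 0 (impacts r S x v 0) := by
  refine ⟨fun j _ => by simp [impacts_zero], Or.inl ⟨h.start, fun w i hw hf => ?_, Or.inl rfl⟩⟩
  exact h.off i (by simpa [impacts_zero] using face_abs h.pos hf hw)

/-- One impact of a live particle. Either the reversed component is again the `k`-th one, and the
particle is still live, or it is another one, and the particle has then passed one cube and is
leaving the other, so that no impact follows. The components other than the `k`-th evolve uniformly
while the particle is live, and at each contact they are in the shadow of the cube, which has width
`r`. So impacts on `c` occur within time `r / |v j|` after the start, and later ones on `c'` within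
this time after the first contact with `c'`, which precedes an impact on `c`. -/
lemma live_step (h : TwoCubes r S x v c c' k) (n : ℕ)
    (hl : Live r x v c c' k n (impacts r S x v n))
    (hne : (hitTimes r S (impacts r S x v n).pos (impacts r S x v n).vel).Nonempty) :
    (Live r x v c c' k (n + 1) (impacts r S x v (n + 1)) ∨
      hitTimes r S (impacts r S x v (n + 1)).pos (impacts r S x v (n + 1)).vel = ∅) ∧
    (∃ i, (∀ j ≠ i, (impacts r S x v (n + 1)).vel j = (impacts r S x v n).vel j)) ∧
    (n ≠ 0 → ∃ s, (∀ j ≠ k, s * |v j| ≤ r) ∧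
      ∀ j ≠ k, ((impacts r S x v (n + 1)).time - s) * |v j| ≤ r) ∧
    (n = 0 → ∀ j ≠ k, |x j + (impacts r S x v (n + 1)).time * v j - c' j| ≤ r / 2) := by
  have hE := h.edge n
  have htime := impacts_succ_time r S x v n
  have hposs := impacts_succ_pos r S x v n
  have hq0 := impacts_time_nonneg r S x v n
  have hvq : ∀ i, (impacts r S x v n).vel i ≠ 0 := (isVel_impacts r S x v n).ne_zero h.vel
  have hn0 : n = 0 → (impacts r S x v n).time = 0 := by rintro rfl; rfl
  rw [impacts_succ] at *
  set q := impacts r S x v n with hq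
  obtain ⟨hstr, hcase⟩ := hl
  have hnext : ∀ {j : Fin 3}, j ≠ k →
      (nextImpact r S q).pos j = x j + (nextImpact r S q).time * v j := by
    intro j hj
    rw [hposs, htime]
    simp only [Pi.add_apply, Pi.smul_apply, smul_eq_mul]
    rw [(hstr j hj).1, (hstr j hj).2]; ring
  have hrange : ∀ {C : Pt} {s t : ℝ}, s ≤ t →
      (∀ j ≠ k, |x j + s * v j - C j| ≤ r / 2) → (∀ j ≠ k, |x j + t * v j - C j| ≤ r / 2) →
      ∀ j ≠ k, (t - s) * |v j| ≤ r := by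
    intro C s t hs' h1 h2 j hj
    have h3 := h1 j hj
    have h4 := h2 j hj
    have h5 : (t - s) * |v j| = |(x j + t * v j - C j) - (x j + s * v j - C j)| := by
      nth_rewrite 1 [← abs_of_nonneg (sub_nonneg.2 hs')]; rw [← abs_mul]
      congr 1; ring
    rw [h5]
    exact (abs_sub _ _).trans (by linarith)
  have hstart : ∀ j ≠ k, |x j + 0 * v j - c j| ≤ r / 2 := fun j hj => by
    simpa using (h.start.2 j hj).le
  -- one impact, on the cube `C'` after contact with `C`
  have main : ∀ C C' : Pt, (∀ z ∈ S, z = C ∨ z = C') → Touches r k q C →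
      (∀ w i, w i ≠ 0 → q.pos - C' ∉ face r w i) →
      q.time ≤ (nextImpact r S q).time ∧
      (∀ j ≠ k, |x j + (nextImpact r S q).time * v j - C' j| ≤ r / 2) ∧
      (∃ i, (∀ j ≠ i, (nextImpact r S q).vel j = q.vel j)) ∧
      (((∀ j ≠ k, (nextImpact r S q).vel j = q.vel j) ∧ Touches r k (nextImpact r S q) C' ∧
        (∀ w i, w i ≠ 0 → (nextImpact r S q).pos - C ∉ face r w i)) ∨
      hitTimes r S (nextImpact r S q).pos (nextImpact r S q).vel = ∅) := by
    intro C C' hsub ht haway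
    have hC' : C' ∈ S := by
      obtain ⟨h0, i, z, hz, hf⟩ := sInf_mem_hitTimes h.finite hvq hne
      rcases hsub z hz with rfl | rfl
      · exact absurd hf (ht.clear.notMem_face h.pos hvq h0 i)
      · exact hz
    obtain ⟨h1, h2, h3, i, h4, h5, h6⟩ :=
      impact_other h.pos h.finite hsub hvq ht (fun i => haway q.vel i (hvq i)) hne (hE C' hC')
    refine ⟨by linarith, fun j hj => ?_, ⟨i, h5⟩, ?_⟩
    · rw [← hnext hj]; exact h2 j
    by_cases hik : i = k
    · subst hik
      refine Or.inl ⟨h5, h6, fun w j _ hf => ?_⟩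
      exact notMem_cube_of_lt (v := q.vel) (i := i) (by simpa using h3) hf.1
    · right
      refine hitTimes_eq_empty h.pos ((isVel_nextImpact r S q).ne_zero hvq) fun z hz => ?_
      rcases hsub z hz with rfl | rfl
      · left; refine ⟨k, ?_⟩; rw [h5 k (Ne.symm hik)]; exact h3
      · exact h6.clear
  rcases hcase with ⟨ht, haway, hs⟩ | ⟨ht, ⟨hn0', haway⟩, s, hs0, hs1, hs2⟩
  · obtain ⟨h1, h2, h3, h4⟩ := main c c' h.sub ht haway
    refine ⟨?_, h3, fun hn => ?_, fun _ => h2⟩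
    · refine h4.imp (fun h4 => ⟨fun j hj => ⟨by rw [h4.1 j hj, (hstr j hj).1], hnext hj⟩,
        Or.inr ⟨h4.2.1, ⟨n.succ_ne_zero, h4.2.2⟩, ?_⟩⟩) id
      rcases hs with hn | ⟨s, hs0, hs1, hs2⟩
      · exact ⟨_, hq0.trans h1, le_rfl, h2⟩
      · exact ⟨s, hs0, hs1.trans h1, hs2⟩
    · obtain ⟨s, hs0, hs1, hs2⟩ := hs.resolve_left hn
      refine ⟨s, fun j hj => ?_, hrange (hs1.trans h1) hs2 h2⟩
      have h5 := hrange hq0 hstart (fun j hj => by rw [← (hstr j hj).2]; exact (ht.2 j hj).le) j hj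
      have := mul_le_mul_of_nonneg_right hs1 (abs_nonneg (v j))
      linarith
  · obtain ⟨h1, h2, h3, h4⟩ := main c' c (fun z hz => (h.sub z hz).symm) ht haway
    refine ⟨?_, h3, fun hn => ⟨0, fun j hj => by simpa using h.pos.le,
      hrange (hq0.trans h1) hstart h2⟩, ?_⟩
    · refine h4.imp (fun h4 => ⟨fun j hj => ⟨by rw [h4.1 j hj, (hstr j hj).1], hnext hj⟩,
        Or.inl ⟨h4.2.1, h4.2.2, Or.inr ⟨s, hs0, hs1.trans h1, hs2⟩⟩⟩) id
    · exact fun hn => absurd hn hn0'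

/-- As long as impacts follow, only the `k`-th component of the velocity has been reversed. -/
lemma live (h : TwoCubes r S x v c c' k) (n : ℕ)
    (hne : (hitTimes r S (impacts r S x v n).pos (impacts r S x v n).vel).Nonempty) :
    Live r x v c c' k n (impacts r S x v n) := by
  induction n with
  | zero => exact h.live_zero
  | succ n ih =>
    rcases eq_empty_or_nonempty (hitTimes r S (impacts r S x v n).pos (impacts r S x v n).vel)
      with he | he
    · exfalso
      have hs : (impacts r S x v (n + 1)).pos = (impacts r S x v n).pos := by
        rw [impacts_succ_pos, he, Real.sInf_empty, zero_smul, add_zero]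
      have hv : (impacts r S x v (n + 1)).vel = (impacts r S x v n).vel := by
        rw [impacts_succ]
        ext i
        simp only [nextImpact]
        rw [if_neg]
        intro hst
        rw [he, Real.sInf_empty] at hst
        have : (0 : ℝ) ∈ hitTimes r S (impacts r S x v n).pos (impacts r S x v n).vel :=
          ⟨le_rfl, i, hst⟩
        rw [he] at this
        exact this
      rw [hs, hv, he] at hne
      exact not_nonempty_empty hne
    · exact (h.live_step n (ih he) he).1.resolve_right hne.ne_empty

end TwoCubes

/-- An impact at an edge is a simultaneous arrival at two planes, in the coordinates `i` and `j`. By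
`impacts_origin_mem` both arrival times are known up to the groups `P i` and `P j`; if the resulting
coincidence is excluded, edges are not met. -/
lemma edge_of_groups {r : ℝ} {S : Set Pt} {x v u : Pt} (hu : ∀ i, u i ≠ 0)
    (hv : IsVel u v) (P : Fin 3 → AddSubgroup ℝ) (hx : ∀ i, x i / u i ∈ P i)
    (hS : ∀ c ∈ S, ∀ i, (2 * c i + r) / u i ∈ P i ∧ (2 * c i - r) / u i ∈ P i)
    (hE : ∀ z ∈ S, ∀ i j, i ≠ j → ∀ s₁ s₂ : ℝ, |s₁| = r / 2 → |s₂| = r / 2 →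
      ∀ q₁ ∈ P i, ∀ q₂ ∈ P j, (z i + s₁) / u i - q₁ ≠ (z j + s₂) / u j - q₂ ∧
        (z i + s₁) / u i - q₁ ≠ -((z j + s₂) / u j - q₂)) :
    ∀ n, ∀ z ∈ S, ∀ i j, i ≠ j → |(impacts r S x v (n + 1)).pos i - z i| = r / 2 →
    |(impacts r S x v (n + 1)).pos j - z j| = r / 2 → False := by
  intro n z hz i j hij h1 h2
  have h := impacts_origin_mem hu hv P hx hS (n + 1)
  have hvel := hv.trans (isVel_impacts r S x v (n + 1))
  set q := impacts r S x v (n + 1)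
  have hi := hE z hz i j hij _ _ h1 h2 _ (h i) _ (h j)
  have hui := hu i
  have huj := hu j
  have key : ∀ l : Fin 3, (z l + (q.pos l - z l)) / u l - (q.pos l - q.time * q.vel l) / u l =
      q.time * (q.vel l / u l) := fun l => by ring
  rw [key, key] at hi
  rcases hvel i with h3 | h3 <;> rcases hvel j with h4 | h4 <;>
    simp [h3, h4, hui, huj] at hi

namespace TwoCubes

variable {r : ℝ} {S : Set Pt} {x v c c' : Pt} {k : Fin 3}

lemma exists_ne (k : Fin 3) : ∃ j, j ≠ k := ⟨k + 1, by fin_cases k <;> simp⟩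

/-- All impacts after the first one occur up to time `2 * r / a`. -/
lemma time_le (h : TwoCubes r S x v c c' k) {a : ℝ} (ha : 0 < a) (hav : ∀ i, a ≤ |v i|) {n : ℕ}
    (hn : n ≠ 0)
    (hne : (hitTimes r S (impacts r S x v n).pos (impacts r S x v n).vel).Nonempty) :
    (impacts r S x v (n + 1)).time ≤ 2 * r / a := by
  obtain ⟨s, h1, h2⟩ := (h.live_step n (h.live n hne) hne).2.2.1 hn
  obtain ⟨j, hj⟩ := exists_ne k
  have h1 := h1 j hj
  have h2 := h2 j hj
  have hpos := h.pos
  rw [le_div_iff₀ ha]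
  have h3 := impacts_time_nonneg r S x v (n + 1)
  calc _ ≤ (impacts r S x v (n + 1)).time * |v j| := mul_le_mul_of_nonneg_left (hav j) h3
    _ ≤ _ := by linarith

/-- The first impact, on `c'`, occurs soon if the particle starts near `c'`. -/
lemma first_time_le (h : TwoCubes r S x v c c' k) {a D : ℝ} (ha : 0 < a) (hav : ∀ i, a ≤ |v i|)
    (hD : ∀ i, |x i - c' i| ≤ D)
    (hne : (hitTimes r S (impacts r S x v 0).pos (impacts r S x v 0).vel).Nonempty) :
    (impacts r S x v 1).time ≤ (D + r / 2) / a := by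
  have h1 := (h.live_step 0 (h.live 0 hne) hne).2.2.2 rfl
  obtain ⟨j, hj⟩ := exists_ne k
  have h1 := h1 j hj
  rw [zero_add] at h1
  have h3 := impacts_time_nonneg r S x v 1
  rw [le_div_iff₀ ha]
  calc _ ≤ (impacts r S x v 1).time * |v j| := mul_le_mul_of_nonneg_left (hav j) h3
    _ = |(x j + (impacts r S x v 1).time * v j - c' j) - (x j - c' j)| := by
        nth_rewrite 1 [← abs_of_nonneg h3]; rw [← abs_mul]; congr 1; ring
    _ ≤ _ := (abs_sub _ _).trans (by linarith [hD j])

/-- Either all impacts occur soon after the start, or there is at most one impact, and it reverses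
a single component of the velocity. -/
lemma dichotomy (h : TwoCubes r S x v c c' k) {a : ℝ} (ha : 0 < a) (hav : ∀ i, a ≤ |v i|) :
    (∀ n, (hitTimes r S (impacts r S x v n).pos (impacts r S x v n).vel).Nonempty →
      (impacts r S x v (n + 1)).time ≤ 2 * r / a) ∨
    ∀ t, ∃ i, ∀ j ≠ i, flightPos r S x v t j = x j + t * v j ∧ flightVel r S x v t j = v j := by
  rcases eq_empty_or_nonempty (hitTimes r S (impacts r S x v 0).pos (impacts r S x v 0).vel)
    with h0 | h0
  · right
    intro t
    rw [impacts_zero] at h0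
    exact ⟨0, fun j _ => by rw [flightPos_of_free h0, flightVel_of_free h0]; simp⟩
  by_cases hT : (impacts r S x v 1).time ≤ 2 * r / a
  · left
    intro n hn
    rcases Nat.eq_zero_or_pos n with rfl | hn'
    · exact hT
    · exact h.time_le ha hav hn'.ne' hn
  right
  have h1 : hitTimes r S (impacts r S x v 1).pos (impacts r S x v 1).vel = ∅ := by
    by_contra hne
    have h2 := h.time_le ha hav one_ne_zero (nonempty_iff_ne_empty.2 hne)
    rw [impacts_succ_time] at h2
    have := sInf_hitTimes_nonneg r S (impacts r S x v 1).pos (impacts r S x v 1).vel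
    linarith
  obtain ⟨i, hi⟩ := (h.live_step 0 (h.live 0 h0) h0).2.1
  intro t
  refine ⟨i, fun j hj => ?_⟩
  have hc : impactCount r S x v t ≤ 1 := Nat.sInf_le (by simp [h1])
  have hj1 := hi j hj
  have hp1 := congrFun (impacts_succ_pos r S x v 0) j
  have ht1 := impacts_succ_time r S x v 0
  rw [zero_add] at hj1 hp1 ht1
  simp only [flightPos, flightVel, lastImpact, Pi.add_apply, Pi.smul_apply, smul_eq_mul]
  have hc : impactCount r S x v t = 0 ∨ impactCount r S x v t = 1 := by omega
  rcases hc with hc | hc <;> rw [hc]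
  · simp [impacts_zero]
  · rw [hj1, hp1, ht1]
    simp only [impacts_zero, Pi.add_apply, Pi.smul_apply, smul_eq_mul, and_true]
    ring

/-- The motion is uniform from time `6 r / a ^ 2` on. The bound for the distance from `c'` is what
a flight of length `5 * r / a` from the boundary of `c'` allows. -/
lemma uniform (h : TwoCubes r S x v c c' k) {a : ℝ} (ha : 0 < a) (ha1 : a ≤ 1)
    (hav : ∀ i, a ≤ |v i|) (hD : ∀ i, |x i - c' i| ≤ (5 / a + 1 / 2) * r) {s t : ℝ}
    (hs : 6 * r / a ^ 2 ≤ s) (ht : 6 * r / a ^ 2 ≤ t) :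
    flightPos r S x v t = flightPos r S x v s + (t - s) • flightVel r S x v s ∧
      flightVel r S x v t = flightVel r S x v s := by
  refine flightPos_of_le h.finite h.vel (B := 6 * r / a ^ 2) (fun n hn => ?_) hs ht
  have hr := h.pos
  rcases Nat.eq_zero_or_pos n with rfl | hn'
  · refine (h.first_time_le ha hav hD hn).trans ?_
    rw [div_le_div_iff₀ ha (by positivity)]
    have : (5 / a + 1 / 2) * r + r / 2 = (5 + a) * r / a := by field_simp; ring
    rw [this, div_mul_eq_mul_div, div_le_iff₀ ha]
    nlinarith [mul_pos hr (mul_pos ha ha)]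
  · refine (h.time_le ha hav hn'.ne' hn).trans ?_
    rw [div_le_div_iff₀ ha (by positivity)]
    nlinarith [mul_pos hr ha]

/-- After a time longer than `5 r / a`, the cube at which the flight started has been passed in two
coordinates at least. -/
lemma separated (h : TwoCubes r S x v c c' k) {a : ℝ} (ha : 0 < a)
    (hav : ∀ i, a ≤ |v i|) {t : ℝ} (ht : 5 * r / a < t) :
    ∃ i, ∀ j ≠ i, |flightVel r S x v t j| * (r / 2) <
      flightVel r S x v t j * (flightPos r S x v t j - c j) := by
  have hr := h.pos
  have hxc : ∀ j, |x j - c j| ≤ r / 2 := by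
    intro j
    by_cases hj : j = k
    · subst hj
      have h1 := congrArg abs h.start.1
      rw [abs_mul, abs_mul, abs_abs, abs_of_pos (half_pos hr)] at h1
      exact (mul_left_cancel₀ (abs_ne_zero.2 (h.vel j)) h1).le
    · exact (h.start.2 j hj).le
  rw [div_lt_iff₀ ha] at ht
  have ht0 : 0 < t := by by_contra h0; nlinarith
  rcases h.dichotomy ha hav with hB | hB
  · refine ⟨k, fun j _ => ?_⟩
    have hBt : 2 * r / a ≤ t := by rw [div_le_iff₀ ha]; linarith
    obtain ⟨h1, h2⟩ := flightPos_of_le h.finite h.vel hB le_rfl hBt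
    have h3 := congrFun h1 j
    simp only [Pi.add_apply, Pi.smul_apply, smul_eq_mul] at h3
    rw [h2, h3]
    have h4 := abs_flightPos_sub_le r S x v (t := 2 * r / a) (by positivity) j
    have h5 := (isVel_flightVel r S x v (2 * r / a)).abs_eq j
    set w := flightVel r S x v (2 * r / a) j
    set y := flightPos r S x v (2 * r / a) j
    have h6 : -(|w| * (|v j| * (2 * r / a) + r / 2)) ≤ w * (y - c j) := by
      have : |w * (y - c j)| ≤ |w| * (|v j| * (2 * r / a) + r / 2) := by
        rw [abs_mul]
        refine mul_le_mul_of_nonneg_left ?_ (abs_nonneg _)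
        have := abs_add_le (y - x j) (x j - c j)
        rw [sub_add_sub_cancel] at this
        linarith [hxc j]
      exact (abs_le.1 this).1
    have h7 : w * w = |w| * |w| := (abs_mul_abs_self w).symm
    have h8 : 0 < |w| := by rw [h5]; exact ha.trans_le (hav j)
    have h9 : |w| * (r / 2) < |w| * ((t - 2 * r / a) * |w| - (|v j| * (2 * r / a) + r / 2)) := by
      refine mul_lt_mul_of_pos_left ?_ h8
      rw [h5]
      have h10 := hav j
      have : (t - 2 * (2 * r / a)) * a > r := by
        have : (t - 2 * (2 * r / a)) * a = t * a - 4 * r := by field_simp; ring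
        linarith
      have h11 : 0 ≤ t - 2 * (2 * r / a) := by
        by_contra h0; push Not at h0; nlinarith
      nlinarith [mul_le_mul_of_nonneg_left h10 h11]
    nlinarith
  · obtain ⟨i, hi⟩ := hB t
    refine ⟨i, fun j hj => ?_⟩
    rw [(hi j hj).1, (hi j hj).2]
    have h1 : 0 < |v j| := ha.trans_le (hav j)
    have h2 : v j * v j = |v j| * |v j| := (abs_mul_abs_self _).symm
    have h3 : -(|v j| * (r / 2)) ≤ v j * (x j - c j) := by
      have : |v j * (x j - c j)| ≤ |v j| * (r / 2) := by
        rw [abs_mul]; exact mul_le_mul_of_nonneg_left (hxc j) h1.le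
      exact (abs_le.1 this).1
    have h4 : |v j| * r < |v j| * (t * |v j|) := by
      refine mul_lt_mul_of_pos_left ?_ h1
      nlinarith [mul_le_mul_of_nonneg_left (hav j) ht0.le]
    nlinarith

end TwoCubes

/-! ### Generic data and the geometry of a leg -/

/-- The group in which the normalised `i`-th coordinate of the position after `n` attempts lies. -/
def posGroup (r : ℝ) (u : Pt) (ω : ℕ → Attempt) (n : ℕ) (i : Fin 3) : AddSubgroup ℝ :=
  AddSubgroup.closure {x | (∃ l ≤ n, x = (ω l).1) ∨ (∃ l, x = 2 * (r * (ω l).2.2 i / u i)) ∨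
    x = r / u i}

/-- The group generated by all data, with the `i`-th coordinates of the impact parameters
doubled. -/
def evenGroup (r : ℝ) (u : Pt) (ω : ℕ → Attempt) (i : Fin 3) : AddSubgroup ℝ :=
  AddSubgroup.closure {x | (∃ l, x = (ω l).1) ∨ (∃ l, x = 2 * (r * (ω l).2.2 i / u i)) ∨
    (∃ l, ∃ j ≠ i, x = r * (ω l).2.2 j / u j) ∨ ∃ j, x = r / 2 / u j}

/-- The group generated by all impact parameters and the first `n` flight times. -/
def pastGroup (r : ℝ) (u : Pt) (ω : ℕ → Attempt) (n : ℕ) : AddSubgroup ℝ :=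
  AddSubgroup.closure {x | (∃ l ≤ n, x = (ω l).1) ∨ (∃ l j, x = r * (ω l).2.2 j / u j) ∨
    ∃ j, x = r / 2 / u j}

/-- Data outside of a null set: there are no coincidences which would allow an impact at an edge, or
an attempt on a plane that carries a face. -/
structure Generic (r : ℝ) (u : Pt) (ω : ℕ → Attempt) : Prop where
  pos : ∀ n, 0 < (ω n).1
  unit : ∀ n i, |(ω n).2.2 i| < 1 / 2
  even : ∀ n i, r * (ω n).2.2 i / u i ∉ evenGroup r u ω i
  past : ∀ n, (ω (n + 1)).1 ∉ pastGroup r u ω n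

section groups
variable {r : ℝ} {u : Pt} {ω : ℕ → Attempt}

lemma posGroup_mono {n m : ℕ} (h : n ≤ m) (i : Fin 3) :
    posGroup r u ω n i ≤ posGroup r u ω m i := by
  refine AddSubgroup.closure_mono ?_
  rintro x (⟨l, hl, rfl⟩ | h | h)
  · exact Or.inl ⟨l, hl.trans ‹_›, rfl⟩
  · exact Or.inr (Or.inl h)
  · exact Or.inr (Or.inr h)

lemma two_mul_mem {G : AddSubgroup ℝ} {x : ℝ} (h : x ∈ G) : 2 * x ∈ G := by
  rw [two_mul]; exact G.add_mem h h

lemma posGroup_le_evenGroup (n : ℕ) (i j : Fin 3) : posGroup r u ω n i ≤ evenGroup r u ω j := by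
  refine (AddSubgroup.closure_le _).2 ?_
  rintro x (⟨l, hl, rfl⟩ | ⟨l, rfl⟩ | rfl)
  · exact AddSubgroup.subset_closure (Or.inl ⟨l, rfl⟩)
  · by_cases h : i = j
    · subst h
      exact AddSubgroup.subset_closure (Or.inr (Or.inl ⟨l, rfl⟩))
    · exact two_mul_mem (AddSubgroup.subset_closure (Or.inr (Or.inr (Or.inl ⟨l, i, h, rfl⟩))))
  · have : r / u i = 2 * (r / 2 / u i) := by ring
    rw [this]
    exact two_mul_mem (AddSubgroup.subset_closure (Or.inr (Or.inr (Or.inr ⟨i, rfl⟩))))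

lemma posGroup_le_pastGroup (n : ℕ) (i : Fin 3) : posGroup r u ω n i ≤ pastGroup r u ω n := by
  refine (AddSubgroup.closure_le _).2 ?_
  rintro x (⟨l, hl, rfl⟩ | ⟨l, rfl⟩ | rfl)
  · exact AddSubgroup.subset_closure (Or.inl ⟨l, hl, rfl⟩)
  · exact two_mul_mem (AddSubgroup.subset_closure (Or.inr (Or.inl ⟨l, i, rfl⟩)))
  · have : r / u i = 2 * (r / 2 / u i) := by ring
    rw [this]
    exact two_mul_mem (AddSubgroup.subset_closure (Or.inr (Or.inr ⟨i, rfl⟩)))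

end groups

/-- No coordinate edge of the cube with centre `c` can be met at an impact. -/
def EdgeFree (r : ℝ) (u : Pt) (ω : ℕ → Attempt) (c : Pt) : Prop :=
  ∀ m, ∀ i j, i ≠ j → ∀ s₁ s₂ : ℝ, |s₁| = r / 2 → |s₂| = r / 2 →
      ∀ q₁ ∈ posGroup r u ω m i, ∀ q₂ ∈ posGroup r u ω m j,
        (c i + s₁) / u i - q₁ ≠ (c j + s₂) / u j - q₂ ∧
        (c i + s₁) / u i - q₁ ≠ -((c j + s₂) / u j - q₂)

/-- The properties of a remembered scatterer that do not depend on where the particle is. -/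
structure GoodCentre (r : ℝ) (u : Pt) (ω : ℕ → Attempt) (n : ℕ) (c : Pt) : Prop where
  planes : ∀ i, (2 * c i + r) / u i ∈ posGroup r u ω n i ∧ (2 * c i - r) / u i ∈ posGroup r u ω n i
  past : ∀ i, c i / u i ∈ pastGroup r u ω n
  edge : EdgeFree r u ω c

/-- The invariants of the state after `n` attempts: the current scatterer is touched and being left;
the preceding one is nearby or has been passed in some coordinate. -/
structure Inv (r a : ℝ) (u : Pt) (ω : ℕ → Attempt) (n : ℕ) (s : State) : Prop where
  vel : IsVel u s.vel
  mem : ∀ i, s.pos i / u i ∈ posGroup r u ω n i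
  cur : ∀ c, s.cur = some c → (∃ k, Touches r k ⟨0, s.pos, s.vel⟩ c) ∧ GoodCentre r u ω n c
  prev : ∀ c, s.prev = some c → GoodCentre r u ω n c ∧ (∀ i, |s.pos i - c i| ≠ r / 2) ∧
    ((∀ i, |s.pos i - c i| ≤ (5 / a + 1 / 2) * r) ∨
      ∃ i, |s.vel i| * (r / 2) < s.vel i * (s.pos i - c i))
  far : 5 * r / a < flightTime ω n → ∀ c, s.prev = some c →
    ∃ i, |s.vel i| * (r / 2) < s.vel i * (s.pos i - c i)

/-- What is known of the flight that starts in the state `s`. -/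
structure GoodFlight (r a : ℝ) (s : State) : Prop where
  uniform : ∀ t₁ t₂, 6 * r / a ^ 2 ≤ t₁ → 6 * r / a ^ 2 ≤ t₂ →
    flightPos r s.scatterers s.pos s.vel t₂ = flightPos r s.scatterers s.pos s.vel t₁ +
      (t₂ - t₁) • flightVel r s.scatterers s.pos s.vel t₁ ∧
    flightVel r s.scatterers s.pos s.vel t₂ = flightVel r s.scatterers s.pos s.vel t₁
  sep : ∀ c, s.cur = some c → ∀ t, 5 * r / a < t → ∃ i, ∀ j ≠ i,
    |flightVel r s.scatterers s.pos s.vel t j| * (r / 2) <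
      flightVel r s.scatterers s.pos s.vel t j *
        (flightPos r s.scatterers s.pos s.vel t j - c j)

/-- A flight without impacts. To know that the cube at the start is passed, `TwoCubes.separated` is
applied to the flight in an empty set of cubes. -/
lemma GoodFlight.of_free {r a : ℝ} {s : State} (hr : 0 < r) (ha : 0 < a) (hv : ∀ i, a ≤ |s.vel i|)
    (hcur : ∀ c, s.cur = some c → ∃ k, Touches r k ⟨0, s.pos, s.vel⟩ c)
    (h : hitTimes r s.scatterers s.pos s.vel = ∅) : GoodFlight r a s := by
  have hv0 : ∀ i, s.vel i ≠ 0 := fun i => abs_pos.1 (ha.trans_le (hv i))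
  refine ⟨fun t₁ t₂ _ _ => ?_, fun c hc t ht => ?_⟩
  · simp only [flightPos_of_free h, flightVel_of_free h, and_true]
    ext i; simp; ring
  · obtain ⟨k, hk⟩ := hcur c hc
    have htc : TwoCubes r ∅ s.pos s.vel c (fun i => s.pos i + r) k :=
      ⟨hr, hv0, by simp, hk, fun i => by
        rw [sub_add_cancel_left, abs_neg, abs_of_pos hr]; linarith, by simp⟩
    have he : hitTimes r ∅ s.pos s.vel = ∅ := hitTimes_eq_empty hr hv0 (by simp)
    have := htc.separated ha hv ht
    simpa only [flightPos_of_free h, flightVel_of_free h, flightPos_of_free he,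
      flightVel_of_free he] using this

section
variable {r a : ℝ} {u : Pt} {ω : ℕ → Attempt}

lemma mem_scatterers {s : State} {z : Pt} : z ∈ s.scatterers ↔ s.cur = some z ∨ s.prev = some z :=
  Iff.rfl

/-- If the preceding scatterer has been passed as well, the next flight is free. -/
lemma Inv.free {n : ℕ} {s : State} (hr : 0 < r) (hu : ∀ i, u i ≠ 0)
    (h : Inv r a u ω n s) (hprev : ∀ c, s.prev = some c →
      ∃ i, |s.vel i| * (r / 2) < s.vel i * (s.pos i - c i)) :
    hitTimes r s.scatterers s.pos s.vel = ∅ := by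
  refine hitTimes_eq_empty hr (h.vel.ne_zero hu) fun c hc => ?_
  rcases hc with hc | hc
  · obtain ⟨⟨k, hk⟩, -⟩ := h.cur c hc
    exact hk.clear
  · exact Or.inl (hprev c hc)

lemma Inv.planes {n : ℕ} {s : State} (h : Inv r a u ω n s) : ∀ c ∈ s.scatterers, ∀ i,
    (2 * c i + r) / u i ∈ posGroup r u ω n i ∧ (2 * c i - r) / u i ∈ posGroup r u ω n i := by
  rintro c (hc | hc)
  · exact (h.cur c hc).2.planes
  · exact (h.prev c hc).1.planes

/-- The invariants control the next flight: either it is free, or the preceding scatterer is nearby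
and the flight is one among `TwoCubes`. -/
lemma Inv.goodFlight {n : ℕ} {s : State} (hr : 0 < r) (ha : 0 < a) (ha1 : a ≤ 1)
    (hu : ∀ i, a ≤ |u i|) (h : Inv r a u ω n s) : GoodFlight r a s := by
  have hu0 : ∀ i, u i ≠ 0 := fun i => abs_pos.1 (ha.trans_le (hu i))
  have hv : ∀ i, a ≤ |s.vel i| := fun i => by rw [h.vel.abs_eq]; exact hu i
  have hv0 := h.vel.ne_zero hu0
  by_cases hp : ∀ c, s.prev = some c → ∃ i, |s.vel i| * (r / 2) < s.vel i * (s.pos i - c i)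
  · exact GoodFlight.of_free hr ha hv (fun c hc => (h.cur c hc).1) (h.free hr hu0 hp)
  push Not at hp
  obtain ⟨c', hc', hn⟩ := hp
  obtain ⟨hgood, hoff, hnear⟩ := h.prev c' hc'
  have hnear := hnear.resolve_right (by push Not; exact hn)
  -- if the last attempt was rejected, any cube that touches the particle serves as the first one
  have hsc : ∃ c k, Touches r k ⟨0, s.pos, s.vel⟩ c ∧ ∀ z, s.cur = some z → z = c := by
    rcases hcur : s.cur with _ | c
    · refine ⟨fun i => if i = 0 then s.pos 0 - s.vel 0 / |s.vel 0| * (r / 2) else s.pos i, 0,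
        ⟨?_, ?_⟩, by simp⟩
      · have : |s.vel 0| ≠ 0 := abs_ne_zero.2 (hv0 0)
        simp only [if_true]
        field_simp
        rw [sq_abs]; ring
      · intro j hj
        simp only [hj, if_false, sub_self, abs_zero]
        exact half_pos hr
    · obtain ⟨⟨k, hk⟩, -⟩ := h.cur c hcur
      exact ⟨c, k, hk, by simp⟩
  obtain ⟨c, k, hk, hck⟩ := hsc
  have htc : TwoCubes r s.scatterers s.pos s.vel c c' k := by
    refine ⟨hr, hv0, ?_, hk, hoff, ?_⟩
    · rintro z (hz | hz)
      · exact Or.inl (hck z hz)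
      · rw [hc'] at hz; exact Or.inr (Option.some.inj hz).symm
    · refine edge_of_groups hu0 h.vel (posGroup r u ω n) h.mem h.planes ?_
      rintro z (hz | hz)
      · exact (h.cur z hz).2.edge n
      · exact (h.prev z hz).1.edge n
  exact ⟨fun t₁ t₂ h1 h2 => htc.uniform ha ha1 hv hnear h1 h2, fun z hz t ht => by
    rw [hck z hz]; exact htc.separated ha hv ht⟩

end

section
variable {r a : ℝ} {u : Pt} {ω : ℕ → Attempt}

/-- The velocity just before the attempt with data `b` that is made from the state `s`. -/
def State.velBefore (r : ℝ) (s : State) (b : Attempt) : Pt :=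
  flightVel r s.scatterers s.pos s.vel b.1

/-- The scatterer which the attempt with data `b` is to place. -/
def State.newCentre (r : ℝ) (s : State) (b : Attempt) : Pt :=
  flightPos r s.scatterers s.pos s.vel b.1 + impactParam r (s.velBefore r b) b.2.1 b.2.2

/-- The attempt with data `b` is rejected. -/
def State.Shadowed (r : ℝ) (s : State) (b : Attempt) : Prop :=
  ∃ z ∈ s.path, z - s.newCentre r b ∈ cube r

lemma step_pos (s : State) (b : Attempt) :
    (s.step r b).pos = flightPos r s.scatterers s.pos s.vel b.1 := rfl

lemma step_attempted (s : State) (b : Attempt) :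
    (s.step r b).attempted = flip b.2.1 (s.velBefore r b) := rfl

lemma step_path (s : State) (b : Attempt) : (s.step r b).path =
    (fun t => flightPos r s.scatterers s.pos s.vel t) '' Ioc 0 b.1 := rfl

lemma step_vel_of_shadowed {s : State} {b : Attempt} (h : s.Shadowed r b) :
    (s.step r b).vel = s.velBefore r b := if_pos h

lemma step_vel_of_not {s : State} {b : Attempt} (h : ¬ s.Shadowed r b) :
    (s.step r b).vel = flip b.2.1 (s.velBefore r b) := if_neg h

lemma step_cur_of_shadowed {s : State} {b : Attempt} (h : s.Shadowed r b) :
    (s.step r b).cur = none := if_pos h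

lemma step_cur_of_not {s : State} {b : Attempt} (h : ¬ s.Shadowed r b) :
    (s.step r b).cur = some (s.newCentre r b) := if_neg h

lemma velBefore_isVel (s : State) (b : Attempt) : IsVel s.vel (s.velBefore r b) :=
  isVel_flightVel _ _ _ _ _

/-- At the attempt, at most one component of the velocity is reversed. -/
lemma step_vel_ne {s : State} {b : Attempt} {j : Fin 3} (hj : j ≠ b.2.1) :
    (s.step r b).vel j = s.velBefore r b j := by
  by_cases h : s.Shadowed r b
  · rw [step_vel_of_shadowed h]
  · rw [step_vel_of_not h]; simp [flip, hj]

lemma step_vel_isVel (s : State) (b : Attempt) : IsVel s.vel (s.step r b).vel := by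
  by_cases h : s.Shadowed r b
  · rw [step_vel_of_shadowed h]; exact velBefore_isVel s b
  · rw [step_vel_of_not h]; exact (velBefore_isVel s b).trans (isVel_flip _ _)

lemma state_isVel (r : ℝ) (v₀ : Pt) (ω : ℕ → Attempt) (n : ℕ) : IsVel v₀ (state r v₀ ω n).vel := by
  induction n with
  | zero => exact IsVel.refl _
  | succ n ih => exact ih.trans (step_vel_isVel _ _)

lemma div_abs_eq {x : ℝ} (h : x ≠ 0) : x / |x| = 1 ∨ x / |x| = -1 := by
  rcases lt_or_gt_of_ne h with h' | h'
  · right; rw [abs_of_neg h', div_neg, div_self h]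
  · left; rw [abs_of_pos h', div_self h]

lemma exists_third (i k : Fin 3) : ∃ j, j ≠ i ∧ j ≠ k := by decide +revert

/-- After an accepted attempt the particle is on the face of the new scatterer and leaves it. -/
lemma touches_newCentre (hr : 0 < r) {s : State} {b : Attempt}
    (hv : ∀ i, s.velBefore r b i ≠ 0) (hb : ∀ i, |b.2.2 i| < 1 / 2) (y : Pt)
    (hy : y = flightPos r s.scatterers s.pos s.vel b.1) :
    Touches r b.2.1 ⟨0, y, flip b.2.1 (s.velBefore r b)⟩ (s.newCentre r b) := by
  subst hy
  constructor
  · simp only [State.newCentre, flip, Function.update_self, Pi.add_apply, impactParam, if_true,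
      abs_neg]
    have := abs_ne_zero.2 (hv b.2.1)
    field_simp
    rw [sq_abs]; ring
  · intro j hj
    simp only [State.newCentre, Pi.add_apply, impactParam, hj, if_false]
    rw [sub_add_cancel_left, abs_neg, abs_mul, abs_of_pos hr]
    have := mul_lt_mul_of_pos_left (hb j) hr
    linarith

/-- A new scatterer is in generic position. In a coordinate other than that of its struck face, its
centre contains the impact parameter `r * a i` once, while the coordinates of all positions contain
impact parameters an even number of times only, since reflections double the planes. -/
lemma goodCentre_newCentre {n : ℕ} {s : State}
    (hω : Generic r u ω) (hv : ∀ i, s.velBefore r (ω n) i ≠ 0)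
    (hy : ∀ i, flightPos r s.scatterers s.pos s.vel (ω n).1 i / u i ∈ posGroup r u ω n i) :
    GoodCentre r u ω n (s.newCentre r (ω n)) := by
  set y := flightPos r s.scatterers s.pos s.vel (ω n).1 with hydef
  have hk : (s.newCentre r (ω n)) (ω n).2.1 = y (ω n).2.1 + r / 2 ∨
      (s.newCentre r (ω n)) (ω n).2.1 = y (ω n).2.1 - r / 2 := by
    simp only [State.newCentre, Pi.add_apply, impactParam, if_true, ← hydef]
    rcases div_abs_eq (hv (ω n).2.1) with h | h <;> rw [h]
    · left; ring
    · right; ring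
  have hi : ∀ i ≠ (ω n).2.1, (s.newCentre r (ω n)) i = y i + r * (ω n).2.2 i := by
    intro i hi
    simp only [State.newCentre, Pi.add_apply, impactParam, hi, if_false, ← hydef]
  generalize s.newCentre r (ω n) = c at *
  have hrP : ∀ m i, r / u i ∈ posGroup r u ω m i := fun m i =>
    AddSubgroup.subset_closure (Or.inr (Or.inr rfl))
  have haP : ∀ m l i, 2 * (r * (ω l).2.2 i / u i) ∈ posGroup r u ω m i := fun m l i =>
    AddSubgroup.subset_closure (Or.inr (Or.inl ⟨l, rfl⟩))
  have hrE : ∀ i j, r / 2 / u j ∈ evenGroup r u ω i := fun i j =>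
    AddSubgroup.subset_closure (Or.inr (Or.inr (Or.inr ⟨j, rfl⟩)))
  have hsE : ∀ i j, ∀ s₁ : ℝ, |s₁| = r / 2 → s₁ / u j ∈ evenGroup r u ω i := by
    intro i j s₁ hs
    rcases abs_choice s₁ with h | h
    · rw [← h, hs]; exact hrE i j
    · rw [← neg_neg s₁, ← h, hs, neg_div]; exact neg_mem (hrE i j)
  refine ⟨fun i => ?_, fun i => ?_, fun m i j hij s₁ s₂ h1 h2 q₁ hq₁ q₂ hq₂ => ?_⟩
  · by_cases h : i = (ω n).2.1
    · rw [h]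
      have h2 := two_mul_mem (hy (ω n).2.1)
      rcases hk with hk | hk <;> rw [hk]
      · constructor
        · convert add_mem (add_mem h2 (hrP n _)) (hrP n _) using 1; ring
        · convert h2 using 1; ring
      · constructor
        · convert h2 using 1; ring
        · convert sub_mem (sub_mem h2 (hrP n _)) (hrP n _) using 1; ring
    · rw [hi i h]
      have h2 := add_mem (two_mul_mem (hy i)) (haP n n i)
      constructor
      · convert add_mem h2 (hrP n i) using 1; ring
      · convert sub_mem h2 (hrP n i) using 1; ring
  · have hyi := posGroup_le_pastGroup n i (hy i)
    by_cases h : i = (ω n).2.1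
    · rw [h] at hyi ⊢
      have h2 : r / 2 / u (ω n).2.1 ∈ pastGroup r u ω n :=
        AddSubgroup.subset_closure (Or.inr (Or.inr ⟨_, rfl⟩))
      rcases hk with hk | hk <;> rw [hk]
      · rw [add_div]; exact add_mem hyi h2
      · rw [sub_div]; exact sub_mem hyi h2
    · rw [hi i h, add_div]
      exact add_mem hyi (AddSubgroup.subset_closure (Or.inr (Or.inl ⟨n, i, rfl⟩)))
  · -- one of the two planes contains an undoubled impact parameter, the other one does not
    have hcj : ∀ i j, j ≠ i → c j / u j ∈ evenGroup r u ω i := by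
      intro i j hj
      have hyj := posGroup_le_evenGroup n j i (hy j)
      by_cases h : j = (ω n).2.1
      · rw [h] at hyj ⊢
        rcases hk with hk | hk <;> rw [hk]
        · rw [add_div]; exact add_mem hyj (hrE i _)
        · rw [sub_div]; exact sub_mem hyj (hrE i _)
      · rw [hi j h, add_div]
        exact add_mem hyj (AddSubgroup.subset_closure (Or.inr (Or.inr (Or.inl ⟨n, j, hj, rfl⟩))))
    have main : ∀ i j, i ≠ j → i ≠ (ω n).2.1 → ∀ s₁ s₂ : ℝ, |s₁| = r / 2 → |s₂| = r / 2 →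
        ∀ q₁ ∈ posGroup r u ω m i, ∀ q₂ ∈ posGroup r u ω m j,
        ((c i + s₁) / u i - q₁) - ((c j + s₂) / u j - q₂) ≠ 0 ∧
        ((c i + s₁) / u i - q₁) + ((c j + s₂) / u j - q₂) ≠ 0 := by
      intro i j hij hin s₁ s₂ h1 h2 q₁ hq₁ q₂ hq₂
      have hA : y i / u i + s₁ / u i - q₁ ∈ evenGroup r u ω i :=
        sub_mem (add_mem (posGroup_le_evenGroup n i i (hy i)) (hsE i i s₁ h1))
          (posGroup_le_evenGroup m i i hq₁)
      have hB : (c j + s₂) / u j - q₂ ∈ evenGroup r u ω i := by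
        rw [add_div]
        exact sub_mem (add_mem (hcj i j hij.symm) (hsE i j s₂ h2))
          (posGroup_le_evenGroup m j i hq₂)
      constructor
      · intro h
        refine hω.even n i ?_
        have : r * (ω n).2.2 i / u i = ((c j + s₂) / u j - q₂) - (y i / u i + s₁ / u i - q₁) := by
          rw [hi i hin] at h; linear_combination h
        rw [this]; exact sub_mem hB hA
      · intro h
        refine hω.even n i ?_
        have : r * (ω n).2.2 i / u i = -(((c j + s₂) / u j - q₂) + (y i / u i + s₁ / u i - q₁)) := by
          rw [hi i hin] at h; linear_combination h
        rw [this]; exact neg_mem (add_mem hB hA)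
    by_cases h : i = (ω n).2.1
    · have hj : j ≠ (ω n).2.1 := fun h' => hij (h.trans h'.symm)
      obtain ⟨h3, h4⟩ := main j i hij.symm hj s₂ s₁ h2 h1 q₂ hq₂ q₁ hq₁
      exact ⟨fun h5 => h3 (by rw [h5, sub_self]), fun h5 => h4 (by rw [h5, add_neg_cancel])⟩
    · obtain ⟨h3, h4⟩ := main i j hij h s₁ s₂ h1 h2 q₁ hq₁ q₂ hq₂
      exact ⟨fun h5 => h3 (by rw [h5, sub_self]), fun h5 => h4 (by rw [h5, neg_add_cancel])⟩

lemma GoodCentre.mono {n m : ℕ} (h : n ≤ m) {c : Pt} (hc : GoodCentre r u ω n c) :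
    GoodCentre r u ω m c := by
  refine ⟨fun i => ⟨posGroup_mono h i (hc.planes i).1, posGroup_mono h i (hc.planes i).2⟩,
    fun i => AddSubgroup.closure_mono ?_ (hc.past i), hc.edge⟩
  rintro x (⟨l, hl, rfl⟩ | h)
  · exact Or.inl ⟨l, hl.trans ‹_›, rfl⟩
  · exact Or.inr h

/-- The invariants are preserved by a flight and an attempt. If the flight is longer than `5 * r / a`,
the scatterer at its start has been passed in two coordinates, and the attempt reverses only one of
them; otherwise that scatterer is nearby. -/
lemma Inv.step (hr : 0 < r) (ha : 0 < a) (ha1 : a ≤ 1) (hu : ∀ i, a ≤ |u i|)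
    (hu1 : ∀ i, |u i| ≤ 1) (hω : Generic r u ω) {n : ℕ} {s : State} (h : Inv r a u ω n s) :
    Inv r a u ω (n + 1) (s.step r (ω (n + 1))) := by
  have hu0 : ∀ i, u i ≠ 0 := fun i => abs_pos.1 (ha.trans_le (hu i))
  have hgf := h.goodFlight hr ha ha1 hu
  have hvb := h.vel.trans (velBefore_isVel (r := r) s (ω (n + 1)))
  have hpos := hω.pos (n + 1)
  have hcases := flightPos_mem hu0 h.vel (posGroup r u ω n) h.mem h.planes (ω (n + 1)).1
  have hmem : ∀ i, flightPos r s.scatterers s.pos s.vel (ω (n + 1)).1 i / u i ∈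
      posGroup r u ω (n + 1) i := by
    intro i
    have hξ : (ω (n + 1)).1 ∈ posGroup r u ω (n + 1) i :=
      AddSubgroup.subset_closure (Or.inl ⟨n + 1, le_rfl, rfl⟩)
    rcases hcases i with h1 | h1
    · simpa using add_mem (posGroup_mono n.le_succ i h1) hξ
    · simpa using sub_mem (posGroup_mono n.le_succ i h1) hξ
  have hsep : ∀ c, s.cur = some c → 5 * r / a < (ω (n + 1)).1 →
      ∃ i, |(s.step r (ω (n + 1))).vel i| * (r / 2) < (s.step r (ω (n + 1))).vel i *
        ((s.step r (ω (n + 1))).pos i - c i) := by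
    intro c hc hlt
    obtain ⟨i, hi⟩ := hgf.sep c hc _ hlt
    obtain ⟨j, hj1, hj2⟩ := exists_third i (ω (n + 1)).2.1
    exact ⟨j, by rw [step_vel_ne hj2]; exact hi j hj1⟩
  refine ⟨h.vel.trans (step_vel_isVel _ _), hmem, fun c hc => ?_, fun c hc => ⟨?_, ?_, ?_⟩,
    fun hlt c hc => hsep c hc hlt⟩
  · by_cases hs : s.Shadowed r (ω (n + 1))
    · rw [step_cur_of_shadowed hs] at hc; cases hc
    · rw [step_cur_of_not hs, Option.some_inj] at hc
      subst hc
      refine ⟨⟨(ω (n + 1)).2.1, ?_⟩, goodCentre_newCentre hω (hvb.ne_zero hu0) hmem⟩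
      rw [step_vel_of_not hs]
      exact touches_newCentre hr (hvb.ne_zero hu0) (hω.unit (n + 1)) _ rfl
  · exact (h.cur c hc).2.mono n.le_succ
  · intro i hi
    have h1 := (h.cur c hc).2.past i
    have h2 : (r / 2) / u i ∈ pastGroup r u ω n :=
      AddSubgroup.subset_closure (Or.inr (Or.inr ⟨i, rfl⟩))
    have h3 : (s.step r (ω (n + 1))).pos i / u i ∈ pastGroup r u ω n := by
      rcases abs_choice ((s.step r (ω (n + 1))).pos i - c i) with h4 | h4 <;> rw [hi] at h4
      · have : (s.step r (ω (n + 1))).pos i = c i + r / 2 := by linarith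
        rw [this, add_div]; exact add_mem h1 h2
      · have : (s.step r (ω (n + 1))).pos i = c i - r / 2 := by linarith
        rw [this, sub_div]; exact sub_mem h1 h2
    refine hω.past n ?_
    rcases hcases i with h4 | h4
    · have := sub_mem h3 (posGroup_le_pastGroup n i h4)
      rwa [step_pos, sub_sub_cancel] at this
    · have := sub_mem (posGroup_le_pastGroup n i h4) h3
      rwa [step_pos, add_sub_cancel_left] at this
  · by_cases hlt : 5 * r / a < (ω (n + 1)).1
    · exact Or.inr (hsep c hc hlt)
    · left
      intro i
      push Not at hlt
      obtain ⟨k, hk⟩ := (h.cur c hc).1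
      have h1 := abs_flightPos_sub_le r s.scatterers s.pos s.vel hpos.le i
      rw [h.vel.abs_eq] at h1
      have h2 : |s.pos i - c i| ≤ r / 2 := by
        by_cases hik : i = k
        · subst hik
          have h1 := congrArg abs hk.1
          rw [abs_mul, abs_mul, abs_abs, abs_of_pos (half_pos hr)] at h1
          exact (mul_left_cancel₀ (abs_ne_zero.2 (h.vel.ne_zero hu0 i)) h1).le
        · exact (hk.2 i hik).le
      have h3 : |u i| * (ω (n + 1)).1 ≤ 5 * r / a :=
        (mul_le_of_le_one_left hpos.le (hu1 i)).trans hlt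
      have h4 := abs_add_le (flightPos r s.scatterers s.pos s.vel (ω (n + 1)).1 i - s.pos i)
        (s.pos i - c i)
      rw [sub_add_sub_cancel] at h4
      rw [step_pos]
      have h5 : (5 / a + 1 / 2) * r = 5 * r / a + r / 2 := by ring
      linarith

/-- The invariants hold at all attempts of a leg with generic data. -/
theorem inv_state (hr : 0 < r) (ha : 0 < a) (ha1 : a ≤ 1) (hu : ∀ i, a ≤ |u i|)
    (hu1 : ∀ i, |u i| ≤ 1) (hω : Generic r u ω) (n : ℕ) : Inv r a u ω n (state r u ω n) := by
  induction n with
  | zero =>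
    refine ⟨IsVel.refl _, fun i => ?_, ?_, ?_, ?_⟩
    · simp [state, State.init, zero_mem]
    all_goals simp [state, State.init]
  | succ n ih => exact ih.step hr ha ha1 hu hu1 hω

end

/-! ### Straight flights and accepted attempts -/

/-- The velocities after the attempts `0, 1, 2, …` if no attempt is rejected and no flight
meets a remembered scatterer. -/
def dirs (u : Pt) (ω : ℕ → Attempt) : ℕ → Pt
  | 0 => u
  | n + 1 => flip (ω (n + 1)).2.1 (dirs u ω n)

lemma flip_flip (i : Fin 3) (v : Pt) : flip i (flip i v) = v := by
  simp [flip]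

lemma dirs_isVel (u : Pt) (ω : ℕ → Attempt) (n : ℕ) : IsVel u (dirs u ω n) := by
  induction n with
  | zero => exact IsVel.refl _
  | succ n ih => exact ih.trans (isVel_flip _ _)

section
variable {r a : ℝ} {u : Pt} {ω : ℕ → Attempt}

/-- The position during a flight is close to the straight line through its end. The flight can
differ from the line only before the time `6 * r / a ^ 2`, and the speed in each coordinate is at
most `1`. -/
lemma GoodFlight.near_line (hr : 0 < r) (ha : 0 < a) {s : State} (h : GoodFlight r a s)
    (hv1 : ∀ i, |s.vel i| ≤ 1) {ξ t : ℝ} (ht : 0 ≤ t) (htξ : t ≤ ξ) (i : Fin 3) :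
    |flightPos r s.scatterers s.pos s.vel t i - (flightPos r s.scatterers s.pos s.vel ξ i -
      (ξ - t) * flightVel r s.scatterers s.pos s.vel ξ i)| ≤ 18 * r / a ^ 2 := by
  set T := 6 * r / a ^ 2 with hT
  have hT0 : 0 < T := by positivity
  have h18 : 18 * r / a ^ 2 = 3 * T := by rw [hT]; ring
  have hfv : ∀ t, |flightVel r s.scatterers s.pos s.vel t i| ≤ 1 := fun t => by
    rw [(isVel_flightVel r s.scatterers s.pos s.vel t).abs_eq]; exact hv1 i
  have hb : ∀ t, 0 ≤ t → |flightPos r s.scatterers s.pos s.vel t i - s.pos i| ≤ t := fun t ht =>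
    (abs_flightPos_sub_le r _ _ _ ht i).trans (mul_le_of_le_one_left ht (hv1 i))
  have hm : ∀ x t, 0 ≤ x → |x * flightVel r s.scatterers s.pos s.vel t i| ≤ x := fun x t hx => by
    rw [abs_mul, abs_of_nonneg hx]; exact mul_le_of_le_one_right hx (hfv t)
  rw [h18]
  rcases le_or_gt T t with h1 | h1
  · obtain ⟨h2, h3⟩ := h.uniform t ξ h1 (h1.trans htξ)
    rw [h2, h3]
    simp only [Pi.add_apply, Pi.smul_apply, smul_eq_mul]
    rw [add_sub_cancel_right, sub_self, abs_zero]; positivity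
  rcases le_or_gt T ξ with h2 | h2
  · obtain ⟨h3, h4⟩ := h.uniform T ξ le_rfl h2
    rw [h3, h4]
    simp only [Pi.add_apply, Pi.smul_apply, smul_eq_mul]
    have e1 := abs_le.1 (hb t ht)
    have e2 := abs_le.1 (hb T hT0.le)
    have e3 := abs_le.1 (hm (T - t) T (by linarith))
    rw [abs_le]; constructor <;> nlinarith
  · have e1 := abs_le.1 (hb t ht)
    have e2 := abs_le.1 (hb ξ (ht.trans htξ))
    have e3 := abs_le.1 (hm (ξ - t) ξ (by linarith))
    rw [abs_le]; constructor <;> nlinarith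

lemma abs_impactParam_le (hr : 0 < r) {v : Pt} (hv : ∀ i, v i ≠ 0) {x : Pt}
    (hx : ∀ i, |x i| < 1 / 2) (k i : Fin 3) : |impactParam r v k x i| ≤ r / 2 := by
  unfold impactParam
  split_ifs with h
  · rw [abs_mul, abs_div, abs_abs, div_self (abs_ne_zero.2 (hv k)), one_mul,
      abs_of_pos (half_pos hr)]
  · rw [abs_mul, abs_of_pos hr]
    have := mul_lt_mul_of_pos_left (hx i) hr
    linarith

/-- The standing assumptions on the initial velocity, the size of the scatterers and the data of
a leg: all components of the velocity are at least `a`, and the scatterers are small. Flights up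
to the length `41 * r / a ^ 3` count as short: in this time a particle moves by `41 * r / a ^ 2` at
least in each coordinate, which exceeds the tolerance `40 * r / a ^ 2` for coincidences. A flight that is
longer than `1` is never short. -/
structure Setting (r a : ℝ) (u : Pt) (ω : ℕ → Attempt) : Prop where
  r_pos : 0 < r
  a_pos : 0 < a
  a_le : a ≤ 1
  le_abs : ∀ i, a ≤ |u i|
  abs_le : ∀ i, |u i| ≤ 1
  small : 41 * r / a ^ 3 < 1
  generic : Generic r u ω

namespace Setting

lemma inv (h : Setting r a u ω) (n : ℕ) : Inv r a u ω n (state r u ω n) :=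
  inv_state h.r_pos h.a_pos h.a_le h.le_abs h.abs_le h.generic n

lemma ne_zero (h : Setting r a u ω) (i : Fin 3) : u i ≠ 0 :=
  abs_pos.1 (h.a_pos.trans_le (h.le_abs i))

lemma goodFlight (h : Setting r a u ω) (n : ℕ) : GoodFlight r a (state r u ω n) :=
  (h.inv n).goodFlight h.r_pos h.a_pos h.a_le h.le_abs

lemma five_le (h : Setting r a u ω) : 5 * r / a ≤ 41 * r / a ^ 3 := by
  have := h.r_pos
  have := h.a_pos
  have h2 : a ^ 2 ≤ 1 := pow_le_one₀ h.a_pos.le h.a_le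
  rw [div_le_div_iff₀ h.a_pos (by positivity)]
  nlinarith [mul_pos h.r_pos h.a_pos]

lemma forty_le (h : Setting r a u ω) : 41 * r / a ^ 2 ≤ a * (41 * r / a ^ 3) := by
  have := h.a_pos
  apply le_of_eq; field_simp

lemma r_le (h : Setting r a u ω) : 41 * r ≤ a ^ 3 := by
  have := h.small
  rw [div_lt_one (pow_pos h.a_pos 3)] at this; exact this.le

lemma r_le' (h : Setting r a u ω) : r ≤ r / a ^ 2 := by
  have := h.a_pos
  have h2 : a ^ 2 ≤ 1 := pow_le_one₀ h.a_pos.le h.a_le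
  rw [le_div_iff₀ (by positivity)]
  exact mul_le_of_le_one_right h.r_pos.le h2

/-- After a flight longer than `5 * r / a`, the next one is free. -/
lemma straight (h : Setting r a u ω) {n : ℕ} (hn : n ≠ 0 → 5 * r / a < flightTime ω n) :
    hitTimes r (state r u ω n).scatterers (state r u ω n).pos (state r u ω n).vel = ∅ := by
  refine (h.inv n).free h.r_pos h.ne_zero fun c hc => ?_
  rcases Nat.eq_zero_or_pos n with rfl | h0
  · simp [state, State.init] at hc
  · exact (h.inv n).far (hn h0.ne') c hc

lemma pos_succ (h : Setting r a u ω) {n : ℕ} (hn : n ≠ 0 → 5 * r / a < flightTime ω n) :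
    (state r u ω (n + 1)).pos = (state r u ω n).pos +
      flightTime ω (n + 1) • (state r u ω n).vel := by
  rw [state, step_pos, flightPos_of_free (h.straight hn)]; rfl

lemma velBefore_eq (h : Setting r a u ω) {n : ℕ} (hn : n ≠ 0 → 5 * r / a < flightTime ω n)
    (b : Attempt) : (state r u ω n).velBefore r b = (state r u ω n).vel :=
  flightVel_of_free (h.straight hn) _

/-- The path that leads to an attempt is close to the straight line through its end. -/
lemma path_near (h : Setting r a u ω) {n : ℕ} {z : Pt} (hz : z ∈ (state r u ω (n + 1)).path) :
    ∃ s, 0 ≤ s ∧ ∀ i, |z i - ((state r u ω (n + 1)).pos i -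
      s * (state r u ω n).velBefore r (ω (n + 1)) i)| ≤ 18 * r / a ^ 2 := by
  obtain ⟨t, ht, rfl⟩ := hz
  exact ⟨(ω (n + 1)).1 - t, sub_nonneg.2 ht.2, fun i => (h.goodFlight n).near_line h.r_pos h.a_pos
    (fun i => by rw [(state_isVel r u ω n).abs_eq]; exact h.abs_le i) ht.1.le ht.2 i⟩

/-- After a long flight that started straight, a new scatterer is ahead of the path of the preceding
flight. -/
lemma not_shadowed (h : Setting r a u ω) {n : ℕ} (hn : n ≠ 0 → 5 * r / a < flightTime ω n)
    (hn' : 41 * r / a ^ 3 < flightTime ω (n + 1)) :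
    ¬ (state r u ω n).Shadowed r (ω (n + 1)) := by
  rintro ⟨z, hz, hzc⟩
  rcases n with _ | n
  · simp [state, State.init] at hz
  obtain ⟨s, hs, hzs⟩ := h.path_near hz
  set i := (ω (n + 1)).2.1 + 1 with hi
  have hik : i ≠ (ω (n + 1)).2.1 := by simp [hi]
  have hvel : (state r u ω (n + 1)).vel i = (state r u ω n).velBefore r (ω (n + 1)) i :=
    step_vel_ne hik
  have h1 := hzs i
  rw [← hvel] at h1
  have h2 := hzc i
  simp only [State.newCentre, flightPos_of_free (h.straight hn), Pi.sub_apply, Pi.add_apply,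
    Pi.smul_apply, smul_eq_mul, h.velBefore_eq hn] at h2
  have h3 := abs_impactParam_le h.r_pos ((state_isVel r u ω (n + 1)).ne_zero h.ne_zero)
    (h.generic.unit (n + 1 + 1)) (ω (n + 1 + 1)).2.1 i
  generalize impactParam r (state r u ω (n + 1)).vel (ω (n + 1 + 1)).2.1
    (ω (n + 1 + 1)).2.2 i = b at h2 h3
  have ha : a ≤ |(state r u ω (n + 1)).vel i| := by
    rw [(state_isVel r u ω (n + 1)).abs_eq]; exact h.le_abs i
  generalize (state r u ω (n + 1)).vel i = w at *
  generalize (state r u ω (n + 1)).pos i = y at *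
  change 41 * r / a ^ 3 < (ω (n + 1 + 1)).1 at hn'
  generalize (ω (n + 1 + 1)).1 = ξ at *
  have hξ : 41 * r / a ^ 2 < |(ξ + s) * w| := by
    have hξ0 : 0 < ξ := lt_of_le_of_lt (by have := h.r_pos; have := h.a_pos; positivity) hn'
    rw [abs_mul, abs_of_pos (by linarith)]
    calc 41 * r / a ^ 2 ≤ a * (41 * r / a ^ 3) := h.forty_le
      _ < a * ξ := mul_lt_mul_of_pos_left hn' h.a_pos
      _ ≤ (ξ + s) * |w| := by nlinarith [h.a_pos, abs_nonneg w]
  have e1 : 41 * r / a ^ 2 = 41 * (r / a ^ 2) := by ring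
  have e2 : 18 * r / a ^ 2 = 18 * (r / a ^ 2) := by ring
  have := h.r_le'
  have hlt : |(ξ + s) * w| ≤ 18 * r / a ^ 2 + r / 2 + r / 2 := by
    have : (ξ + s) * w = (z i - (y - s * w)) - (z i - (y + ξ * w + b)) - b := by ring
    rw [this]
    refine (abs_sub _ _).trans (add_le_add ((abs_sub _ _).trans (add_le_add h1 h2)) h3)
  have := h.r_pos
  nlinarith

lemma vel_succ (h : Setting r a u ω) {n : ℕ} (hn : n ≠ 0 → 5 * r / a < flightTime ω n)
    (hn' : 41 * r / a ^ 3 < flightTime ω (n + 1)) :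
    (state r u ω (n + 1)).vel = flip (ω (n + 1)).2.1 (state r u ω n).vel := by
  rw [state, step_vel_of_not (h.not_shadowed hn hn'), h.velBefore_eq hn]

lemma attempted_succ (h : Setting r a u ω) {n : ℕ} (hn : n ≠ 0 → 5 * r / a < flightTime ω n) :
    (state r u ω (n + 1)).attempted = flip (ω (n + 1)).2.1 (state r u ω n).vel := by
  rw [state, step_attempted, h.velBefore_eq hn]

/-- As long as there is no short flight, the velocities are given by the indices of the attempts,
and the flights are straight. -/
lemma of_clean (h : Setting r a u ω) {N : ℕ}
    (hN : ∀ l, l ≠ 0 → l ≤ N → 41 * r / a ^ 3 < flightTime ω l) {n : ℕ} (hn : n ≤ N) :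
    (state r u ω n).vel = dirs u ω n ∧ (state r u ω n).attempted = dirs u ω n ∧
      (state r u ω n).pos = ∑ l ∈ Finset.range n, flightTime ω (l + 1) • dirs u ω l := by
  induction n with
  | zero => simp [state, State.init, dirs]
  | succ n ih =>
    obtain ⟨h1, -, h3⟩ := ih (by omega)
    have hs : n ≠ 0 → 5 * r / a < flightTime ω n := fun h0 =>
      h.five_le.trans_lt (hN n h0 (by omega))
    rw [h.vel_succ hs (hN _ (by omega) hn), h.attempted_succ hs, h.pos_succ hs, h1, h3,
      Finset.sum_range_succ]
    exact ⟨rfl, rfl, rfl⟩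

lemma velBefore_of_clean (h : Setting r a u ω) {N : ℕ}
    (hN : ∀ l, l ≠ 0 → l ≤ N → 41 * r / a ^ 3 < flightTime ω l) {n : ℕ} (hn : n ≤ N)
    (b : Attempt) : (state r u ω n).velBefore r b = dirs u ω n := by
  rw [h.velBefore_eq fun h0 => h.five_le.trans_lt (hN n h0 hn), (h.of_clean hN hn).1]

lemma flightTime_pos (h : Setting r a u ω) (n : ℕ) : 0 < flightTime ω n := h.generic.pos n

end Setting

end

/-! ### Translations, and the effect of the first two flight times -/

section translation
variable (r : ℝ) (d : Pt)

/-- The translate of a set of centres. -/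
def shiftSet (S : Set Pt) : Set Pt := {c | c - d ∈ S}

lemma strikes_shift (S : Set Pt) (y v : Pt) (i : Fin 3) :
    Strikes r (shiftSet d S) (y + d) v i ↔ Strikes r S y v i := by
  constructor
  · rintro ⟨c, hc, h⟩
    exact ⟨c - d, hc, by rwa [sub_sub_eq_add_sub]⟩
  · rintro ⟨c, hc, h⟩
    exact ⟨c + d, by simpa [shiftSet] using hc, by rwa [add_sub_add_right_eq_sub]⟩

lemma hitTimes_shift (S : Set Pt) (x v : Pt) :
    hitTimes r (shiftSet d S) (x + d) v = hitTimes r S x v := by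
  ext t
  simp only [hitTimes, Set.mem_ofPred_eq, add_right_comm x d, strikes_shift]

lemma nextImpact_shift (S : Set Pt) (q : Phase) :
    nextImpact r (shiftSet d S) ⟨q.time, q.pos + d, q.vel⟩ =
      ⟨(nextImpact r S q).time, (nextImpact r S q).pos + d, (nextImpact r S q).vel⟩ := by
  simp only [nextImpact, hitTimes_shift, add_right_comm q.pos d]
  congr 1
  funext i
  have h : Strikes r (shiftSet d S) (q.pos + d + sInf (hitTimes r S q.pos q.vel) • q.vel) q.vel i ↔
      Strikes r S (q.pos + sInf (hitTimes r S q.pos q.vel) • q.vel) q.vel i := by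
    rw [add_right_comm, strikes_shift]
  rw [hitTimes_shift]
  by_cases h' : Strikes r S (q.pos + sInf (hitTimes r S q.pos q.vel) • q.vel) q.vel i
  · rw [if_pos h', if_pos (h.2 h')]
  · rw [if_neg h', if_neg (mt h.1 h')]

lemma impacts_shift (S : Set Pt) (x v : Pt) (n : ℕ) :
    impacts r (shiftSet d S) (x + d) v n =
      ⟨(impacts r S x v n).time, (impacts r S x v n).pos + d, (impacts r S x v n).vel⟩ := by
  induction n with
  | zero => rfl
  | succ n ih => rw [impacts_succ, ih, nextImpact_shift, ← impacts_succ]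

lemma lastImpact_shift (S : Set Pt) (x v : Pt) (t : ℝ) :
    lastImpact r (shiftSet d S) (x + d) v t =
      ⟨(lastImpact r S x v t).time, (lastImpact r S x v t).pos + d, (lastImpact r S x v t).vel⟩ := by
  simp only [lastImpact, impactCount, impacts_shift, hitTimes_shift]

lemma flightPos_shift (S : Set Pt) (x v : Pt) (t : ℝ) :
    flightPos r (shiftSet d S) (x + d) v t = flightPos r S x v t + d := by
  simp only [flightPos, lastImpact_shift]; abel

lemma flightVel_shift (S : Set Pt) (x v : Pt) (t : ℝ) :
    flightVel r (shiftSet d S) (x + d) v t = flightVel r S x v t := by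
  simp only [flightVel, lastImpact_shift]

/-- The translate of a state. -/
def State.shift (s : State) : State :=
  ⟨s.pos + d, s.vel, s.attempted, s.cur.map (· + d), s.prev.map (· + d), shiftSet d s.path⟩

lemma map_add_eq_some (o : Option Pt) (c : Pt) : o.map (· + d) = some c ↔ o = some (c - d) := by
  cases o with
  | none => simp
  | some x => simp [eq_sub_iff_add_eq]

lemma scatterers_shift (s : State) : (s.shift d).scatterers = shiftSet d s.scatterers := by
  ext c
  simp only [State.scatterers, State.shift, map_add_eq_some, shiftSet, Set.mem_ofPred_eq]

variable {r d}

lemma State.eq_of {s t : State} (h1 : s.pos = t.pos) (h2 : s.vel = t.vel)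
    (h3 : s.attempted = t.attempted) (h4 : s.cur = t.cur) (h5 : s.prev = t.prev)
    (h6 : s.path = t.path) : s = t := by
  cases s; cases t; simp_all

/-- If the flights from two states and the attempts after them are translates of each other, so are
the next states. -/
lemma step_eq_shift {s t : State} {b : Attempt}
    (hpos : ∀ τ, flightPos r t.scatterers t.pos t.vel τ =
      flightPos r s.scatterers s.pos s.vel τ + d)
    (hvel : t.velBefore r b = s.velBefore r b) (hcur : t.cur = s.cur.map (· + d))
    (hsh : t.Shadowed r b ↔ s.Shadowed r b) : t.step r b = (s.step r b).shift d := by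
  have hc : t.newCentre r b = s.newCentre r b + d := by
    simp only [State.newCentre, hpos, hvel]; abel
  apply State.eq_of
  · rw [step_pos, hpos]; rfl
  · by_cases h : s.Shadowed r b
    · rw [step_vel_of_shadowed (hsh.2 h), hvel]; exact (step_vel_of_shadowed h).symm
    · rw [step_vel_of_not (mt hsh.1 h), hvel]; exact (step_vel_of_not h).symm
  · rw [step_attempted, hvel]; rfl
  · by_cases h : s.Shadowed r b
    · rw [step_cur_of_shadowed (hsh.2 h), State.shift, step_cur_of_shadowed h]; rfl
    · rw [step_cur_of_not (mt hsh.1 h), State.shift, step_cur_of_not h, hc]; rfl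
  · exact hcur
  · rw [step_path, State.shift, step_path]
    ext z
    simp only [mem_image, shiftSet, Set.mem_ofPred_eq, hpos, eq_sub_iff_add_eq]

lemma step_shift (s : State) (b : Attempt) :
    (s.shift d).step r b = (s.step r b).shift d := by
  have hpos : ∀ τ, flightPos r (s.shift d).scatterers (s.shift d).pos (s.shift d).vel τ =
      flightPos r s.scatterers s.pos s.vel τ + d := fun τ => by
    rw [scatterers_shift]; exact flightPos_shift r d _ _ _ τ
  have hvel : (s.shift d).velBefore r b = s.velBefore r b := by
    rw [State.velBefore, scatterers_shift]; exact flightVel_shift r d _ _ _ _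
  refine step_eq_shift hpos hvel rfl ?_
  have hc : (s.shift d).newCentre r b = s.newCentre r b + d := by
    simp only [State.newCentre, hpos, hvel]; abel
  simp only [State.Shadowed, hc]
  constructor
  · rintro ⟨z, hz, h⟩
    exact ⟨z - d, hz, by rwa [sub_sub, add_comm d]⟩
  · rintro ⟨z, hz, h⟩
    exact ⟨z + d, by simpa [State.shift, shiftSet] using hz, by
      rwa [add_sub_add_right_eq_sub]⟩

end translation

section
variable {r a : ℝ} {u : Pt} {ω ω' : ℕ → Attempt}

/-- Two sequences of data differ at most in the flight times with index in `B`. -/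
def AgreeOff (B : Set ℕ) (ω ω' : ℕ → Attempt) : Prop :=
  ∀ l, (ω l).2 = (ω' l).2 ∧ (l ∉ B → (ω l).1 = (ω' l).1)

lemma AgreeOff.eq {B : Set ℕ} (h : AgreeOff B ω ω') {l : ℕ} (hl : l ∉ B) : ω l = ω' l :=
  Prod.ext ((h l).2 hl) (h l).1

lemma AgreeOff.dirs_eq {B : Set ℕ} (h : AgreeOff B ω ω') (n : ℕ) : dirs u ω n = dirs u ω' n := by
  induction n with
  | zero => rfl
  | succ n ih => rw [dirs, dirs, ih, (h (n + 1)).1]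

/-- The states of the leg depend only on the data up to the respective attempt. -/
lemma state_congr {n : ℕ} (h : ∀ l, l ≠ 0 → l ≤ n → ω l = ω' l) :
    state r u ω n = state r u ω' n := by
  induction n with
  | zero => rfl
  | succ n ih => rw [state, state, ih fun l h0 hl => h l h0 (by omega), h (n + 1) (by omega) le_rfl]

namespace Setting

lemma lt_of_one_lt (h : Setting r a u ω) {x : ℝ} (hx : 1 < x) : 41 * r / a ^ 3 < x :=
  h.small.trans hx

lemma five_lt_of_one_lt (h : Setting r a u ω) {x : ℝ} (hx : 1 < x) : 5 * r / a < x :=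
  h.five_le.trans_lt (h.lt_of_one_lt hx)

lemma clean_two (h : Setting r a u ω) (h1 : 1 < flightTime ω 1) (h2 : 1 < flightTime ω 2) :
    ∀ l, l ≠ 0 → l ≤ 2 → 41 * r / a ^ 3 < flightTime ω l := by
  intro l h0 hl
  have : l = 1 ∨ l = 2 := by omega
  rcases this with rfl | rfl
  · exact h.lt_of_one_lt h1
  · exact h.lt_of_one_lt h2

/-- The condition for the rejection of the third attempt, in terms of data that do not include the
first two flight times. -/
lemma shadowed_two_iff (h : Setting r a u ω) (h1 : 1 < flightTime ω 1) (h2 : 1 < flightTime ω 2) :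
    (state r u ω 2).Shadowed r (ω 3) ↔ ∃ s ∈ Ico (0 : ℝ) 1, ∀ i,
      |s * dirs u ω 1 i + (ω 3).1 * dirs u ω 2 i +
        impactParam r (dirs u ω 2) (ω 3).2.1 (ω 3).2.2 i| ≤ r / 2 := by
  have hcl := h.clean_two h1 h2
  have hst1 : 1 ≠ 0 → 5 * r / a < flightTime ω 1 := fun _ => h.five_lt_of_one_lt h1
  have hst2 : 2 ≠ 0 → 5 * r / a < flightTime ω 2 := fun _ => h.five_lt_of_one_lt h2
  have hv1 := (h.of_clean hcl (n := 1) (by omega)).1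
  have hv2 := (h.of_clean hcl (n := 2) le_rfl).1
  have hp2 : (state r u ω 2).pos = (state r u ω 1).pos + flightTime ω 2 • dirs u ω 1 := by
    rw [h.pos_succ hst1, hv1]
  have hpath : (state r u ω 2).path =
      (fun t => (state r u ω 1).pos + t • dirs u ω 1) '' Ioc 0 (flightTime ω 2) := by
    rw [state, step_path]
    simp only [flightPos_of_free (h.straight hst1)]
    rw [hv1]; rfl
  have hkey : ∀ s i, (state r u ω 1).pos i + (flightTime ω 2 - s) * dirs u ω 1 i -
      (state r u ω 2).newCentre r (ω 3) i = -(s * dirs u ω 1 i + (ω 3).1 * dirs u ω 2 i +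
        impactParam r (dirs u ω 2) (ω 3).2.1 (ω 3).2.2 i) := by
    intro s i
    simp only [State.newCentre, h.velBefore_eq hst2, flightPos_of_free (h.straight hst2)]
    simp only [hp2, hv2, Pi.add_apply, Pi.smul_apply, smul_eq_mul]
    ring
  constructor
  · rintro ⟨z, hz, hzc⟩
    rw [hpath] at hz
    obtain ⟨t, ht, rfl⟩ := hz
    have h3 : ∀ i, |(flightTime ω 2 - t) * dirs u ω 1 i + (ω 3).1 * dirs u ω 2 i +
        impactParam r (dirs u ω 2) (ω 3).2.1 (ω 3).2.2 i| ≤ r / 2 := by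
      intro i
      rw [← abs_neg, ← hkey, sub_sub_cancel]; exact hzc i
    refine ⟨flightTime ω 2 - t, ⟨sub_nonneg.2 ht.2, ?_⟩, h3⟩
    -- in a coordinate that is not reversed at the second attempt, the two flights add up
    set i := (ω 2).2.1 + 1 with hi
    have hik : i ≠ (ω 2).2.1 := by simp [hi]
    have hd : dirs u ω 2 i = dirs u ω 1 i := by
      rw [dirs]; simp [flip, hik]
    have h4 := h3 i
    rw [hd, ← add_mul] at h4
    have h5 := abs_impactParam_le h.r_pos ((dirs_isVel u ω 2).ne_zero h.ne_zero)
      (h.generic.unit 3) (ω 3).2.1 i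
    have h6 : |(flightTime ω 2 - t + (ω 3).1) * dirs u ω 1 i| ≤ r := by
      have := abs_sub ((flightTime ω 2 - t + (ω 3).1) * dirs u ω 1 i +
        impactParam r (dirs u ω 2) (ω 3).2.1 (ω 3).2.2 i)
        (impactParam r (dirs u ω 2) (ω 3).2.1 (ω 3).2.2 i)
      rw [add_sub_cancel_right] at this
      linarith
    have h7 := h.generic.pos 3
    rw [abs_mul, abs_of_pos (by have := ht.2; linarith), (dirs_isVel u ω 1).abs_eq] at h6
    have h8 := h.r_le
    have h9 := h.le_abs i
    have h10 := h.a_pos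
    have h11 : a ^ 3 ≤ a := pow_le_of_le_one h10.le h.a_le (by norm_num)
    by_contra! hcon
    have : a ≤ (flightTime ω 2 - t + (ω 3).1) * |u i| := by nlinarith
    linarith [h.r_pos]
  · rintro ⟨s, ⟨hs0, hs1⟩, hs⟩
    refine ⟨(state r u ω 1).pos + (flightTime ω 2 - s) • dirs u ω 1, ?_, fun i => ?_⟩
    · rw [hpath]
      exact ⟨_, ⟨by linarith, by linarith⟩, rfl⟩
    · have := hkey s i
      simp only [Pi.sub_apply, Pi.add_apply, Pi.smul_apply, smul_eq_mul]
      rw [this, abs_neg]; exact hs i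

/-- A change of the first two flight times translates all states after the second one. -/
lemma state_eq_shift (h : Setting r a u ω) (h' : Setting r a u ω') (hag : AgreeOff {1, 2} ω ω')
    (h1 : 1 < flightTime ω 1) (h2 : 1 < flightTime ω 2) (h1' : 1 < flightTime ω' 1)
    (h2' : 1 < flightTime ω' 2) (n : ℕ) :
    state r u ω' (n + 3) = (state r u ω (n + 3)).shift
      ((flightTime ω' 1 - flightTime ω 1) • u +
        (flightTime ω' 2 - flightTime ω 2) • dirs u ω 1) := by
  set d := (flightTime ω' 1 - flightTime ω 1) • u +
    (flightTime ω' 2 - flightTime ω 2) • dirs u ω 1 with hd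
  induction n with
  | zero =>
    have hcl := h.clean_two h1 h2
    have hcl' := h'.clean_two h1' h2'
    have hst : 2 ≠ 0 → 5 * r / a < flightTime ω 2 := fun _ => h.five_lt_of_one_lt h2
    have hst' : 2 ≠ 0 → 5 * r / a < flightTime ω' 2 := fun _ => h.five_lt_of_one_lt h2'
    obtain ⟨hv2, -, hp2⟩ := h.of_clean hcl (n := 2) le_rfl
    obtain ⟨hv2', -, hp2'⟩ := h'.of_clean hcl' (n := 2) le_rfl
    rw [← hag.dirs_eq] at hv2'
    have hw3 : ω' 3 = ω 3 := (hag.eq (by simp)).symm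
    have hp : (state r u ω' 2).pos = (state r u ω 2).pos + d := by
      rw [hp2, hp2', hd]
      simp only [Finset.sum_range_succ, Finset.sum_range_zero, zero_add, ← hag.dirs_eq,
        sub_smul]
      simp only [dirs]
      abel
    change (state r u ω' 2).step r (ω' 3) = ((state r u ω 2).step r (ω 3)).shift d
    rw [hw3]
    refine step_eq_shift (fun τ => ?_) ?_ ?_ ?_
    · rw [flightPos_of_free (h.straight hst), flightPos_of_free (h'.straight hst'), hp, hv2, hv2']
      abel
    · rw [h.velBefore_eq hst, h'.velBefore_eq hst', hv2, hv2']
    · have e := h.not_shadowed (n := 1) (fun _ => h.five_lt_of_one_lt h1) (h.lt_of_one_lt h2)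
      have e' := h'.not_shadowed (n := 1) (fun _ => h.five_lt_of_one_lt h1') (h.lt_of_one_lt h2')
      have hc : (state r u ω 2).cur = some ((state r u ω 2).pos +
          impactParam r (dirs u ω 1) (ω 2).2.1 (ω 2).2.2) := by
        rw [state, step_cur_of_not e, State.newCentre, step_pos]
        rw [h.velBefore_of_clean hcl (by omega)]
      have hc' : (state r u ω' 2).cur = some ((state r u ω' 2).pos +
          impactParam r (dirs u ω 1) (ω 2).2.1 (ω 2).2.2) := by
        rw [state, step_cur_of_not e', State.newCentre, step_pos]
        rw [h'.velBefore_of_clean hcl' (by omega), ← hag.dirs_eq, ← (hag 2).1]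
      rw [hc, hc', hp, Option.map_some, add_right_comm]
    · have e := h'.shadowed_two_iff h1' h2'
      rw [hw3] at e
      rw [e, h.shadowed_two_iff h1 h2]
      simp only [hag.dirs_eq]
  | succ n ih =>
    have hw : ω' (n + 3 + 1) = ω (n + 3 + 1) := (hag.eq (by simp)).symm
    change (state r u ω' (n + 3)).step r (ω' (n + 3 + 1)) =
      ((state r u ω (n + 3)).step r (ω (n + 3 + 1))).shift d
    rw [hw, ih, step_shift]

end Setting
end

/-! ### The number of attempts and the displacement in a leg -/

section
variable {r a : ℝ} {u : Pt} {ω ω' : ℕ → Attempt}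

/-- The attempts at which the leg could end. -/
def stopSet (r : ℝ) (u : Pt) (ω : ℕ → Attempt) : Set ℕ :=
  {i | 1 < i ∧ 1 < flightTime ω (i - 1) ∧ 1 < flightTime ω i ∧ 1 < flightTime ω (i + 1) ∧
    1 < flightTime ω (i + 2) ∧ (state r u ω i).attempted = u}

lemma legCount_eq_sInf : legCount r u ω = sInf (stopSet r u ω) := rfl

lemma legCount_mem (h : (stopSet r u ω).Nonempty) : legCount r u ω ∈ stopSet r u ω :=
  Nat.sInf_mem h

lemma legCount_le {i : ℕ} (h : i ∈ stopSet r u ω) : legCount r u ω ≤ i := Nat.sInf_le h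

/-- The part of the displacement in a leg with `g` attempts that follows the moment at time `s`
after the `k`-th attempt (on the straight line through the end of that flight). -/
def backVec (r : ℝ) (u : Pt) (ω : ℕ → Attempt) (g k : ℕ) (s : ℝ) : Pt :=
  if k < g then (state r u ω g).pos - (state r u ω (k + 1)).pos +
    (flightTime ω (k + 1) - s) • (state r u ω k).velBefore r (ω (k + 1)) else 0

/-- The displacement in a leg up to the moment at time `s` before the `k + 1`-st attempt
(on the straight line through the end of that flight). -/
def fwdVec (r : ℝ) (u : Pt) (ω : ℕ → Attempt) (k : ℕ) (s : ℝ) : Pt :=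
  (state r u ω (k + 1)).pos - s • (state r u ω k).velBefore r (ω (k + 1))

/-- There is no short flight among the first `N` ones. -/
def Clean (K : ℝ) (ω : ℕ → Attempt) (N : ℕ) : Prop := ∀ l, l ≠ 0 → l ≤ N → K < flightTime ω l

namespace Setting

lemma pos_of_clean (h : Setting r a u ω) {N : ℕ} (hN : Clean (41 * r / a ^ 3) ω N) :
    (state r u ω N).pos = ∑ l ∈ Finset.range N, flightTime ω (l + 1) • dirs u ω l :=
  (h.of_clean hN le_rfl).2.2

lemma fwdVec_of_clean (h : Setting r a u ω) {k : ℕ} (hN : Clean (41 * r / a ^ 3) ω (k + 1))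
    (s : ℝ) : fwdVec r u ω k s =
      ∑ l ∈ Finset.range (k + 1), flightTime ω (l + 1) • dirs u ω l - s • dirs u ω k := by
  rw [fwdVec, h.pos_of_clean hN, h.velBefore_of_clean hN (by omega)]

lemma backVec_of_clean (h : Setting r a u ω) {g k : ℕ} (hN : Clean (41 * r / a ^ 3) ω g) {s : ℝ}
    (hs : g ≤ k → s = 0) : backVec r u ω g k s =
      ∑ l ∈ Finset.Ico k g, flightTime ω (l + 1) • dirs u ω l - s • dirs u ω k := by
  unfold backVec
  split_ifs with hk
  · rw [h.pos_of_clean hN, (h.of_clean hN (n := k + 1) (by omega)).2.2,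
      h.velBefore_of_clean hN (by omega), ← Finset.sum_range_add_sum_Ico _ hk.le,
      Finset.sum_range_succ, sub_smul]
    abel
  · rw [hs (by omega), Finset.Ico_eq_empty (by omega)]; simp

/-- A change of the first two flight times translates all positions from the second attempt on, and
has no effect on the velocities. -/
lemma pos_shift (h : Setting r a u ω) (h' : Setting r a u ω') (hag : AgreeOff {1, 2} ω ω')
    (h1 : 1 < flightTime ω 1) (h2 : 1 < flightTime ω 2) (h1' : 1 < flightTime ω' 1)
    (h2' : 1 < flightTime ω' 2) {n : ℕ} (hn : 1 < n) :
    (state r u ω' n).pos = (state r u ω n).pos + ((flightTime ω' 1 - flightTime ω 1) • u +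
        (flightTime ω' 2 - flightTime ω 2) • dirs u ω 1) ∧
      (state r u ω' n).attempted = (state r u ω n).attempted := by
  obtain rfl | hn := (show n = 2 ∨ 3 ≤ n by omega)
  · obtain ⟨-, ha, hp⟩ := h.of_clean (h.clean_two h1 h2) (n := 2) le_rfl
    obtain ⟨-, ha', hp'⟩ := h'.of_clean (h'.clean_two h1' h2') (n := 2) le_rfl
    rw [hp, hp', ha, ha']
    simp only [← hag.dirs_eq, and_true, Finset.sum_range_succ, Finset.sum_range_zero, zero_add,
      sub_smul]
    simp only [dirs]
    abel
  · obtain ⟨m, rfl⟩ := Nat.exists_eq_add_of_le' hn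
    rw [h.state_eq_shift h' hag h1 h2 h1' h2']
    exact ⟨rfl, rfl⟩

/-- The number of attempts in a leg does not depend on the first two flight times, as these are
greater than `1` anyway. -/
lemma legCount_eq (h : Setting r a u ω) (h' : Setting r a u ω') (hag : AgreeOff {1, 2} ω ω')
    (h1 : 1 < flightTime ω 1) (h2 : 1 < flightTime ω 2) (h1' : 1 < flightTime ω' 1)
    (h2' : 1 < flightTime ω' 2) : legCount r u ω' = legCount r u ω := by
  have hξ : ∀ l, 1 < flightTime ω' l ↔ 1 < flightTime ω l := by
    intro l
    by_cases hl : l = 1 ∨ l = 2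
    · rcases hl with rfl | rfl <;> simp [*]
    · unfold flightTime; rw [hag.eq (by simpa using hl)]
  rw [legCount_eq_sInf, legCount_eq_sInf]
  congr 1
  ext i
  simp only [stopSet, Set.mem_ofPred_eq, hξ]
  refine and_congr_right fun hi => ?_
  rw [(h.pos_shift h' hag h1 h2 h1' h2' hi).2]

/-- A change of the first two flight times translates the end of the leg. -/
lemma legEnd_shift (h : Setting r a u ω) (h' : Setting r a u ω') (hag : AgreeOff {1, 2} ω ω')
    (h1 : 1 < flightTime ω 1) (h2 : 1 < flightTime ω 2) (h1' : 1 < flightTime ω' 1)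
    (h2' : 1 < flightTime ω' 2) (hγ : (stopSet r u ω).Nonempty) :
    legEnd r u ω' = legEnd r u ω + ((flightTime ω' 1 - flightTime ω 1) • u +
        (flightTime ω' 2 - flightTime ω 2) • dirs u ω 1) := by
  rw [legEnd, legEnd, h.legCount_eq h' hag h1 h2 h1' h2',
    (h.pos_shift h' hag h1 h2 h1' h2' (legCount_mem hγ).1).1]

/-- A change of the first flight time translates the displacement up to any moment. -/
lemma fwdVec_shift (h : Setting r a u ω) (h' : Setting r a u ω') (hag : AgreeOff {1} ω ω')
    (h1 : 1 < flightTime ω 1) (h2 : 1 < flightTime ω 2) (h1' : 1 < flightTime ω' 1)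
    (h2' : 1 < flightTime ω' 2) (k : ℕ) (s : ℝ) :
    fwdVec r u ω' k s = fwdVec r u ω k s + (flightTime ω' 1 - flightTime ω 1) • u := by
  have hag' : AgreeOff {1, 2} ω ω' := fun l => ⟨(hag l).1, fun hl => (hag l).2 fun hl' => hl (by
    simp only [mem_singleton_iff] at hl'; simp [hl'])⟩
  have h22 : flightTime ω' 2 = flightTime ω 2 := ((hag 2).2 (by simp)).symm
  obtain rfl | hk := Nat.eq_zero_or_pos k
  · have hcl : Clean (41 * r / a ^ 3) ω 1 := fun l h0 hl => h.clean_two h1 h2 l h0 (by omega)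
    have hcl' : Clean (41 * r / a ^ 3) ω' 1 := fun l h0 hl => h'.clean_two h1' h2' l h0 (by omega)
    rw [h.fwdVec_of_clean hcl, h'.fwdVec_of_clean hcl']
    simp only [zero_add, Finset.sum_range_one, dirs, sub_smul]
    abel
  · have hp := (h.pos_shift h' hag' h1 h2 h1' h2' (n := k + 1) (by omega)).1
    have hat := (h.pos_shift h' hag' h1 h2 h1' h2' (n := k + 1) (by omega)).2
    have hvb : (state r u ω' k).velBefore r (ω' (k + 1)) =
        (state r u ω k).velBefore r (ω (k + 1)) := by
      rw [state, state, step_attempted, step_attempted, ← (hag (k + 1)).1] at hat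
      rw [← flip_flip (ω (k + 1)).2.1 ((state r u ω' k).velBefore r (ω' (k + 1))), hat, flip_flip]
    rw [fwdVec, fwdVec, hp, hvb, h22]
    simp only [sub_self, zero_smul, add_zero]
    abel

/-- The last flight of a leg is free, and its direction is determined by the last index. -/
lemma vel_before_last (h : Setting r a u ω) {g : ℕ} (hg : g ∈ stopSet r u ω) :
    (state r u ω (g - 1)).vel = flip (ω g).2.1 u ∧
      (state r u ω (g - 1)).velBefore r (ω g) = flip (ω g).2.1 u ∧
      (state r u ω g).pos = (state r u ω (g - 1)).pos + flightTime ω g • flip (ω g).2.1 u := by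
  obtain ⟨h1, h2, -, -, -, hat⟩ := hg
  obtain ⟨n, rfl⟩ := Nat.exists_eq_add_of_le' h1.le
  rw [Nat.add_sub_cancel] at *
  have hst : n ≠ 0 → 5 * r / a < flightTime ω n := fun _ => h.five_lt_of_one_lt h2
  rw [h.attempted_succ hst] at hat
  have hv : (state r u ω n).vel = flip (ω (n + 1)).2.1 u :=
    (flip_flip _ _).symm.trans (congrArg (flip _) hat)
  refine ⟨hv, by rw [h.velBefore_eq hst, hv], ?_⟩
  rw [h.pos_succ hst, hv]

/-- A change of the last flight time translates the displacement up to the end of the leg. -/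
lemma backVec_shift (h : Setting r a u ω) (h' : Setting r a u ω') {g k : ℕ} (hkg : k < g)
    (hag : AgreeOff {g} ω ω') (hg : g ∈ stopSet r u ω) (hg' : g ∈ stopSet r u ω') (s : ℝ) :
    backVec r u ω' g k s = backVec r u ω g k s +
      (flightTime ω' g - flightTime ω g) • flip (ω g).2.1 u := by
  obtain ⟨hv, hb, hp⟩ := h.vel_before_last hg
  obtain ⟨hv', hb', hp'⟩ := h'.vel_before_last hg'
  rw [← (hag g).1] at hv' hb' hp'
  have hst : ∀ n < g, state r u ω' n = state r u ω n := fun n hn =>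
    state_congr fun l _ hl => (hag.eq (by simp; omega)).symm
  simp only [backVec, hkg, if_true]
  obtain hk | hk := (show k + 1 < g ∨ k + 1 = g by omega)
  · rw [hp, hp', hst _ hk, hst _ hkg, hst (g - 1) (by omega)]
    have : ω' (k + 1) = ω (k + 1) := (hag.eq (by simp; omega)).symm
    unfold flightTime
    rw [this]
    simp only [sub_smul]
    abel
  · subst hk
    rw [Nat.add_sub_cancel] at *
    rw [hb, hb']
    simp only [sub_self, zero_add, sub_smul]
    abel

/-- A run of long flights with suitable indices contains an attempt at which the leg can end: the
indices follow a Gray code, so that all accessible velocities occur. -/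
lemma exists_mem_stopSet (h : Setting r a u ω) {m : ℕ} (hlong : ∀ t, t < 11 → 1 < flightTime ω (m + 1 + t))
    (h2 : (ω (m + 2)).2.1 = 0) (h3 : (ω (m + 3)).2.1 = 1) (h4 : (ω (m + 4)).2.1 = 0)
    (h5 : (ω (m + 5)).2.1 = 2) (h6 : (ω (m + 6)).2.1 = 0) (h7 : (ω (m + 7)).2.1 = 1)
    (h8 : (ω (m + 8)).2.1 = 0) (h9 : (ω (m + 9)).2.1 = 2) :
    ∃ i, i ≤ m + 9 ∧ i ∈ stopSet r u ω := by
  have step : ∀ t, t < 10 → (state r u ω (m + 1 + t + 1)).vel =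
      flip (ω (m + 1 + t + 1)).2.1 (state r u ω (m + 1 + t)).vel ∧
      (state r u ω (m + 1 + t + 1)).attempted =
      flip (ω (m + 1 + t + 1)).2.1 (state r u ω (m + 1 + t)).vel := by
    intro t ht
    have hst : m + 1 + t ≠ 0 → 5 * r / a < flightTime ω (m + 1 + t) := fun _ =>
      h.five_lt_of_one_lt (hlong t (by omega))
    exact ⟨h.vel_succ hst (h.lt_of_one_lt (hlong (t + 1) (by omega))), h.attempted_succ hst⟩
  have key : ∀ t, t < 8 → (state r u ω (m + 1 + t + 1)).attempted = u →
      ∃ i, i ≤ m + 9 ∧ i ∈ stopSet r u ω := by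
    intro t ht hu
    refine ⟨m + 1 + t + 1, by omega, by omega, ?_, ?_, ?_, ?_, hu⟩
    · exact hlong t (by omega)
    · exact hlong (t + 1) (by omega)
    · exact hlong (t + 2) (by omega)
    · exact hlong (t + 3) (by omega)
  have e0 := step 0 (by omega)
  have e1 := step 1 (by omega)
  have e2 := step 2 (by omega)
  have e3 := step 3 (by omega)
  have e4 := step 4 (by omega)
  have e5 := step 5 (by omega)
  have e6 := step 6 (by omega)
  have e7 := step 7 (by omega)
  simp only [add_assoc, Nat.reduceAdd, h2, h3, h4, h5, h6, h7, h8, h9] at e0 e1 e2 e3 e4 e5 e6 e7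
  rw [e0.1] at e1
  rw [e1.1] at e2
  rw [e2.1] at e3
  rw [e3.1] at e4
  rw [e4.1] at e5
  rw [e5.1] at e6
  rw [e6.1] at e7
  have hV := state_isVel r u ω (m + 1)
  generalize (state r u ω (m + 1)).vel = V at *
  have fin : ∀ W : Pt, W 0 = u 0 → W 1 = u 1 → W 2 = u 2 → W = u := by
    intro W h0 h1 h2; funext i; fin_cases i <;> assumption
  rcases hV 0 with v0 | v0 <;> rcases hV 1 with v1 | v1 <;> rcases hV 2 with v2 | v2
  · exact key 7 (by omega) (e7.2.trans (fin _ (by simp [flip, v0]) (by simp [flip, v1])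
      (by simp [flip, v2])))
  · exact key 6 (by omega) (e6.2.trans (fin _ (by simp [flip, v0]) (by simp [flip, v1])
      (by simp [flip, v2])))
  · exact key 2 (by omega) (e2.2.trans (fin _ (by simp [flip, v0]) (by simp [flip, v1])
      (by simp [flip, v2])))
  · exact key 3 (by omega) (e3.2.trans (fin _ (by simp [flip, v0]) (by simp [flip, v1])
      (by simp [flip, v2])))
  · exact key 0 (by omega) (e0.2.trans (fin _ (by simp [flip, v0]) (by simp [flip, v1])
      (by simp [flip, v2])))
  · exact key 5 (by omega) (e5.2.trans (fin _ (by simp [flip, v0]) (by simp [flip, v1])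
      (by simp [flip, v2])))
  · exact key 1 (by omega) (e1.2.trans (fin _ (by simp [flip, v0]) (by simp [flip, v1])
      (by simp [flip, v2])))
  · exact key 4 (by omega) (e4.2.trans (fin _ (by simp [flip, v0]) (by simp [flip, v1])
      (by simp [flip, v2])))

end Setting
end

/-! ### Resampling of coordinates of a product measure -/

section resampling
set_option linter.unusedSectionVars false
variable {ι Y : Type*} [DecidableEq ι] [MeasurableSpace Y]

/-- The first components of the coordinates with index in `S` are taken from `ω'`, all the rest
from `ω`. -/
def mix (S : Finset ι) (ω ω' : ι → ℝ × Y) : ι → ℝ × Y :=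
  fun c => (if c ∈ S then (ω' c).1 else (ω c).1, (ω c).2)

lemma measurable_mix (S : Finset ι) :
    Measurable fun z : (ι → ℝ × Y) × (ι → ℝ × Y) => mix S z.1 z.2 := by
  refine measurable_pi_lambda _ fun c => Measurable.prodMk ?_ (by fun_prop)
  by_cases h : c ∈ S <;> simp only [h, if_true, if_false] <;> fun_prop

lemma mix_apply_of_mem {S : Finset ι} {ω ω' : ι → ℝ × Y} {c : ι} (h : c ∈ S) :
    (mix S ω ω' c).1 = (ω' c).1 := if_pos h

lemma mix_apply_of_notMem {S : Finset ι} {ω ω' : ι → ℝ × Y} {c : ι} (h : c ∉ S) :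
    mix S ω ω' c = ω c := by simp [mix, h]

lemma measurable_update_prod {X : Type*} [MeasurableSpace X] (c : ι) :
    Measurable fun z : (ι → X) × X => Function.update z.1 c z.2 := by
  refine measurable_pi_lambda _ fun i => ?_
  by_cases h : i = c
  · subst h; simpa using measurable_snd
  · simp only [Function.update_of_ne h]; fun_prop

lemma measurable_update_fst (c : ι) :
    Measurable fun z : (ι → ℝ × Y) × ℝ => Function.update z.1 c (z.2, (z.1 c).2) :=
  (measurable_update_prod c).comp
    (measurable_fst.prodMk (measurable_snd.prodMk (by fun_prop)))

/-- A coordinate of a product measure can be drawn anew. -/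
lemma lintegral_update {X : Type*} [MeasurableSpace X] (μ : ι → Measure X)
    [∀ c, IsProbabilityMeasure (μ c)] (c : ι) {f : (ι → X) → ℝ≥0∞} (hf : Measurable f) :
    ∫⁻ ω, ∫⁻ z, f (Function.update ω c z) ∂μ c ∂Measure.infinitePi μ =
      ∫⁻ ω, f ω ∂Measure.infinitePi μ := by
  have h : ((Measure.infinitePi μ).prod (μ c)).map (fun z => Function.update z.1 c z.2) =
      Measure.infinitePi μ := by
    refine Measure.eq_infinitePi μ fun s t ht => ?_
    rw [Measure.map_apply (measurable_update_prod c)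
      (MeasurableSet.pi s.countable_toSet fun i hi => ht i)]
    have hpre : (fun z : (ι → X) × X => Function.update z.1 c z.2) ⁻¹'
        (Set.pi s t) = (Set.pi (s.erase c : Finset ι) t) ×ˢ (if c ∈ s then t c else univ) := by
      ext ⟨ω, z⟩
      simp only [mem_preimage, Set.mem_pi, Finset.mem_coe, mem_prod, Finset.mem_erase]
      constructor
      · intro hz
        refine ⟨fun i hi => ?_, ?_⟩
        · have := hz i hi.2; rwa [Function.update_of_ne hi.1] at this
        · split_ifs with hc
          · have := hz c hc; rwa [Function.update_self] at this
          · trivial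
      · rintro ⟨h1, h2⟩ i hi
        by_cases hic : i = c
        · subst hic; rw [if_pos hi] at h2; rwa [Function.update_self]
        · rw [Function.update_of_ne hic]; exact h1 i ⟨hic, hi⟩
    rw [hpre, Measure.prod_prod, Measure.infinitePi_pi _ fun i _ => ht i]
    by_cases hc : c ∈ s
    · rw [if_pos hc, Finset.prod_erase_mul _ _ hc]
    · rw [if_neg hc, measure_univ, mul_one, Finset.erase_eq_of_notMem hc]
  conv_rhs => rw [← h]
  rw [lintegral_map hf (measurable_update_prod c)]
  exact (lintegral_prod (fun z => f (Function.update z.1 c z.2))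
    (hf.comp (measurable_update_prod c)).aemeasurable).symm

variable (ν : ι → Measure ℝ) [∀ c, IsProbabilityMeasure (ν c)] (ρ : Measure Y)
  [IsProbabilityMeasure ρ]

/-- The law of a family of independent pairs with independent components. -/
abbrev pairLaw : Measure (ι → ℝ × Y) := Measure.infinitePi fun c => (ν c).prod ρ

/-- The first component of a coordinate can be drawn anew. -/
lemma lintegral_update_fst (c : ι) {f : (ι → ℝ × Y) → ℝ≥0∞} (hf : Measurable f) :
    ∫⁻ ω, ∫⁻ x, f (Function.update ω c (x, (ω c).2)) ∂ν c ∂pairLaw ν ρ =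
      ∫⁻ ω, f ω ∂pairLaw ν ρ := by
  have hg : Measurable fun ω : ι → ℝ × Y => ∫⁻ x, f (Function.update ω c (x, (ω c).2)) ∂ν c :=
    (hf.comp (measurable_update_fst c)).lintegral_prod_right'
  rw [← lintegral_update (fun c => (ν c).prod ρ) c hg,
    ← lintegral_update (fun c => (ν c).prod ρ) c hf]
  refine lintegral_congr fun ω => ?_
  have hm : Measurable fun z : ℝ × Y => f (Function.update ω c z) :=
    hf.comp ((measurable_update_prod c).comp (measurable_const.prodMk measurable_id))
  simp only [Function.update_idem, Function.update_self]
  have h1 : Measurable fun y : Y => ∫⁻ x, f (Function.update ω c (x, y)) ∂ν c :=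
    (hm.comp measurable_swap).lintegral_prod_right'
  rw [lintegral_prod_symm _ hm.aemeasurable, lintegral_prod_symm]
  · simp
  · exact (h1.comp measurable_snd).aemeasurable

/-- First components can be taken from an independent copy. -/
lemma lintegral_mix (S : Finset ι) {f : (ι → ℝ × Y) → ℝ≥0∞} (hf : Measurable f) :
    ∫⁻ ω, ∫⁻ ω', f (mix S ω ω') ∂pairLaw ν ρ ∂pairLaw ν ρ = ∫⁻ ω, f ω ∂pairLaw ν ρ := by
  induction S using Finset.induction_on generalizing f with
  | empty =>
    have : ∀ ω ω' : ι → ℝ × Y, mix ∅ ω ω' = ω := fun ω ω' => by ext c <;> simp [mix]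
    simp [this]
  | insert b S hb ih =>
    have hg : Measurable fun ω : ι → ℝ × Y => ∫⁻ x, f (Function.update ω b (x, (ω b).2)) ∂ν b :=
      (hf.comp (measurable_update_fst b)).lintegral_prod_right'
    rw [← lintegral_update_fst ν ρ b hf, ← ih hg]
    refine lintegral_congr fun ω => ?_
    rw [← lintegral_update_fst ν ρ b (f := fun ω' => f (mix (insert b S) ω ω'))
      (hf.comp ((measurable_mix _).comp (measurable_const.prodMk measurable_id)))]
    refine lintegral_congr fun ω' => lintegral_congr fun x => ?_
    congr 1
    funext c
    by_cases hc : c = b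
    · subst hc; simp [mix]
    · by_cases hcS : c ∈ S
      · simp [mix, hc, hcS]
      · simp [mix, hc, hcS]

/-- The law of total probability, given all but the first components with index in `S`. -/
lemma measure_eq_lintegral_mix (S : Finset ι) {E : Set (ι → ℝ × Y)} (hE : MeasurableSet E) :
    pairLaw ν ρ E = ∫⁻ ω, pairLaw ν ρ {ω' | mix S ω ω' ∈ E} ∂pairLaw ν ρ := by
  rw [← lintegral_indicator_one hE, ← lintegral_mix ν ρ S (measurable_one.indicator hE)]
  refine lintegral_congr fun ω => ?_
  rw [← lintegral_indicator_one]
  · rfl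
  · exact ((measurable_mix S).comp (measurable_const.prodMk measurable_id)) hE

/-- A bound for the conditional probability, given all but the first components with index in `S`,
bounds the probability. -/
lemma measure_le_of_fiber (S : Finset ι) {E W : Set (ι → ℝ × Y)} (hE : MeasurableSet E)
    (hW : MeasurableSet W) (hEW : ∀ ω ω', mix S ω ω' ∈ E → ω ∈ W) {q : ℝ≥0∞}
    (hq : ∀ ω, pairLaw ν ρ {ω' | mix S ω ω' ∈ E} ≤ q) :
    pairLaw ν ρ E ≤ q * pairLaw ν ρ W := by
  rw [measure_eq_lintegral_mix ν ρ S hE, ← lintegral_indicator_const hW]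
  refine lintegral_mono fun ω => ?_
  by_cases h : ω ∈ W
  · rw [indicator_of_mem h]; exact hq ω
  · have : {ω' | mix S ω ω' ∈ E} = ∅ := by
      ext ω'; exact ⟨fun h' => h (hEW ω ω' h'), fun h' => h'.elim⟩
    rw [this, measure_empty]; exact zero_le

/-- An event that does not depend on the first components with index in `S`, and an event that depends
on nothing else, are independent. -/
lemma measure_inter_of_mix (S : Finset ι) {V H : Set (ι → ℝ × Y)} (hV : MeasurableSet V)
    (hH : MeasurableSet H) (h1 : ∀ ω ω', mix S ω ω' ∈ V ↔ ω ∈ V)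
    (h2 : ∀ ω ω', mix S ω ω' ∈ H ↔ ω' ∈ H) :
    pairLaw ν ρ (V ∩ H) = pairLaw ν ρ V * pairLaw ν ρ H := by
  rw [measure_eq_lintegral_mix ν ρ S (hV.inter hH), mul_comm, ← lintegral_indicator_const hV]
  refine lintegral_congr fun ω => ?_
  by_cases h : ω ∈ V
  · rw [indicator_of_mem h]; congr 1; ext ω'; simp [h1, h2, h]
  · rw [indicator_of_notMem h]
    have : {ω' | mix S ω ω' ∈ V ∩ H} = ∅ := by
      ext ω'; simp [h1, h]
    rw [this, measure_empty]

/-- The probability that first components lie in given sets. -/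
lemma measure_fst_mem (S : Finset ι) {A : ι → Set ℝ} (hA : ∀ c, MeasurableSet (A c)) :
    pairLaw ν ρ {ω | ∀ c ∈ S, (ω c).1 ∈ A c} = ∏ c ∈ S, ν c (A c) := by
  have : {ω : ι → ℝ × Y | ∀ c ∈ S, (ω c).1 ∈ A c} = Set.pi S fun c => A c ×ˢ univ := by
    ext ω; simp [Set.pi]
  rw [this, Measure.infinitePi_pi _ fun c _ => (hA c).prod MeasurableSet.univ]
  simp [Measure.prod_prod]

lemma measurableSet_fst_mem (S : Finset ι) {A : ι → Set ℝ} (hA : ∀ c, MeasurableSet (A c)) :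
    MeasurableSet {ω : ι → ℝ × Y | ∀ c ∈ S, (ω c).1 ∈ A c} := by
  have : {ω : ι → ℝ × Y | ∀ c ∈ S, (ω c).1 ∈ A c} = Set.pi S fun c => A c ×ˢ univ := by
    ext ω; simp [Set.pi]
  rw [this]
  exact MeasurableSet.pi S.countable_toSet fun c _ => (hA c).prod MeasurableSet.univ

/-- The laws `ν c` have densities which are bounded by `C * exp (-x)`. -/
def ExpBound (ν : ι → Measure ℝ) (C : ℝ≥0∞) : Prop :=
  (∀ c s, 0 ≤ s → ν c (Ici s) ≤ C * ENNReal.ofReal (Real.exp (-s))) ∧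
    ∀ c s l, 0 ≤ s → ∀ x, ν c (Ici s ∩ Icc x (x + l)) ≤
      C * ENNReal.ofReal (Real.exp (-s)) * ENNReal.ofReal l

/-- The basic estimate: if, on the event `E`, the flight times with index in `B` are determined by
all other data up to an error `d`, those with index in `T \ B` are at most `d`, and those
with index in `K` at least `s c`, then these facts contribute to the bound as if they were
independent. -/
lemma measure_le_of_determined {C : ℝ≥0∞} (hν : ExpBound ν C) {d : ℝ} (hd : 0 ≤ d)
    {B T K : Finset ι} (hBT : B ⊆ T) (hTK : T ⊆ K) {s : ι → ℝ} (hs : ∀ c, 0 ≤ s c)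
    {E W : Set (ι → ℝ × Y)} (hE : MeasurableSet E) (hW : MeasurableSet W) (hEW : E ⊆ W)
    (hWK : ∀ ω ω', mix K ω ω' ∈ W ↔ ω ∈ W)
    (htail : ∀ ω ∈ E, ∀ c ∈ K, s c ≤ (ω c).1)
    (hshort : ∀ ω ∈ E, ∀ c ∈ T, c ∉ B → (ω c).1 ≤ d)
    (hdet : ∀ ω ∈ E, ∀ ω' ∈ E, (∀ c, (ω c).2 = (ω' c).2 ∧ (c ∉ B → (ω c).1 = (ω' c).1)) →
      ∀ c ∈ B, |(ω c).1 - (ω' c).1| ≤ d) :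
    pairLaw ν ρ E ≤ (∏ c ∈ K, C * ENNReal.ofReal (Real.exp (-s c))) *
      ENNReal.ofReal (2 * d) ^ T.card * pairLaw ν ρ W := by
  set w : ι → ℝ≥0∞ := fun c => C * ENNReal.ofReal (Real.exp (-s c)) with hw
  set A : ι → Set ℝ := fun c => if c ∈ T then Ici (s c) ∩ Icc 0 (0 + d) else Ici (s c) with hAdef
  have hA : ∀ c, MeasurableSet (A c) := fun c => by
    simp only [hAdef]; split_ifs
    · exact measurableSet_Ici.inter measurableSet_Icc
    · exact measurableSet_Ici
  set H : Set (ι → ℝ × Y) := {ω | ∀ c ∈ K \ B, (ω c).1 ∈ A c} with hH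
  have hHm : MeasurableSet H := measurableSet_fst_mem _ hA
  -- the flight times with index in `B`, given all the rest
  have h1 : pairLaw ν ρ E ≤ (∏ c ∈ B, w c * ENNReal.ofReal (2 * d)) * pairLaw ν ρ (W ∩ H) := by
    refine measure_le_of_fiber ν ρ B hE (hW.inter hHm) (fun ω ω' h => ⟨?_, ?_⟩) fun ω => ?_
    · have hmm : mix K (mix B ω ω') ω = ω := by
        funext c
        by_cases hc : c ∈ K
        · simp [mix, hc]
        · have : c ∉ B := fun hcB => hc (hTK (hBT hcB))
          simp [mix, hc, this]
      rw [← hmm, hWK]; exact hEW h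
    · intro c hc
      rw [Finset.mem_sdiff] at hc
      have e : mix B ω ω' c = ω c := mix_apply_of_notMem hc.2
      have h3 := htail _ h c hc.1
      rw [e] at h3
      simp only [hAdef]
      split_ifs with hcT
      · have h4 := hshort _ h c hcT hc.2
        rw [e] at h4
        exact ⟨h3, (hs c).trans h3, by simpa using h4⟩
      · exact h3
    · rcases eq_empty_or_nonempty {ω' | mix B ω ω' ∈ E} with h0 | ⟨ω₀, h0⟩
      · rw [h0, measure_empty]; exact zero_le
      · have hsub : {ω' | mix B ω ω' ∈ E} ⊆ {ω' : ι → ℝ × Y | ∀ c ∈ B, (ω' c).1 ∈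
            Ici (s c) ∩ Icc ((ω₀ c).1 - d) ((ω₀ c).1 - d + 2 * d)} := by
          intro ω' h' c hc
          have h3 := htail _ h' c (hTK (hBT hc))
          have h4 := hdet _ h' _ h0 (fun c => ⟨rfl, fun hc' => by
            rw [mix_apply_of_notMem hc', mix_apply_of_notMem hc']⟩) c hc
          rw [mix_apply_of_mem hc] at h3 h4
          rw [mix_apply_of_mem hc, abs_le] at h4
          exact ⟨h3, by linarith, by linarith⟩
        refine (measure_mono hsub).trans ?_
        rw [measure_fst_mem ν ρ B fun c => measurableSet_Ici.inter measurableSet_Icc]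
        exact Finset.prod_le_prod' fun c _ => hν.2 c (s c) (2 * d) (hs c) _
  have h2 : pairLaw ν ρ (W ∩ H) ≤ pairLaw ν ρ W *
      ∏ c ∈ K \ B, (w c * if c ∈ T then ENNReal.ofReal (2 * d) else 1) := by
    rw [measure_inter_of_mix ν ρ K hW hHm hWK, hH, measure_fst_mem ν ρ _ hA]
    · refine mul_le_mul_right (Finset.prod_le_prod' fun c _ => ?_) _
      simp only [hAdef]
      split_ifs
      · refine (hν.2 c (s c) d (hs c) 0).trans ?_
        exact mul_le_mul_right (ENNReal.ofReal_le_ofReal (by linarith)) _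
      · rw [mul_one]; exact hν.1 c (s c) (hs c)
    · intro ω ω'
      simp only [hH, Set.mem_ofPred_eq]
      refine forall₂_congr fun c hc => ?_
      rw [mix_apply_of_mem (Finset.mem_sdiff.1 hc).1]
  refine (h1.trans (mul_le_mul_right h2 _)).trans (le_of_eq ?_)
  have h3 : ∏ c ∈ B, w c * ENNReal.ofReal (2 * d) =
      ∏ c ∈ B, (w c * if c ∈ T then ENNReal.ofReal (2 * d) else 1) :=
    Finset.prod_congr rfl fun c hc => by rw [if_pos (hBT hc)]
  have h4 : ∏ c ∈ K, (if c ∈ T then ENNReal.ofReal (2 * d) else 1) =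
      ENNReal.ofReal (2 * d) ^ T.card := by
    rw [Finset.prod_ite_mem, Finset.inter_eq_right.2 hTK, Finset.prod_const]
  rw [h3, ← h4, ← Finset.prod_mul_distrib, ← Finset.prod_sdiff (hBT.trans hTK)]
  ring

end resampling

/-! ### Sums of exponential variables -/

/-- The density of the sum of `n + 1` independent variables with density `exp (1 - x)` on
`(1, ∞)`. -/
def sumDensity (n : ℕ) (x : ℝ) : ℝ :=
  Real.exp (n + 1 - x) * (x - (n + 1)) ^ n / n.factorial

@[fun_prop]
lemma continuous_sumDensity (n : ℕ) : Continuous (sumDensity n) := by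
  unfold sumDensity; fun_prop

/-- The density of the sum of `N` variables is at most `1 / √N`. -/
lemma sumDensity_le {n : ℕ} {x : ℝ} (hx : (n : ℝ) + 1 < x) :
    sumDensity n x ≤ 1 / Real.sqrt (n + 1) := by
  set t := x - (n + 1) with ht
  have ht0 : 0 < t := by linarith
  have hexp : Real.exp (n + 1 - x) = Real.exp (-t) := by congr 1; rw [ht]; ring
  rw [sumDensity, hexp, ← ht]
  rcases Nat.eq_zero_or_pos n with rfl | hn
  · simp [ht0.le]
  have hn' : (0 : ℝ) < n := Nat.cast_pos.2 hn
  have h1 : t ^ n ≤ (n : ℝ) ^ n * Real.exp (t - n) := by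
    have h2 : t / n ≤ Real.exp (t / n - 1) := by
      have := Real.add_one_le_exp (t / n - 1); linarith
    have h3 : (t / n) ^ n ≤ Real.exp (t / n - 1) ^ n := pow_le_pow_left₀ (by positivity) h2 n
    rw [← Real.exp_nat_mul, div_pow, div_le_iff₀ (by positivity)] at h3
    have h4 : (n : ℝ) * (t / n - 1) = t - n := by field_simp
    rw [h4] at h3; linarith
  have h5 := Stirling.le_factorial_stirling n
  have h6 : Real.sqrt (n + 1) ≤ Real.sqrt (2 * Real.pi * n) := by
    apply Real.sqrt_le_sqrt
    have : (1 : ℝ) ≤ n := by exact_mod_cast hn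
    nlinarith [Real.pi_gt_three]
  have h7 : Real.exp (-t) * t ^ n ≤ ((n : ℝ) / Real.exp 1) ^ n := by
    calc Real.exp (-t) * t ^ n ≤ Real.exp (-t) * ((n : ℝ) ^ n * Real.exp (t - n)) :=
          mul_le_mul_of_nonneg_left h1 (Real.exp_pos _).le
      _ = (n : ℝ) ^ n * (Real.exp (-t) * Real.exp (t - n)) := by ring
      _ = ((n : ℝ) / Real.exp 1) ^ n := by
        rw [← Real.exp_add, div_pow, ← Real.exp_nat_mul, div_eq_mul_inv, ← Real.exp_neg]
        congr 2; ring
  rw [div_le_div_iff₀ (by positivity) (by positivity), one_mul]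
  calc Real.exp (-t) * t ^ n * Real.sqrt (n + 1)
      ≤ ((n : ℝ) / Real.exp 1) ^ n * Real.sqrt (2 * Real.pi * n) := by gcongr
    _ ≤ n.factorial := by rw [mul_comm]; exact h5

/-- The densities of the sums satisfy the convolution recursion. -/
lemma integral_sumDensity (n : ℕ) {z : ℝ} (hz : (n : ℝ) + 2 < z) :
    ∫⁻ y in Ioo ((n : ℝ) + 1) (z - 1),
      ENNReal.ofReal (Real.exp (1 - (z - y))) * ENNReal.ofReal (sumDensity n y) =
      ENNReal.ofReal (sumDensity (n + 1) z) := by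
  have hle : (n : ℝ) + 1 ≤ z - 1 := by linarith
  have h1 : ∀ y ∈ Ioo ((n : ℝ) + 1) (z - 1),
      ENNReal.ofReal (Real.exp (1 - (z - y))) * ENNReal.ofReal (sumDensity n y) =
        ENNReal.ofReal (Real.exp (n + 2 - z) * (y - (n + 1)) ^ n / n.factorial) := by
    intro y hy
    rw [← ENNReal.ofReal_mul (Real.exp_pos _).le, sumDensity, ← mul_div_assoc, ← mul_assoc,
      ← Real.exp_add]
    congr 4; ring
  rw [setLIntegral_congr_fun measurableSet_Ioo h1, ← ofReal_integral_eq_lintegral_ofReal]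
  · congr 1
    rw [← integral_Ioc_eq_integral_Ioo, ← intervalIntegral.integral_of_le hle]
    simp_rw [mul_div_assoc]
    rw [intervalIntegral.integral_const_mul, intervalIntegral.integral_div,
      intervalIntegral.integral_comp_sub_right (fun y => y ^ n), integral_pow, sumDensity]
    push_cast
    rw [Nat.factorial_succ]
    have h2 : (n : ℝ) + 1 + 1 - z = n + 2 - z := by ring
    have h3 : z - 1 - ((n : ℝ) + 1) = z - (n + 1 + 1) := by ring
    rw [h2, h3, sub_self, zero_pow (by omega)]
    push_cast
    field_simp
    ring
  · exact (Continuous.integrableOn_Icc (by fun_prop)).mono_set Ioo_subset_Icc_self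
  · refine (ae_restrict_iff' measurableSet_Ioo).2 (Filter.Eventually.of_forall fun y hy => ?_)
    have : 0 ≤ y - (n + 1) := by linarith [hy.1]
    simp only [Pi.zero_apply]
    positivity

section
set_option linter.unusedSectionVars false
variable {ι Y : Type*} [DecidableEq ι] [MeasurableSpace Y]
variable (ν : ι → Measure ℝ) [∀ c, IsProbabilityMeasure (ν c)] (ρ : Measure Y)
  [IsProbabilityMeasure ρ]

lemma measurable_sum_fst (S : Finset ι) :
    Measurable fun ω : ι → ℝ × Y => ∑ c ∈ S, (ω c).1 := by fun_prop

/-- The density of a sum of independent variables with density `exp (1 - x)` on `(1, ∞)`. -/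
lemma lintegral_sum_fst (n : ℕ) (S : Finset ι) (hS : S.card = n + 1)
    (hν : ∀ c ∈ S, ν c = (volume.restrict (Ioi 1)).withDensity
      fun x => ENNReal.ofReal (Real.exp (1 - x)))
    {f : ℝ → ℝ≥0∞} (hf : Measurable f) :
    ∫⁻ ω, f (∑ c ∈ S, (ω c).1) ∂pairLaw ν ρ =
      ∫⁻ x in Ioi ((n : ℝ) + 1), f x * ENNReal.ofReal (sumDensity n x) := by
  have hone : ∀ c ∈ S, ∀ g : ℝ → ℝ≥0∞, Measurable g → ∫⁻ x, g x ∂ν c =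
      ∫⁻ x in Ioi 1, ENNReal.ofReal (Real.exp (1 - x)) * g x := by
    intro c hc g hg
    rw [hν c hc, lintegral_withDensity_eq_lintegral_mul _ (by fun_prop) hg]
    rfl
  induction n generalizing S f with
  | zero =>
    obtain ⟨b, rfl⟩ := Finset.card_eq_one.1 hS
    simp only [Finset.sum_singleton, CharP.cast_eq_zero, zero_add]
    rw [← lintegral_update_fst ν ρ b (f := fun ω => f (ω b).1) (by fun_prop)]
    simp only [Function.update_self, lintegral_const, measure_univ, mul_one]
    rw [hone b (by simp) f hf]
    refine lintegral_congr fun x => ?_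
    rw [mul_comm]; simp [sumDensity]
  | succ n ih =>
    obtain ⟨b, S', hb, rfl, hS'⟩ := Finset.card_eq_succ.1 hS
    have hb0 := hone b (by simp)
    have ih' := fun (g : ℝ → ℝ≥0∞) (hg : Measurable g) => ih S' hS'
      (fun c hc => hν c (by simp [hc])) hg (fun c hc => hone c (by simp [hc]))
    simp only [Finset.sum_insert hb]
    have hm : Measurable fun ω : ι → ℝ × Y => f ((ω b).1 + ∑ c ∈ S', (ω c).1) := by fun_prop
    rw [← lintegral_update_fst ν ρ b hm]
    have hup : ∀ (ω : ι → ℝ × Y) x, (Function.update ω b (x, (ω b).2) b).1 +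
        ∑ c ∈ S', (Function.update ω b (x, (ω b).2) c).1 = x + ∑ c ∈ S', (ω c).1 := by
      intro ω x
      rw [Function.update_self]
      congr 1
      refine Finset.sum_congr rfl fun c hc => ?_
      rw [Function.update_of_ne (fun h : c = b => hb (h ▸ hc))]
    simp only [hup]
    rw [lintegral_lintegral_swap]
    swap
    · exact (hf.comp (measurable_snd.add ((measurable_sum_fst S').comp
        measurable_fst))).aemeasurable
    have hinner : ∀ x : ℝ, ∫⁻ ω, f (x + ∑ c ∈ S', (ω c).1) ∂pairLaw ν ρ =
        ∫⁻ y in Ioi ((n : ℝ) + 1), f (x + y) * ENNReal.ofReal (sumDensity n y) := fun x =>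
      ih' (fun y => f (x + y)) (by fun_prop)
    simp only [hinner]
    rw [hb0]
    swap
    · exact Measurable.lintegral_prod_right' (f := fun z : ℝ × ℝ =>
        f (z.1 + z.2) * ENNReal.ofReal (sumDensity n z.2)) (by fun_prop)
    -- the pairs of the values of the single variable and of the sum
    set F : ℝ → ℝ → ℝ≥0∞ := fun y z => (Ioi ((n : ℝ) + 1)).indicator (fun _ => 1) y *
      (Ioi (y + 1)).indicator (fun _ => 1) z * (f z * (ENNReal.ofReal (Real.exp (1 - (z - y))) *
        ENNReal.ofReal (sumDensity n y))) with hF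
    have hFm : Measurable (Function.uncurry F) := by
      have h1 : Measurable fun p : ℝ × ℝ => (Ioi ((n : ℝ) + 1)).indicator (fun _ => (1 : ℝ≥0∞)) p.1 :=
        (measurable_const.indicator measurableSet_Ioi).comp measurable_fst
      have h2 : Measurable fun p : ℝ × ℝ =>
          (Ioi (p.1 + 1)).indicator (fun _ => (1 : ℝ≥0∞)) p.2 := by
        have : (fun p : ℝ × ℝ => (Ioi (p.1 + 1)).indicator (fun _ => (1 : ℝ≥0∞)) p.2) =
            {p : ℝ × ℝ | p.1 + 1 < p.2}.indicator fun _ => 1 := by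
          ext p; simp [indicator]
        rw [this]
        exact measurable_const.indicator (measurableSet_lt (by fun_prop) (by fun_prop))
      exact (h1.mul h2).mul (by fun_prop)
    have hleft : ∫⁻ x in Ioi (1 : ℝ), ENNReal.ofReal (Real.exp (1 - x)) *
        ∫⁻ y in Ioi ((n : ℝ) + 1), f (x + y) * ENNReal.ofReal (sumDensity n y) =
        ∫⁻ y, ∫⁻ z, F y z := by
      calc _ = ∫⁻ x in Ioi (1 : ℝ), ∫⁻ y in Ioi ((n : ℝ) + 1), ENNReal.ofReal (Real.exp (1 - x)) *
            (f (x + y) * ENNReal.ofReal (sumDensity n y)) := by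
            refine lintegral_congr fun x => ?_
            rw [lintegral_const_mul]; fun_prop
        _ = ∫⁻ y in Ioi ((n : ℝ) + 1), ∫⁻ x in Ioi (1 : ℝ), ENNReal.ofReal (Real.exp (1 - x)) *
            (f (x + y) * ENNReal.ofReal (sumDensity n y)) := by
            rw [lintegral_lintegral_swap]
            fun_prop
        _ = ∫⁻ y, ∫⁻ z, F y z := by
            rw [← lintegral_indicator measurableSet_Ioi]
            refine lintegral_congr fun y => ?_
            by_cases hy : y ∈ Ioi ((n : ℝ) + 1)
            · rw [indicator_of_mem hy, ← lintegral_indicator measurableSet_Ioi,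
                ← lintegral_sub_right_eq_self _ y]
              refine lintegral_congr fun z => ?_
              simp only [hF, indicator_of_mem hy, one_mul]
              by_cases hz : z - y ∈ Ioi (1 : ℝ)
              · have hz' : z ∈ Ioi (y + 1) := by simp only [mem_Ioi] at hz ⊢; linarith
                rw [indicator_of_mem hz, indicator_of_mem hz', sub_add_cancel, one_mul]
                ring
              · have hz' : z ∉ Ioi (y + 1) := by simp only [mem_Ioi] at hz ⊢; linarith
                rw [indicator_of_notMem hz, indicator_of_notMem hz', zero_mul]
            · rw [indicator_of_notMem hy]; simp [hF, indicator_of_notMem hy]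
    rw [hleft, lintegral_lintegral_swap hFm.aemeasurable, ← lintegral_indicator measurableSet_Ioi]
    refine lintegral_congr fun z => ?_
    have hFz : ∀ y, F y z = (Ioo ((n : ℝ) + 1) (z - 1)).indicator (fun y => f z *
        (ENNReal.ofReal (Real.exp (1 - (z - y))) * ENNReal.ofReal (sumDensity n y))) y := by
      intro y
      simp only [hF, indicator, mem_Ioi, mem_Ioo, lt_sub_iff_add_lt]
      split_ifs <;> simp_all
    simp only [hFz]
    rw [lintegral_indicator measurableSet_Ioo, lintegral_const_mul _ (by fun_prop)]
    push_cast
    by_cases hz : (n : ℝ) + 2 < z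
    · rw [integral_sumDensity n hz, indicator_of_mem]
      simp only [mem_Ioi]; linarith
    · rw [Ioo_eq_empty (by linarith), indicator_of_notMem]
      · simp
      · simp only [mem_Ioi]; linarith

/-- A sum of `N` of these variables is in a given interval of length `2 * d` with probability at
most `2 * d / √N`. -/
lemma measure_sum_fst_le (S : Finset ι) (hS : S.Nonempty)
    (hν : ∀ c ∈ S, ν c = (volume.restrict (Ioi 1)).withDensity
      fun x => ENNReal.ofReal (Real.exp (1 - x))) (x d : ℝ) :
    pairLaw ν ρ {ω | |∑ c ∈ S, (ω c).1 - x| ≤ d} ≤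
      ENNReal.ofReal (1 / Real.sqrt S.card) * ENNReal.ofReal (2 * d) := by
  obtain ⟨n, hn⟩ := Nat.exists_eq_succ_of_ne_zero hS.card_pos.ne'
  have hset : {ω : ι → ℝ × Y | |∑ c ∈ S, (ω c).1 - x| ≤ d} =
      (fun ω : ι → ℝ × Y => ∑ c ∈ S, (ω c).1) ⁻¹' Icc (x - d) (x + d) := by
    ext ω; simp only [Set.mem_ofPred_eq, mem_preimage, mem_Icc, abs_le]
    constructor <;> rintro ⟨h1, h2⟩ <;> constructor <;> linarith
  rw [hset, ← lintegral_indicator_one (measurable_sum_fst S measurableSet_Icc)]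
  have := lintegral_sum_fst ν ρ n S hn hν (f := (Icc (x - d) (x + d)).indicator 1)
    (measurable_one.indicator measurableSet_Icc)
  refine (le_of_eq this).trans ?_
  calc _ ≤ ∫⁻ y in Ioi ((n : ℝ) + 1), ENNReal.ofReal (1 / Real.sqrt S.card) *
        (Icc (x - d) (x + d)).indicator 1 y := by
        refine setLIntegral_mono' measurableSet_Ioi fun y hy => ?_
        rw [mul_comm, hn]
        push_cast
        exact mul_le_mul_left (ENNReal.ofReal_le_ofReal (sumDensity_le hy)) _
    _ ≤ ∫⁻ y, ENNReal.ofReal (1 / Real.sqrt S.card) * (Icc (x - d) (x + d)).indicator 1 y :=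
        setLIntegral_le_lintegral _ _
    _ = _ := by
        rw [lintegral_const_mul _ (measurable_one.indicator measurableSet_Icc),
          lintegral_indicator_one measurableSet_Icc, Real.volume_Icc]
        congr 2; ring

end

section
set_option linter.unusedSectionVars false
variable {ι Y : Type*} [DecidableEq ι] [MeasurableSpace Y]
variable (ν : ι → Measure ℝ) [∀ c, IsProbabilityMeasure (ν c)] (ρ : Measure Y)
  [IsProbabilityMeasure ρ]

lemma sum_mix_of_subset {S T : Finset ι} (h : T ⊆ S) (ω ω' : ι → ℝ × Y) :
    ∑ c ∈ T, (mix S ω ω' c).1 = ∑ c ∈ T, (ω' c).1 :=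
  Finset.sum_congr rfl fun _ hc => mix_apply_of_mem (h hc)

lemma sum_mix_of_disjoint {S T : Finset ι} (h : Disjoint T S) (ω ω' : ι → ℝ × Y) :
    ∑ c ∈ T, (mix S ω ω' c).1 = ∑ c ∈ T, (ω c).1 :=
  Finset.sum_congr rfl fun _ hc => by rw [mix_apply_of_notMem (Finset.disjoint_left.1 h hc)]

/-- Sums over three disjoint sets of indices are independent. -/
lemma measure_three_sums_le {S₀ S₁ S₂ : Finset ι} (h01 : Disjoint S₀ S₁) (h02 : Disjoint S₀ S₂)
    (h12 : Disjoint S₁ S₂) {d : ℝ} {q₀ q₁ q₂ : ℝ≥0∞}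
    (hq₀ : ∀ x, pairLaw ν ρ {ω | |∑ c ∈ S₀, (ω c).1 - x| ≤ d} ≤ q₀)
    (hq₁ : ∀ x, pairLaw ν ρ {ω | |∑ c ∈ S₁, (ω c).1 - x| ≤ d} ≤ q₁)
    (hq₂ : ∀ x, pairLaw ν ρ {ω | |∑ c ∈ S₂, (ω c).1 - x| ≤ d} ≤ q₂) (x₀ x₁ x₂ : ℝ) :
    pairLaw ν ρ ({ω | |∑ c ∈ S₀, (ω c).1 - x₀| ≤ d} ∩ ({ω | |∑ c ∈ S₁, (ω c).1 - x₁| ≤ d} ∩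
      {ω | |∑ c ∈ S₂, (ω c).1 - x₂| ≤ d})) ≤ q₀ * q₁ * q₂ := by
  have hm : ∀ (S : Finset ι) x, MeasurableSet {ω : ι → ℝ × Y | |∑ c ∈ S, (ω c).1 - x| ≤ d} :=
    fun S x => measurableSet_le (((measurable_sum_fst S).sub_const x).abs) measurable_const
  rw [measure_inter_of_mix ν ρ (S₁ ∪ S₂) (hm _ _) ((hm _ _).inter (hm _ _)),
    measure_inter_of_mix ν ρ S₂ (hm _ _) (hm _ _), mul_assoc]
  · gcongr
    · exact hq₀ _
    · exact hq₁ _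
    · exact hq₂ _
  · intro ω ω'
    simp only [Set.mem_ofPred_eq, sum_mix_of_disjoint h12]
  · intro ω ω'
    simp only [Set.mem_ofPred_eq, sum_mix_of_subset le_rfl]
  · intro ω ω'
    simp only [Set.mem_ofPred_eq,
      sum_mix_of_disjoint (Finset.disjoint_union_right.2 ⟨h01, h02⟩)]
  · intro ω ω'
    simp only [mem_inter_iff, Set.mem_ofPred_eq, sum_mix_of_subset Finset.subset_union_left,
      sum_mix_of_subset Finset.subset_union_right]

/-- The analogue of `measure_le_of_determined` for three sums of flight times. -/
lemma measure_le_of_sums_determined {C : ℝ≥0∞} (hν : ExpBound ν C) {d : ℝ}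
    {S₀ S₁ S₂ K : Finset ι} (h01 : Disjoint S₀ S₁) (h02 : Disjoint S₀ S₂)
    (h12 : Disjoint S₁ S₂) (hK : Disjoint K (S₀ ∪ (S₁ ∪ S₂))) {s : ι → ℝ} (hs : ∀ c, 0 ≤ s c)
    {q₀ q₁ q₂ : ℝ≥0∞}
    (hq₀ : ∀ x, pairLaw ν ρ {ω | |∑ c ∈ S₀, (ω c).1 - x| ≤ d} ≤ q₀)
    (hq₁ : ∀ x, pairLaw ν ρ {ω | |∑ c ∈ S₁, (ω c).1 - x| ≤ d} ≤ q₁)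
    (hq₂ : ∀ x, pairLaw ν ρ {ω | |∑ c ∈ S₂, (ω c).1 - x| ≤ d} ≤ q₂)
    {E W : Set (ι → ℝ × Y)} (hE : MeasurableSet E) (hW : MeasurableSet W) (hEW : E ⊆ W)
    (hWK : ∀ ω ω', mix K ω ω' ∈ W ↔ ω ∈ W)
    (hWS : ∀ ω ω', mix (S₀ ∪ (S₁ ∪ S₂)) ω ω' ∈ W ↔ ω ∈ W)
    (htail : ∀ ω ∈ E, ∀ c ∈ K, s c ≤ (ω c).1)
    (hdet : ∀ ω ∈ E, ∀ ω' ∈ E, (∀ c, (ω c).2 = (ω' c).2 ∧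
        (c ∉ S₀ ∪ (S₁ ∪ S₂) → (ω c).1 = (ω' c).1)) →
      |∑ c ∈ S₀, (ω c).1 - ∑ c ∈ S₀, (ω' c).1| ≤ d ∧
      |∑ c ∈ S₁, (ω c).1 - ∑ c ∈ S₁, (ω' c).1| ≤ d ∧
      |∑ c ∈ S₂, (ω c).1 - ∑ c ∈ S₂, (ω' c).1| ≤ d) :
    pairLaw ν ρ E ≤ q₀ * q₁ * q₂ * ((∏ c ∈ K, C * ENNReal.ofReal (Real.exp (-s c))) *
      pairLaw ν ρ W) := by
  set S := S₀ ∪ (S₁ ∪ S₂) with hSdef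
  have hH : MeasurableSet {ω : ι → ℝ × Y | ∀ c ∈ K, (ω c).1 ∈ Ici (s c)} :=
    measurableSet_fst_mem _ fun c => measurableSet_Ici
  have h1 : pairLaw ν ρ E ≤ (q₀ * q₁ * q₂) *
      pairLaw ν ρ (W ∩ {ω | ∀ c ∈ K, (ω c).1 ∈ Ici (s c)}) := by
    refine measure_le_of_fiber ν ρ S hE (hW.inter hH) (fun ω ω' h => ⟨?_, ?_⟩) fun ω => ?_
    · rw [← hWS ω ω']; exact hEW h
    · intro c hc
      have := htail _ h c hc
      rwa [mix_apply_of_notMem (Finset.disjoint_left.1 hK hc)] at this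
    · rcases eq_empty_or_nonempty {ω' | mix S ω ω' ∈ E} with h0 | ⟨ω₀, h0⟩
      · rw [h0, measure_empty]; exact zero_le
      · refine (measure_mono ?_).trans (measure_three_sums_le ν ρ h01 h02 h12 hq₀ hq₁ hq₂
          (∑ c ∈ S₀, (ω₀ c).1) (∑ c ∈ S₁, (ω₀ c).1) (∑ c ∈ S₂, (ω₀ c).1))
        intro ω' h'
        have := hdet _ h' _ h0 (fun c => ⟨rfl, fun hc' => by
            rw [mix_apply_of_notMem hc', mix_apply_of_notMem hc']⟩)
        have e0 : S₀ ⊆ S := Finset.subset_union_left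
        have e1 : S₁ ⊆ S := Finset.subset_union_left.trans Finset.subset_union_right
        have e2 : S₂ ⊆ S := Finset.subset_union_right.trans Finset.subset_union_right
        simp only [sum_mix_of_subset e0, sum_mix_of_subset e1, sum_mix_of_subset e2] at this
        exact this
  refine h1.trans (mul_le_mul_right ?_ _)
  rw [measure_inter_of_mix ν ρ K hW hH hWK, measure_fst_mem ν ρ _ fun _ => measurableSet_Ici,
    mul_comm]
  · exact mul_le_mul_left (Finset.prod_le_prod' fun c _ => hν.1 c (s c) (hs c)) _
  · intro ω ω'
    simp only [Set.mem_ofPred_eq]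
    refine forall₂_congr fun c hc => ?_
    rw [mix_apply_of_mem hc]

end

section blocks
set_option linter.unusedSectionVars false
variable {ι X β : Type*} [DecidableEq ι] [MeasurableSpace X]
  (μ : ι → Measure X) [∀ c, IsProbabilityMeasure (μ c)]

lemma measurableSet_forall_mem (J : Finset ι) {D : ι → Set X} (hD : ∀ c, MeasurableSet (D c)) :
    MeasurableSet {ω : ι → X | ∀ c ∈ J, ω c ∈ D c} :=
  MeasurableSet.pi (s := (J : Set ι)) J.countable_toSet fun c _ => hD c

lemma measurableSet_fails (B : Finset β) (I : β → Finset ι) {A : ι → Set X}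
    (hA : ∀ c, MeasurableSet (A c)) :
    MeasurableSet {ω : ι → X | ∀ b ∈ B, ¬ ∀ c ∈ I b, ω c ∈ A c} := by
  have : {ω : ι → X | ∀ b ∈ B, ¬ ∀ c ∈ I b, ω c ∈ A c} =
      ⋂ b ∈ B, {ω : ι → X | ∀ c ∈ I b, ω c ∈ A c}ᶜ := by ext; simp
  rw [this]
  exact Finset.measurableSet_biInter _ fun b _ => (measurableSet_forall_mem _ hA).compl

/-- The probability that none of some disjoint blocks of coordinates is as prescribed, and that
some coordinates outside of the blocks are in given sets. -/
lemma measure_fails (B : Finset β) (I : β → Finset ι)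
    (hI : ∀ b ∈ B, ∀ b' ∈ B, b ≠ b' → Disjoint (I b) (I b')) {A : ι → Set X}
    (hA : ∀ c, MeasurableSet (A c)) (J : Finset ι) {D : ι → Set X}
    (hD : ∀ c, MeasurableSet (D c)) (hJ : ∀ b ∈ B, Disjoint J (I b)) :
    Measure.infinitePi μ ({ω | ∀ c ∈ J, ω c ∈ D c} ∩ {ω | ∀ b ∈ B, ¬ ∀ c ∈ I b, ω c ∈ A c}) =
      (∏ c ∈ J, μ c (D c)) * ∏ b ∈ B, (1 - ∏ c ∈ I b, μ c (A c)) := by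
  classical
  induction B using Finset.induction_on generalizing J D with
  | empty =>
    simp only [Finset.notMem_empty, false_implies, implies_true, Finset.prod_empty, mul_one]
    rw [show {ω : ι → X | True} = univ from rfl, inter_univ]
    exact Measure.infinitePi_pi μ fun c _ => hD c
  | insert b B hb ih =>
    have hI' : ∀ b ∈ B, ∀ b' ∈ B, b ≠ b' → Disjoint (I b) (I b') := fun x hx y hy =>
      hI x (Finset.mem_insert_of_mem hx) y (Finset.mem_insert_of_mem hy)
    set X₀ := {ω : ι → X | ∀ c ∈ J, ω c ∈ D c} ∩ {ω | ∀ b ∈ B, ¬ ∀ c ∈ I b, ω c ∈ A c} with hX₀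
    set G := {ω : ι → X | ∀ c ∈ I b, ω c ∈ A c} with hG
    have hGm : MeasurableSet G := measurableSet_forall_mem _ hA
    have h1 : {ω : ι → X | ∀ c ∈ J, ω c ∈ D c} ∩
        {ω | ∀ b' ∈ insert b B, ¬ ∀ c ∈ I b', ω c ∈ A c} = X₀ \ G := by
      ext ω
      simp only [hX₀, hG, mem_inter_iff, Set.mem_ofPred_eq, Finset.mem_insert, forall_eq_or_imp,
        mem_sdiff]
      tauto
    have hJb : Disjoint J (I b) := hJ b (Finset.mem_insert_self _ _)
    have h2 : X₀ ∩ G = {ω : ι → X | ∀ c ∈ J ∪ I b, ω c ∈ if c ∈ J then D c else A c} ∩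
        {ω | ∀ b ∈ B, ¬ ∀ c ∈ I b, ω c ∈ A c} := by
      ext ω
      simp only [hX₀, hG, mem_inter_iff, Set.mem_ofPred_eq, Finset.mem_union]
      constructor
      · rintro ⟨⟨h3, h4⟩, h5⟩
        refine ⟨fun c hc => ?_, h4⟩
        split_ifs with hcJ
        · exact h3 c hcJ
        · exact h5 c (hc.resolve_left hcJ)
      · rintro ⟨h3, h4⟩
        refine ⟨⟨fun c hc => ?_, h4⟩, fun c hc => ?_⟩
        · have := h3 c (Or.inl hc); rwa [if_pos hc] at this
        · have := h3 c (Or.inr hc)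
          rwa [if_neg (Finset.disjoint_right.1 hJb hc)] at this
    have h3 := ih hI' J hD fun x hx => hJ x (Finset.mem_insert_of_mem hx)
    have h4 := ih hI' (J ∪ I b) (D := fun c => if c ∈ J then D c else A c)
      (fun c => by split_ifs; exacts [hD c, hA c])
      (fun x hx => Finset.disjoint_union_left.2 ⟨hJ x (Finset.mem_insert_of_mem hx),
        hI b (Finset.mem_insert_self _ _) x (Finset.mem_insert_of_mem hx) fun h => hb (h ▸ hx)⟩)
    have h5 : ∏ c ∈ J ∪ I b, μ c (if c ∈ J then D c else A c) =
        (∏ c ∈ J, μ c (D c)) * ∏ c ∈ I b, μ c (A c) := by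
      rw [Finset.prod_union hJb]
      congr 1
      · exact Finset.prod_congr rfl fun c hc => by rw [if_pos hc]
      · exact Finset.prod_congr rfl fun c hc => by rw [if_neg (Finset.disjoint_right.1 hJb hc)]
    have h6 : Measure.infinitePi μ (X₀ \ G) =
        Measure.infinitePi μ X₀ - Measure.infinitePi μ (X₀ ∩ G) :=
      ENNReal.eq_sub_of_add_eq (measure_ne_top _ _)
        (by rw [add_comm]; exact measure_inter_add_sdiff X₀ hGm)
    rw [h1, h6, h2, h4, h3, h5, Finset.prod_insert hb]
    have hle : ∏ b ∈ B, (1 - ∏ c ∈ I b, μ c (A c)) ≤ 1 :=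
      Finset.prod_le_one' fun b _ => tsub_le_self
    have hle' : ∏ c ∈ J, μ c (D c) ≤ 1 := Finset.prod_le_one' fun c _ => prob_le_one
    rw [mul_left_comm, ENNReal.sub_mul, one_mul]
    · congr 1; ring
    · intro _ _
      exact ((mul_le_mul' hle' hle).trans_lt (by simp)).ne

end blocks

/-! ### The laws of a leg and of the sequence of legs as product measures -/

/-- Conditioning a product measure on a finite number of coordinates gives a product measure. -/
lemma infinitePi_cond {X : Type*} [MeasurableSpace X] (μ : ℕ → Measure X)
    [∀ c, IsProbabilityMeasure (μ c)] (F : Finset ℕ) (e : ℕ → Set X)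
    (he : ∀ c, MeasurableSet (e c)) (hF : ∀ c ∉ F, e c = univ) (h0 : ∀ c, μ c (e c) ≠ 0)
    [∀ c, IsProbabilityMeasure ((μ c)[|e c])] :
    (Measure.infinitePi μ)[|Set.pi F e] = Measure.infinitePi fun c => (μ c)[|e c] := by
  refine Measure.eq_infinitePi _ fun s t ht => ?_
  have hm : MeasurableSet (Set.pi (F : Set ℕ) e) := MeasurableSet.pi F.countable_toSet fun c _ => he c
  rw [cond_apply hm]
  set t' : ℕ → Set X := fun c => if c ∈ s then t c else univ with ht'
  have ht'm : ∀ c, MeasurableSet (t' c) := fun c => by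
    simp only [ht']; split_ifs; exacts [ht c, MeasurableSet.univ]
  have h1 : Set.pi (F : Set ℕ) e ∩ Set.pi (s : Set ℕ) t =
      Set.pi (F ∪ s : Finset ℕ) fun c => e c ∩ t' c := by
    ext x
    simp only [mem_inter_iff, Set.mem_pi, Finset.mem_coe, Finset.mem_union, ht']
    constructor
    · rintro ⟨hx, hy⟩ c -
      refine ⟨?_, ?_⟩
      · by_cases hc : c ∈ F
        · exact hx c hc
        · rw [hF c hc]; trivial
      · split_ifs with hc
        · exact hy c hc
        · trivial
    · intro hx
      refine ⟨fun c hc => (hx c (Or.inl hc)).1, fun c hc => ?_⟩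
      have := (hx c (Or.inr hc)).2
      rwa [if_pos hc] at this
  have h2 : Set.pi (F : Set ℕ) e = Set.pi (F ∪ s : Finset ℕ) e := by
    ext x
    simp only [Set.mem_pi, Finset.mem_coe, Finset.mem_union]
    refine ⟨fun hx c _ => ?_, fun hx c hc => hx c (Or.inl hc)⟩
    by_cases hc : c ∈ F
    · exact hx c hc
    · rw [hF c hc]; trivial
  have h3 : ∏ c ∈ s, (μ c)[|e c] (t c) = ∏ c ∈ F ∪ s, (μ c)[|e c] (t' c) := by
    rw [← Finset.prod_subset (Finset.subset_union_right (s₁ := F))]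
    · exact Finset.prod_congr rfl fun c hc => by simp [ht', hc]
    · intro c _ hc; simp [ht', hc]
  rw [h1, h2, h3, Measure.infinitePi_pi _ fun c _ => he c,
    Measure.infinitePi_pi _ fun c _ => (he c).inter (ht'm c)]
  simp only [cond_apply (he _)]
  rw [Finset.prod_mul_distrib, ENNReal.prod_inv_distrib]
  intro c _ d _ _
  exact Or.inl (h0 c)

/-- The set to which the flight time of index `l` in a leg is restricted. -/
def flightRange (l : ℕ) : Set ℝ := if l = 1 ∨ l = 2 then Ioi 1 else univ

/-- The law of the flight time of index `l` in a leg. -/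
def flightLaw (l : ℕ) : Measure ℝ := (expMeasure 1)[|flightRange l]

/-- The law of the index and of the point that selects the impact parameter. -/
def markLaw (p : Fin 3 → ℝ) : Measure (Fin 3 × (Fin 3 → ℝ)) := (indexLaw p).prod unitCubeLaw

instance : IsProbabilityMeasure (expMeasure 1) := isProbabilityMeasure_expMeasure one_pos

instance : IsProbabilityMeasure unitCubeLaw := by
  have h : IsProbabilityMeasure ((volume : Measure ℝ).restrict (Icc (-(1 / 2)) (1 / 2))) := ⟨by
    rw [Measure.restrict_apply_univ, Real.volume_Icc]; norm_num⟩
  unfold unitCubeLaw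
  infer_instance

lemma measurableSet_flightRange (l : ℕ) : MeasurableSet (flightRange l) := by
  unfold flightRange; split_ifs; exacts [measurableSet_Ioi, MeasurableSet.univ]

lemma expMeasure_Ioi_one : expMeasure 1 (Ioi 1) = ENNReal.ofReal (Real.exp (-1)) := by
  have h := prob_compl_eq_one_sub (μ := expMeasure 1) (measurableSet_Iic (a := (1 : ℝ)))
  rw [compl_Iic] at h
  rw [h, ← ofReal_cdf, cdf_expMeasure_eq one_pos]
  simp only [zero_le_one, if_true, mul_one]
  rw [ENNReal.ofReal_sub _ (Real.exp_pos _).le, ENNReal.ofReal_one]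
  refine ENNReal.sub_sub_cancel ENNReal.one_ne_top ?_
  rw [ENNReal.ofReal_le_one]
  exact Real.exp_le_one_iff.2 (by norm_num)

lemma expMeasure_flightRange_ne_zero (l : ℕ) : expMeasure 1 (flightRange l) ≠ 0 := by
  unfold flightRange; split_ifs
  · rw [expMeasure_Ioi_one]; simp [Real.exp_pos]
  · simp

instance (l : ℕ) : IsProbabilityMeasure (flightLaw l) :=
  cond_isProbabilityMeasure (expMeasure_flightRange_ne_zero l)

lemma cond_prod_univ {X Y : Type*} [MeasurableSpace X] [MeasurableSpace Y] (ν : Measure X)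
    (ρ : Measure Y) [IsProbabilityMeasure ν] [IsProbabilityMeasure ρ] (A : Set X) :
    (ν.prod ρ)[|A ×ˢ univ] = (ν[|A]).prod ρ := by
  rw [ProbabilityTheory.cond, ProbabilityTheory.cond, Measure.prod_prod, measure_univ, mul_one,
    Measure.prod_smul_left, ← Measure.prod_restrict, Measure.restrict_univ]

lemma isProbabilityMeasure_markLaw {p : Fin 3 → ℝ} (hp : IsProbVec p) :
    IsProbabilityMeasure (markLaw p) := by
  have h2 : IsProbabilityMeasure (indexLaw p) := ⟨by
    simp only [indexLaw, Measure.coe_finsetSum, Finset.sum_apply, Measure.smul_apply,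
      measure_univ, smul_eq_mul, mul_one]
    rw [← ENNReal.ofReal_sum_of_nonneg fun i _ => (hp.1 i).le, hp.2, ENNReal.ofReal_one]⟩
  have h3 : IsProbabilityMeasure ((volume : Measure ℝ).restrict (Icc (-(1 / 2)) (1 / 2))) := ⟨by
    rw [Measure.restrict_apply_univ, Real.volume_Icc]; norm_num⟩
  unfold markLaw unitCubeLaw
  infer_instance

/-- The data of a leg are independent. -/
lemma legLaw_eq {p : Fin 3 → ℝ} (hp : IsProbVec p) : legLaw p = pairLaw flightLaw (markLaw p) := by
  have := isProbabilityMeasure_attemptLaw hp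
  have := isProbabilityMeasure_markLaw hp
  have hset : {ω : ℕ → Attempt | 1 < flightTime ω 1 ∧ 1 < flightTime ω 2} =
      Set.pi (({1, 2} : Finset ℕ) : Set ℕ) fun l => flightRange l ×ˢ univ := by
    ext ω; simp [flightTime, Set.pi, flightRange]
  have heq : ∀ l, (attemptLaw p)[|flightRange l ×ˢ univ] = (flightLaw l).prod (markLaw p) :=
    fun l => cond_prod_univ (expMeasure 1) (markLaw p) _
  have hpr : ∀ l, IsProbabilityMeasure ((attemptLaw p)[|flightRange l ×ˢ univ]) := fun l => by
    rw [heq]; infer_instance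
  rw [legLaw, hset, infinitePi_cond (fun _ => attemptLaw p) {1, 2}]
  · simp only [heq]
  · exact fun l => (measurableSet_flightRange l).prod MeasurableSet.univ
  · intro l hl
    have : ¬ (l = 1 ∨ l = 2) := by simpa using hl
    simp [flightRange, this]
  · intro l
    change (expMeasure 1).prod (markLaw p) _ ≠ 0
    rw [Measure.prod_prod, measure_univ, mul_one]
    exact expMeasure_flightRange_ne_zero l

/-- The law of the data of all legs, indexed by the leg and the attempt. -/
def gridLaw (p : Fin 3 → ℝ) [IsProbabilityMeasure (markLaw p)] : Measure (ℕ × ℕ → Attempt) :=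
  pairLaw (fun c : ℕ × ℕ => flightLaw c.2) (markLaw p)

lemma processLaw_eq {p : Fin 3 → ℝ} (hp : IsProbVec p) [IsProbabilityMeasure (markLaw p)] :
    processLaw p = (gridLaw p).map (MeasurableEquiv.curry ℕ ℕ Attempt) := by
  have := isProbabilityMeasure_legLaw hp
  have h := Measure.infinitePi_map_curry (ι := ℕ) (κ := ℕ) (X := Attempt)
    (fun _ l => (flightLaw l).prod (markLaw p))
  rw [gridLaw, pairLaw, h, processLaw]
  simp only [legLaw_eq hp]

lemma expMeasure_eq : expMeasure 1 =
    (volume.restrict (Ici 0)).withDensity fun x => ENNReal.ofReal (Real.exp (-x)) := by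
  rw [expMeasure, gammaMeasure, ← withDensity_indicator measurableSet_Ici]
  congr 1
  funext x
  simp only [gammaPDF_eq, indicator, mem_Ici]
  split_ifs <;> simp

lemma flightLaw_le (l : ℕ) (A : Set ℝ) :
    flightLaw l A ≤ ENNReal.ofReal (Real.exp 1) * expMeasure 1 A := by
  rw [flightLaw, cond_apply (measurableSet_flightRange l)]
  refine mul_le_mul' ?_ (measure_mono inter_subset_right)
  unfold flightRange; split_ifs
  · rw [expMeasure_Ioi_one, ← ENNReal.ofReal_inv_of_pos (Real.exp_pos _), ← Real.exp_neg, neg_neg]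
  · rw [measure_univ, inv_one, ← ENNReal.ofReal_one]
    exact ENNReal.ofReal_le_ofReal (Real.one_le_exp (by norm_num))

/-- The conditioning of the first two flight times costs a factor `exp 1`. -/
lemma expBound_flightLaw :
    ExpBound (fun c : ℕ × ℕ => flightLaw c.2) (ENNReal.ofReal (Real.exp 1)) := by
  constructor
  · intro c s hs
    refine (flightLaw_le _ _).trans (mul_le_mul_right ?_ _)
    rw [expMeasure_eq, withDensity_apply _ measurableSet_Ici, Measure.restrict_restrict
      measurableSet_Ici, inter_eq_left.2 (Ici_subset_Ici.2 hs),
      ← ofReal_integral_eq_lintegral_ofReal]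
    · rw [integral_Ici_eq_integral_Ioi, integral_exp_neg_Ioi]
    · exact (integrableOn_Ici_iff_integrableOn_Ioi (by simp)).2 (integrableOn_exp_neg_Ioi s)
    · exact Filter.Eventually.of_forall fun x => (Real.exp_pos _).le
  · intro c s l hs x
    refine (flightLaw_le _ _).trans ?_
    rw [mul_assoc]
    refine mul_le_mul_right ?_ _
    have hm : MeasurableSet (Ici s ∩ Icc x (x + l)) := measurableSet_Ici.inter measurableSet_Icc
    rw [expMeasure_eq, withDensity_apply _ hm, Measure.restrict_restrict hm]
    calc _ ≤ ∫⁻ _ in Ici s ∩ Icc x (x + l) ∩ Ici 0, ENNReal.ofReal (Real.exp (-s)) := by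
          refine setLIntegral_mono' (hm.inter measurableSet_Ici) fun y hy => ?_
          exact ENNReal.ofReal_le_ofReal (Real.exp_le_exp.2 (neg_le_neg hy.1.1))
      _ ≤ _ := by
          rw [setLIntegral_const]
          refine mul_le_mul_right ?_ _
          refine (measure_mono (inter_subset_left.trans inter_subset_right)).trans ?_
          rw [Real.volume_Icc, add_sub_cancel_left]

/-- The first two flight times of a leg are greater than `1` by an exponential time. -/
lemma flightLaw_eq_withDensity {l : ℕ} (hl : l = 1 ∨ l = 2) : flightLaw l =
    (volume.restrict (Ioi 1)).withDensity fun x => ENNReal.ofReal (Real.exp (1 - x)) := by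
  rw [flightLaw, flightRange, if_pos hl, ProbabilityTheory.cond, expMeasure_Ioi_one,
    ← ENNReal.ofReal_inv_of_pos (Real.exp_pos _), ← Real.exp_neg, neg_neg, expMeasure_eq,
    restrict_withDensity measurableSet_Ioi, Measure.restrict_restrict measurableSet_Ioi,
    inter_eq_left.2 (Ioi_subset_Ici zero_le_one), ← withDensity_smul _ (by fun_prop)]
  congr 1
  funext x
  rw [Pi.smul_apply, smul_eq_mul, ← ENNReal.ofReal_mul (Real.exp_pos _).le, ← Real.exp_add]
  congr 2

/-! ### Measurability of the flight and of the states -/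

section flight
variable {Ω : Type*} [MeasurableSpace Ω] {r : ℝ}

/-- A random set of at most two centres, each a measurable point that is present on a measurable
event. -/
structure MeasCentres (S : Ω → Set Pt) (P : Fin 2 → Set Ω) (C : Fin 2 → Ω → Pt) : Prop where
  pres : ∀ j, MeasurableSet (P j)
  point : ∀ j, Measurable (C j)
  mem : ∀ ω c, c ∈ S ω ↔ ∃ j, ω ∈ P j ∧ c = C j ω

lemma MeasCentres.finite {S : Ω → Set Pt} {P C} (h : MeasCentres S P C) (ω : Ω) : (S ω).Finite := by
  refine (Set.finite_range fun j => C j ω).subset fun c hc => ?_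
  obtain ⟨j, -, rfl⟩ := (h.mem ω c).1 hc
  exact ⟨j, rfl⟩

lemma measurableSet_cube_mem {z : Ω → Pt} (hz : Measurable z) :
    MeasurableSet {ω | z ω ∈ cube r} := by
  have : {ω | z ω ∈ cube r} = ⋂ i, {ω | |z ω i| ≤ r / 2} := by ext ω; simp [cube]
  rw [this]
  exact MeasurableSet.iInter fun i => measurableSet_le (by fun_prop) measurable_const

lemma measurableSet_face_mem {z v : Ω → Pt} (hz : Measurable z) (hv : Measurable v) (i : Fin 3) :
    MeasurableSet {ω | z ω ∈ face r (v ω) i} :=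
  (measurableSet_cube_mem hz).inter (measurableSet_eq_fun (by fun_prop) (by fun_prop))

lemma MeasCentres.measurableSet_strikes {S : Ω → Set Pt} {P C} (h : MeasCentres S P C)
    {y v : Ω → Pt} (hy : Measurable y) (hv : Measurable v) (i : Fin 3) :
    MeasurableSet {ω | Strikes r (S ω) (y ω) (v ω) i} := by
  have : {ω | Strikes r (S ω) (y ω) (v ω) i} =
      ⋃ j, P j ∩ {ω | y ω - C j ω ∈ face r (v ω) i} := by
    ext ω
    simp only [Strikes, Set.mem_ofPred_eq, mem_iUnion, mem_inter_iff, h.mem]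
    constructor
    · rintro ⟨_, ⟨j, hj, rfl⟩, hf⟩; exact ⟨j, hj, hf⟩
    · rintro ⟨j, hj, hf⟩; exact ⟨_, ⟨j, hj, rfl⟩, hf⟩
  rw [this]
  exact MeasurableSet.iUnion fun j => (h.pres j).inter
    (measurableSet_face_mem (hy.sub (h.point j)) hv i)

/-- The time at which the free motion is on the plane of a face. -/
def faceTime (r : ℝ) (x v c : Pt) (i : Fin 3) : ℝ := (c i - v i / |v i| * (r / 2) - x i) / v i

/-- A hitting time is one of finitely many explicit functions of the data; this makes the flight
measurable. -/
lemma mem_hitTimes_iff {S : Ω → Set Pt} {P C} (h : MeasCentres S P C) (ω : Ω) {x v : Pt}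
    (hv : ∀ i, v i ≠ 0) (t : ℝ) : t ∈ hitTimes r (S ω) x v ↔
      ∃ j i, t = faceTime r x v (C j ω) i ∧ ω ∈ P j ∧ 0 ≤ faceTime r x v (C j ω) i ∧
        x + faceTime r x v (C j ω) i • v - C j ω ∈ face r v i := by
  constructor
  · rintro ⟨h0, i, c, hc, hf⟩
    obtain ⟨j, hj, rfl⟩ := (h.mem ω c).1 hc
    have ht : t = faceTime r x v (C j ω) i := by
      have := hf.2
      simp only [Pi.sub_apply, Pi.add_apply, Pi.smul_apply, smul_eq_mul] at this
      rw [faceTime, eq_div_iff (hv i)]; linarith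
    exact ⟨j, i, ht, hj, ht ▸ h0, ht ▸ hf⟩
  · rintro ⟨j, i, rfl, hj, h0, hf⟩
    exact ⟨h0, i, _, (h.mem ω _).2 ⟨j, hj, rfl⟩, hf⟩

lemma measurable_faceTime {x v c : Ω → Pt} (hx : Measurable x) (hv : Measurable v)
    (hc : Measurable c) (i : Fin 3) : Measurable fun ω => faceTime r (x ω) (v ω) (c ω) i := by
  unfold faceTime; fun_prop

lemma MeasCentres.measurableSet_hit {S : Ω → Set Pt} {P C} (h : MeasCentres S P C)
    {x v : Ω → Pt} (hx : Measurable x) (hv : Measurable v) (hv0 : ∀ ω i, v ω i ≠ 0)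
    {Q : Set (Ω × ℝ)} (hQ : MeasurableSet Q) :
    MeasurableSet {ω | ∃ t ∈ hitTimes r (S ω) (x ω) (v ω), (ω, t) ∈ Q} := by
  have hft := fun j i => measurable_faceTime (r := r) hx hv (h.point j) i
  have : {ω | ∃ t ∈ hitTimes r (S ω) (x ω) (v ω), (ω, t) ∈ Q} = ⋃ j, ⋃ i,
      P j ∩ ({ω | 0 ≤ faceTime r (x ω) (v ω) (C j ω) i} ∩
        ({ω | x ω + faceTime r (x ω) (v ω) (C j ω) i • v ω - C j ω ∈ face r (v ω) i} ∩
          {ω | (ω, faceTime r (x ω) (v ω) (C j ω) i) ∈ Q})) := by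
    ext ω
    simp only [Set.mem_ofPred_eq, mem_iUnion, mem_inter_iff, mem_hitTimes_iff h ω (hv0 ω)]
    constructor
    · rintro ⟨_, ⟨j, i, rfl, h1, h2, h3⟩, h4⟩; exact ⟨j, i, h1, h2, h3, h4⟩
    · rintro ⟨j, i, h1, h2, h3, h4⟩; exact ⟨_, ⟨j, i, rfl, h1, h2, h3⟩, h4⟩
  rw [this]
  refine MeasurableSet.iUnion fun j => MeasurableSet.iUnion fun i => (h.pres j).inter
    ((measurableSet_le measurable_const (hft j i)).inter ((measurableSet_face_mem ?_ hv i).inter ?_))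
  · exact (hx.add ((hft j i).smul hv)).sub (h.point j)
  · exact (measurable_id.prodMk (hft j i)) hQ

lemma MeasCentres.measurable_sInf {S : Ω → Set Pt} {P C} (h : MeasCentres S P C)
    {x v : Ω → Pt} (hx : Measurable x) (hv : Measurable v) (hv0 : ∀ ω i, v ω i ≠ 0) :
    Measurable fun ω => sInf (hitTimes r (S ω) (x ω) (v ω)) := by
  refine measurable_of_Iio fun a => ?_
  have : (fun ω => sInf (hitTimes r (S ω) (x ω) (v ω))) ⁻¹' Iio a =
      {ω | ∃ t ∈ hitTimes r (S ω) (x ω) (v ω), (ω, t) ∈ {z : Ω × ℝ | z.2 < a}} ∪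
      ({ω | ∃ t ∈ hitTimes r (S ω) (x ω) (v ω), (ω, t) ∈ (univ : Set (Ω × ℝ))}ᶜ ∩
        {_ω | 0 < a}) := by
    ext ω
    simp only [mem_preimage, mem_Iio, mem_union, Set.mem_ofPred_eq, mem_inter_iff, mem_compl_iff,
      mem_univ, and_true]
    rcases eq_empty_or_nonempty (hitTimes r (S ω) (x ω) (v ω)) with he | he
    · rw [he]; simp
    · have : ∃ t, t ∈ hitTimes r (S ω) (x ω) (v ω) := he
      simp only [this, not_true_eq_false, false_and, or_false]
      constructor
      · intro hlt; exact ⟨_, sInf_mem_hitTimes (h.finite ω) (hv0 ω) he, hlt⟩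
      · rintro ⟨t, ht, hlt⟩; exact (csInf_le (bddBelow_hitTimes _ _ _ _) ht).trans_lt hlt
  rw [this]
  refine (h.measurableSet_hit hx hv hv0 (measurableSet_lt measurable_snd measurable_const)).union
    ((h.measurableSet_hit hx hv hv0 MeasurableSet.univ).compl.inter ?_)
  exact MeasurableSet.const _

/-- A random phase all of whose components are measurable. -/
structure MeasPhase (q : Ω → Phase) : Prop where
  time : Measurable fun ω => (q ω).time
  pos : Measurable fun ω => (q ω).pos
  vel : Measurable fun ω => (q ω).vel

lemma MeasCentres.measPhase_impacts {S : Ω → Set Pt} {P C} (h : MeasCentres S P C)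
    {x v : Ω → Pt} (hx : Measurable x) (hv : Measurable v) (hv0 : ∀ ω i, v ω i ≠ 0) (n : ℕ) :
    MeasPhase fun ω => impacts r (S ω) (x ω) (v ω) n := by
  induction n with
  | zero => exact ⟨measurable_const, hx, hv⟩
  | succ n ih =>
    have hn0 : ∀ ω i, (impacts r (S ω) (x ω) (v ω) n).vel i ≠ 0 := fun ω =>
      (isVel_impacts r (S ω) (x ω) (v ω) n).ne_zero (hv0 ω)
    have hinf := h.measurable_sInf (r := r) ih.pos ih.vel hn0
    have hpos := ih.pos.add (hinf.smul ih.vel)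
    simp only [impacts_succ]
    refine ⟨ih.time.add hinf, hpos, measurable_pi_lambda _ fun i => ?_⟩
    refine Measurable.ite (h.measurableSet_strikes hpos ih.vel i) ?_ ?_
    · exact ((measurable_pi_apply i).comp ih.vel).neg
    · exact (measurable_pi_apply i).comp ih.vel

lemma measurable_nat_sInf {A : Ω → Set ℕ} (hA : ∀ n, MeasurableSet {ω | n ∈ A ω}) :
    Measurable fun ω => sInf (A ω) := by
  refine measurable_to_countable' fun n => ?_
  have : (fun ω => sInf (A ω)) ⁻¹' {n} = ({ω | n ∈ A ω} ∩ ⋂ m : Fin n, {ω | (m : ℕ) ∈ A ω}ᶜ) ∪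
      ((⋂ m, {ω | m ∈ A ω}ᶜ) ∩ {_ω | n = 0}) := by
    ext ω
    simp only [mem_preimage, mem_singleton_iff, mem_union, mem_inter_iff, Set.mem_ofPred_eq,
      mem_iInter, mem_compl_iff]
    constructor
    · intro hn
      rcases eq_empty_or_nonempty (A ω) with he | he
      · right; rw [he, Nat.sInf_empty] at hn; rw [he]; exact ⟨by simp, hn.symm⟩
      · left
        refine ⟨hn ▸ Nat.sInf_mem he, fun m => Nat.notMem_of_lt_sInf (hn ▸ m.2)⟩
    · rintro (⟨h1, h2⟩ | ⟨h1, rfl⟩)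
      · refine le_antisymm (Nat.sInf_le h1) ?_
        by_contra! hlt
        exact h2 ⟨_, hlt⟩ (Nat.sInf_mem ⟨n, h1⟩)
      · rw [eq_empty_of_forall_notMem h1, Nat.sInf_empty]
  rw [this]
  exact ((hA n).inter (MeasurableSet.iInter fun m : Fin n => (hA m).compl)).union
    ((MeasurableSet.iInter fun m => (hA m).compl).inter (MeasurableSet.const _))

lemma MeasPhase.of_nat {q : ℕ → Ω → Phase} (hq : ∀ n, MeasPhase (q n)) {N : Ω → ℕ}
    (hN : Measurable N) : MeasPhase fun ω => q (N ω) ω := by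
  have hid : Measurable fun ω => (ω, N ω) := measurable_id.prodMk hN
  have h1 : Measurable fun z : Ω × ℕ => (q z.2 z.1).time :=
    measurable_from_prod_countable_left fun n => (hq n).time
  have h2 : Measurable fun z : Ω × ℕ => (q z.2 z.1).pos :=
    measurable_from_prod_countable_left fun n => (hq n).pos
  have h3 : Measurable fun z : Ω × ℕ => (q z.2 z.1).vel :=
    measurable_from_prod_countable_left fun n => (hq n).vel
  exact ⟨h1.comp hid, h2.comp hid, h3.comp hid⟩

lemma MeasCentres.measPhase_lastImpact {S : Ω → Set Pt} {P C} (h : MeasCentres S P C)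
    {x v : Ω → Pt} (hx : Measurable x) (hv : Measurable v) (hv0 : ∀ ω i, v ω i ≠ 0)
    {t : Ω → ℝ} (ht : Measurable t) :
    MeasPhase fun ω => lastImpact r (S ω) (x ω) (v ω) (t ω) := by
  have hi := h.measPhase_impacts (r := r) hx hv hv0
  have hN : Measurable fun ω => impactCount r (S ω) (x ω) (v ω) (t ω) := by
    refine measurable_nat_sInf fun n => ?_
    have hn0 : ∀ ω i, (impacts r (S ω) (x ω) (v ω) n).vel i ≠ 0 := fun ω =>
      (isVel_impacts r (S ω) (x ω) (v ω) n).ne_zero (hv0 ω)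
    have hQ : MeasurableSet {z : Ω × ℝ | (impacts r (S z.1) (x z.1) (v z.1) n).time + z.2 ≤ t z.1} :=
      measurableSet_le (((hi n).time.comp measurable_fst).add measurable_snd)
        (ht.comp measurable_fst)
    have hset : {ω | n ∈ {n | ∀ h ∈ hitTimes r (S ω) (impacts r (S ω) (x ω) (v ω) n).pos
        (impacts r (S ω) (x ω) (v ω) n).vel, t ω < (impacts r (S ω) (x ω) (v ω) n).time + h}} =
        {ω | ∃ τ ∈ hitTimes r (S ω) (impacts r (S ω) (x ω) (v ω) n).pos
          (impacts r (S ω) (x ω) (v ω) n).vel, (ω, τ) ∈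
            {z : Ω × ℝ | (impacts r (S z.1) (x z.1) (v z.1) n).time + z.2 ≤ t z.1}}ᶜ := by
      ext ω
      simp only [Set.mem_ofPred_eq, mem_compl_iff, not_exists, not_and, not_le]
    rw [hset]
    exact (h.measurableSet_hit (r := r) (hi n).pos (hi n).vel hn0 hQ).compl
  exact MeasPhase.of_nat hi hN

lemma MeasCentres.measurable_flightPos {S : Ω → Set Pt} {P C} (h : MeasCentres S P C)
    {x v : Ω → Pt} (hx : Measurable x) (hv : Measurable v) (hv0 : ∀ ω i, v ω i ≠ 0)
    {t : Ω → ℝ} (ht : Measurable t) :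
    Measurable fun ω => flightPos r (S ω) (x ω) (v ω) (t ω) := by
  have hq := h.measPhase_lastImpact (r := r) hx hv hv0 ht
  exact hq.pos.add ((ht.sub hq.time).smul hq.vel)

lemma MeasCentres.measurable_flightVel {S : Ω → Set Pt} {P C} (h : MeasCentres S P C)
    {x v : Ω → Pt} (hx : Measurable x) (hv : Measurable v) (hv0 : ∀ ω i, v ω i ≠ 0)
    {t : Ω → ℝ} (ht : Measurable t) :
    Measurable fun ω => flightVel r (S ω) (x ω) (v ω) (t ω) :=
  (h.measPhase_lastImpact (r := r) hx hv hv0 ht).vel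

end flight

section visits
variable {r : ℝ} {S : Set Pt} {x v : Pt}

/-- The number of impacts is continuous from the right. -/
lemma exists_impactCount_eq (hS : S.Finite) (hv : ∀ i, v i ≠ 0) (t : ℝ) :
    ∃ ε > 0, ∀ t', t ≤ t' → t' < t + ε →
      impactCount r S x v t' = impactCount r S x v t := by
  set A : ℝ → Set ℕ := fun t => {n | ∀ h ∈ hitTimes r S (impacts r S x v n).pos
    (impacts r S x v n).vel, t < (impacts r S x v n).time + h} with hA
  have hanti : ∀ t t', t ≤ t' → A t' ⊆ A t := fun t t' ht n hn h hh => ht.trans_lt (hn h hh)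
  rcases eq_empty_or_nonempty (A t) with he | he
  · refine ⟨1, one_pos, fun t' ht _ => ?_⟩
    have he' : A t' = ∅ := subset_eq_empty (hanti t t' ht) he
    change sInf (A t') = sInf (A t)
    rw [he, he']
  · set N := sInf (A t) with hN
    have hmem : N ∈ A t := Nat.sInf_mem he
    have hfin : (hitTimes r S (impacts r S x v N).pos (impacts r S x v N).vel).Finite :=
      hitTimes_finite r hS _ ((isVel_impacts r S x v N).ne_zero hv)
    have hev : ∀ᶠ t' in nhds t, ∀ h ∈ hitTimes r S (impacts r S x v N).pos
        (impacts r S x v N).vel, t' < (impacts r S x v N).time + h :=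
      (Filter.eventually_all_finite hfin).2 fun h hh => eventually_lt_nhds (hmem h hh)
    obtain ⟨ε, hε, hball⟩ := Metric.eventually_nhds_iff.1 hev
    refine ⟨ε, hε, fun t' ht hlt => ?_⟩
    have h1 : N ∈ A t' := hball (by rw [Real.dist_eq, abs_of_nonneg (by linarith)]; linarith)
    exact le_antisymm (Nat.sInf_le h1) (Nat.sInf_le (hanti t t' ht (Nat.sInf_mem ⟨N, h1⟩)))

/-- The times in `(0, ξ]` at which the particle is in a cube need to be sought only among countably
many candidates: rational times, the end of the flight, and times at which the particle is on
the plane of a face. -/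
lemma exists_mem_cube_iff (hS : S.Finite) (hv : ∀ i, v i ≠ 0) (c : Pt) (ξ : ℝ) :
    (∃ t ∈ Ioc 0 ξ, flightPos r S x v t - c ∈ cube r) ↔
      (∃ q : ℚ, (q : ℝ) ∈ Ioc 0 ξ ∧ flightPos r S x v q - c ∈ cube r) ∨
      (ξ ∈ Ioc 0 ξ ∧ flightPos r S x v ξ - c ∈ cube r) ∨
      ∃ (N : ℕ) (i : Fin 3) (b : Bool), ∃ t, t = (impacts r S x v N).time +
        (c i + (if b then r / 2 else -(r / 2)) - (impacts r S x v N).pos i) /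
          (impacts r S x v N).vel i ∧ t ∈ Ioc 0 ξ ∧ flightPos r S x v t - c ∈ cube r := by
  constructor
  swap
  · rintro (⟨q, h1, h2⟩ | ⟨h1, h2⟩ | ⟨N, i, b, t, -, h1, h2⟩)
    exacts [⟨q, h1, h2⟩, ⟨ξ, h1, h2⟩, ⟨t, h1, h2⟩]
  rintro ⟨t, ht, htc⟩
  by_cases hξ : t = ξ
  · subst hξ; exact Or.inr (Or.inl ⟨ht, htc⟩)
  have htξ : t < ξ := lt_of_le_of_ne ht.2 hξ
  set q := lastImpact r S x v t with hq
  have hq0 : ∀ i, q.vel i ≠ 0 := (isVel_impacts r S x v _).ne_zero hv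
  have hpos : ∀ i, flightPos r S x v t i = q.pos i + (t - q.time) * q.vel i := fun i => rfl
  by_cases hb : ∃ i, |flightPos r S x v t i - c i| = r / 2
  · obtain ⟨i, hi⟩ := hb
    refine Or.inr (Or.inr ⟨impactCount r S x v t, i, ?_⟩)
    change ∃ b : Bool, ∃ t, t = q.time + (c i + (if b then r / 2 else -(r / 2)) - q.pos i) /
      q.vel i ∧ _
    rcases abs_choice (flightPos r S x v t i - c i) with h | h <;> rw [hi, hpos] at h
    · refine ⟨true, t, ?_, ht, htc⟩
      have : c i + r / 2 - q.pos i = (t - q.time) * q.vel i := by linarith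
      rw [if_pos rfl, this, mul_div_cancel_right₀ _ (hq0 i)]; ring
    · refine ⟨false, t, ?_, ht, htc⟩
      have : c i + -(r / 2) - q.pos i = (t - q.time) * q.vel i := by linarith
      rw [if_neg (by simp), this, mul_div_cancel_right₀ _ (hq0 i)]; ring
  · left
    push Not at hb
    obtain ⟨ε, hε, hcount⟩ := exists_impactCount_eq (r := r) (x := x) hS hv t
    have hlt : ∀ i, |q.pos i + (t - q.time) * q.vel i - c i| < r / 2 := fun i =>
      lt_of_le_of_ne (htc i) (hb i)
    have hev : ∀ᶠ t' in nhds t, ∀ i, |q.pos i + (t' - q.time) * q.vel i - c i| < r / 2 := by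
      refine Filter.eventually_all.2 fun i => ?_
      have hc : Continuous fun t' : ℝ => |q.pos i + (t' - q.time) * q.vel i - c i| := by fun_prop
      exact hc.continuousAt.eventually_lt continuousAt_const (hlt i)
    obtain ⟨δ, hδ, hball⟩ := Metric.eventually_nhds_iff.1 hev
    obtain ⟨s, hs1, hs2⟩ := exists_rat_btwn (show t < min ξ (min (t + ε) (t + δ)) by
      simp [htξ, hε, hδ])
    simp only [lt_min_iff] at hs2
    refine ⟨s, ⟨ht.1.trans hs1, hs2.1.le⟩, fun i => ?_⟩
    have h1 : lastImpact r S x v s = q := by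
      rw [lastImpact, hcount s hs1.le hs2.2.1, hq, lastImpact]
    have h2 : flightPos r S x v s i = q.pos i + (s - q.time) * q.vel i := by
      simp only [flightPos, h1]; rfl
    rw [Pi.sub_apply, h2]
    exact (hball (by rw [Real.dist_eq, abs_of_pos (by linarith)]; linarith [hs2.2.2]) i).le

end visits

section
variable {Ω : Type*} [MeasurableSpace Ω] {r : ℝ}

lemma measurable_flip {k : Ω → Fin 3} {v : Ω → Pt} (hk : Measurable k) (hv : Measurable v) :
    Measurable fun ω => flip (k ω) (v ω) := by
  refine measurable_pi_lambda _ fun i => ?_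
  have : (fun ω => flip (k ω) (v ω) i) = fun ω => if k ω = i then -(v ω i) else v ω i := by
    funext ω
    unfold flip
    by_cases h : k ω = i
    · subst h; simp
    · rw [Function.update_of_ne (Ne.symm h), if_neg h]
  rw [this]
  exact Measurable.ite (hk (measurableSet_singleton i)) (by fun_prop) (by fun_prop)

lemma measurable_impactParam {k : Ω → Fin 3} {v x : Ω → Pt} (hk : Measurable k)
    (hv : Measurable v) (hx : Measurable x) :
    Measurable fun ω => impactParam r (v ω) (k ω) (x ω) := by
  refine measurable_pi_lambda _ fun i => ?_
  have : (fun ω => impactParam r (v ω) (k ω) (x ω) i) =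
      fun ω => if k ω = i then v ω i / |v ω i| * (r / 2) else r * x ω i := by
    funext ω
    unfold impactParam
    by_cases h : k ω = i
    · subst h; simp
    · rw [if_neg (Ne.symm h), if_neg h]
  rw [this]
  exact Measurable.ite (hk (measurableSet_singleton i)) (by fun_prop) (by fun_prop)

/-- A random optional point: its presence is an event, and the point is measurable. -/
structure MeasOpt (o : Ω → Option Pt) : Prop where
  pres : MeasurableSet {ω | (o ω).isSome}
  point : Measurable fun ω => (o ω).getD 0

/-- A random state whose components, apart from the path, are measurable, and whose velocity has
no vanishing component. -/
structure MeasState (s : Ω → State) : Prop where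
  pos : Measurable fun ω => (s ω).pos
  vel : Measurable fun ω => (s ω).vel
  attempted : Measurable fun ω => (s ω).attempted
  cur : MeasOpt fun ω => (s ω).cur
  prev : MeasOpt fun ω => (s ω).prev
  ne_zero : ∀ ω i, (s ω).vel i ≠ 0

namespace MeasState
variable {s : Ω → State} {b : Ω → Attempt}

lemma centres (h : MeasState s) : MeasCentres (fun ω => (s ω).scatterers)
    ![{ω | (s ω).cur.isSome}, {ω | (s ω).prev.isSome}]
    ![fun ω => (s ω).cur.getD 0, fun ω => (s ω).prev.getD 0] := by
  refine ⟨fun j => ?_, fun j => ?_, fun ω c => ?_⟩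
  · fin_cases j
    exacts [h.cur.pres, h.prev.pres]
  · fin_cases j
    exacts [h.cur.point, h.prev.point]
  · have key : ∀ o : Option Pt, o = some c ↔ o.isSome ∧ c = o.getD 0 := by
      intro o; cases o <;> simp [eq_comm]
    rw [mem_scatterers, key, key]
    simp only [Fin.exists_fin_two]
    rfl

lemma velBefore (h : MeasState s) (hb : Measurable b) :
    Measurable fun ω => (s ω).velBefore r (b ω) :=
  h.centres.measurable_flightVel h.pos h.vel h.ne_zero hb.fst

lemma newCentre (h : MeasState s) (hb : Measurable b) :
    Measurable fun ω => (s ω).newCentre r (b ω) :=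
  (h.centres.measurable_flightPos h.pos h.vel h.ne_zero hb.fst).add
    (measurable_impactParam hb.snd.fst (h.velBefore hb) hb.snd.snd)

open Classical in
lemma step (h : MeasState s) (hb : Measurable b)
    (hsh : MeasurableSet {ω | (s ω).Shadowed r (b ω)}) :
    MeasState fun ω => (s ω).step r (b ω) := by
  have hflip := measurable_flip hb.snd.fst (h.velBefore (r := r) hb)
  refine ⟨h.centres.measurable_flightPos h.pos h.vel h.ne_zero hb.fst, ?_, hflip, ⟨?_, ?_⟩,
    h.cur, fun ω => (step_vel_isVel (s ω) (b ω)).ne_zero (h.ne_zero ω)⟩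
  · exact Measurable.ite hsh (h.velBefore hb) hflip
  · convert hsh.compl using 1
    ext ω
    simp only [Set.mem_ofPred_eq, mem_compl_iff]
    by_cases h' : (s ω).Shadowed r (b ω)
    · simp [step_cur_of_shadowed h', h']
    · simp [step_cur_of_not h', h']
  · have : (fun ω => ((s ω).step r (b ω)).cur.getD 0) =
        fun ω => if (s ω).Shadowed r (b ω) then 0 else (s ω).newCentre r (b ω) := by
      funext ω
      by_cases h' : (s ω).Shadowed r (b ω)
      · rw [step_cur_of_shadowed h', if_pos h', Option.getD_none]
      · rw [step_cur_of_not h', if_neg h', Option.getD_some]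
    rw [this]
    exact Measurable.ite hsh measurable_const (h.newCentre hb)

lemma shadowed_step (h : MeasState s) (hb : Measurable b) {b' : Ω → Attempt}
    (hb' : Measurable b') (h' : MeasState fun ω => (s ω).step r (b ω)) :
    MeasurableSet {ω | ((s ω).step r (b ω)).Shadowed r (b' ω)} := by
  have hc := h'.newCentre (r := r) hb'
  have hC := h.centres
  have hfp := fun {t : Ω → ℝ} (ht : Measurable t) =>
    hC.measurable_flightPos (r := r) h.pos h.vel h.ne_zero ht
  have hξ : Measurable fun ω => (b ω).1 := hb.fst
  have hmem : ∀ {t : Ω → ℝ}, Measurable t → MeasurableSet {ω | t ω ∈ Ioc 0 (b ω).1 ∧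
      flightPos r (s ω).scatterers (s ω).pos (s ω).vel (t ω) -
        ((s ω).step r (b ω)).newCentre r (b' ω) ∈ cube r} := by
    intro t ht
    exact ((measurableSet_lt measurable_const ht).inter (measurableSet_le ht hξ)).inter
      (measurableSet_cube_mem ((hfp ht).sub hc))
  have himp := hC.measPhase_impacts (r := r) h.pos h.vel h.ne_zero
  set τ : ℕ → Fin 3 → Bool → Ω → ℝ := fun N i b₀ ω =>
    (impacts r (s ω).scatterers (s ω).pos (s ω).vel N).time +
      (((s ω).step r (b ω)).newCentre r (b' ω) i + (if b₀ then r / 2 else -(r / 2)) -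
        (impacts r (s ω).scatterers (s ω).pos (s ω).vel N).pos i) /
          (impacts r (s ω).scatterers (s ω).pos (s ω).vel N).vel i with hτ
  have hτm : ∀ N i b₀, Measurable (τ N i b₀) := fun N i b₀ => by
    refine (himp N).time.add (Measurable.div (Measurable.sub (Measurable.add_const ?_ _) ?_) ?_)
    · exact (measurable_pi_apply i).comp hc
    · exact (measurable_pi_apply i).comp (himp N).pos
    · exact (measurable_pi_apply i).comp (himp N).vel
  have hset : {ω | ((s ω).step r (b ω)).Shadowed r (b' ω)} =
      (⋃ q : ℚ, {ω | (q : ℝ) ∈ Ioc 0 (b ω).1 ∧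
        flightPos r (s ω).scatterers (s ω).pos (s ω).vel q -
          ((s ω).step r (b ω)).newCentre r (b' ω) ∈ cube r}) ∪
      ({ω | (b ω).1 ∈ Ioc 0 (b ω).1 ∧
        flightPos r (s ω).scatterers (s ω).pos (s ω).vel (b ω).1 -
          ((s ω).step r (b ω)).newCentre r (b' ω) ∈ cube r} ∪
      ⋃ N, ⋃ i, ⋃ b₀, {ω | τ N i b₀ ω ∈ Ioc 0 (b ω).1 ∧
        flightPos r (s ω).scatterers (s ω).pos (s ω).vel (τ N i b₀ ω) -
          ((s ω).step r (b ω)).newCentre r (b' ω) ∈ cube r}) := by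
    ext ω
    have := exists_mem_cube_iff (r := r) (x := (s ω).pos) (hC.finite ω) (h.ne_zero ω)
      (((s ω).step r (b ω)).newCentre r (b' ω)) (b ω).1
    simp only [Set.mem_ofPred_eq, mem_union, mem_iUnion, State.Shadowed, step_path, mem_image,
      exists_exists_and_eq_and, this, exists_eq_left, hτ]
  rw [hset]
  exact (MeasurableSet.iUnion fun q => hmem measurable_const).union
    ((hmem hξ).union (MeasurableSet.iUnion fun N => MeasurableSet.iUnion fun i =>
      MeasurableSet.iUnion fun b₀ => hmem (hτm N i b₀)))

end MeasState
end

section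
variable {r : ℝ} {u : Pt}

/-- The states of a leg are measurable functions of the data. -/
theorem measState (hu : ∀ i, u i ≠ 0) (n : ℕ) :
    MeasState (fun ω => state r u ω n) ∧
      MeasurableSet {ω | (state r u ω n).Shadowed r (ω (n + 1))} := by
  induction n with
  | zero =>
    refine ⟨⟨measurable_const, measurable_const, measurable_const, ⟨?_, ?_⟩, ⟨?_, ?_⟩,
      fun ω => hu⟩, ?_⟩
    · simp [state, State.init]
    · exact measurable_const
    · simp [state, State.init]
    · exact measurable_const
    · simp [state, State.init, State.Shadowed]
  | succ n ih =>
    have h := ih.1.step (measurable_pi_apply (n + 1)) ih.2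
    exact ⟨h, ih.1.shadowed_step (measurable_pi_apply _) (measurable_pi_apply (n + 1 + 1)) h⟩

lemma measurable_flightTime (n : ℕ) : Measurable fun ω : ℕ → Attempt => flightTime ω n := by
  unfold flightTime; fun_prop

lemma measurableSet_mem_stopSet (hu : ∀ i, u i ≠ 0) (n : ℕ) :
    MeasurableSet {ω | n ∈ stopSet r u ω} := by
  have h := fun l => measurableSet_lt (measurable_const (a := (1 : ℝ))) (measurable_flightTime l)
  exact (MeasurableSet.const _).inter ((h _).inter ((h _).inter ((h _).inter ((h _).inter
    ((measState hu n).1.attempted (measurableSet_singleton u))))))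

lemma measurable_legCount (hu : ∀ i, u i ≠ 0) : Measurable fun ω => legCount r u ω :=
  measurable_nat_sInf fun n => measurableSet_mem_stopSet hu n

lemma measurable_legEnd (hu : ∀ i, u i ≠ 0) : Measurable fun ω => legEnd r u ω := by
  have h1 : Measurable fun z : (ℕ → Attempt) × ℕ => (state r u z.1 z.2).pos :=
    measurable_from_prod_countable_left fun n => (measState hu n).1.pos
  exact h1.comp (measurable_id.prodMk (measurable_legCount hu))

lemma measurable_fwdVec (hu : ∀ i, u i ≠ 0) (k : ℕ) (s : ℝ) :
    Measurable fun ω => fwdVec r u ω k s :=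
  (measState hu (k + 1)).1.pos.sub
    (((measState hu k).1.velBefore (measurable_pi_apply (k + 1))).const_smul s)

lemma measurable_backVec (hu : ∀ i, u i ≠ 0) (g k : ℕ) (s : ℝ) :
    Measurable fun ω => backVec r u ω g k s := by
  unfold backVec
  split_ifs
  · exact ((measState hu g).1.pos.sub (measState hu (k + 1)).1.pos).add
      (((measurable_flightTime (k + 1)).sub_const s).smul
        ((measState hu k).1.velBefore (measurable_pi_apply (k + 1))))
  · exact measurable_const

lemma measurable_dirs (l : ℕ) : Measurable fun ω => dirs u ω l := by
  induction l with
  | zero => exact measurable_const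
  | succ l ih => exact measurable_flip (measurable_pi_apply (l + 1)).snd.fst ih

lemma measurableSet_clean (K : ℝ) (N : ℕ) : MeasurableSet {ω | Clean K ω N} := by
  have : {ω | Clean K ω N} = ⋂ l, ⋂ (_ : l ≠ 0), ⋂ (_ : l ≤ N), {ω | K < flightTime ω l} := by
    ext ω; simp [Clean]
  rw [this]
  exact MeasurableSet.iInter fun l => MeasurableSet.iInter fun _ => MeasurableSet.iInter fun _ =>
    measurableSet_lt measurable_const (measurable_flightTime l)

end

/-! ### Almost all data are generic -/

section null
variable {ι X : Type*} [DecidableEq ι] [MeasurableSpace X]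

/-- An event is null if it is null for each fixed value of all other coordinates. -/
lemma measure_eq_zero_of_update (μ : ι → Measure X) [∀ c, IsProbabilityMeasure (μ c)] (c : ι)
    {E : Set (ι → X)} (hE : MeasurableSet E)
    (h : ∀ ω, μ c {z | Function.update ω c z ∈ E} = 0) : Measure.infinitePi μ E = 0 := by
  rw [← lintegral_indicator_one hE, ← lintegral_update μ c (measurable_one.indicator hE)]
  refine (lintegral_congr fun ω => ?_).trans lintegral_zero
  rw [← h ω, ← lintegral_indicator_one]
  · rfl
  · exact ((measurable_update_prod c).comp (measurable_const.prodMk measurable_id)) hE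

/-- A random number lies almost surely outside of a countably generated random group if it almost
surely differs from each integral combination of the generators. -/
lemma measure_mem_closure_eq_zero {Ω κ : Type*} [MeasurableSpace Ω] [Countable κ] (P : Measure Ω)
    (g : κ → Ω → ℝ) (x : Ω → ℝ)
    (h : ∀ c : κ →₀ ℤ, P {ω | x ω = c.sum fun k m => m • g k ω} = 0) :
    P {ω | x ω ∈ AddSubgroup.closure (range fun k => g k ω)} = 0 := by
  refine measure_mono_null ?_ (measure_iUnion_null h)
  intro ω hω
  have h1 : x ω ∈ Submodule.span ℤ (range fun k => g k ω) := by
    rw [← Submodule.mem_toAddSubgroup, Submodule.span_int_eq_addSubgroupClosure]; exact hω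
  obtain ⟨c, hc⟩ := Finsupp.mem_span_range_iff_exists_finsupp.1 h1
  exact mem_iUnion.2 ⟨c, hc.symm⟩

end null

instance : NullSingletonClass (expMeasure 1) := by
  rw [expMeasure_eq]; infer_instance

lemma flightLaw_subsingleton (l : ℕ) {A : Set ℝ} (hA : A.Subsingleton) : flightLaw l A = 0 := by
  refine le_antisymm ((flightLaw_le l A).trans ?_) zero_le
  rw [hA.measure_zero, mul_zero]

lemma flightLaw_Iic (l : ℕ) : flightLaw l (Iic 0) = 0 := by
  refine le_antisymm ((flightLaw_le l _).trans ?_) zero_le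
  rw [← ofReal_cdf, cdf_expMeasure_eq one_pos]
  simp

lemma unitCubeLaw_eq_zero (i : Fin 3) {E : Set Pt} (hE : MeasurableSet E)
    (h : ∀ x, {t : ℝ | Function.update x i t ∈ E}.Subsingleton) : unitCubeLaw E = 0 := by
  have h3 : IsProbabilityMeasure ((volume : Measure ℝ).restrict (Icc (-(1 / 2)) (1 / 2))) := ⟨by
    rw [Measure.restrict_apply_univ, Real.volume_Icc]; norm_num⟩
  rw [unitCubeLaw, ← Measure.infinitePi_eq_pi]
  exact measure_eq_zero_of_update _ i hE fun x => (h x).measure_zero _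

section generic
variable {p : Fin 3 → ℝ} {r : ℝ} {u : Pt}

/-- A set of data is null if, given all the rest, one coordinate of the point that selects the
impact parameter is determined. -/
lemma legLaw_eq_zero_of_unit (hp : IsProbVec p) (n : ℕ) (i : Fin 3) {E : Set (ℕ → Attempt)}
    (hE : MeasurableSet E) (h : ∀ (ω : ℕ → Attempt) ξ k x,
      {t : ℝ | Function.update ω n (ξ, k, Function.update x i t) ∈ E}.Subsingleton) :
    legLaw p E = 0 := by
  have := isProbabilityMeasure_markLaw hp
  have h3 : IsProbabilityMeasure ((volume : Measure ℝ).restrict (Icc (-(1 / 2)) (1 / 2))) := ⟨by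
    rw [Measure.restrict_apply_univ, Real.volume_Icc]; norm_num⟩
  have h5 : SFinite (indexLaw p) := by unfold indexLaw; infer_instance
  rw [legLaw_eq hp]
  refine measure_eq_zero_of_update _ n hE fun ω => ?_
  have hm : MeasurableSet {z : Attempt | Function.update ω n z ∈ E} :=
    ((measurable_update_prod n).comp (measurable_const.prodMk measurable_id)) hE
  rw [Measure.measure_prod_null hm]
  refine Filter.Eventually.of_forall fun ξ => ?_
  have hm2 := measurable_prodMk_left (x := ξ) hm
  change ((indexLaw p).prod unitCubeLaw) _ = 0
  rw [Measure.measure_prod_null hm2]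
  refine Filter.Eventually.of_forall fun k => ?_
  exact unitCubeLaw_eq_zero i (measurable_prodMk_left (x := k) hm2) fun x => h ω ξ k x

lemma legLaw_eq_zero_of_flight (hp : IsProbVec p) (n : ℕ) {E : Set (ℕ → Attempt)}
    (hE : MeasurableSet E) (h : ∀ (ω : ℕ → Attempt) z,
      {t : ℝ | Function.update ω n (t, z) ∈ E}.Subsingleton) : legLaw p E = 0 := by
  have := isProbabilityMeasure_markLaw hp
  rw [legLaw_eq hp]
  refine measure_eq_zero_of_update _ n hE fun ω => ?_
  have hm : MeasurableSet {z : Attempt | Function.update ω n z ∈ E} :=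
    ((measurable_update_prod n).comp (measurable_const.prodMk measurable_id)) hE
  rw [Measure.prod_apply_symm hm]
  exact (lintegral_congr fun z => flightLaw_subsingleton n (h ω z)).trans lintegral_zero

/-- The generators of `evenGroup`. -/
def evenGen (r : ℝ) (u : Pt) (i : Fin 3) :
    ℕ ⊕ ℕ ⊕ (ℕ × Fin 3) ⊕ Fin 3 → (ℕ → Attempt) → ℝ
  | .inl l, ω => (ω l).1
  | .inr (.inl l), ω => 2 * (r * (ω l).2.2 i / u i)
  | .inr (.inr (.inl (l, j))), ω => if j = i then 0 else r * (ω l).2.2 j / u j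
  | .inr (.inr (.inr j)), _ => r / 2 / u j

lemma evenGroup_le (ω : ℕ → Attempt) (i : Fin 3) :
    evenGroup r u ω i ≤ AddSubgroup.closure (range fun k => evenGen r u i k ω) := by
  refine AddSubgroup.closure_mono ?_
  rintro x (⟨l, rfl⟩ | ⟨l, rfl⟩ | ⟨l, j, hj, rfl⟩ | ⟨j, rfl⟩)
  · exact ⟨.inl l, rfl⟩
  · exact ⟨.inr (.inl l), rfl⟩
  · exact ⟨.inr (.inr (.inl (l, j))), by simp [evenGen, hj]⟩
  · exact ⟨.inr (.inr (.inr j)), rfl⟩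

/-- The generators of `pastGroup`. -/
def pastGen (r : ℝ) (u : Pt) (n : ℕ) : ℕ ⊕ (ℕ × Fin 3) ⊕ Fin 3 → (ℕ → Attempt) → ℝ
  | .inl l, ω => if l ≤ n then (ω l).1 else 0
  | .inr (.inl (l, j)), ω => r * (ω l).2.2 j / u j
  | .inr (.inr j), _ => r / 2 / u j

lemma pastGroup_le (ω : ℕ → Attempt) (n : ℕ) :
    pastGroup r u ω n ≤ AddSubgroup.closure (range fun k => pastGen r u n k ω) := by
  refine AddSubgroup.closure_mono ?_
  rintro x (⟨l, hl, rfl⟩ | ⟨l, j, rfl⟩ | ⟨j, rfl⟩)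
  · exact ⟨.inl l, by simp [pastGen, hl]⟩
  · exact ⟨.inr (.inl (l, j)), rfl⟩
  · exact ⟨.inr (.inr j), rfl⟩

lemma measurable_evenGen (i : Fin 3) (k) : Measurable (evenGen r u i k) := by
  rcases k with l | l | ⟨l, j⟩ | j
  · change Measurable fun ω : ℕ → Attempt => (ω l).1
    fun_prop
  · change Measurable fun ω : ℕ → Attempt => 2 * (r * (ω l).2.2 i / u i)
    fun_prop
  · change Measurable fun ω : ℕ → Attempt => if j = i then 0 else r * (ω l).2.2 j / u j
    split_ifs <;> fun_prop
  · exact measurable_const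

lemma measurable_pastGen (n : ℕ) (k) : Measurable (pastGen r u n k) := by
  rcases k with l | ⟨l, j⟩ | j
  · change Measurable fun ω : ℕ → Attempt => if l ≤ n then (ω l).1 else 0
    split_ifs <;> fun_prop
  · change Measurable fun ω : ℕ → Attempt => r * (ω l).2.2 j / u j
    fun_prop
  · exact measurable_const

lemma measurable_finsupp_sum {Ω κ : Type*} [MeasurableSpace Ω] {g : κ → Ω → ℝ}
    (hg : ∀ k, Measurable (g k)) (c : κ →₀ ℤ) :
    Measurable fun ω => c.sum fun k m => m • g k ω := by
  simp only [Finsupp.sum, zsmul_eq_mul]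
  exact Finset.measurable_sum _ fun k _ => (hg k).const_mul _

/-- An impact parameter is almost surely not a combination of the flight times, the other impact
parameters, and the doubles of the impact parameters in the same coordinate. -/
lemma ae_even (hp : IsProbVec p) (hr : 0 < r) (hu : ∀ i, u i ≠ 0) (n : ℕ) (i : Fin 3) :
    legLaw p {ω | r * (ω n).2.2 i / u i ∈ evenGroup r u ω i} = 0 := by
  refine measure_mono_null (fun ω hω => evenGroup_le ω i hω)
    (measure_mem_closure_eq_zero (legLaw p) (evenGen r u i) (fun ω => r * (ω n).2.2 i / u i)
      fun c => ?_)
  have hm : Measurable fun ω : ℕ → Attempt => r * (ω n).2.2 i / u i := by fun_prop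
  refine legLaw_eq_zero_of_unit hp n i
    (measurableSet_eq_fun hm (measurable_finsupp_sum (measurable_evenGen i) c)) ?_
  intro ω ξ k x t ht t' ht'
  simp only [Set.mem_ofPred_eq, Function.update_self] at ht ht'
  -- the equation has an odd coefficient at the coordinate in question
  set ω₁ := Function.update ω n (ξ, k, Function.update x i t) with h1
  set ω₂ := Function.update ω n (ξ, k, Function.update x i t') with h2
  have hdiff : ∀ κ, evenGen r u i κ ω₁ - evenGen r u i κ ω₂ =
      if κ = .inr (.inl n) then 2 * (r * (t - t') / u i) else 0 := by
    rintro (l | l | ⟨l, j⟩ | j)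
    · by_cases hl : l = n
      · subst hl; simp [evenGen, h1, h2]
      · simp [evenGen, h1, h2, hl]
    · by_cases hl : l = n
      · subst hl; simp [evenGen, h1, h2]; ring
      · simp [evenGen, h1, h2, hl]
    · by_cases hj : j = i
      · simp [evenGen, hj]
      · by_cases hl : l = n
        · subst hl; simp [evenGen, h1, h2, hj]
        · simp [evenGen, h1, h2, hl]
    · simp [evenGen]
  have hsum : (c.sum fun k m => m • evenGen r u i k ω₁) -
      (c.sum fun k m => m • evenGen r u i k ω₂) =
        c (.inr (.inl n)) • (2 * (r * (t - t') / u i)) := by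
    rw [Finsupp.sum, Finsupp.sum, ← Finset.sum_sub_distrib]
    simp only [← smul_sub, hdiff, smul_ite, smul_zero, Finset.sum_ite_eq']
    split_ifs with hs
    · rfl
    · rw [Finsupp.notMem_support_iff.1 hs, zero_smul]
  rw [← ht, ← ht', zsmul_eq_mul] at hsum
  have hne : (1 : ℝ) - 2 * (c (.inr (.inl n)) : ℝ) ≠ 0 := by
    intro h0
    have : (1 : ℤ) - 2 * c (.inr (.inl n)) = 0 := by exact_mod_cast h0
    omega
  have h3 : (1 - 2 * (c (.inr (.inl n)) : ℝ)) * (r / u i) * (t - t') = 0 := by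
    linear_combination hsum
  rcases mul_eq_zero.1 h3 with h4 | h4
  · exact absurd h4 (mul_ne_zero hne (div_ne_zero hr.ne' (hu i)))
  · linarith

/-- A flight time is almost surely not a combination of the preceding ones and of impact parameters. -/
lemma ae_past (hp : IsProbVec p) (n : ℕ) :
    legLaw p {ω | (ω (n + 1)).1 ∈ pastGroup r u ω n} = 0 := by
  refine measure_mono_null (fun ω hω => pastGroup_le ω n hω)
    (measure_mem_closure_eq_zero (legLaw p) (pastGen r u n) (fun ω => (ω (n + 1)).1) fun c => ?_)
  have hm : Measurable fun ω : ℕ → Attempt => (ω (n + 1)).1 := by fun_prop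
  refine legLaw_eq_zero_of_flight hp (n + 1)
    (measurableSet_eq_fun hm (measurable_finsupp_sum (measurable_pastGen n) c)) ?_
  intro ω z t ht t' ht'
  simp only [Set.mem_ofPred_eq, Function.update_self] at ht ht'
  rw [ht, ht']
  congr 1
  funext κ m
  congr 1
  rcases κ with l | ⟨l, j⟩ | j
  · by_cases hl : l ≤ n
    · have : l ≠ n + 1 := by omega
      simp [pastGen, this]
    · simp [pastGen, hl]
  · by_cases hl : l = n + 1
    · subst hl; simp [pastGen]
    · simp [pastGen, hl]
  · rfl

lemma ae_pos (hp : IsProbVec p) (n : ℕ) : legLaw p {ω | (ω n).1 ≤ 0} = 0 := by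
  have := isProbabilityMeasure_markLaw hp
  have h : {ω : ℕ → Attempt | (ω n).1 ≤ 0} = {ω | ∀ c ∈ ({n} : Finset ℕ), (ω c).1 ∈ Iic 0} := by
    ext; simp
  rw [legLaw_eq hp, h]
  rw [measure_fst_mem flightLaw (markLaw p) {n} (A := fun _ => Iic 0) fun _ => measurableSet_Iic]
  simp [flightLaw_Iic]

lemma ae_unit (hp : IsProbVec p) (n : ℕ) (i : Fin 3) :
    legLaw p {ω | ¬ |(ω n).2.2 i| < 1 / 2} = 0 := by
  have := isProbabilityMeasure_markLaw hp
  have hi : Measurable fun x : Pt => |x i| := by fun_prop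
  have hA : MeasurableSet {x : Pt | ¬ |x i| < 1 / 2} :=
    (measurableSet_lt hi measurable_const).compl
  have hcube : unitCubeLaw {x | ¬ |x i| < 1 / 2} = 0 := by
    have h3 : IsProbabilityMeasure ((volume : Measure ℝ).restrict (Icc (-(1 / 2)) (1 / 2))) := ⟨by
      rw [Measure.restrict_apply_univ, Real.volume_Icc]; norm_num⟩
    rw [unitCubeLaw, ← Measure.infinitePi_eq_pi]
    refine measure_eq_zero_of_update _ i hA fun x => ?_
    simp only [Set.mem_ofPred_eq, Function.update_self]
    have hm : MeasurableSet {z : ℝ | ¬ |z| < 1 / 2} :=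
      (measurableSet_lt continuous_abs.measurable measurable_const).compl
    rw [Measure.restrict_apply hm]
    have : {z : ℝ | ¬ |z| < 1 / 2} ∩ Icc (-(1 / 2)) (1 / 2) ⊆ {-(1 / 2), 1 / 2} := by
      rintro z ⟨hz, h1, h2⟩
      simp only [Set.mem_ofPred_eq, not_lt] at hz
      rcases le_abs.1 hz with h | h
      · exact Or.inr (le_antisymm h2 h)
      · exact Or.inl (le_antisymm (by linarith) h1)
    exact measure_mono_null this ((Set.toFinite _).measure_zero _)
  rw [legLaw_eq hp]
  have hm : Measurable fun ω : ℕ → Attempt => |(ω n).2.2 i| := by fun_prop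
  refine measure_eq_zero_of_update _ n ?_ fun ω => ?_
  · exact (measurableSet_lt hm measurable_const).compl
  · simp only [Set.mem_ofPred_eq, Function.update_self]
    have h : {z : Attempt | ¬ |z.2.2 i| < 1 / 2} = univ ×ˢ (univ ×ˢ {x : Pt | ¬ |x i| < 1 / 2}) := by
      ext; simp
    rw [h, Measure.prod_prod, markLaw, Measure.prod_prod, hcube, mul_zero, mul_zero]

/-- Almost all data of a leg are generic. -/
theorem ae_generic (hp : IsProbVec p) (hr : 0 < r) (hu : ∀ i, u i ≠ 0) :
    ∀ᵐ ω ∂legLaw p, Generic r u ω := by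
  have h1 : ∀ᵐ ω ∂legLaw p, ∀ n, ¬ (ω n).1 ≤ 0 := ae_all_iff.2 fun n => by
    rw [ae_iff]; simpa using ae_pos hp n
  have h2 : ∀ᵐ ω ∂legLaw p, ∀ n i, |(ω n).2.2 i| < 1 / 2 := ae_all_iff.2 fun n =>
    ae_all_iff.2 fun i => ae_iff.2 (ae_unit hp n i)
  have h3 : ∀ᵐ ω ∂legLaw p, ∀ n i, r * (ω n).2.2 i / u i ∉ evenGroup r u ω i :=
    ae_all_iff.2 fun n => ae_all_iff.2 fun i => by
      rw [ae_iff]; simpa using ae_even hp hr hu n i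
  have h4 : ∀ᵐ ω ∂legLaw p, ∀ n, (ω (n + 1)).1 ∉ pastGroup r u ω n :=
    ae_all_iff.2 fun n => by rw [ae_iff]; simpa using ae_past hp n
  filter_upwards [h1, h2, h3, h4] with ω g1 g2 g3 g4
  exact ⟨fun n => not_le.1 (g1 n), g2, g3, g4⟩

/-- The first two flight times of a leg are greater than `1`. -/
lemma ae_one_lt :
    ∀ᵐ ω ∂legLaw p, 1 < flightTime ω 1 ∧ 1 < flightTime ω 2 := by
  refine ae_cond_mem ?_
  exact (measurableSet_lt measurable_const (measurable_flightTime 1)).inter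
    (measurableSet_lt measurable_const (measurable_flightTime 2))

end generic

/-! ### The tail of the number of attempts -/

/-- The data of one leg. -/
def leg (ω : ℕ × ℕ → Attempt) (l : ℕ) : ℕ → Attempt := fun n => ω (l, n)

/-- The indices that a run of attempts must have, in order to pass through all accessible
velocities. -/
def grayIndex (t : ℕ) : Set (Fin 3) :=
  if t = 1 ∨ t = 3 ∨ t = 5 ∨ t = 7 then {0} else if t = 2 ∨ t = 6 then {1}
    else if t = 4 ∨ t = 8 then {2} else univ

/-- The attempts of the `k`-th run in leg `b.1`, where `k = b.2`. -/
def blockIdx (b : ℕ × ℕ) : Finset (ℕ × ℕ) :=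
  (Finset.range 11).image fun t => (b.1, 3 + 11 * b.2 + t)

/-- The data which an attempt of a run must have. -/
def blockSet (c : ℕ × ℕ) : Set Attempt := Ioi 1 ×ˢ (grayIndex ((c.2 - 3) % 11) ×ˢ univ)

lemma mem_blockIdx {b c : ℕ × ℕ} : c ∈ blockIdx b ↔ c.1 = b.1 ∧ ∃ t < 11, c.2 = 3 + 11 * b.2 + t := by
  simp only [blockIdx, Finset.mem_image, Finset.mem_range]
  constructor
  · rintro ⟨t, ht, rfl⟩; exact ⟨rfl, t, ht, rfl⟩
  · rintro ⟨h1, t, ht, h2⟩; exact ⟨t, ht, Prod.ext h1.symm h2.symm⟩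

lemma three_le_of_mem_blockIdx {b c : ℕ × ℕ} (h : c ∈ blockIdx b) : 3 ≤ c.2 := by
  obtain ⟨-, t, -, h⟩ := mem_blockIdx.1 h; omega

lemma eq_of_mem_blockIdx {b b' c : ℕ × ℕ} (h : c ∈ blockIdx b) (h' : c ∈ blockIdx b') : b = b' := by
  obtain ⟨h1, t, ht, h2⟩ := mem_blockIdx.1 h
  obtain ⟨h1', t', ht', h2'⟩ := mem_blockIdx.1 h'
  exact Prod.ext (h1.symm.trans h1') (by omega)

lemma disjoint_blockIdx {b b' : ℕ × ℕ} (h : b ≠ b') : Disjoint (blockIdx b) (blockIdx b') :=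
  Finset.disjoint_left.2 fun _ hc hc' => h (eq_of_mem_blockIdx hc hc')

lemma measurableSet_blockSet (c : ℕ × ℕ) : MeasurableSet (blockSet c) :=
  measurableSet_Ioi.prod ((Set.toFinite _).measurableSet.prod MeasurableSet.univ)

/-- A complete run ends the leg. -/
lemma mem_stopSet_of_block {r a : ℝ} {u : Pt} {ω : ℕ × ℕ → Attempt} {b : ℕ × ℕ}
    (h : Setting r a u (leg ω b.1)) (hb : ∀ c ∈ blockIdx b, ω c ∈ blockSet c) :
    ∃ i, i ≤ 11 * b.2 + 11 ∧ i ∈ stopSet r u (leg ω b.1) := by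
  have hmem : ∀ t < 11, ω (b.1, 2 + 11 * b.2 + 1 + t) ∈ Ioi (1 : ℝ) ×ˢ (grayIndex t ×ˢ univ) := by
    intro t ht
    have := hb (b.1, 2 + 11 * b.2 + 1 + t) (mem_blockIdx.2 ⟨rfl, t, ht, by omega⟩)
    rw [blockSet] at this
    convert this using 3
    congr 1
    simp only
    omega
  have hidx : ∀ t < 11, ∀ i, grayIndex t = {i} → (leg ω b.1 (2 + 11 * b.2 + 1 + t)).2.1 = i := by
    intro t ht i hi
    have := (hmem t ht).2.1
    rw [hi] at this; exact this
  obtain ⟨i, hi, hs⟩ := h.exists_mem_stopSet (m := 2 + 11 * b.2) (fun t ht => (hmem t ht).1)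
    (hidx 1 (by omega) 0 (by simp [grayIndex])) (hidx 2 (by omega) 1 (by simp [grayIndex]))
    (hidx 3 (by omega) 0 (by simp [grayIndex])) (hidx 4 (by omega) 2 (by simp [grayIndex]))
    (hidx 5 (by omega) 0 (by simp [grayIndex])) (hidx 6 (by omega) 1 (by simp [grayIndex]))
    (hidx 7 (by omega) 0 (by simp [grayIndex])) (hidx 8 (by omega) 2 (by simp [grayIndex]))
  exact ⟨i, by omega, hs⟩

/-- The runs in the first `N l` attempts of the legs `l ∈ A` that do not contain an index from
`K`. -/
def blocks (A : Finset ℕ) (N : ℕ → ℕ) (K : Finset (ℕ × ℕ)) : Finset (ℕ × ℕ) :=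
  (A.biUnion fun l => (Finset.range (N l / 11 - 1)).image fun k => (l, k)).filter
    fun b => Disjoint (blockIdx b) K

/-- None of these runs is complete. -/
def noBlock (A : Finset ℕ) (N : ℕ → ℕ) (K : Finset (ℕ × ℕ)) : Set (ℕ × ℕ → Attempt) :=
  {ω | ∀ b ∈ blocks A N K, ¬ ∀ c ∈ blockIdx b, ω c ∈ blockSet c}

lemma mem_blocks {A : Finset ℕ} {N : ℕ → ℕ} {K : Finset (ℕ × ℕ)} {b : ℕ × ℕ} :
    b ∈ blocks A N K ↔ (b.1 ∈ A ∧ b.2 < N b.1 / 11 - 1) ∧ Disjoint (blockIdx b) K := by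
  simp only [blocks, Finset.mem_filter, Finset.mem_biUnion, Finset.mem_image, Finset.mem_range]
  refine and_congr_left fun _ => ⟨?_, fun h => ⟨b.1, h.1, b.2, h.2, rfl⟩⟩
  rintro ⟨l, hl, k, hk, rfl⟩; exact ⟨hl, hk⟩

lemma measurableSet_noBlock (A : Finset ℕ) (N : ℕ → ℕ) (K : Finset (ℕ × ℕ)) :
    MeasurableSet (noBlock A N K) :=
  measurableSet_fails _ _ measurableSet_blockSet

lemma mix_mem_noBlock {A : Finset ℕ} {N : ℕ → ℕ} {K : Finset (ℕ × ℕ)}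
    (ω ω' : ℕ × ℕ → Attempt) : mix K ω ω' ∈ noBlock A N K ↔ ω ∈ noBlock A N K := by
  simp only [noBlock, Set.mem_ofPred_eq]
  refine forall₂_congr fun b hb => not_congr (forall₂_congr fun c hc => ?_)
  rw [mix_apply_of_notMem (Finset.disjoint_left.1 (mem_blocks.1 hb).2 hc)]

/-- If no leg `l ∈ A` ends before `N l` attempts, no run among these attempts is complete. -/
lemma mem_noBlock {r a : ℝ} {u : Pt} {ω : ℕ × ℕ → Attempt} {A : Finset ℕ} {N : ℕ → ℕ}
    (K : Finset (ℕ × ℕ)) (hS : ∀ l ∈ A, Setting r a u (leg ω l))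
    (hN : ∀ l ∈ A, ∀ i ∈ stopSet r u (leg ω l), N l ≤ i) : ω ∈ noBlock A N K := by
  intro b hb hc
  obtain ⟨⟨hA, hk⟩, -⟩ := mem_blocks.1 hb
  obtain ⟨i, hi, hs⟩ := mem_stopSet_of_block (hS _ hA) hc
  have := hN _ hA i hs
  omega

/-- The number of runs available, in terms of the number of attempts. In each leg at most `22`
attempts are lost by rounding and by the offset of the runs, and each index in `K` spoils at most one
run. -/
lemma sum_le_card_blocks (A : Finset ℕ) (N : ℕ → ℕ) (K : Finset (ℕ × ℕ)) :
    ∑ l ∈ A, N l ≤ 11 * (blocks A N K).card + (22 * A.card + 11 * K.card) := by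
  set U := A.biUnion fun l => (Finset.range (N l / 11 - 1)).image fun k => (l, k) with hU
  have hUc : U.card = ∑ l ∈ A, (N l / 11 - 1) := by
    rw [hU, Finset.card_biUnion]
    · refine Finset.sum_congr rfl fun l _ => ?_
      rw [Finset.card_image_of_injective _ (Prod.mk_right_injective l), Finset.card_range]
    · intro l _ l' _ hll
      refine Finset.disjoint_left.2 fun b hb hb' => hll ?_
      obtain ⟨k, -, rfl⟩ := Finset.mem_image.1 hb
      obtain ⟨k', -, h⟩ := Finset.mem_image.1 hb'
      exact (Prod.ext_iff.1 h).1.symm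
  have hbad : (U.filter fun b => ¬ Disjoint (blockIdx b) K).card ≤ K.card := by
    have hex : ∀ b ∈ U.filter fun b => ¬ Disjoint (blockIdx b) K, ∃ c ∈ K, c ∈ blockIdx b := by
      intro b hb
      obtain ⟨c, h1, h2⟩ := Finset.not_disjoint_iff.1 (Finset.mem_filter.1 hb).2
      exact ⟨c, h2, h1⟩
    choose! f hf using hex
    refine Finset.card_le_card_of_injOn f (fun b hb => (hf b hb).1) fun b hb b' hb' h => ?_
    exact eq_of_mem_blockIdx (hf b hb).2 (h ▸ (hf b' hb').2)
  have hsplit := Finset.card_filter_add_card_filter_not (s := U) fun b => Disjoint (blockIdx b) K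
  have hsum : ∑ l ∈ A, N l ≤ 11 * (∑ l ∈ A, (N l / 11 - 1)) + 22 * A.card := by
    rw [Finset.mul_sum, mul_comm 22, ← smul_eq_mul A.card, ← Finset.sum_const,
      ← Finset.sum_add_distrib]
    exact Finset.sum_le_sum fun l _ => by omega
  have hb : (blocks A N K).card = (U.filter fun b => Disjoint (blockIdx b) K).card := rfl
  rw [← hUc] at hsum
  omega

section law
variable {p : Fin 3 → ℝ}

lemma flightLaw_of_three_le {l : ℕ} (hl : 3 ≤ l) : flightLaw l = expMeasure 1 := by
  rw [flightLaw, flightRange, if_neg (by omega), cond_univ]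

lemma indexLaw_apply (p : Fin 3 → ℝ) (A : Set (Fin 3)) :
    indexLaw p A = ∑ i, ENNReal.ofReal (p i) * A.indicator 1 i := by
  simp only [indexLaw, Measure.coe_finsetSum, Finset.sum_apply, Measure.smul_apply, smul_eq_mul]
  refine Finset.sum_congr rfl fun i _ => ?_
  rw [Measure.dirac_apply' _ (Set.toFinite A).measurableSet]

lemma indexLaw_singleton (p : Fin 3 → ℝ) (i : Fin 3) :
    indexLaw p {i} = ENNReal.ofReal (p i) := by
  rw [indexLaw_apply, Finset.sum_eq_single i] <;> simp +contextual

lemma IsProbVec.exists_le (hp : IsProbVec p) : ∃ q : ℝ, 0 < q ∧ q ≤ 1 ∧ ∀ i, q ≤ p i := by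
  obtain ⟨i, -, hi⟩ := Finset.exists_min_image Finset.univ p Finset.univ_nonempty
  refine ⟨p i, hp.1 i, ?_, fun j => hi j (Finset.mem_univ j)⟩
  rw [← hp.2]
  exact Finset.single_le_sum (fun j _ => (hp.1 j).le) (Finset.mem_univ i)

/-- The number of attempts in a leg has exponential tails, also for several legs together and if
finitely many attempts are disregarded. -/
theorem exists_decay (hp : IsProbVec p) [IsProbabilityMeasure (markLaw p)] : ∃ ρ : ℝ, 0 < ρ ∧ ρ < 1 ∧
    ∀ (A : Finset ℕ) (N : ℕ → ℕ) (K J : Finset (ℕ × ℕ)) (D : ℕ × ℕ → Set Attempt),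
      (∀ c, MeasurableSet (D c)) → (∀ c ∈ J, c.2 < 3) →
      gridLaw p ({ω | ∀ c ∈ J, ω c ∈ D c} ∩ noBlock A N K) ≤
        (∏ c ∈ J, ((flightLaw c.2).prod (markLaw p)) (D c)) *
          (ENNReal.ofReal ρ⁻¹ ^ (22 * A.card + 11 * K.card) *
            ENNReal.ofReal ρ ^ (∑ l ∈ A, N l)) := by
  obtain ⟨q, hq0, hq1, hq⟩ := hp.exists_le
  have hcube : unitCubeLaw univ = 1 := measure_univ
  set ε := Real.exp (-1) * q with hε
  have hε0 : 0 < ε := by positivity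
  have hε1 : ε ≤ 1 := mul_le_one₀ (Real.exp_le_one_iff.2 (by norm_num)) hq0.le hq1
  have hidx : ∀ t, ENNReal.ofReal q ≤ indexLaw p (grayIndex t) := by
    have hs : ∀ i, ENNReal.ofReal q ≤ indexLaw p {i} := fun i => by
      rw [indexLaw_singleton]; exact ENNReal.ofReal_le_ofReal (hq i)
    intro t
    unfold grayIndex
    split_ifs
    · exact hs 0
    · exact hs 1
    · exact hs 2
    · exact (hs 0).trans (measure_mono (subset_univ _))
  have hblock : ∀ c : ℕ × ℕ, 3 ≤ c.2 →
      ENNReal.ofReal ε ≤ ((flightLaw c.2).prod (markLaw p)) (blockSet c) := by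
    intro c hc
    rw [blockSet, Measure.prod_prod, markLaw, Measure.prod_prod, hcube, mul_one,
      flightLaw_of_three_le hc, expMeasure_Ioi_one, hε, ENNReal.ofReal_mul (Real.exp_pos _).le]
    exact mul_le_mul_right (hidx _) _
  have hσ : ∀ b, ENNReal.ofReal (ε ^ 11) ≤
      ∏ c ∈ blockIdx b, ((flightLaw c.2).prod (markLaw p)) (blockSet c) := by
    intro b
    have hcard : (blockIdx b).card = 11 := by
      rw [blockIdx, Finset.card_image_of_injective, Finset.card_range]
      intro t t' h; simpa using h
    rw [ENNReal.ofReal_pow hε0.le, ← hcard]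
    exact Finset.pow_card_le_prod _ _ _ fun c hc => hblock c (three_le_of_mem_blockIdx hc)
  set σ := ε ^ 11 with hσdef
  have hσ0 : 0 < σ := by positivity
  have hσ1 : σ ≤ 1 := pow_le_one₀ hε0.le hε1
  refine ⟨1 - σ / 11, by linarith, by linarith, fun A N K J D hD hJ => ?_⟩
  set ρ := 1 - σ / 11 with hρ
  have hρ0 : 0 < ρ := by linarith
  -- by Bernoulli's inequality
  have hbern : 1 - ENNReal.ofReal σ ≤ ENNReal.ofReal ρ ^ 11 := by
    rw [← ENNReal.ofReal_one, ← ENNReal.ofReal_sub _ hσ0.le, ← ENNReal.ofReal_pow hρ0.le]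
    refine ENNReal.ofReal_le_ofReal ?_
    have := one_add_mul_le_pow (a := -(σ / 11)) (by linarith) 11
    rw [hρ]; push_cast at this; linarith
  have hfails := measure_fails (fun c : ℕ × ℕ => (flightLaw c.2).prod (markLaw p)) (blocks A N K)
    blockIdx (fun b _ b' _ h => disjoint_blockIdx h) measurableSet_blockSet J hD
    (fun b _ => Finset.disjoint_left.2 fun c hc hc' => by
      have := hJ c hc; have := three_le_of_mem_blockIdx hc'; omega)
  refine (le_of_eq hfails).trans (mul_le_mul_right ?_ _)
  calc ∏ b ∈ blocks A N K, (1 - ∏ c ∈ blockIdx b, ((flightLaw c.2).prod (markLaw p)) (blockSet c))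
      ≤ ∏ _b ∈ blocks A N K, ENNReal.ofReal ρ ^ 11 :=
        Finset.prod_le_prod' fun b _ => (tsub_le_tsub_left (hσ b) 1).trans hbern
    _ = ENNReal.ofReal ρ ^ (11 * (blocks A N K).card) := by rw [Finset.prod_const, pow_mul]
    _ = ENNReal.ofReal ρ⁻¹ ^ (22 * A.card + 11 * K.card) *
          ENNReal.ofReal ρ ^ (11 * (blocks A N K).card + (22 * A.card + 11 * K.card)) := by
        rw [pow_add _ (11 * _), mul_left_comm, ← mul_pow, ← ENNReal.ofReal_mul (inv_nonneg.2 hρ0.le),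
          inv_mul_cancel₀ hρ0.ne', ENNReal.ofReal_one, one_pow, mul_one]
    _ ≤ _ := by
        refine mul_le_mul_right (pow_le_pow_right_of_le_one' ?_ (sum_le_card_blocks A N K)) _
        rw [ENNReal.ofReal_le_one]; linarith

/-- Each leg has the law `legLaw p`. -/
lemma gridLaw_map_leg (hp : IsProbVec p) [IsProbabilityMeasure (markLaw p)] (l : ℕ) :
    (gridLaw p).map (fun ω => leg ω l) = legLaw p := by
  have := isProbabilityMeasure_legLaw hp
  have h1 : (processLaw p).map (fun ϖ => ϖ l) = legLaw p :=
    Measure.infinitePi_map_eval (fun _ : ℕ => legLaw p) l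
  rw [processLaw_eq hp, Measure.map_map (measurable_pi_apply l)
    (MeasurableEquiv.measurable _)] at h1
  exact h1

lemma measurable_leg (l : ℕ) : Measurable fun ω : ℕ × ℕ → Attempt => leg ω l :=
  measurable_pi_lambda _ fun n => measurable_pi_apply (l, n)

/-- What holds for almost all data of a leg: they are generic, the first two flights are long, and
the leg has an end. -/
structure GoodLeg (r a : ℝ) (u : Pt) (ω : ℕ → Attempt) : Prop extends Setting r a u ω where
  one_lt : 1 < flightTime ω 1
  one_lt' : 1 < flightTime ω 2
  nonempty : (stopSet r u ω).Nonempty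

/-- By the exponential tail of the number of attempts, almost every leg has an end. -/
theorem ae_goodLeg (hp : IsProbVec p) [IsProbabilityMeasure (markLaw p)] {r a : ℝ} {u : Pt}
    (hr : 0 < r) (ha : 0 < a) (ha1 : a ≤ 1) (hu : ∀ i, a ≤ |u i|) (hu1 : ∀ i, |u i| ≤ 1)
    (hsmall : 41 * r / a ^ 3 < 1) : ∀ᵐ ω ∂gridLaw p, ∀ l, GoodLeg r a u (leg ω l) := by
  have hu0 : ∀ i, u i ≠ 0 := fun i => abs_pos.1 (ha.trans_le (hu i))
  obtain ⟨ρ, hρ0, hρ1, hdecay⟩ := exists_decay hp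
  refine ae_all_iff.2 fun l => ?_
  have h1 : ∀ᵐ ω ∂gridLaw p, Setting r a u (leg ω l) ∧ 1 < flightTime (leg ω l) 1 ∧
      1 < flightTime (leg ω l) 2 := by
    have h : ∀ᵐ ω ∂legLaw p, Setting r a u ω ∧ 1 < flightTime ω 1 ∧ 1 < flightTime ω 2 := by
      filter_upwards [ae_generic hp hr hu0, ae_one_lt] with ω h1 h2
      exact ⟨⟨hr, ha, ha1, hu, hu1, hsmall, h1⟩, h2⟩
    rw [← gridLaw_map_leg hp l] at h
    exact ae_of_ae_map (measurable_leg l).aemeasurable h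
  have h2 : ∀ᵐ ω ∂gridLaw p, ω ∉ ⋂ n : ℕ, noBlock {l} (fun _ => n) ∅ := by
    refine measure_eq_zero_iff_ae_notMem.1 (le_antisymm ?_ zero_le)
    have hle : ∀ n : ℕ, gridLaw p (⋂ n : ℕ, noBlock {l} (fun _ => n) ∅) ≤
        ENNReal.ofReal ρ⁻¹ ^ 22 * ENNReal.ofReal ρ ^ n := by
      intro n
      refine (measure_mono (iInter_subset _ n)).trans ?_
      have := hdecay {l} (fun _ => n) ∅ ∅ (fun _ => univ) (fun _ => MeasurableSet.univ) (by simp)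
      simpa using this
    have hlim : Filter.Tendsto (fun n : ℕ => ENNReal.ofReal ρ⁻¹ ^ 22 * ENNReal.ofReal ρ ^ n)
        Filter.atTop (nhds 0) := by
      rw [← mul_zero (ENNReal.ofReal ρ⁻¹ ^ 22)]
      refine ENNReal.Tendsto.const_mul ?_ (Or.inr (ENNReal.pow_ne_top ENNReal.ofReal_ne_top))
      exact ENNReal.tendsto_pow_atTop_nhds_zero_of_lt_one (by
        rw [ENNReal.ofReal_lt_one]; exact hρ1)
    exact ge_of_tendsto' hlim hle
  filter_upwards [h1, h2] with ω h1 h2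
  refine ⟨h1.1, h1.2.1, h1.2.2, ?_⟩
  by_contra hne
  rw [not_nonempty_iff_eq_empty] at hne
  refine h2 (mem_iInter.2 fun n => mem_noBlock ∅ (r := r) (a := a) (u := u) ?_ ?_)
  · intro l' hl'; rw [Finset.mem_singleton] at hl'; exact hl' ▸ h1.1
  · intro l' hl' i hi; rw [Finset.mem_singleton] at hl'; rw [hl', hne] at hi; exact hi.elim

end law

/-! ### The displacement between two moments in different legs -/

/-- A moment in the flight before the attempt `k + 1` of leg `i`, which has `g` attempts, and a
moment in the flight before the attempt `k' + 1` of the later leg `j`. The first moment follows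
attempt `k` by the time `s`, the second one precedes attempt `k' + 1` by the time `s'`. The case
`k = g` stands for the end of leg `i`; it is excluded for adjacent legs, and one of the moments is
that of an attempt, so that at least one flight between the two moments is complete. Leg `0` is not
a part of the process, but its end stands for the start of leg `1`. -/
structure Sample where
  (i j g k k' : ℕ)
  (s s' : ℝ)
  lt : i < j
  le : k ≤ g
  eq_zero : g ≤ k → s = 0
  lt_of_adjacent : j = i + 1 → k < g
  s_nonneg : 0 ≤ s
  s'_nonneg : 0 ≤ s'
  or_eq_zero : s = 0 ∨ s' = 0

namespace Sample

/-- The part of the displacement which is due to leg `l`. -/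
def vec (x : Sample) (r : ℝ) (u : Pt) (ω : ℕ × ℕ → Attempt) (l : ℕ) : Pt :=
  if l = x.i then backVec r u (leg ω l) x.g x.k x.s
    else if l = x.j then fwdVec r u (leg ω l) x.k' x.s' else legEnd r u (leg ω l)

/-- The displacement between the two moments. -/
def disp (x : Sample) (r : ℝ) (u : Pt) (ω : ℕ × ℕ → Attempt) : Pt :=
  ∑ l ∈ Finset.Icc x.i x.j, x.vec r u ω l

/-- The two moments exist, and the displacement between them is small. Here `G` is a set of regular
data. -/
def event (x : Sample) (G : Set (ℕ × ℕ → Attempt)) (r a : ℝ) (u : Pt) :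
    Set (ℕ × ℕ → Attempt) :=
  G ∩ {ω | legCount r u (leg ω x.i) = x.g ∧ x.k' < legCount r u (leg ω x.j) ∧
    x.s ≤ (ω (x.i, x.k + 1)).1 ∧ x.s' ≤ (ω (x.j, x.k' + 1)).1 ∧
    ∀ t, |x.disp r u ω t| ≤ 40 * r / a ^ 2}

/-- The flights of leg `l` between the two moments have indices greater than `x.lo l`. -/
def lo (x : Sample) (l : ℕ) : ℕ := if l = x.i then x.k else 0

/-- The flights of leg `l` between the two moments have indices up to `x.len r u ω l`. -/
def len (x : Sample) (r : ℝ) (u : Pt) (ω : ℕ × ℕ → Attempt) (l : ℕ) : ℕ :=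
  if l = x.i then x.g else if l = x.j then x.k' + 1 else legCount r u (leg ω l)

/-- The direction of a flight. The last flight of leg `x.i` has the direction that leads to the
velocity `u`. -/
def dir (x : Sample) (u : Pt) (ω : ℕ × ℕ → Attempt) (c : ℕ × ℕ) : Pt :=
  if c = (x.i, x.g) then flip (ω c).2.1 u else dirs u (leg ω c.1) (c.2 - 1)

/-- The flights of leg `l` the lengths of which influence the displacement in a linear way, whatever
else happens. -/
def anchors (x : Sample) (l : ℕ) : Finset ℕ :=
  if l = x.i then (if x.k < x.g then {x.g} else ∅) else if l = x.j then {1} else {1, 2}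

end Sample

section
variable {r a : ℝ} {u : Pt} {ω ω' : ℕ × ℕ → Attempt} {x : Sample} {G : Set (ℕ × ℕ → Attempt)}

lemma sum_eq_of_subset {ω ω' : ℕ → Attempt} {N N' : Finset ℕ} (hag : AgreeOff ↑N ω ω') (h : N ⊆ N')
    (f : ℕ → Pt) :
    ∑ n ∈ N', (flightTime ω' n - flightTime ω n) • f n =
      ∑ n ∈ N, (flightTime ω' n - flightTime ω n) • f n := by
  refine (Finset.sum_subset h fun n _ hn => ?_).symm
  have := (hag n).2 (by simpa using hn)
  rw [flightTime, flightTime, this, sub_self, zero_smul]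

lemma AgreeOff.mono {ω ω' : ℕ → Attempt} {N N' : Set ℕ} (hag : AgreeOff N ω ω') (h : N ⊆ N') :
    AgreeOff N' ω ω' := fun n => ⟨(hag n).1, fun hn => (hag n).2 fun hn' => hn (h hn')⟩

/-- If all flights up to the end of the leg are long, the velocity is `u` at the end, and the last
flight has the direction from which the last attempt leads to `u`. -/
lemma Setting.dirs_legCount {ω : ℕ → Attempt} (h : Setting r a u ω) {g : ℕ}
    (hg : g ∈ stopSet r u ω) (hcl : Clean (41 * r / a ^ 3) ω g) :
    dirs u ω g = u ∧ dirs u ω (g - 1) = flip (ω g).2.1 u := by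
  have h1 := (h.of_clean hcl le_rfl).2.1
  have h2 : dirs u ω g = u := h1.symm.trans hg.2.2.2.2.2
  refine ⟨h2, ?_⟩
  obtain ⟨n, rfl⟩ := Nat.exists_eq_add_of_le' hg.1.le
  rw [dirs] at h2
  rw [Nat.add_sub_cancel, ← flip_flip (ω (n + 1)).2.1 (dirs _ _ n), h2]

/-- A sum along flights depends linearly on their lengths. -/
lemma sum_dirs_shift {ω ω' : ℕ → Attempt} {N : Finset ℕ} {A : Finset ℕ}
    (hag : AgreeOff ↑N ω ω') (hN : ∀ n ∈ N, n ≠ 0 ∧ n - 1 ∈ A) :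
    ∑ l ∈ A, flightTime ω' (l + 1) • dirs u ω' l = ∑ l ∈ A, flightTime ω (l + 1) • dirs u ω l +
      ∑ n ∈ N, (flightTime ω' n - flightTime ω n) • dirs u ω (n - 1) := by
  have h1 : N ⊆ A.image (· + 1) := fun n hn => Finset.mem_image.2
    ⟨n - 1, (hN n hn).2, by have := (hN n hn).1; omega⟩
  rw [← sum_eq_of_subset hag h1, Finset.sum_image (by intro a _ b _ h; simpa using h),
    ← Finset.sum_add_distrib]
  refine Finset.sum_congr rfl fun l _ => ?_
  rw [← hag.dirs_eq, Nat.add_sub_cancel, sub_smul]; abel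

/-- How the contribution of one leg depends on the lengths of some flights. -/
lemma Sample.vec_shift {l : ℕ} (h : GoodLeg r a u (leg ω l)) (h' : GoodLeg r a u (leg ω' l))
    (hi : l = x.i → legCount r u (leg ω l) = x.g ∧ legCount r u (leg ω' l) = x.g)
    {N : Finset ℕ} (hag : AgreeOff ↑N (leg ω l) (leg ω' l))
    (hN : N ⊆ x.anchors l ∨ (x.len r u ω l = x.len r u ω' l ∧
      Clean (41 * r / a ^ 3) (leg ω l) (x.len r u ω l) ∧
      Clean (41 * r / a ^ 3) (leg ω' l) (x.len r u ω l) ∧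
      ∀ n ∈ N, x.lo l < n ∧ n ≤ x.len r u ω l)) :
    x.vec r u ω' l = x.vec r u ω l +
      ∑ n ∈ N, (flightTime (leg ω' l) n - flightTime (leg ω l) n) • x.dir u ω (l, n) := by
  have hji : x.j ≠ x.i := x.lt.ne'
  rcases hN with hN | ⟨hlen, hcl, hcl', hN⟩
  · rw [← sum_eq_of_subset hag hN]
    replace hag := hag.mono (Finset.coe_subset.2 hN)
    unfold anchors at *
    unfold vec
    split_ifs at * with h1 h2 h3
    · subst h1
      obtain ⟨h3, h4⟩ := hi rfl
      have hg := legCount_mem h.nonempty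
      have hg' := legCount_mem h'.nonempty
      rw [h3] at hg; rw [h4] at hg'
      rw [h.backVec_shift h'.toSetting h2 (by simpa using hag) hg hg', Finset.sum_singleton, dir,
        if_pos rfl]
      rfl
    · have : leg ω' l = leg ω l := funext fun n => (hag.eq (by simp)).symm
      rw [this]; simp
    · subst h3
      rw [h.fwdVec_shift h'.toSetting (by simpa using hag) h.one_lt h.one_lt' h'.one_lt h'.one_lt',
        Finset.sum_singleton, dir, if_neg (by simp [hji])]
      rfl
    · rw [h.legEnd_shift h'.toSetting (by simpa using hag) h.one_lt h.one_lt' h'.one_lt h'.one_lt'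
        h.nonempty, Finset.sum_pair (by norm_num), dir, dir, if_neg (by simp [h1]),
        if_neg (by simp [h1])]
      rfl
  · have hdir : ∀ n ∈ N, x.dir u ω (l, n) = dirs u (leg ω l) (n - 1) := by
      intro n _
      unfold dir
      split_ifs with h1
      · simp only [Prod.mk.injEq] at h1
        obtain ⟨rfl, rfl⟩ := h1
        have hg := legCount_mem h.nonempty
        rw [(hi rfl).1] at hg
        rw [len, if_pos rfl] at hcl
        exact (h.dirs_legCount hg hcl).2.symm
      · rfl
    rw [Finset.sum_congr rfl fun n hn => by rw [hdir n hn]]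
    unfold vec len lo at *
    split_ifs at * with h1 h2
    · rw [h.backVec_of_clean hcl x.eq_zero, h'.backVec_of_clean hcl' x.eq_zero,
        sum_dirs_shift hag (fun n hn => by have := hN n hn; simp; omega), hag.dirs_eq]
      abel
    · rw [h.fwdVec_of_clean hcl, h'.fwdVec_of_clean hcl',
        sum_dirs_shift hag (fun n hn => by have := hN n hn; simp; omega), hag.dirs_eq]
      abel
    · rw [legEnd, legEnd, ← hlen, h.pos_of_clean hcl, h'.pos_of_clean hcl',
        sum_dirs_shift hag (fun n hn => by have := hN n hn; simp; omega)]

/-- The indices in leg `l` which belong to `B`. -/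
def fibre (B : Finset (ℕ × ℕ)) (l : ℕ) : Finset ℕ := (B.filter fun c => c.1 = l).image Prod.snd

lemma mem_fibre {B : Finset (ℕ × ℕ)} {l n : ℕ} : n ∈ fibre B l ↔ (l, n) ∈ B := by
  simp only [fibre, Finset.mem_image, Finset.mem_filter]
  exact ⟨by rintro ⟨c, ⟨h1, rfl⟩, rfl⟩; exact h1, fun h => ⟨(l, n), ⟨h, rfl⟩, rfl⟩⟩

lemma sum_fibre {B : Finset (ℕ × ℕ)} {I : Finset ℕ} (hB : ∀ c ∈ B, c.1 ∈ I) (f : ℕ × ℕ → Pt) :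
    ∑ l ∈ I, ∑ n ∈ fibre B l, f (l, n) = ∑ c ∈ B, f c := by
  rw [← Finset.sum_fiberwise_of_maps_to hB]
  refine Finset.sum_congr rfl fun l _ => ?_
  rw [fibre, Finset.sum_image]
  · refine Finset.sum_congr rfl fun c hc => ?_
    rw [← (Finset.mem_filter.1 hc).2]
  · intro c hc c' hc' h
    exact Prod.ext ((Finset.mem_filter.1 hc).2.trans (Finset.mem_filter.1 hc').2.symm) h

/-- How the displacement depends on the lengths of some flights. -/
lemma Sample.disp_shift (hG : ∀ ω ∈ G, ∀ l, GoodLeg r a u (leg ω l)) (h : ω ∈ x.event G r a u)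
    (h' : ω' ∈ x.event G r a u) {B : Finset (ℕ × ℕ)} (hB : ∀ c ∈ B, c.1 ∈ Finset.Icc x.i x.j)
    (hag : ∀ c, (ω c).2 = (ω' c).2 ∧ (c ∉ B → (ω c).1 = (ω' c).1))
    (hN : ∀ l, (∀ n, (l, n) ∈ B → n ∈ x.anchors l) ∨ (x.len r u ω l = x.len r u ω' l ∧
      Clean (41 * r / a ^ 3) (leg ω l) (x.len r u ω l) ∧
      Clean (41 * r / a ^ 3) (leg ω' l) (x.len r u ω l) ∧
      ∀ n, (l, n) ∈ B → x.lo l < n ∧ n ≤ x.len r u ω l)) (t : Fin 3) :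
    |∑ c ∈ B, ((ω' c).1 - (ω c).1) * x.dir u ω c t| ≤ 80 * r / a ^ 2 := by
  have h1 : x.disp r u ω' = x.disp r u ω + ∑ c ∈ B, ((ω' c).1 - (ω c).1) • x.dir u ω c := by
    rw [← sum_fibre hB, disp, disp, ← Finset.sum_add_distrib]
    refine Finset.sum_congr rfl fun l _ => ?_
    refine Sample.vec_shift (hG ω h.1 l) (hG ω' h'.1 l) (fun hl => hl ▸ ⟨h.2.1, h'.2.1⟩) ?_ ?_
    · intro n
      refine ⟨(hag (l, n)).1, fun hn => (hag (l, n)).2 fun hn' => hn ?_⟩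
      exact Finset.mem_coe.2 (mem_fibre.2 hn')
    · rcases hN l with hN | ⟨h1, h2, h3, h4⟩
      · exact Or.inl fun n hn => hN n (mem_fibre.1 hn)
      · exact Or.inr ⟨h1, h2, h3, fun n hn => h4 n (mem_fibre.1 hn)⟩
  have h2 := congrFun h1 t
  simp only [Pi.add_apply, Finset.sum_apply, Pi.smul_apply, smul_eq_mul] at h2
  have h3 := h.2.2.2.2.2 t
  have h4 := h'.2.2.2.2.2 t
  have h5 : ∑ c ∈ B, ((ω' c).1 - (ω c).1) * x.dir u ω c t = x.disp r u ω' t - x.disp r u ω t := by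
    linarith
  rw [h5]
  refine (abs_sub _ _).trans ?_
  have : 80 * r / a ^ 2 = 40 * r / a ^ 2 + 40 * r / a ^ 2 := by ring
  linarith

end

/-! ### Three directions -/

section
variable {a ε α β δ : ℝ} {u : Pt}

lemma abs_le_of_mul {x y : ℝ} (ha : 0 < a) (hy : a ≤ |y|) (h : |x * y| ≤ ε) : |x| ≤ ε / a := by
  rw [le_div_iff₀ ha]
  rw [abs_mul] at h
  exact (mul_le_mul_of_nonneg_left hy (abs_nonneg x)).trans h

/-- A small combination of `u` and `flip κ u` has small coefficients. -/
lemma abs_le_of_two_dirs (ha : 0 < a) (hu : ∀ i, a ≤ |u i|) {κ : Fin 3}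
    (h : ∀ t, |α * u t + β * flip κ u t| ≤ ε) : |α| ≤ ε / a ∧ |β| ≤ ε / a := by
  have h1 := h κ
  have h2 := h (κ + 1)
  simp only [flip, Function.update_self,
    Function.update_of_ne (show κ + 1 ≠ κ by simp)] at h1 h2
  rw [show α * u κ + β * -u κ = (α - β) * u κ by ring] at h1
  rw [← add_mul] at h2
  replace h1 := abs_le.1 (abs_le_of_mul ha (hu _) h1)
  replace h2 := abs_le.1 (abs_le_of_mul ha (hu _) h2)
  constructor <;> rw [abs_le] <;> constructor <;> linarith

/-- A small combination of `u` and of `u` with one of two components reversed has small coefficients. -/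
lemma abs_le_of_three_flips (ha : 0 < a) (hu : ∀ i, a ≤ |u i|) {κ κ' : Fin 3} (hκ : κ ≠ κ')
    (h : ∀ t, |α * u t + β * flip κ u t + δ * flip κ' u t| ≤ ε) :
    |α| ≤ ε / a ∧ |β| ≤ ε / a ∧ |δ| ≤ ε / a := by
  obtain ⟨κ'', h1, h2⟩ : ∃ κ'' : Fin 3, κ'' ≠ κ ∧ κ'' ≠ κ' := by
    clear h; revert κ κ'; decide
  have e1 := h κ
  have e2 := h κ'
  have e3 := h κ''
  simp only [flip, Function.update_self, Function.update_of_ne h1, Function.update_of_ne h2,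
    Function.update_of_ne hκ, Function.update_of_ne hκ.symm] at e1 e2 e3
  rw [show α * u κ + β * -u κ + δ * u κ = (α - β + δ) * u κ by ring] at e1
  rw [show α * u κ' + β * u κ' + δ * -u κ' = (α + β - δ) * u κ' by ring] at e2
  rw [← add_mul, ← add_mul] at e3
  replace e1 := abs_le.1 (abs_le_of_mul ha (hu _) e1)
  replace e2 := abs_le.1 (abs_le_of_mul ha (hu _) e2)
  replace e3 := abs_le.1 (abs_le_of_mul ha (hu _) e3)
  refine ⟨?_, ?_, ?_⟩ <;> rw [abs_le] <;> constructor <;> linarith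

/-- The velocity `e` does not belong to the plane spanned by `u` and `flip κ u`. -/
def Transversal (u : Pt) (κ : Fin 3) (e : Pt) : Prop :=
  ∃ t t', t ≠ κ ∧ t' ≠ κ ∧ e t = u t ∧ e t' = -(u t')

/-- A small combination of `u`, `flip κ u` and a transversal velocity has small coefficients. -/
lemma abs_le_of_transversal (ha : 0 < a) (hu : ∀ i, a ≤ |u i|) {κ : Fin 3} {e : Pt}
    (he : IsVel u e) (ht : Transversal u κ e)
    (h : ∀ t, |α * u t + β * flip κ u t + δ * e t| ≤ ε) :
    |α| ≤ 2 * (ε / a) ∧ |β| ≤ 2 * (ε / a) ∧ |δ| ≤ 2 * (ε / a) := by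
  obtain ⟨t, t', h1, h2, h3, h4⟩ := ht
  have e1 := h t
  have e2 := h t'
  have e3 := h κ
  simp only [flip, Function.update_self, Function.update_of_ne h1, Function.update_of_ne h2,
    h3, h4] at e1 e2 e3
  rw [← add_mul, ← add_mul] at e1
  rw [show α * u t' + β * u t' + δ * -u t' = (α + β - δ) * u t' by ring] at e2
  replace e1 := abs_le.1 (abs_le_of_mul ha (hu _) e1)
  replace e2 := abs_le.1 (abs_le_of_mul ha (hu _) e2)
  have e4 : ∃ σ : ℝ, (σ = 1 ∨ σ = -1) ∧ e κ = σ * u κ := by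
    rcases he κ with h | h
    · exact ⟨1, Or.inl rfl, by rw [h, one_mul]⟩
    · exact ⟨-1, Or.inr rfl, by rw [h]; ring⟩
  obtain ⟨σ, hσ, h5⟩ := e4
  rw [h5, show α * u κ + β * -u κ + δ * (σ * u κ) = (α - β + σ * δ) * u κ by ring] at e3
  replace e3 := abs_le.1 (abs_le_of_mul ha (hu _) e3)
  rcases hσ with rfl | rfl
  · refine ⟨?_, ?_, ?_⟩ <;> rw [abs_le] <;> constructor <;> linarith
  · refine ⟨?_, ?_, ?_⟩ <;> rw [abs_le] <;> constructor <;> linarith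

end

/-! ### Long legs, long flights and prescribed indices -/

namespace Sample
section
variable {r a : ℝ} {u : Pt} {ω ω' : ℕ × ℕ → Attempt} {G : Set (ℕ × ℕ → Attempt)} {p : Fin 3 → ℝ}
variable (x : Sample)

/-- The legs between the two moments have the first indices `w`. -/
def words (w : ℕ → Fin 3) : Set (ℕ × ℕ → Attempt) :=
  {ω | ∀ l ∈ Finset.Ioo x.i x.j, (ω (l, 1)).2.1 = w l}

/-- A lower bound for the number of attempts in the legs `x.i`, `x.j`, and in one leg between them,
which has `h` attempts. -/
def minCount (h l : ℕ) : ℕ := if l = x.i then x.g else if l = x.j then x.k' else h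

/-- The two flights that contain the two moments last at least so long. -/
def tail (c : ℕ × ℕ) : ℝ :=
  if c = (x.i, x.k + 1) then x.s else if c = (x.j, x.k' + 1) then x.s' else 0

/-- The flights that contain the two moments. -/
def ends : Finset (ℕ × ℕ) := {(x.i, x.k + 1), (x.j, x.k' + 1)}

lemma tail_nonneg (c : ℕ × ℕ) : 0 ≤ x.tail c := by
  unfold tail; split_ifs; exacts [x.s_nonneg, x.s'_nonneg, le_rfl]

lemma card_ends : x.ends.card = 2 := Finset.card_pair (by simp [x.lt.ne])

lemma sum_tail_ends : ∑ c ∈ x.ends, x.tail c = x.s + x.s' := by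
  have : (x.j, x.k' + 1) ≠ (x.i, x.k + 1) := by simp [x.lt.ne']
  rw [ends, Finset.sum_pair this.symm, tail, tail, if_pos rfl, if_neg this, if_pos rfl]

/-- The weight of the two flights that contain the moments, with up to five of the factors `exp 1`
from `expBound_flightLaw`. -/
lemma prod_tail_le {K : Finset (ℕ × ℕ)} (hK : x.ends ⊆ K) (hc : K.card ≤ 5) :
    ∏ c ∈ K, ENNReal.ofReal (Real.exp 1) * ENNReal.ofReal (Real.exp (-x.tail c)) ≤
      ENNReal.ofReal (Real.exp 5 * Real.exp (-(x.s + x.s'))) := by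
  have h1 : ∀ c ∈ K, ENNReal.ofReal (Real.exp 1) * ENNReal.ofReal (Real.exp (-x.tail c)) =
      ENNReal.ofReal (Real.exp (1 - x.tail c)) := fun c _ => by
    rw [← ENNReal.ofReal_mul (Real.exp_pos _).le, ← Real.exp_add, sub_eq_add_neg]
  rw [Finset.prod_congr rfl h1, ← ENNReal.ofReal_prod_of_nonneg fun c _ => (Real.exp_pos _).le,
    ← Real.exp_sum, ← Real.exp_add]
  refine ENNReal.ofReal_le_ofReal (Real.exp_le_exp.2 ?_)
  have h2 : x.s + x.s' ≤ ∑ c ∈ K, x.tail c := by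
    rw [← sum_tail_ends]
    exact Finset.sum_le_sum_of_subset_of_nonneg hK fun c _ _ => x.tail_nonneg c
  have h3 : (K.card : ℝ) ≤ 5 := by exact_mod_cast hc
  rw [Finset.sum_sub_distrib, Finset.sum_const, nsmul_eq_mul, mul_one]
  linarith

lemma tail_le (h : ω ∈ x.event G r a u) (hG : ∀ ω ∈ G, ∀ l, GoodLeg r a u (leg ω l)) (c : ℕ × ℕ) :
    x.tail c ≤ (ω c).1 := by
  unfold tail
  split_ifs with h1 h2
  · rw [h1]; exact h.2.2.2.1
  · rw [h2]; exact h.2.2.2.2.1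
  · exact ((hG ω h.1 c.1).flightTime_pos c.2).le

lemma measurableSet_words (w : ℕ → Fin 3) : MeasurableSet (x.words w) := by
  have : x.words w = ⋂ l ∈ Finset.Ioo x.i x.j, {ω | (ω (l, 1)).2.1 = w l} := by
    ext ω; simp [words]
  rw [this]
  exact Finset.measurableSet_biInter _ fun l _ =>
    (measurable_pi_apply (l, 1)).snd.fst (measurableSet_singleton (w l))

lemma mix_mem_words (K : Finset (ℕ × ℕ)) (w : ℕ → Fin 3) (ω ω' : ℕ × ℕ → Attempt) :
    mix K ω ω' ∈ x.words w ↔ ω ∈ x.words w := Iff.rfl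

lemma measurable_vec (hu : ∀ i, u i ≠ 0) (l : ℕ) : Measurable fun ω => x.vec r u ω l := by
  unfold vec
  split_ifs
  · exact (measurable_backVec hu _ _ _).comp (measurable_leg l)
  · exact (measurable_fwdVec hu _ _).comp (measurable_leg l)
  · exact (measurable_legEnd hu).comp (measurable_leg l)

lemma measurable_disp (hu : ∀ i, u i ≠ 0) : Measurable fun ω => x.disp r u ω :=
  Finset.measurable_fun_sum _ fun l _ => x.measurable_vec hu l

lemma measurable_len (hu : ∀ i, u i ≠ 0) (l : ℕ) : Measurable fun ω => x.len r u ω l := by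
  unfold len
  split_ifs
  · exact measurable_const
  · exact measurable_const
  · exact (measurable_legCount hu).comp (measurable_leg l)

lemma measurable_dir (c : ℕ × ℕ) : Measurable fun ω => x.dir u ω c := by
  unfold dir
  split_ifs
  · exact measurable_flip (measurable_pi_apply c).snd.fst measurable_const
  · exact (measurable_dirs _).comp (measurable_leg c.1)

lemma measurableSet_transversal (κ : Fin 3) (c : ℕ × ℕ) :
    MeasurableSet {ω | Transversal u κ (x.dir u ω c)} := by
  have : {ω | Transversal u κ (x.dir u ω c)} = ⋃ t : Fin 3, ⋃ t' : Fin 3,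
      ⋃ (_ : t ≠ κ), ⋃ (_ : t' ≠ κ), ({ω | x.dir u ω c t = u t} ∩ {ω | x.dir u ω c t' = -(u t')}) := by
    ext ω; simp only [Transversal, Set.mem_ofPred_eq, Set.mem_iUnion, Set.mem_inter_iff, exists_prop]
  rw [this]
  have h : ∀ t, Measurable fun ω => x.dir u ω c t := fun t =>
    (measurable_pi_apply t).comp (x.measurable_dir c)
  exact MeasurableSet.iUnion fun t => MeasurableSet.iUnion fun t' => MeasurableSet.iUnion fun _ =>
    MeasurableSet.iUnion fun _ => (measurableSet_eq_fun (h t) measurable_const).inter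
      (measurableSet_eq_fun (h t') measurable_const)

lemma measurableSet_event (hG : MeasurableSet G) (hu : ∀ i, u i ≠ 0) :
    MeasurableSet (x.event G r a u) := by
  have hc : ∀ l, Measurable fun ω => legCount r u (leg ω l) := fun l =>
    (measurable_legCount hu).comp (measurable_leg l)
  have hd : ∀ t, Measurable fun ω => |x.disp r u ω t| := fun t =>
    measurable_norm.comp ((measurable_pi_apply t).comp (x.measurable_disp hu))
  have h5 : MeasurableSet {ω | ∀ t, |x.disp r u ω t| ≤ 40 * r / a ^ 2} := by
    rw [Set.ofPred_forall]
    exact MeasurableSet.iInter fun t => measurableSet_le (hd t) measurable_const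
  have h3 : MeasurableSet {ω : ℕ × ℕ → Attempt | x.s ≤ (ω (x.i, x.k + 1)).1} :=
    measurableSet_le measurable_const (measurable_pi_apply _).fst
  have h4 : MeasurableSet {ω : ℕ × ℕ → Attempt | x.s' ≤ (ω (x.j, x.k' + 1)).1} :=
    measurableSet_le measurable_const (measurable_pi_apply _).fst
  exact hG.inter ((hc x.i (measurableSet_singleton x.g)).inter
    ((hc x.j (measurableSet_Ioi (a := x.k'))).inter (h3.inter (h4.inter h5))))

lemma isVel_dir (c : ℕ × ℕ) : IsVel u (x.dir u ω c) := by
  unfold dir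
  split_ifs
  · exact isVel_flip _ _
  · exact dirs_isVel _ _ _

/-- The existence of the two moments bounds the numbers of attempts in their legs from below. -/
lemma mem_noBlock_of_event (hG : ∀ ω ∈ G, ∀ l, GoodLeg r a u (leg ω l)) (h : ω ∈ x.event G r a u)
    {l n : ℕ} (hn : x.len r u ω l = n) (K : Finset (ℕ × ℕ)) :
    ω ∈ noBlock {x.i, x.j, l} (x.minCount n) K := by
  refine mem_noBlock K (r := r) (a := a) (u := u) (fun l _ => (hG ω h.1 l).toSetting) fun l' hl' m hm => ?_
  have h1 := legCount_le hm
  unfold minCount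
  split_ifs with h2 h3
  · rw [h2, h.2.1] at h1; exact h1
  · rw [h3] at h1; have := h.2.2.1; omega
  · obtain rfl : l' = l := by simpa [h2, h3] using hl'
    rw [len, if_neg h2, if_neg h3] at hn
    omega

/-- The factor `2` allows for the case that `l` is one of the two legs `x.i` and `x.j`, where the same
lower bound serves for two numbers. -/
lemma le_sum_minCount {l n : ℕ} (hi : l = x.i → n = x.g) (hj : l = x.j → n = x.k' + 1) :
    x.g + x.k' + n ≤ 2 * (∑ l' ∈ {x.i, x.j, l}, x.minCount n l') + 1 := by
  have hij : x.i ≠ x.j := x.lt.ne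
  have h1 : x.minCount n x.i = x.g := if_pos rfl
  have h2 : x.minCount n x.j = x.k' := by rw [minCount, if_neg hij.symm, if_pos rfl]
  by_cases hl : l = x.i
  · rw [hl, show ({x.i, x.j, x.i} : Finset ℕ) = {x.i, x.j} by ext; simp; tauto,
      Finset.sum_pair hij, h1, h2, hi hl]
    omega
  · by_cases hl' : l = x.j
    · rw [hl', Finset.pair_eq_singleton, Finset.sum_pair hij, h1, h2, hj hl']
      omega
    · rw [Finset.sum_insert (by simp [hij, Ne.symm hl]), Finset.sum_pair (Ne.symm hl'), h1, h2,
        minCount, if_neg hl, if_neg hl']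
      omega

end
end Sample

lemma markLaw_index {p : Fin 3 → ℝ} (n : ℕ) (κ : Fin 3) [IsProbabilityMeasure (markLaw p)] :
    ((flightLaw n).prod (markLaw p)) {y | y.2.1 = κ} = ENNReal.ofReal (p κ) := by
  have hcube : unitCubeLaw univ = 1 := measure_univ
  have : {y : Attempt | y.2.1 = κ} = univ ×ˢ (({κ} : Set (Fin 3)) ×ˢ univ) := by
    ext y; simp
  rw [this, Measure.prod_prod, markLaw, Measure.prod_prod, hcube, mul_one, measure_univ, one_mul,
    indexLaw_singleton]

/-- The first indices of the legs between the two moments, and the numbers of attempts in three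
legs, are independent for the purpose of upper bounds. -/
theorem exists_decay_words {p : Fin 3 → ℝ} (hp : IsProbVec p) [IsProbabilityMeasure (markLaw p)] :
    ∃ σ C : ℝ, 0 < σ ∧ σ < 1 ∧ 0 < C ∧ ∀ (x : Sample) (l n : ℕ), (l = x.i → n = x.g) →
      (l = x.j → n = x.k' + 1) → ∀ (w : ℕ → Fin 3) (K : Finset (ℕ × ℕ)), K.card ≤ 5 →
      gridLaw p (x.words w ∩ noBlock {x.i, x.j, l} (x.minCount n) K) ≤
        (∏ l ∈ Finset.Ioo x.i x.j, ENNReal.ofReal (p (w l))) *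
          ENNReal.ofReal (C * σ ^ (x.g + x.k' + n)) := by
  obtain ⟨ρ, hρ0, hρ1, hdecay⟩ := exists_decay hp
  set σ := √ρ with hσ
  have hσ0 : 0 < σ := Real.sqrt_pos.2 hρ0
  have hσ1 : σ < 1 := by rw [hσ, Real.sqrt_lt' one_pos]; simpa using hρ1
  have hσ2 : σ ^ 2 = ρ := Real.sq_sqrt hρ0.le
  refine ⟨σ, ρ⁻¹ ^ 121 * σ⁻¹, hσ0, hσ1, by positivity, fun x l n hi hj w K hK => ?_⟩
  have hset : x.words w = {ω | ∀ c ∈ (Finset.Ioo x.i x.j).image fun l => (l, 1),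
      ω c ∈ {y : Attempt | y.2.1 = w c.1}} := by
    ext ω; simp only [Sample.words, Set.mem_ofPred_eq, Finset.forall_mem_image]
  have h := hdecay {x.i, x.j, l} (x.minCount n) K ((Finset.Ioo x.i x.j).image fun l => (l, 1))
    (fun c => {y : Attempt | y.2.1 = w c.1})
    (fun c => measurable_snd.fst (measurableSet_singleton (w c.1)))
    (fun c hc => by obtain ⟨l, -, rfl⟩ := Finset.mem_image.1 hc; norm_num)
  rw [← hset, Finset.prod_image (by intro a _ b _ h; simpa using h)] at h
  simp only [markLaw_index] at h
  refine h.trans (mul_le_mul_right ?_ _)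
  rw [← ENNReal.ofReal_pow (by positivity), ← ENNReal.ofReal_pow hρ0.le,
    ← ENNReal.ofReal_mul (by positivity)]
  refine ENNReal.ofReal_le_ofReal ?_
  have hcard : ({x.i, x.j, l} : Finset ℕ).card ≤ 3 := Finset.card_le_three
  have h1 : ρ⁻¹ ^ (22 * ({x.i, x.j, l} : Finset ℕ).card + 11 * K.card) ≤ ρ⁻¹ ^ 121 :=
    pow_le_pow_right₀ ((one_le_inv₀ hρ0).2 hρ1.le) (by omega)
  have h2 : ρ ^ (∑ l' ∈ {x.i, x.j, l}, x.minCount n l') ≤ σ⁻¹ * σ ^ (x.g + x.k' + n) := by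
    rw [← hσ2, ← pow_mul, ← mul_le_mul_iff_right₀ hσ0, ← mul_assoc, mul_inv_cancel₀ hσ0.ne', one_mul,
      ← pow_succ']
    exact pow_le_pow_of_le_one hσ0.le hσ1.le (x.le_sum_minCount hi hj)
  rw [mul_assoc]
  exact mul_le_mul h1 h2 (by positivity) (by positivity)

/-! ### Displacements that may be confined to a plane -/

namespace Sample
section
variable {r a : ℝ} {u : Pt} {ω ω' : ℕ × ℕ → Attempt} {G : Set (ℕ × ℕ → Attempt)} {p : Fin 3 → ℝ}
variable {κ : Fin 3} (x : Sample)

/-- One of two flights with different directions, at the junction of two legs; the other one is the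
flight `(x.i + 1, 1)`. -/
def second : ℕ × ℕ := if x.j = x.i + 1 then (x.i, x.g) else (x.i + 1, 2)

/-- All flights the directions of which are known in advance lie in the plane spanned by `u` and
`flip κ u`. -/
def planar (κ : Fin 3) : Set (ℕ × ℕ → Attempt) :=
  {ω | ω ∈ x.words (fun _ => κ) ∧ (x.j = x.i + 1 → (ω (x.i, x.g)).2.1 = κ)}

lemma measurableSet_planar (κ : Fin 3) : MeasurableSet (x.planar κ) := by
  have h1 : MeasurableSet {ω : ℕ × ℕ → Attempt | (ω (x.i, x.g)).2.1 = κ} :=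
    (measurable_pi_apply (x.i, x.g)).snd.fst (measurableSet_singleton κ)
  refine (x.measurableSet_words _).inter ?_
  by_cases h : x.j = x.i + 1
  · simp only [h, forall_true_left]; exact h1
  · simp only [h, false_implies]; exact MeasurableSet.univ

lemma dir_first : x.dir u ω (x.i + 1, 1) = u := by
  rw [dir, if_neg (by simp)]; rfl

lemma dir_second (h : ω ∈ x.planar κ) : x.dir u ω x.second = flip κ u := by
  unfold second
  split_ifs with hj
  · rw [dir, if_pos rfl, h.2 hj]
  · rw [dir, if_neg (by simp)]
    have := h.1 (x.i + 1) (Finset.mem_Ioo.2 ⟨Nat.lt_succ_self _, by have := x.lt; omega⟩)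
    simp [dirs, leg, this]

lemma first_ne_second : (x.i + 1, 1) ≠ x.second := by
  unfold second; split_ifs <;> simp

lemma first_mem : x.i + 1 ∈ Finset.Icc x.i x.j := by
  rw [Finset.mem_Icc]; have := x.lt; omega

lemma second_mem : x.second.1 ∈ Finset.Icc x.i x.j := by
  have := x.lt
  unfold second; split_ifs
  · simp [x.lt.le]
  · simp; omega

lemma first_mem_anchors : 1 ∈ x.anchors (x.i + 1) := by
  unfold anchors; split_ifs <;> simp_all

lemma second_mem_anchors : x.second.2 ∈ x.anchors x.second.1 := by
  unfold second
  split_ifs with hj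
  · simp [anchors, x.lt_of_adjacent hj]
  · simp [anchors, show x.i + 1 ≠ x.j from fun h => hj h.symm]

lemma mem_anchors {l n : ℕ} (h : (l, n) ∈ ({(x.i + 1, 1), x.second} : Finset (ℕ × ℕ))) :
    n ∈ x.anchors l := by
  simp only [Finset.mem_insert, Finset.mem_singleton, Prod.mk.injEq] at h
  rcases h with ⟨rfl, rfl⟩ | h
  · exact x.first_mem_anchors
  · have := x.second_mem_anchors; rwa [← h] at this

/-- The flights with known direction are among those between the two moments. -/
lemma mem_range_of_mem_anchors (hG : ∀ ω ∈ G, ∀ l, GoodLeg r a u (leg ω l))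
    (h : ω ∈ x.event G r a u) {l n : ℕ} (hn : n ∈ x.anchors l) :
    x.lo l < n ∧ n ≤ x.len r u ω l := by
  have h1 := (legCount_mem (hG ω h.1 l).nonempty).1
  unfold anchors at hn
  unfold lo len
  split_ifs at * with h1 h2 h3
  · rw [Finset.mem_singleton] at hn; omega
  · simp at hn
  · rw [Finset.mem_singleton] at hn; omega
  · simp at hn; omega

/-- The flights with known direction are long. -/
lemma one_lt_of_mem_anchors (hG : ∀ ω ∈ G, ∀ l, GoodLeg r a u (leg ω l))
    (h : ω ∈ x.event G r a u) {l n : ℕ} (hn : n ∈ x.anchors l) : 1 < (ω (l, n)).1 := by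
  have h1 := hG ω h.1 l
  have h2 := legCount_mem (hG ω h.1 x.i).nonempty
  rw [h.2.1] at h2
  unfold anchors at hn
  split_ifs at * with h3 h4
  · rw [Finset.mem_singleton] at hn; rw [hn, h3]; exact h2.2.2.1
  · simp at hn
  · rw [Finset.mem_singleton] at hn; rw [hn]; exact h1.one_lt
  · simp only [Finset.mem_insert, Finset.mem_singleton] at hn
    rcases hn with rfl | rfl
    exacts [h1.one_lt, h1.one_lt']

/-- Three conditions on single flight times give the factor `d ^ 3`, next to the weight `Q` of the
indices and of the numbers of attempts, and the weight of the two flights that contain the moments. -/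
lemma measure_le_of_three [IsProbabilityMeasure (markLaw p)]
    (hG : ∀ ω ∈ G, ∀ l, GoodLeg r a u (leg ω l)) {d : ℝ} (hd : 0 ≤ d) {w : ℕ → Fin 3}
    {l n : ℕ} {Q : ℝ≥0∞}
    (hQ : ∀ K : Finset (ℕ × ℕ), K.card ≤ 5 →
      gridLaw p (x.words w ∩ noBlock {x.i, x.j, l} (x.minCount n) K) ≤ Q)
    {E : Set (ℕ × ℕ → Attempt)} (hE : MeasurableSet E) (hEw : E ⊆ x.event G r a u ∩ x.words w)
    (hlen : ∀ ω ∈ E, x.len r u ω l = n) {B T : Finset (ℕ × ℕ)} (hBT : B ⊆ T) (hT : T.card = 3)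
    (hshort : ∀ ω ∈ E, ∀ c ∈ T, c ∉ B → (ω c).1 ≤ d)
    (hdet : ∀ ω ∈ E, ∀ ω' ∈ E, (∀ c, (ω c).2 = (ω' c).2 ∧ (c ∉ B → (ω c).1 = (ω' c).1)) →
      ∀ c ∈ B, |(ω c).1 - (ω' c).1| ≤ d) :
    gridLaw p E ≤ ENNReal.ofReal (Real.exp 5 * Real.exp (-(x.s + x.s'))) *
      ENNReal.ofReal (2 * d) ^ 3 * Q := by
  have hcard : (T ∪ x.ends).card ≤ 5 := by
    have := Finset.card_union_le T x.ends
    rw [hT, x.card_ends] at this; exact this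
  have h := measure_le_of_determined (fun c : ℕ × ℕ => flightLaw c.2) (markLaw p) expBound_flightLaw
    hd hBT (Finset.subset_union_left (s₂ := x.ends)) x.tail_nonneg hE
    ((x.measurableSet_words w).inter
      (measurableSet_noBlock {x.i, x.j, l} (x.minCount n) (T ∪ x.ends)))
    (fun ω hω => ⟨(hEw hω).2, x.mem_noBlock_of_event hG (hEw hω).1 (hlen ω hω) _⟩)
    (fun ω ω' => and_congr (x.mix_mem_words _ w ω ω') (mix_mem_noBlock ω ω'))
    (fun ω hω c _ => x.tail_le (hEw hω).1 hG c) hshort hdet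
  rw [hT] at h
  exact h.trans (mul_le_mul' (mul_le_mul_left (x.prod_tail_le Finset.subset_union_right hcard) _)
    (hQ _ hcard))

/-- Two flights with known directions, and a short flight. -/
lemma measure_short_le [IsProbabilityMeasure (markLaw p)] (hr : 0 < r) (ha : 0 < a)
    (hu : ∀ i, a ≤ |u i|) (hGm : MeasurableSet G)
    (hG : ∀ ω ∈ G, ∀ l, GoodLeg r a u (leg ω l)) {l n b : ℕ} {Q : ℝ≥0∞}
    (hQ : ∀ K : Finset (ℕ × ℕ), K.card ≤ 5 →
      gridLaw p (x.words (fun _ => κ) ∩ noBlock {x.i, x.j, l} (x.minCount n) K) ≤ Q)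
    (hb : (l, b) ∉ ({(x.i + 1, 1), x.second} : Finset (ℕ × ℕ))) :
    gridLaw p (x.event G r a u ∩ x.planar κ ∩
        ({ω | x.len r u ω l = n} ∩ {ω | (ω (l, b)).1 ≤ 41 * r / a ^ 3})) ≤
      ENNReal.ofReal (Real.exp 5 * Real.exp (-(x.s + x.s'))) *
        ENNReal.ofReal (2 * (160 * r / a ^ 3)) ^ 3 * Q := by
  have hu0 : ∀ i, u i ≠ 0 := fun i => abs_pos.1 (ha.trans_le (hu i))
  have hra : 0 < r / a ^ 3 := by positivity
  refine x.measure_le_of_three hG (by positivity) hQ (l := l) (n := n)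
    (B := {(x.i + 1, 1), x.second}) (T := insert (l, b) {(x.i + 1, 1), x.second}) ?_
    (fun ω hω => ⟨hω.1.1, hω.1.2.1⟩) (fun ω hω => hω.2.1) (Finset.subset_insert _ _) ?_ ?_ ?_
  · exact ((x.measurableSet_event hGm hu0).inter (x.measurableSet_planar κ)).inter
      ((x.measurable_len hu0 l (measurableSet_singleton n)).inter
        (measurableSet_le (measurable_pi_apply _).fst measurable_const))
  · rw [Finset.card_insert_of_notMem hb, Finset.card_pair x.first_ne_second]
  · intro ω hω c hc hcB
    obtain rfl : c = (l, b) := by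
      rcases Finset.mem_insert.1 hc with h | h
      exacts [h, absurd h hcB]
    refine (show (ω (l, b)).1 ≤ 41 * r / a ^ 3 from hω.2.2).trans ?_
    rw [mul_div_assoc, mul_div_assoc]; linarith
  · intro ω hω ω' hω' hag
    have h := x.disp_shift hG hω.1.1 hω'.1.1 (B := {(x.i + 1, 1), x.second}) ?_ hag
      (fun l => Or.inl fun n hn => x.mem_anchors hn)
    · simp only [Finset.sum_pair x.first_ne_second, x.dir_first, x.dir_second hω.1.2] at h
      obtain ⟨h1, h2⟩ := abs_le_of_two_dirs ha hu h
      have e : 80 * r / a ^ 2 / a ≤ 160 * r / a ^ 3 := by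
        rw [show 80 * r / a ^ 2 / a = 80 * (r / a ^ 3) by field_simp, mul_div_assoc]; linarith
      intro c hc
      simp only [Finset.mem_insert, Finset.mem_singleton] at hc
      rw [abs_sub_comm]
      rcases hc with rfl | rfl
      exacts [h1.trans e, h2.trans e]
    · intro c hc
      simp only [Finset.mem_insert, Finset.mem_singleton] at hc
      rcases hc with rfl | rfl
      exacts [x.first_mem, x.second_mem]

/-- Two flights with known directions, and a flight with a third direction. -/
lemma measure_transversal_le [IsProbabilityMeasure (markLaw p)] (hr : 0 < r) (ha : 0 < a)
    (hu : ∀ i, a ≤ |u i|) (hGm : MeasurableSet G)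
    (hG : ∀ ω ∈ G, ∀ l, GoodLeg r a u (leg ω l)) {l n b : ℕ} {Q : ℝ≥0∞}
    (hQ : ∀ K : Finset (ℕ × ℕ), K.card ≤ 5 →
      gridLaw p (x.words (fun _ => κ) ∩ noBlock {x.i, x.j, l} (x.minCount n) K) ≤ Q)
    (hl : l ∈ Finset.Icc x.i x.j) (hb : x.lo l < b) (hbn : b ≤ n) :
    gridLaw p (x.event G r a u ∩ x.planar κ ∩ ({ω | x.len r u ω l = n} ∩
        ({ω | Clean (41 * r / a ^ 3) (leg ω l) n} ∩ {ω | Transversal u κ (x.dir u ω (l, b))}))) ≤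
      ENNReal.ofReal (Real.exp 5 * Real.exp (-(x.s + x.s'))) *
        ENNReal.ofReal (2 * (160 * r / a ^ 3)) ^ 3 * Q := by
  have hu0 : ∀ i, u i ≠ 0 := fun i => abs_pos.1 (ha.trans_le (hu i))
  set E := x.event G r a u ∩ x.planar κ ∩ ({ω | x.len r u ω l = n} ∩
        ({ω | Clean (41 * r / a ^ 3) (leg ω l) n} ∩ {ω | Transversal u κ (x.dir u ω (l, b))})) with hE
  rcases E.eq_empty_or_nonempty with h0 | ⟨ω₀, hω₀⟩
  · rw [h0, measure_empty]; exact zero_le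
  -- the velocities `u` and `flip κ u` are not transversal
  have hb' : (l, b) ∉ ({(x.i + 1, 1), x.second} : Finset (ℕ × ℕ)) := by
    have ht : Transversal u κ (x.dir u ω₀ (l, b)) := hω₀.2.2.2
    simp only [Finset.mem_insert, Finset.mem_singleton, not_or]
    constructor <;> intro h <;> rw [h] at ht
    · rw [x.dir_first] at ht
      obtain ⟨-, t, -, -, -, h⟩ := ht
      have := hu0 t
      apply this; linarith
    · rw [x.dir_second hω₀.1.2] at ht
      obtain ⟨-, t, -, h1, -, h⟩ := ht
      rw [flip, Function.update_of_ne h1] at h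
      have := hu0 t
      apply this; linarith
  refine x.measure_le_of_three hG (by positivity) hQ (l := l) (n := n)
    (B := insert (l, b) {(x.i + 1, 1), x.second}) (T := insert (l, b) {(x.i + 1, 1), x.second}) ?_
    (fun ω hω => ⟨hω.1.1, hω.1.2.1⟩) (fun ω hω => hω.2.1) subset_rfl ?_ ?_ ?_
  · exact ((x.measurableSet_event hGm hu0).inter (x.measurableSet_planar κ)).inter
      ((x.measurable_len hu0 l (measurableSet_singleton n)).inter
        ((measurable_leg l (measurableSet_clean _ n)).inter (x.measurableSet_transversal κ _)))
  · rw [Finset.card_insert_of_notMem hb', Finset.card_pair x.first_ne_second]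
  · intro ω hω c hc hcB; exact absurd hc hcB
  · intro ω hω ω' hω' hag
    have hlen : x.len r u ω l = n := hω.2.1
    have hlen' : x.len r u ω' l = n := hω'.2.1
    have h := x.disp_shift hG hω.1.1 hω'.1.1 ?_ hag fun l' => ?_
    · simp only [Finset.sum_insert hb', Finset.sum_pair x.first_ne_second, x.dir_first,
        x.dir_second hω.1.2, add_comm (_ * x.dir u ω (l, b) _)] at h
      obtain ⟨h1, h2, h3⟩ := abs_le_of_transversal ha hu (x.isVel_dir _) hω.2.2.2 h
      have e : 2 * (80 * r / a ^ 2 / a) = 160 * r / a ^ 3 := by field_simp; norm_num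
      rw [e] at h1 h2 h3
      intro c hc
      simp only [Finset.mem_insert, Finset.mem_singleton] at hc
      rw [abs_sub_comm]
      rcases hc with rfl | rfl | rfl
      exacts [h3, h1, h2]
    · intro c hc
      simp only [Finset.mem_insert, Finset.mem_singleton] at hc
      rcases hc with rfl | rfl | rfl
      exacts [hl, x.first_mem, x.second_mem]
    · by_cases hl' : l' = l
      · subst hl'
        refine Or.inr ⟨hlen.trans hlen'.symm, hlen ▸ hω.2.2.1, hlen ▸ hω'.2.2.1, fun m hm => ?_⟩
        rcases Finset.mem_insert.1 hm with h | h
        · obtain rfl : m = b := by simpa using h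
          exact ⟨hb, hlen ▸ hbn⟩
        · exact x.mem_range_of_mem_anchors hG hω.1.1 (x.mem_anchors h)
      · refine Or.inl fun m hm => ?_
        rcases Finset.mem_insert.1 hm with h | h
        · exact absurd (Prod.ext_iff.1 h).1 hl'
        · exact x.mem_anchors h

end
end Sample

section
variable {r a : ℝ} {u : Pt} {κ : Fin 3}

/-- A velocity that is not transversal agrees, up to a common sign, with `u` outside of the direction
`κ`. -/
lemma eq_or_eq_of_not_transversal {e : Pt} (he : IsVel u e) (ht : ¬ Transversal u κ e) :
    (∀ t, t ≠ κ → e t = u t) ∨ ∀ t, t ≠ κ → e t = -(u t) := by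
  by_contra! h
  obtain ⟨⟨t, h1, h2⟩, t', h3, h4⟩ := h
  exact ht ⟨t', t, h3, h1, (he t').resolve_right h4, (he t).resolve_left h2⟩

/-- One collision cannot change the common sign of the two components other than the `κ`-th. -/
lemma eq_of_flip (hu : ∀ i, u i ≠ 0) {e : Pt} {i : Fin 3}
    (he : IsVel u e) (ht : ¬ Transversal u κ e) (h : ∀ t, t ≠ κ → flip i e t = u t) :
    ∀ t, t ≠ κ → e t = u t := by
  refine (eq_or_eq_of_not_transversal he ht).resolve_right fun h1 => ?_
  obtain ⟨t, h2, h3⟩ : ∃ t : Fin 3, t ≠ κ ∧ t ≠ i := by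
    clear h he ht h1; revert κ i; decide
  have h4 := h t h2
  rw [flip, Function.update_of_ne h3, h1 t h2] at h4
  apply hu t; linarith

/-- If no velocity of a run that starts with `u` is transversal, then all agree with `u` outside of
the direction `κ`. -/
lemma dirs_eq_of_not_transversal (hu : ∀ i, u i ≠ 0) {ω : ℕ → Attempt} {N : ℕ}
    (h : ∀ n < N, ¬ Transversal u κ (dirs u ω n)) {n : ℕ} (hn : n < N) :
    ∀ t, t ≠ κ → dirs u ω n t = u t := by
  induction n with
  | zero => exact fun _ _ => rfl
  | succ n ih =>
    refine eq_of_flip (i := (ω (n + 1)).2.1) hu (dirs_isVel _ _ _) (h _ hn) ?_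
    rw [dirs, flip_flip]
    exact ih (by omega)

/-- The same for a run that ends with the velocity `u`, read backwards. -/
lemma dirs_eq_of_not_transversal' (hu : ∀ i, u i ≠ 0) {ω : ℕ → Attempt} {k g : ℕ}
    (hg : dirs u ω g = u) (h : ∀ n, k ≤ n → n < g → ¬ Transversal u κ (dirs u ω n)) (d : ℕ)
    (hd : k + d ≤ g) : ∀ t, t ≠ κ → dirs u ω (g - d) t = u t := by
  induction d with
  | zero => rw [Nat.sub_zero, hg]; exact fun _ _ => rfl
  | succ d ih =>
    have e : g - d = g - (d + 1) + 1 := by omega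
    refine eq_of_flip (i := (ω (g - d)).2.1) hu (dirs_isVel _ _ _) (h _ (by omega) (by omega)) ?_
    have h1 := ih (by omega)
    rw [e] at h1 ⊢
    exact h1

end

namespace Sample
section
variable {r a : ℝ} {u : Pt} {ω : ℕ × ℕ → Attempt} {G : Set (ℕ × ℕ → Attempt)} {p : Fin 3 → ℝ}
variable {κ : Fin 3} (x : Sample)

/-- If all flights are long and none is transversal, the displacement in the direction `κ + 1` is
proportional to the time that passes. -/
lemma vec_eq_mul (hG : ∀ ω ∈ G, ∀ l, GoodLeg r a u (leg ω l)) (h : ω ∈ x.event G r a u) {l : ℕ}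
    (hcl : Clean (41 * r / a ^ 3) (leg ω l) (x.len r u ω l))
    (ht : ∀ n, x.lo l ≤ n → n < x.len r u ω l → ¬ Transversal u κ (dirs u (leg ω l) n)) :
    ∃ m : ℝ, x.vec r u ω l (κ + 1) = m * u (κ + 1) ∧ 0 ≤ m ∧
      (l = x.i → x.k < x.g → (ω (l, x.k + 1)).1 - x.s ≤ m) ∧
      (l = x.j → (ω (l, x.k' + 1)).1 - x.s' ≤ m) ∧
      (l ≠ x.i → l ≠ x.j → 1 ≤ m) := by
  have hl := hG ω h.1 l
  have hκ : κ + 1 ≠ κ := by simp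
  have hpos : ∀ n, 0 ≤ flightTime (leg ω l) n := fun n => (hl.flightTime_pos n).le
  have hji : x.j ≠ x.i := x.lt.ne'
  have hg := legCount_mem hl.nonempty
  unfold vec lo len at *
  split_ifs at * with h1 h2
  · subst h1
    rw [h.2.1] at hg
    have hd : ∀ n, x.k ≤ n → n ≤ x.g → dirs u (leg ω x.i) n (κ + 1) = u (κ + 1) := by
      intro n h1 h2
      have := dirs_eq_of_not_transversal' hl.ne_zero (hl.dirs_legCount hg hcl).1 ht (x.g - n)
        (by omega) (κ + 1) hκ
      rwa [Nat.sub_sub_self h2] at this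
    rw [hl.backVec_of_clean hcl x.eq_zero]
    refine ⟨∑ n ∈ Finset.Ico x.k x.g, flightTime (leg ω x.i) (n + 1) - x.s, ?_, ?_⟩
    · simp only [Pi.sub_apply, Finset.sum_apply, Pi.smul_apply, smul_eq_mul]
      rw [hd _ le_rfl x.le, sub_mul, Finset.sum_mul]
      congr 1
      refine Finset.sum_congr rfl fun n hn => ?_
      rw [Finset.mem_Ico] at hn
      rw [hd n hn.1 hn.2.le]
    · have h3 : x.k < x.g → (ω (x.i, x.k + 1)).1 - x.s ≤
          ∑ n ∈ Finset.Ico x.k x.g, flightTime (leg ω x.i) (n + 1) - x.s := fun hk => by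
        have := Finset.single_le_sum (f := fun n => flightTime (leg ω x.i) (n + 1))
          (fun n _ => hpos _) (Finset.mem_Ico.2 ⟨le_rfl, hk⟩)
        exact sub_le_sub_right this _
      refine ⟨?_, fun _ => h3, fun h => absurd h hji.symm, fun h => absurd rfl h⟩
      rcases x.le.lt_or_eq with hk | hk
      · exact (sub_nonneg.2 h.2.2.2.1).trans (h3 hk)
      · rw [x.eq_zero hk.ge, hk]; simp
  · subst h2
    have hd : ∀ n, n < x.k' + 1 → dirs u (leg ω x.j) n (κ + 1) = u (κ + 1) := fun n hn =>
      dirs_eq_of_not_transversal hl.ne_zero (fun n hn => ht n (Nat.zero_le _) hn) hn _ hκ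
    rw [hl.fwdVec_of_clean hcl]
    refine ⟨∑ n ∈ Finset.range (x.k' + 1), flightTime (leg ω x.j) (n + 1) - x.s', ?_, ?_⟩
    · simp only [Pi.sub_apply, Finset.sum_apply, Pi.smul_apply, smul_eq_mul]
      rw [hd _ (Nat.lt_succ_self _), sub_mul, Finset.sum_mul]
      congr 1
      refine Finset.sum_congr rfl fun n hn => ?_
      rw [hd n (Finset.mem_range.1 hn)]
    · have h3 : (ω (x.j, x.k' + 1)).1 - x.s' ≤
          ∑ n ∈ Finset.range (x.k' + 1), flightTime (leg ω x.j) (n + 1) - x.s' := by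
        have := Finset.single_le_sum (f := fun n => flightTime (leg ω x.j) (n + 1))
          (fun n _ => hpos _) (Finset.mem_range.2 (Nat.lt_succ_self x.k'))
        exact sub_le_sub_right this _
      exact ⟨(sub_nonneg.2 h.2.2.2.2.1).trans h3, fun h => absurd h hji, fun _ => h3,
        fun _ h => absurd rfl h⟩
  · have hd : ∀ n, n < legCount r u (leg ω l) → dirs u (leg ω l) n (κ + 1) = u (κ + 1) :=
      fun n hn => dirs_eq_of_not_transversal hl.ne_zero (fun n hn => ht n (Nat.zero_le _) hn) hn _ hκ
    have h3 : 1 ≤ ∑ n ∈ Finset.range (legCount r u (leg ω l)), flightTime (leg ω l) (n + 1) := by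
      have := Finset.single_le_sum (f := fun n => flightTime (leg ω l) (n + 1))
          (fun n _ => hpos _) (Finset.mem_range.2 (zero_lt_one.trans hg.1))
      exact hl.one_lt.le.trans this
    rw [legEnd, hl.pos_of_clean hcl]
    refine ⟨_, ?_, zero_le_one.trans h3, fun h => absurd h h1, fun h => absurd h h2, fun _ _ => h3⟩
    simp only [Finset.sum_apply, Pi.smul_apply, smul_eq_mul]
    rw [Finset.sum_mul]
    refine Finset.sum_congr rfl fun n hn => ?_
    rw [hd n (Finset.mem_range.1 hn)]

/-- A small displacement requires a short flight, or a flight in a transversal direction. Otherwise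
the motion in the coordinate `κ + 1` has constant sign, and it lasts at least `41 * r / a ^ 3`: a
whole leg lies between the two moments, or else at least one complete flight. -/
lemma exists_short_or_transversal (hG : ∀ ω ∈ G, ∀ l, GoodLeg r a u (leg ω l))
    (h : ω ∈ x.event G r a u) (κ : Fin 3) :
    ∃ l ∈ Finset.Icc x.i x.j, ∃ b ≤ x.len r u ω l,
      ((l, b) ∉ ({(x.i + 1, 1), x.second} : Finset (ℕ × ℕ)) ∧ (ω (l, b)).1 ≤ 41 * r / a ^ 3) ∨
      (x.lo l < b ∧ Clean (41 * r / a ^ 3) (leg ω l) (x.len r u ω l) ∧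
        Transversal u κ (x.dir u ω (l, b))) := by
  by_contra! hno
  have hS := hG ω h.1 x.i
  have ha := hS.a_pos
  have hcl : ∀ l ∈ Finset.Icc x.i x.j, Clean (41 * r / a ^ 3) (leg ω l) (x.len r u ω l) := by
    intro l hl b hb0 hb
    by_cases hm : (l, b) ∈ ({(x.i + 1, 1), x.second} : Finset (ℕ × ℕ))
    · exact hS.small.trans (x.one_lt_of_mem_anchors hG h (x.mem_anchors hm))
    · exact (hno l hl b hb).1 hm
  have ht : ∀ l ∈ Finset.Icc x.i x.j, ∀ n, x.lo l ≤ n → n < x.len r u ω l →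
      ¬ Transversal u κ (dirs u (leg ω l) n) := by
    intro l hl n h1 h2
    have h3 := (hno l hl (n + 1) h2).2 (by omega) (hcl l hl)
    suffices x.dir u ω (l, n + 1) = dirs u (leg ω l) n by rwa [this] at h3
    unfold dir
    split_ifs with h4
    · simp only [Prod.mk.injEq] at h4
      obtain ⟨rfl, h5⟩ := h4
      have hg := legCount_mem hS.nonempty
      rw [h.2.1] at hg
      have hc := hcl x.i hl
      rw [len, if_pos rfl] at hc
      have h6 := (hS.dirs_legCount hg hc).2
      rw [← h5, Nat.add_sub_cancel] at h6
      exact h6.symm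
    · rfl
  have hm := fun l (hl : l ∈ Finset.Icc x.i x.j) => x.vec_eq_mul hG h (hcl l hl) (ht l hl)
  choose! m hm1 hm2 hm3 hm4 hm5 using hm
  have hi : x.i ∈ Finset.Icc x.i x.j := Finset.mem_Icc.2 ⟨le_rfl, x.lt.le⟩
  have hj : x.j ∈ Finset.Icc x.i x.j := Finset.mem_Icc.2 ⟨x.lt.le, le_rfl⟩
  have hsum : x.disp r u ω (κ + 1) = (∑ l ∈ Finset.Icc x.i x.j, m l) * u (κ + 1) := by
    rw [disp, Finset.sum_apply, Finset.sum_mul]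
    exact Finset.sum_congr rfl hm1
  have hle := h.2.2.2.2.2 (κ + 1)
  rw [hsum] at hle
  have h1 := abs_le_of_mul ha (hS.le_abs _) hle
  rw [abs_of_nonneg (Finset.sum_nonneg hm2)] at h1
  have h2 : ∃ l ∈ Finset.Icc x.i x.j, 41 * r / a ^ 3 ≤ m l := by
    by_cases hadj : x.j = x.i + 1
    · have hk := x.lt_of_adjacent hadj
      rcases x.or_eq_zero with h0 | h0
      · refine ⟨x.i, hi, le_trans ?_ (hm3 x.i hi rfl hk)⟩
        have := hcl x.i hi (x.k + 1) (by omega) (by rw [len, if_pos rfl]; omega)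
        rw [h0, sub_zero]; exact this.le
      · refine ⟨x.j, hj, le_trans ?_ (hm4 x.j hj rfl)⟩
        have := hcl x.j hj (x.k' + 1) (by omega) (by rw [len, if_neg x.lt.ne', if_pos rfl])
        rw [h0, sub_zero]; exact this.le
    · have := x.lt
      exact ⟨x.i + 1, x.first_mem, hS.small.le.trans (hm5 _ x.first_mem (by omega) (by omega))⟩
  obtain ⟨l, hl, h2⟩ := h2
  have h3 := Finset.single_le_sum hm2 hl
  have hr : 0 < r / a ^ 3 := div_pos hS.r_pos (by positivity)
  have e : 40 * r / a ^ 2 / a = 40 * (r / a ^ 3) := by field_simp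
  rw [mul_div_assoc] at h2
  linarith

end
end Sample

/-- The contribution of the planar case. -/
theorem exists_measure_planar_le {p : Fin 3 → ℝ} (hp : IsProbVec p)
    [IsProbabilityMeasure (markLaw p)] {a : ℝ} (ha : 0 < a) {u : Pt} (hu : ∀ i, a ≤ |u i|) :
    ∃ σ C : ℝ, 0 < σ ∧ σ < 1 ∧ 0 < C ∧ ∀ r : ℝ, 0 < r → ∀ G : Set (ℕ × ℕ → Attempt),
      MeasurableSet G → (∀ ω ∈ G, ∀ l, GoodLeg r a u (leg ω l)) → ∀ (x : Sample) (κ : Fin 3),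
        gridLaw p (x.event G r a u ∩ x.planar κ) ≤
          ENNReal.ofReal (C * ((x.j + 1 - x.i : ℕ) * p κ ^ (x.j - x.i - 1)) *
            (r ^ 3 * σ ^ (x.g + x.k') * Real.exp (-(x.s + x.s')))) := by
  obtain ⟨σ, C, hσ0, hσ1, hC, hW⟩ := exists_decay_words hp
  have hsum : Summable fun n : ℕ => ((n : ℝ) + 1) * σ ^ n := by
    have h1 := summable_pow_mul_geometric_of_norm_lt_one 1 (r := σ) (by
      rw [Real.norm_eq_abs, abs_of_pos hσ0]; exact hσ1)
    have h2 := summable_geometric_of_lt_one hσ0.le hσ1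
    refine (h1.add h2).congr fun n => ?_
    ring
  set S := ∑' n : ℕ, ((n : ℝ) + 1) * σ ^ n with hS
  have hS0 : 0 < S := by
    refine hsum.tsum_pos (fun n => by positivity) 0 (by simp)
  refine ⟨σ, Real.exp 5 * (320 / a ^ 3) ^ 3 * C * (2 * S), hσ0, hσ1, by positivity,
    fun r hr G hGm hG x κ => ?_⟩
  have hpκ : 0 < p κ := hp.1 κ
  set Y := Real.exp 5 * Real.exp (-(x.s + x.s')) * (2 * (160 * r / a ^ 3)) ^ 3 *
    (p κ ^ (x.j - x.i - 1) * (C * σ ^ (x.g + x.k'))) with hY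
  have hY0 : 0 ≤ Y := by positivity
  set F : ℕ → ℕ → ℕ → Set (ℕ × ℕ → Attempt) := fun l n b =>
    {ω | ω ∈ x.event G r a u ∩ x.planar κ ∧ x.len r u ω l = n ∧
      (((l, b) ∉ ({(x.i + 1, 1), x.second} : Finset (ℕ × ℕ)) ∧ (ω (l, b)).1 ≤ 41 * r / a ^ 3) ∨
      (x.lo l < b ∧ Clean (41 * r / a ^ 3) (leg ω l) (x.len r u ω l) ∧
        Transversal u κ (x.dir u ω (l, b))))} with hF
  have hbound : ∀ l ∈ Finset.Icc x.i x.j, ∀ n, ∀ b ∈ Finset.range (n + 1),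
      gridLaw p (F l n b) ≤ ENNReal.ofReal (2 * (Y * σ ^ n)) := by
    intro l hl n b hb
    rw [Finset.mem_range] at hb
    by_cases hn : (l = x.i → n = x.g) ∧ (l = x.j → n = x.k' + 1)
    · have hQ : ∀ K : Finset (ℕ × ℕ), K.card ≤ 5 →
          gridLaw p (x.words (fun _ => κ) ∩ noBlock {x.i, x.j, l} (x.minCount n) K) ≤
            ENNReal.ofReal (p κ ^ (x.j - x.i - 1) * (C * σ ^ (x.g + x.k' + n))) := by
        intro K hK
        refine (hW x l n hn.1 hn.2 _ K hK).trans (le_of_eq ?_)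
        rw [Finset.prod_const, Nat.card_Ioo, ← ENNReal.ofReal_pow hpκ.le,
          ← ENNReal.ofReal_mul (by positivity)]
      have hval : ENNReal.ofReal (Real.exp 5 * Real.exp (-(x.s + x.s'))) *
          ENNReal.ofReal (2 * (160 * r / a ^ 3)) ^ 3 *
            ENNReal.ofReal (p κ ^ (x.j - x.i - 1) * (C * σ ^ (x.g + x.k' + n))) =
          ENNReal.ofReal (Y * σ ^ n) := by
        rw [← ENNReal.ofReal_pow (by positivity), ← ENNReal.ofReal_mul (by positivity),
          ← ENNReal.ofReal_mul (by positivity), hY, pow_add σ (x.g + x.k') n]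
        ring_nf
      rw [two_mul, ENNReal.ofReal_add (by positivity) (by positivity)]
      have hsub : F l n b ⊆ F l n b ∩ {ω | (l, b) ∉ ({(x.i + 1, 1), x.second} : Finset (ℕ × ℕ)) ∧
          (ω (l, b)).1 ≤ 41 * r / a ^ 3} ∪ F l n b ∩ {ω | x.lo l < b ∧
          Clean (41 * r / a ^ 3) (leg ω l) (x.len r u ω l) ∧ Transversal u κ (x.dir u ω (l, b))} := by
        intro ω hω
        rcases hω.2.2 with h | h
        exacts [Or.inl ⟨hω, h⟩, Or.inr ⟨hω, h⟩]
      refine (measure_mono hsub).trans ((measure_union_le _ _).trans (add_le_add ?_ ?_))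
      · by_cases hb' : (l, b) ∉ ({(x.i + 1, 1), x.second} : Finset (ℕ × ℕ))
        · rw [← hval]
          refine (measure_mono ?_).trans (x.measure_short_le hr ha hu hGm hG hQ hb')
          exact fun ω hω => ⟨hω.1.1, hω.1.2.1, hω.2.2⟩
        · refine (measure_mono (t := ∅) fun ω hω => hb' hω.2.1).trans ?_
          simp
      · by_cases hb' : x.lo l < b
        · rw [← hval]
          refine (measure_mono ?_).trans (x.measure_transversal_le hr ha hu hGm hG hQ hl hb'
            (show b ≤ n by omega))
          exact fun ω hω => ⟨hω.1.1, hω.1.2.1, by have := hω.2.2.1; rwa [hω.1.2.1] at this, hω.2.2.2⟩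
        · refine (measure_mono (t := ∅) fun ω hω => hb' hω.2.1).trans ?_
          simp
    · refine (measure_mono (t := ∅) fun ω hω => hn ?_).trans (by simp)
      have h1 : x.len r u ω l = n := hω.2.1
      constructor <;> rintro rfl
      · rw [← h1, Sample.len, if_pos rfl]
      · rw [← h1, Sample.len, if_neg x.lt.ne', if_pos rfl]
  have hcover : x.event G r a u ∩ x.planar κ ⊆
      ⋃ l ∈ Finset.Icc x.i x.j, ⋃ n, ⋃ b ∈ Finset.range (n + 1), F l n b := by
    intro ω hω
    obtain ⟨l, hl, b, hb, h⟩ := x.exists_short_or_transversal hG hω.1 κ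
    simp only [mem_iUnion]
    exact ⟨l, hl, _, b, Finset.mem_range.2 (Nat.lt_succ_of_le hb), hω, rfl, h⟩
  calc gridLaw p (x.event G r a u ∩ x.planar κ)
      ≤ ∑ l ∈ Finset.Icc x.i x.j, ∑' n, ∑ b ∈ Finset.range (n + 1), gridLaw p (F l n b) := by
        refine (measure_mono hcover).trans ((measure_biUnion_finset_le _ _).trans
          (Finset.sum_le_sum fun l _ => (measure_iUnion_le _).trans
            (ENNReal.tsum_le_tsum fun n => measure_biUnion_finset_le _ _)))
    _ ≤ ∑ _l ∈ Finset.Icc x.i x.j, ∑' n : ℕ, ENNReal.ofReal (2 * Y * (((n : ℝ) + 1) * σ ^ n)) := by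
        refine Finset.sum_le_sum fun l hl => ENNReal.tsum_le_tsum fun n => ?_
        refine (Finset.sum_le_sum (hbound l hl n)).trans (le_of_eq ?_)
        rw [Finset.sum_const, Finset.card_range, nsmul_eq_mul, ← ENNReal.ofReal_natCast,
          ← ENNReal.ofReal_mul (by positivity)]
        push_cast
        ring_nf
    _ = ENNReal.ofReal ((x.j + 1 - x.i : ℕ) * (2 * Y * S)) := by
        rw [← ENNReal.ofReal_tsum_of_nonneg (fun n => by positivity) (hsum.mul_left _), tsum_mul_left,
          Finset.sum_const, Nat.card_Icc, nsmul_eq_mul, ← ENNReal.ofReal_natCast,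
          ← ENNReal.ofReal_mul (by positivity)]
    _ = _ := by
        congr 1
        rw [hY]
        ring

/-! ### Random words -/

section words
variable {p : Fin 3 → ℝ}

/-- The number of occurrences of a letter in a word. -/
def letterCount {m : ℕ} (κ : Fin 3) (v : Fin m → Fin 3) : ℕ := ∑ t, if v t = κ then 1 else 0

lemma letterCount_insertNth {m : ℕ} (κ c : Fin 3) (t : Fin (m + 1)) (v : Fin m → Fin 3) :
    letterCount κ (t.insertNth c v : Fin (m + 1) → Fin 3) =
      (if c = κ then 1 else 0) + letterCount κ v := by
  simp [letterCount, Fin.sum_univ_succAbove _ t]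

lemma sum_words (hp : IsProbVec p) (m : ℕ) : ∑ v : Fin m → Fin 3, ∏ t, p (v t) = 1 := by
  rw [← Fintype.sum_pow, hp.2, one_pow]

/-- In a word of length `m + 1`, each occurrence of a letter is removed with the same weight. -/
lemma sum_inv_letterCount_add_one_le (hp : IsProbVec p) (m : ℕ) (κ : Fin 3) :
    ∑ v : Fin m → Fin 3, (∏ t, p (v t)) * ((letterCount κ v : ℝ) + 1)⁻¹ ≤ ((m + 1) * p κ)⁻¹ := by
  have hpκ := hp.1 κ
  rw [← one_div, le_div_iff₀ (by positivity)]
  have h1 : ∀ t : Fin (m + 1), ∑ v : Fin (m + 1) → Fin 3,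
      (∏ t, p (v t)) * (if v t = κ then (letterCount κ v : ℝ)⁻¹ else 0) =
      (∑ v : Fin m → Fin 3, (∏ t, p (v t)) * ((letterCount κ v : ℝ) + 1)⁻¹) * p κ := by
    intro t
    rw [← (Fin.insertNthEquiv (fun _ => Fin 3) t).sum_comp, Fintype.sum_prod_type,
      Finset.sum_eq_single κ]
    · rw [Finset.sum_mul]
      refine Finset.sum_congr rfl fun v _ => ?_
      have e : (Fin.insertNthEquiv (fun _ => Fin 3) t) (κ, v) = t.insertNth κ v := rfl
      simp only [e, Fin.insertNth_apply_same, if_true, letterCount_insertNth,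
        Fin.prod_univ_succAbove _ t, Fin.insertNth_apply_succAbove]
      push_cast
      rw [add_comm (1 : ℝ)]; ring
    · intro c _ hc
      refine Finset.sum_eq_zero fun v _ => ?_
      simp [hc]
    · simp
  have h2 : ∑ t : Fin (m + 1), ∑ v : Fin (m + 1) → Fin 3,
      (∏ t, p (v t)) * (if v t = κ then (letterCount κ v : ℝ)⁻¹ else 0) ≤ 1 := by
    rw [Finset.sum_comm, ← sum_words hp (m + 1)]
    refine Finset.sum_le_sum fun v _ => ?_
    rw [← Finset.mul_sum]
    have hP : 0 ≤ ∏ t, p (v t) := Finset.prod_nonneg fun t _ => (hp.1 _).le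
    refine mul_le_of_le_one_right hP ?_
    have h3 : ∑ t, (if v t = κ then (letterCount κ v : ℝ)⁻¹ else 0) =
        (letterCount κ v : ℝ) * (letterCount κ v : ℝ)⁻¹ := by
      rw [letterCount]; push_cast; rw [Finset.sum_mul]
      exact Finset.sum_congr rfl fun t _ => by split_ifs <;> simp
    rw [h3]
    exact mul_inv_le_one
  simp only [h1, Finset.sum_const, Finset.card_univ, Fintype.card_fin, nsmul_eq_mul] at h2
  push_cast at h2
  linarith

/-- By the inequality of the arithmetic and the geometric mean, with `1 / z ≤ 2 / (z + 1)`. -/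
lemma inv_sqrt_le {x y : ℝ} (hx : 1 ≤ x) (hy : 1 ≤ y) :
    1 / √x * (1 / √y) ≤ (x + 1)⁻¹ + (y + 1)⁻¹ := by
  have h1 : 1 / √x * (1 / √y) ≤ (x⁻¹ + y⁻¹) / 2 := by
    have := two_mul_le_add_sq (1 / √x) (1 / √y)
    rw [div_pow, div_pow, Real.sq_sqrt (by linarith), Real.sq_sqrt (by linarith), one_pow, one_div x,
      one_div y] at this
    linarith
  have h2 : ∀ z : ℝ, 1 ≤ z → z⁻¹ ≤ 2 * (z + 1)⁻¹ := fun z hz => by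
    rw [← one_div, ← div_eq_mul_inv, div_le_div_iff₀ (by linarith) (by linarith)]
    linarith
  have h3 := h2 x hx
  have h4 := h2 y hy
  linarith

/-- The mean of the three-dimensional concentration bound over words of length `m`. -/
lemma sum_words_inv_sqrt_le (hp : IsProbVec p) (m : ℕ) (κ κ' : Fin 3) :
    ∑ v : Fin m → Fin 3 with letterCount κ v ≠ 0 ∧ letterCount κ' v ≠ 0,
      (∏ t, p (v t)) * (1 / √m * (1 / √(letterCount κ v : ℝ) * (1 / √(letterCount κ' v : ℝ)))) ≤
    (1 / √m * (1 / (m + 1))) * ((p κ)⁻¹ + (p κ')⁻¹) := by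
  have hP : ∀ v : Fin m → Fin 3, 0 ≤ ∏ t, p (v t) := fun v =>
    Finset.prod_nonneg fun t _ => (hp.1 _).le
  calc _ ≤ ∑ v : Fin m → Fin 3 with letterCount κ v ≠ 0 ∧ letterCount κ' v ≠ 0,
        1 / √m * ((∏ t, p (v t)) * ((letterCount κ v : ℝ) + 1)⁻¹ +
          (∏ t, p (v t)) * ((letterCount κ' v : ℝ) + 1)⁻¹) := by
        refine Finset.sum_le_sum fun v hv => ?_
        obtain ⟨h1, h2⟩ := (Finset.mem_filter.1 hv).2
        rw [mul_left_comm, ← mul_add]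
        exact mul_le_mul_of_nonneg_left (mul_le_mul_of_nonneg_left (inv_sqrt_le
          (by exact_mod_cast Nat.one_le_iff_ne_zero.2 h1)
          (by exact_mod_cast Nat.one_le_iff_ne_zero.2 h2)) (hP v)) (by positivity)
    _ ≤ ∑ v : Fin m → Fin 3, 1 / √m * ((∏ t, p (v t)) * ((letterCount κ v : ℝ) + 1)⁻¹ +
          (∏ t, p (v t)) * ((letterCount κ' v : ℝ) + 1)⁻¹) := by
        refine Finset.sum_le_sum_of_subset_of_nonneg (Finset.filter_subset _ _) fun v _ _ => ?_
        have := hP v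
        positivity
    _ ≤ 1 / √m * (((m + 1) * p κ)⁻¹ + ((m + 1) * p κ')⁻¹) := by
        rw [← Finset.mul_sum, Finset.sum_add_distrib]
        exact mul_le_mul_of_nonneg_left (add_le_add (sum_inv_letterCount_add_one_le hp m κ)
          (sum_inv_letterCount_add_one_le hp m κ')) (by positivity)
    _ = _ := by rw [mul_inv, mul_inv, ← mul_add, one_div ((m : ℝ) + 1), mul_assoc]

end words

/-! ### Displacements in three independent directions -/

/-- The runs start at index `3`; so the first two flight times are irrelevant for them. -/
lemma mix_mem_noBlock_of_lt {A : Finset ℕ} {N : ℕ → ℕ} {K S : Finset (ℕ × ℕ)}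
    (hS : ∀ c ∈ S, c.2 < 3) (ω ω' : ℕ × ℕ → Attempt) :
    mix S ω ω' ∈ noBlock A N K ↔ ω ∈ noBlock A N K := by
  simp only [noBlock, Set.mem_ofPred_eq]
  refine forall₂_congr fun b hb => not_congr (forall₂_congr fun c hc => ?_)
  rw [mix_apply_of_notMem fun h => by
    have := hS c h; have := three_le_of_mem_blockIdx hc; omega]

namespace Sample
section
variable {r a : ℝ} {u : Pt} {ω : ℕ × ℕ → Attempt} {G : Set (ℕ × ℕ → Attempt)} {p : Fin 3 → ℝ}
variable {κ κ' : Fin 3} (x : Sample)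

/-- The flights of index `b` in the legs `l` between the two moments with `w l = κ`. -/
def slots (w : ℕ → Fin 3) (b : ℕ) (κ : Fin 3) : Finset (ℕ × ℕ) :=
  ((Finset.Ioo x.i x.j).filter fun l => w l = κ).image fun l => (l, b)

/-- The first flights of the legs between the two moments. -/
def firsts : Finset (ℕ × ℕ) := (Finset.Ioo x.i x.j).image fun l => (l, 1)

lemma mem_slots {w : ℕ → Fin 3} {b : ℕ} {c : ℕ × ℕ} :
    c ∈ x.slots w b κ ↔ c.1 ∈ Finset.Ioo x.i x.j ∧ w c.1 = κ ∧ c.2 = b := by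
  simp only [slots, Finset.mem_image, Finset.mem_filter]
  constructor
  · rintro ⟨l, ⟨h1, h2⟩, rfl⟩; exact ⟨h1, h2, rfl⟩
  · rintro ⟨h1, h2, rfl⟩; exact ⟨c.1, ⟨h1, h2⟩, rfl⟩

lemma mem_firsts {c : ℕ × ℕ} : c ∈ x.firsts ↔ c.1 ∈ Finset.Ioo x.i x.j ∧ c.2 = 1 := by
  simp only [firsts, Finset.mem_image]
  constructor
  · rintro ⟨l, h1, rfl⟩; exact ⟨h1, rfl⟩
  · rintro ⟨h1, h2⟩; exact ⟨c.1, h1, Prod.ext rfl h2.symm⟩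

lemma card_slots (w : ℕ → Fin 3) (b : ℕ) (κ : Fin 3) :
    (x.slots w b κ).card = ((Finset.Ioo x.i x.j).filter fun l => w l = κ).card :=
  Finset.card_image_of_injective _ fun l l' h => by simpa using h

lemma card_firsts : x.firsts.card = x.j - x.i - 1 := by
  rw [firsts, Finset.card_image_of_injective _ fun l l' h => by simpa using h, Nat.card_Ioo]

/-- The lengths of the first two flights in the legs between the two moments can be grouped in
three sums, which belong to three different directions. -/
lemma measure_words_le [IsProbabilityMeasure (markLaw p)] (hr : 0 < r) (ha : 0 < a)
    (hu : ∀ i, a ≤ |u i|) (hGm : MeasurableSet G) (hG : ∀ ω ∈ G, ∀ l, GoodLeg r a u (leg ω l))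
    {w : ℕ → Fin 3} (hκ : κ ≠ κ') (h1 : (x.slots w 2 κ).Nonempty) (h2 : (x.slots w 2 κ').Nonempty)
    {Q : ℝ≥0∞} (hQ : gridLaw p (x.words w ∩ noBlock {x.i, x.j, x.i} (x.minCount x.g) x.ends) ≤ Q) :
    gridLaw p (x.event G r a u ∩ x.words w) ≤
      ENNReal.ofReal (1 / √(x.j - x.i - 1 : ℕ)) * ENNReal.ofReal (2 * (80 * r / a ^ 3)) *
      (ENNReal.ofReal (1 / √(x.slots w 2 κ).card) * ENNReal.ofReal (2 * (80 * r / a ^ 3))) *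
      (ENNReal.ofReal (1 / √(x.slots w 2 κ').card) * ENNReal.ofReal (2 * (80 * r / a ^ 3))) *
      (ENNReal.ofReal (Real.exp 5 * Real.exp (-(x.s + x.s'))) * Q) := by
  have hu0 : ∀ i, u i ≠ 0 := fun i => abs_pos.1 (ha.trans_le (hu i))
  have h0 : x.firsts.Nonempty := by
    obtain ⟨c, hc⟩ := h1
    exact ⟨(c.1, 1), x.mem_firsts.2 ⟨(x.mem_slots.1 hc).1, rfl⟩⟩
  have h01 : ∀ κ, Disjoint x.firsts (x.slots w 2 κ) := fun κ => Finset.disjoint_left.2 fun c hc hc' => by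
    have := (x.mem_firsts.1 hc).2; have := (x.mem_slots.1 hc').2.2; omega
  have h12 : Disjoint (x.slots w 2 κ) (x.slots w 2 κ') := Finset.disjoint_left.2 fun c hc hc' =>
    hκ ((x.mem_slots.1 hc).2.1.symm.trans (x.mem_slots.1 hc').2.1)
  have hmem : ∀ c ∈ x.firsts ∪ (x.slots w 2 κ ∪ x.slots w 2 κ'), c.1 ∈ Finset.Ioo x.i x.j ∧
      (c.2 = 1 ∨ c.2 = 2) := by
    intro c hc
    simp only [Finset.mem_union, mem_firsts, mem_slots] at hc
    tauto
  have hlaw : ∀ S ⊆ x.firsts ∪ (x.slots w 2 κ ∪ x.slots w 2 κ'), S.Nonempty → ∀ y,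
      gridLaw p {ω | |∑ c ∈ S, (ω c).1 - y| ≤ 80 * r / a ^ 3} ≤
        ENNReal.ofReal (1 / √S.card) * ENNReal.ofReal (2 * (80 * r / a ^ 3)) := fun S hS hne y =>
    measure_sum_fst_le (fun c : ℕ × ℕ => flightLaw c.2) (markLaw p) S hne
      (fun c hc => flightLaw_eq_withDensity (hmem c (hS hc)).2) y _
  have hK : Disjoint x.ends (x.firsts ∪ (x.slots w 2 κ ∪ x.slots w 2 κ')) := by
    refine Finset.disjoint_left.2 fun c hc hc' => ?_
    have h := Finset.mem_Ioo.1 (hmem c hc').1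
    simp only [ends, Finset.mem_insert, Finset.mem_singleton] at hc
    rcases hc with rfl | rfl
    exacts [h.1.ne rfl, h.2.ne rfl]
  have h := measure_le_of_sums_determined (fun c : ℕ × ℕ => flightLaw c.2) (markLaw p)
    expBound_flightLaw (h01 κ) (h01 κ') h12 hK x.tail_nonneg
    (hlaw x.firsts Finset.subset_union_left h0)
    (hlaw _ (Finset.subset_union_left.trans Finset.subset_union_right) h1)
    (hlaw _ (Finset.subset_union_right.trans Finset.subset_union_right) h2)
    ((x.measurableSet_event hGm hu0).inter (x.measurableSet_words w))
    ((x.measurableSet_words w).inter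
      (measurableSet_noBlock {x.i, x.j, x.i} (x.minCount x.g) x.ends))
    (fun ω hω => ⟨hω.2, x.mem_noBlock_of_event hG hω.1 (by rw [len, if_pos rfl]) _⟩)
    (fun ω ω' => and_congr (x.mix_mem_words _ w ω ω') (mix_mem_noBlock ω ω'))
    (fun ω ω' => and_congr (x.mix_mem_words _ w ω ω') (mix_mem_noBlock_of_lt
      (fun c hc => by have := (hmem c hc).2; omega) ω ω'))
    (fun ω hω c _ => x.tail_le hω.1 hG c) ?_
  · rw [card_firsts] at h
    exact h.trans (mul_le_mul_right (mul_le_mul' (x.prod_tail_le subset_rfl (by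
      rw [card_ends]; norm_num)) hQ) _)
  · intro ω hω ω' hω' hag
    have hsh := x.disp_shift hG hω.1 hω'.1 (fun c hc => Finset.Ioo_subset_Icc_self (hmem c hc).1) hag
      (fun l => Or.inl fun n hn => by
        obtain ⟨h3, h4⟩ := hmem _ hn
        rw [Finset.mem_Ioo] at h3
        rw [anchors, if_neg h3.1.ne', if_neg h3.2.ne]
        simpa using h4)
    have hd1 : ∀ c ∈ x.firsts, x.dir u ω c = u := by
      intro c hc
      obtain ⟨h3, h4⟩ := x.mem_firsts.1 hc
      have h5 := (Finset.mem_Ioo.1 h3).1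
      rw [dir, if_neg (fun h => h5.ne' (congrArg Prod.fst h)), h4]; rfl
    have hd2 : ∀ κ, ∀ c ∈ x.slots w 2 κ, x.dir u ω c = flip κ u := by
      intro κ c hc
      obtain ⟨h3, h4, h5⟩ := x.mem_slots.1 hc
      have h6 := (Finset.mem_Ioo.1 h3).1
      rw [dir, if_neg (fun h => h6.ne' (congrArg Prod.fst h)), h5, ← h4, ← hω.2 _ h3]; rfl
    have hsum : ∀ t, |(∑ c ∈ x.firsts, ((ω' c).1 - (ω c).1)) * u t +
        (∑ c ∈ x.slots w 2 κ, ((ω' c).1 - (ω c).1)) * flip κ u t +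
        (∑ c ∈ x.slots w 2 κ', ((ω' c).1 - (ω c).1)) * flip κ' u t| ≤ 80 * r / a ^ 2 := by
      intro t
      have := hsh t
      rw [Finset.sum_union (Finset.disjoint_union_right.2 ⟨h01 κ, h01 κ'⟩), Finset.sum_union h12,
        Finset.sum_congr rfl fun c hc => by rw [hd1 c hc],
        Finset.sum_congr (s₁ := x.slots w 2 κ) rfl fun c hc => by rw [hd2 κ c hc],
        Finset.sum_congr (s₁ := x.slots w 2 κ') rfl fun c hc => by rw [hd2 κ' c hc],
        ← Finset.sum_mul, ← Finset.sum_mul, ← Finset.sum_mul, ← add_assoc] at this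
      exact this
    obtain ⟨e1, e2, e3⟩ := abs_le_of_three_flips ha hu hκ hsum
    have e : 80 * r / a ^ 2 / a = 80 * r / a ^ 3 := by field_simp
    simp only [e, Finset.sum_sub_distrib] at e1 e2 e3
    simp only [abs_sub_comm (∑ c ∈ _, (ω c).1)]
    exact ⟨e1, e2, e3⟩

/-- The extension of a word of the legs between the two moments. -/
def extend (v : Fin (x.j - x.i - 1) → Fin 3) (l : ℕ) : Fin 3 :=
  if h : x.i < l ∧ l < x.j then v ⟨l - x.i - 1, by omega⟩ else 0

lemma prod_extend {M : Type*} [CommMonoid M] (f : Fin 3 → M) (v : Fin (x.j - x.i - 1) → Fin 3) :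
    ∏ l ∈ Finset.Ioo x.i x.j, f (x.extend v l) = ∏ t, f (v t) := by
  refine (Finset.prod_bij (fun t _ => t.1 + x.i + 1) ?_ ?_ ?_ ?_).symm
  · intro t _; have := t.2; rw [Finset.mem_Ioo]; omega
  · intro t _ t' _ h; exact Fin.ext (by omega)
  · intro l hl
    rw [Finset.mem_Ioo] at hl
    exact ⟨⟨l - x.i - 1, by omega⟩, Finset.mem_univ _, by simp only; omega⟩
  · intro t _
    have := t.2
    rw [extend, dif_pos (by omega)]
    congr 2
    exact Fin.ext (by simp only; omega)

lemma card_slots_extend (v : Fin (x.j - x.i - 1) → Fin 3) (b : ℕ) (κ : Fin 3) :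
    (x.slots (x.extend v) b κ).card = letterCount κ v := by
  rw [card_slots, Finset.card_filter, letterCount]
  exact x.prod_extend (M := Multiplicative ℕ) (fun c => Multiplicative.ofAdd (if c = κ then 1 else 0)) v

/-- A displacement is planar, or else it contains three directions. -/
lemma exists_planar_or_words (ω : ℕ × ℕ → Attempt) : (∃ κ, ω ∈ x.planar κ) ∨
    ∃ κ κ', κ ≠ κ' ∧ ∃ v : Fin (x.j - x.i - 1) → Fin 3, (letterCount κ v ≠ 0 ∧ letterCount κ' v ≠ 0) ∧
      ω ∈ x.words (x.extend v) := by
  by_cases hadj : x.j = x.i + 1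
  · refine Or.inl ⟨(ω (x.i, x.g)).2.1, fun l hl => ?_, fun _ => rfl⟩
    rw [Finset.mem_Ioo] at hl; omega
  have hlt := x.lt
  by_cases hc : ∀ l ∈ Finset.Ioo x.i x.j, (ω (l, 1)).2.1 = (ω (x.i + 1, 1)).2.1
  · exact Or.inl ⟨_, hc, fun h => absurd h hadj⟩
  push Not at hc
  obtain ⟨l, hl, hne⟩ := hc
  rw [Finset.mem_Ioo] at hl
  set v : Fin (x.j - x.i - 1) → Fin 3 := fun t => (ω (t.1 + x.i + 1, 1)).2.1 with hv
  have hpos : ∀ t, letterCount (v t) v ≠ 0 := fun t h => by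
    rw [letterCount, Finset.sum_eq_zero_iff] at h
    have := h t (Finset.mem_univ _)
    simp at this
  refine Or.inr ⟨_, _, hne, v, ⟨?_, ?_⟩, fun l' hl' => ?_⟩
  · have := hpos ⟨l - x.i - 1, by omega⟩
    simpa only [hv, show l - x.i - 1 + x.i + 1 = l by omega] using this
  · have := hpos ⟨0, by omega⟩
    simpa only [hv, zero_add] using this
  · rw [Finset.mem_Ioo] at hl'
    rw [extend, dif_pos hl', hv]
    simp only [show l' - x.i - 1 + x.i + 1 = l' by omega]

end
end Sample

/-- The contribution of the displacements that contain three directions. -/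
theorem exists_measure_spatial_le {p : Fin 3 → ℝ} (hp : IsProbVec p)
    [IsProbabilityMeasure (markLaw p)] {a : ℝ} (ha : 0 < a) {u : Pt} (hu : ∀ i, a ≤ |u i|) :
    ∃ σ C : ℝ, 0 < σ ∧ σ < 1 ∧ 0 < C ∧ ∀ r : ℝ, 0 < r → ∀ G : Set (ℕ × ℕ → Attempt),
      MeasurableSet G → (∀ ω ∈ G, ∀ l, GoodLeg r a u (leg ω l)) → ∀ (x : Sample) (κ κ' : Fin 3),
        κ ≠ κ' → ∑ v : Fin (x.j - x.i - 1) → Fin 3 with letterCount κ v ≠ 0 ∧ letterCount κ' v ≠ 0,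
            gridLaw p (x.event G r a u ∩ x.words (x.extend v)) ≤
          ENNReal.ofReal (C * ((1 / √(x.j - x.i - 1 : ℕ) * (1 / ((x.j - x.i - 1 : ℕ) + 1))) *
            ((p κ)⁻¹ + (p κ')⁻¹)) * (r ^ 3 * σ ^ (x.g + x.k') * Real.exp (-(x.s + x.s')))) := by
  obtain ⟨σ, C, hσ0, hσ1, hC, hW⟩ := exists_decay_words hp
  refine ⟨σ, Real.exp 5 * (160 / a ^ 3) ^ 3 * C, hσ0, hσ1, by positivity,
    fun r hr G hGm hG x κ κ' hκ => ?_⟩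
  set Y := Real.exp 5 * Real.exp (-(x.s + x.s')) * (2 * (80 * r / a ^ 3)) ^ 3 *
    (C * σ ^ (x.g + x.k')) with hY
  have hY0 : 0 ≤ Y := by positivity
  have hv : ∀ v : Fin (x.j - x.i - 1) → Fin 3, (letterCount κ v ≠ 0 ∧ letterCount κ' v ≠ 0) →
      gridLaw p (x.event G r a u ∩ x.words (x.extend v)) ≤ ENNReal.ofReal (Y *
        ((∏ t, p (v t)) * (1 / √(x.j - x.i - 1 : ℕ) * (1 / √(letterCount κ v : ℝ) *
          (1 / √(letterCount κ' v : ℝ)))))) := by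
    intro v hv
    have hne : ∀ κ, letterCount κ v ≠ 0 → (x.slots (x.extend v) 2 κ).Nonempty := fun κ h =>
      Finset.card_ne_zero.1 (by rwa [x.card_slots_extend])
    have hP : 0 ≤ ∏ t, p (v t) := Finset.prod_nonneg fun t _ => (hp.1 _).le
    have hQ : gridLaw p (x.words (x.extend v) ∩
        noBlock {x.i, x.j, x.i} (x.minCount x.g) x.ends) ≤
          ENNReal.ofReal ((∏ t, p (v t)) * (C * σ ^ (x.g + x.k'))) := by
      refine (hW x x.i x.g (fun _ => rfl) (fun h => absurd h x.lt.ne) _ _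
        (by rw [x.card_ends]; norm_num)).trans ?_
      rw [x.prod_extend (fun c => ENNReal.ofReal (p c)),
        ← ENNReal.ofReal_prod_of_nonneg fun t _ => (hp.1 _).le, ← ENNReal.ofReal_mul hP]
      refine ENNReal.ofReal_le_ofReal (mul_le_mul_of_nonneg_left (mul_le_mul_of_nonneg_left ?_ hC.le) hP)
      exact pow_le_pow_of_le_one hσ0.le hσ1.le (by omega)
    refine (x.measure_words_le hr ha hu hGm hG hκ (hne κ hv.1) (hne κ' hv.2) hQ).trans (le_of_eq ?_)
    rw [x.card_slots_extend, x.card_slots_extend]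
    rw [← ENNReal.ofReal_mul (by positivity), ← ENNReal.ofReal_mul (by positivity),
      ← ENNReal.ofReal_mul (by positivity), ← ENNReal.ofReal_mul (by positivity),
      ← ENNReal.ofReal_mul (by positivity), ← ENNReal.ofReal_mul (by positivity),
      ← ENNReal.ofReal_mul (by positivity), hY]
    congr 1
    ring
  refine (Finset.sum_le_sum fun v h => hv v (Finset.mem_filter.1 h).2).trans ?_
  rw [← ENNReal.ofReal_sum_of_nonneg fun v _ => by
    have hP : 0 ≤ ∏ t, p (v t) := Finset.prod_nonneg fun t _ => (hp.1 _).le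
    positivity, ← Finset.mul_sum]
  refine ENNReal.ofReal_le_ofReal ((mul_le_mul_of_nonneg_left
    (sum_words_inv_sqrt_le hp _ κ κ') hY0).trans (le_of_eq ?_))
  rw [hY]
  ring

lemma summable_inv_sqrt_mul : Summable fun m : ℕ => 1 / √(m : ℝ) * (1 / ((m : ℝ) + 1)) := by
  refine Summable.of_nonneg_of_le (fun m => by positivity) (fun m => ?_)
    (Real.summable_one_div_nat_rpow.2 (by norm_num : (1 : ℝ) < 3 / 2))
  rcases Nat.eq_zero_or_pos m with rfl | hm
  · simp
  have hm' : (0 : ℝ) < m := by exact_mod_cast hm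
  have e : (m : ℝ) ^ (3 / 2 : ℝ) = √m * m := by
    rw [Real.sqrt_eq_rpow, show (3 / 2 : ℝ) = 1 / 2 + 1 by norm_num, Real.rpow_add hm', Real.rpow_one]
  rw [e, ← one_div_mul_one_div]
  exact mul_le_mul_of_nonneg_left (one_div_le_one_div_of_le hm' (by linarith)) (by positivity)

lemma IsProbVec.lt_one {p : Fin 3 → ℝ} (hp : IsProbVec p) (κ : Fin 3) : p κ < 1 := by
  have h := hp.2
  have h0 := hp.1 0; have h1 := hp.1 1; have h2 := hp.1 2
  rw [Fin.sum_univ_three] at h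
  fin_cases κ <;> simp only [Fin.zero_eta, Fin.mk_one, Fin.reduceFinMk] <;> linarith

/-- The basic estimate for two moments in different legs. The bound is summable over the second
leg, over the numbers of the flights, and over discretized moments. -/
theorem exists_measure_event_le {p : Fin 3 → ℝ} (hp : IsProbVec p)
    [IsProbabilityMeasure (markLaw p)] {a : ℝ} (ha : 0 < a) {u : Pt} (hu : ∀ i, a ≤ |u i|) :
    ∃ (σ : ℝ) (b : ℕ → ℝ), 0 < σ ∧ σ < 1 ∧ (∀ m, 0 ≤ b m) ∧ Summable b ∧
      ∀ r : ℝ, 0 < r → ∀ G : Set (ℕ × ℕ → Attempt), MeasurableSet G →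
        (∀ ω ∈ G, ∀ l, GoodLeg r a u (leg ω l)) → ∀ x : Sample, gridLaw p (x.event G r a u) ≤
          ENNReal.ofReal (b (x.j - x.i - 1) *
            (r ^ 3 * σ ^ (x.g + x.k') * Real.exp (-(x.s + x.s')))) := by
  obtain ⟨σ₁, C₁, hσ₁, hσ₁', hC₁, h₁⟩ := exists_measure_planar_le hp ha hu
  obtain ⟨σ₂, C₂, hσ₂, hσ₂', hC₂, h₂⟩ := exists_measure_spatial_le hp ha hu
  set b₁ : Fin 3 → ℕ → ℝ := fun κ m => C₁ * (((m + 2 : ℕ) : ℝ) * p κ ^ m) with hb₁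
  set b₂ : Fin 3 × Fin 3 → ℕ → ℝ := fun κ m =>
    C₂ * ((1 / √(m : ℝ) * (1 / ((m : ℝ) + 1))) * ((p κ.1)⁻¹ + (p κ.2)⁻¹)) with hb₂
  have hb₁0 : ∀ κ m, 0 ≤ b₁ κ m := fun κ m => by have := hp.1 κ; positivity
  have hb₂0 : ∀ κ m, 0 ≤ b₂ κ m := fun κ m => by
    have := hp.1 κ.1; have := hp.1 κ.2; positivity
  have hs₁ : ∀ κ, Summable (b₁ κ) := by
    intro κ
    have hκ := hp.1 κ
    have h1 := summable_pow_mul_geometric_of_norm_lt_one 1 (r := p κ) (by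
      rw [Real.norm_eq_abs, abs_of_pos hκ]; exact hp.lt_one κ)
    have h2 := (summable_geometric_of_lt_one hκ.le (hp.lt_one κ)).mul_left 2
    refine ((h1.add h2).mul_left C₁).congr fun m => ?_
    simp only [hb₁]; push_cast; ring
  have hs₂ : ∀ κ, Summable (b₂ κ) := fun κ => (summable_inv_sqrt_mul.mul_right _).mul_left C₂
  set σ := max σ₁ σ₂ with hσ
  have hσ0 : 0 < σ := lt_max_of_lt_left hσ₁
  refine ⟨σ, fun m => ∑ κ, b₁ κ m + ∑ κ, b₂ κ m, hσ0, max_lt hσ₁' hσ₂', fun m => ?_, ?_, ?_⟩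
  · exact add_nonneg (Finset.sum_nonneg fun κ _ => hb₁0 κ m) (Finset.sum_nonneg fun κ _ => hb₂0 κ m)
  · exact (summable_sum fun κ _ => hs₁ κ).add (summable_sum fun κ _ => hs₂ κ)
  intro r hr G hGm hG x
  set m := x.j - x.i - 1 with hm
  set R := r ^ 3 * σ ^ (x.g + x.k') * Real.exp (-(x.s + x.s')) with hR
  have hR0 : 0 ≤ R := by positivity
  have hmono : ∀ σ' C, 0 < σ' → σ' ≤ σ → 0 ≤ C → ENNReal.ofReal (C *
      (r ^ 3 * σ' ^ (x.g + x.k') * Real.exp (-(x.s + x.s')))) ≤ ENNReal.ofReal (C * R) := by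
    intro σ' C h0 h1 hC
    refine ENNReal.ofReal_le_ofReal (mul_le_mul_of_nonneg_left ?_ hC)
    rw [hR]
    gcongr
  set P : Set (ℕ × ℕ → Attempt) := ⋃ κ, x.event G r a u ∩ x.planar κ with hP
  set Q : Set (ℕ × ℕ → Attempt) := ⋃ κ : Fin 3 × Fin 3, if κ.1 ≠ κ.2 then
    ⋃ v ∈ Finset.univ.filter fun v : Fin m → Fin 3 => letterCount κ.1 v ≠ 0 ∧ letterCount κ.2 v ≠ 0,
      x.event G r a u ∩ x.words (x.extend v) else ∅ with hQ
  have hsub : x.event G r a u ⊆ P ∪ Q := by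
    intro ω hω
    rcases x.exists_planar_or_words ω with ⟨κ, h⟩ | ⟨κ, κ', hne, v, hv, h⟩
    · exact Or.inl (mem_iUnion.2 ⟨κ, hω, h⟩)
    · refine Or.inr (mem_iUnion.2 ⟨(κ, κ'), ?_⟩)
      rw [if_pos hne]
      exact mem_iUnion₂.2 ⟨v, Finset.mem_filter.2 ⟨Finset.mem_univ _, hv⟩, hω, h⟩
  have hPle : gridLaw p P ≤ ∑ κ, ENNReal.ofReal (b₁ κ m * R) := by
    refine (measure_iUnion_le _).trans ((tsum_fintype _).le.trans (Finset.sum_le_sum fun κ _ => ?_))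
    refine (h₁ r hr G hGm hG x κ).trans ?_
    rw [show x.j + 1 - x.i = m + 2 by have := x.lt; omega]
    exact hmono σ₁ _ hσ₁ (le_max_left _ _) (hb₁0 κ m)
  have hQle : gridLaw p Q ≤ ∑ κ, ENNReal.ofReal (b₂ κ m * R) := by
    refine (measure_iUnion_le _).trans ((tsum_fintype _).le.trans (Finset.sum_le_sum fun κ _ => ?_))
    split_ifs with hne
    · refine (measure_biUnion_finset_le _ _).trans ((h₂ r hr G hGm hG x _ _ hne).trans ?_)
      exact hmono σ₂ _ hσ₂ (le_max_right _ _) (hb₂0 κ m)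
    · simp
  refine (measure_mono hsub).trans ((measure_union_le _ _).trans ((add_le_add hPle hQle).trans
    (le_of_eq ?_)))
  rw [← ENNReal.ofReal_sum_of_nonneg fun κ _ => mul_nonneg (hb₁0 κ m) hR0,
    ← ENNReal.ofReal_sum_of_nonneg fun κ _ => mul_nonneg (hb₂0 κ m) hR0,
    ← Finset.sum_mul, ← Finset.sum_mul, ← ENNReal.ofReal_add, add_mul]
  · exact mul_nonneg (Finset.sum_nonneg fun κ _ => hb₁0 κ m) hR0
  · exact mul_nonneg (Finset.sum_nonneg fun κ _ => hb₂0 κ m) hR0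

/-! ### Summation -/

/-- Some moment in an earlier leg and some moment in leg `j` are virtually at the same place. One of
them is the moment of an attempt, the other one is discretized with step `r`. -/
def encounter (G : Set (ℕ × ℕ → Attempt)) (r a : ℝ) (u : Pt) (j : ℕ) : Set (ℕ × ℕ → Attempt) :=
  {ω | ∃ x : Sample, x.j = j ∧ (∃ q : ℕ, x.s + x.s' = q * r) ∧ ω ∈ x.event G r a u}

/-- The sum of `exp (-(q * r))` over `q`. -/
lemma one_sub_exp_inv_le {r : ℝ} (hr : 0 < r) (hr1 : r ≤ 1) :
    (1 - ENNReal.ofReal (Real.exp (-r)))⁻¹ ≤ ENNReal.ofReal (2 / r) := by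
  have h1 : r / 2 ≤ 1 - Real.exp (-r) := by
    have h2 : Real.exp (-r) ≤ 1 / (1 + r) := by
      rw [Real.exp_neg, ← one_div]
      exact one_div_le_one_div_of_le (by linarith) (by linarith [Real.add_one_le_exp r])
    have h3 : 1 / (1 + r) ≤ 1 - r / 2 := by
      rw [div_le_iff₀ (by linarith)]; nlinarith
    linarith
  rw [← ENNReal.ofReal_one, ← ENNReal.ofReal_sub _ (Real.exp_pos _).le,
    ← ENNReal.ofReal_inv_of_pos (by linarith [half_pos hr])]
  refine ENNReal.ofReal_le_ofReal ?_
  rw [← inv_div, inv_le_inv₀ (by linarith [half_pos hr]) (half_pos hr)]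
  exact h1

/-- Summation of the basic estimate. The sum over the discretized moments `q * r` costs a factor of
order `1 / r`, and `r ^ 3 / r = r ^ 2`. -/
theorem exists_measure_encounter_le {p : Fin 3 → ℝ} (hp : IsProbVec p)
    [IsProbabilityMeasure (markLaw p)] {a : ℝ} (ha : 0 < a) {u : Pt} (hu : ∀ i, a ≤ |u i|) :
    ∃ C : ℝ, 0 ≤ C ∧ ∀ r : ℝ, 0 < r → r ≤ 1 → ∀ G : Set (ℕ × ℕ → Attempt), MeasurableSet G →
      (∀ ω ∈ G, ∀ l, GoodLeg r a u (leg ω l)) → ∀ j,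
        gridLaw p (encounter G r a u j) ≤ ENNReal.ofReal (C * r ^ 2) := by
  obtain ⟨σ, b, hσ0, hσ1, hb0, hb, hmain⟩ := exists_measure_event_le hp ha hu
  have hsum : Summable fun n : ℕ => ((n : ℝ) + 1) * σ ^ n := by
    have h1 := summable_pow_mul_geometric_of_norm_lt_one 1 (r := σ) (by
      rw [Real.norm_eq_abs, abs_of_pos hσ0]; exact hσ1)
    have h2 := summable_geometric_of_lt_one hσ0.le hσ1
    refine (h1.add h2).congr fun n => ?_
    ring
  set S := ∑' n : ℕ, ((n : ℝ) + 1) * σ ^ n with hS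
  have hS0 : 0 ≤ S := tsum_nonneg fun n => by positivity
  have hB0 : 0 ≤ ∑' m, b m := tsum_nonneg hb0
  have h1σ : 0 < 1 - σ := by linarith
  refine ⟨4 * (∑' m, b m) * (S * (1 - σ)⁻¹), by positivity, fun r hr hr1 G hGm hG j => ?_⟩
  set F : ℕ → ℕ → ℕ → ℕ → ℕ → Bool → Set (ℕ × ℕ → Attempt) := fun i g k k' q ε =>
    {ω | ∃ x : Sample, (x.i = i ∧ x.j = j ∧ x.g = g ∧ x.k = k ∧ x.k' = k' ∧
      x.s = (if ε then q * r else 0) ∧ x.s' = (if ε then 0 else q * r)) ∧ ω ∈ x.event G r a u} with hF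
  have hbound : ∀ i g k k' q ε, gridLaw p (F i g k k' q ε) ≤ ENNReal.ofReal (b (j - i - 1)) *
      (ENNReal.ofReal (r ^ 3) * (ENNReal.ofReal (σ ^ g) * (ENNReal.ofReal σ ^ k' *
        ENNReal.ofReal (Real.exp (-r)) ^ q))) := by
    intro i g k k' q ε
    by_cases hx : ∃ x : Sample, x.i = i ∧ x.j = j ∧ x.g = g ∧ x.k = k ∧ x.k' = k' ∧
      x.s = (if ε then q * r else 0) ∧ x.s' = (if ε then 0 else q * r)
    · obtain ⟨x, h1, h2, h3, h4, h5, h6, h7⟩ := hx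
      have hsub : F i g k k' q ε ⊆ x.event G r a u := by
        rintro ω ⟨y, ⟨h1', h2', h3', h4', h5', h6', h7'⟩, hy⟩
        rw [← h1] at h1'; rw [← h2] at h2'; rw [← h3] at h3'; rw [← h4] at h4'
        rw [← h5] at h5'; rw [← h6] at h6'; rw [← h7] at h7'
        have : y = x := by
          cases x; cases y
          simp only at h1' h2' h3' h4' h5' h6' h7'
          subst_vars
          rfl
        exact this ▸ hy
      refine (measure_mono hsub).trans ((hmain r hr G hGm hG x).trans (le_of_eq ?_))
      have hss : x.s + x.s' = q * r := by
        rw [h6, h7]; cases ε <;> simp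
      rw [hss, h1, h2, h3, h5, ← ENNReal.ofReal_pow hσ0.le, ← ENNReal.ofReal_pow (Real.exp_pos _).le,
        ← Real.exp_nat_mul, ← ENNReal.ofReal_mul (by positivity), ← ENNReal.ofReal_mul (by positivity),
        ← ENNReal.ofReal_mul (by positivity), ← ENNReal.ofReal_mul (hb0 _), pow_add, mul_neg]
      congr 1
      ring
    · have : F i g k k' q ε = ∅ := by
        ext ω
        simp only [hF, Set.mem_ofPred_eq, mem_empty_iff_false, iff_false]
        rintro ⟨x, h, -⟩
        exact hx ⟨x, h⟩
      rw [this, measure_empty]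
      exact zero_le
  have hcover : encounter G r a u j ⊆ ⋃ i ∈ Finset.range j, ⋃ g, ⋃ k ∈ Finset.range (g + 1),
      ⋃ k', ⋃ q, ⋃ ε, F i g k k' q ε := by
    rintro ω ⟨x, hj, ⟨q, hq⟩, hω⟩
    have hlt := x.lt
    simp only [mem_iUnion]
    rcases x.or_eq_zero with h0 | h0
    · refine ⟨x.i, Finset.mem_range.2 (hj ▸ hlt), x.g, x.k, Finset.mem_range.2
        (Nat.lt_succ_of_le x.le), x.k', q, false, x, ⟨rfl, hj, rfl, rfl, rfl, by simp [h0], ?_⟩, hω⟩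
      rw [h0, zero_add] at hq; simpa using hq
    · refine ⟨x.i, Finset.mem_range.2 (hj ▸ hlt), x.g, x.k, Finset.mem_range.2
        (Nat.lt_succ_of_le x.le), x.k', q, true, x, ⟨rfl, hj, rfl, rfl, rfl, ?_, by simp [h0]⟩, hω⟩
      rw [h0, add_zero] at hq; simpa using hq
  calc gridLaw p (encounter G r a u j)
      ≤ ∑ i ∈ Finset.range j, ∑' g, ∑ k ∈ Finset.range (g + 1), ∑' k', ∑' q, ∑ ε,
          gridLaw p (F i g k k' q ε) := by
        refine (measure_mono hcover).trans ((measure_biUnion_finset_le _ _).trans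
          (Finset.sum_le_sum fun i _ => (measure_iUnion_le _).trans
            (ENNReal.tsum_le_tsum fun g => (measure_biUnion_finset_le _ _).trans
              (Finset.sum_le_sum fun k _ => (measure_iUnion_le _).trans
                (ENNReal.tsum_le_tsum fun k' => (measure_iUnion_le _).trans
                  (ENNReal.tsum_le_tsum fun q => ?_))))))
        exact (measure_iUnion_le _).trans (tsum_fintype _).le
    _ ≤ ∑ i ∈ Finset.range j, ∑' g : ℕ, ∑ k ∈ Finset.range (g + 1), ∑' k', ∑' q, ∑ _ε : Bool,
          ENNReal.ofReal (b (j - i - 1)) * (ENNReal.ofReal (r ^ 3) * (ENNReal.ofReal (σ ^ g) *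
            (ENNReal.ofReal σ ^ k' * ENNReal.ofReal (Real.exp (-r)) ^ q))) := by
        exact Finset.sum_le_sum fun i _ => ENNReal.tsum_le_tsum fun g => Finset.sum_le_sum fun k _ =>
          ENNReal.tsum_le_tsum fun k' => ENNReal.tsum_le_tsum fun q => Finset.sum_le_sum fun ε _ =>
            hbound i g k k' q ε
    _ = (∑ i ∈ Finset.range j, ENNReal.ofReal (b (j - i - 1))) * (ENNReal.ofReal (r ^ 3) *
          ((∑' g : ℕ, ENNReal.ofReal (((g : ℝ) + 1) * σ ^ g)) * ((1 - ENNReal.ofReal σ)⁻¹ *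
            (2 * (1 - ENNReal.ofReal (Real.exp (-r)))⁻¹)))) := by
        rw [Finset.sum_mul]
        refine Finset.sum_congr rfl fun i _ => ?_
        simp only [Finset.sum_const, Finset.card_univ, Fintype.card_bool, Finset.card_range,
          nsmul_eq_mul, ENNReal.tsum_mul_left, ENNReal.tsum_mul_right, ENNReal.tsum_geometric]
        have e : ∀ g : ℕ, ENNReal.ofReal (((g : ℝ) + 1) * σ ^ g) =
            ((g + 1 : ℕ) : ℝ≥0∞) * ENNReal.ofReal (σ ^ g) := fun g => by
          rw [ENNReal.ofReal_mul (by positivity), ← ENNReal.ofReal_natCast]; push_cast; rfl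
        simp only [e]
        rw [← ENNReal.tsum_mul_right, ← ENNReal.tsum_mul_left, ← ENNReal.tsum_mul_left]
        refine tsum_congr fun g => ?_
        push_cast
        ring
    _ ≤ ENNReal.ofReal (∑' m, b m) * (ENNReal.ofReal (r ^ 3) *
          (ENNReal.ofReal S * (ENNReal.ofReal (1 - σ)⁻¹ * (2 * ENNReal.ofReal (2 / r))))) := by
        have e1 : ∑ i ∈ Finset.range j, ENNReal.ofReal (b (j - i - 1)) ≤ ENNReal.ofReal (∑' m, b m) := by
          have e2 : ∀ i, b (j - i - 1) = b (j - 1 - i) := fun i => by congr 1; omega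
          simp only [e2]
          rw [Finset.sum_range_reflect (fun m => ENNReal.ofReal (b m)) j,
            ENNReal.ofReal_tsum_of_nonneg hb0 hb]
          exact ENNReal.sum_le_tsum _
        have e2 : (1 - ENNReal.ofReal σ)⁻¹ = ENNReal.ofReal (1 - σ)⁻¹ := by
          rw [← ENNReal.ofReal_one, ← ENNReal.ofReal_sub _ hσ0.le, ENNReal.ofReal_inv_of_pos h1σ]
        rw [← ENNReal.ofReal_tsum_of_nonneg (fun n => by positivity) hsum, e2]
        gcongr
        exact one_sub_exp_inv_le hr hr1
    _ = _ := by
        rw [show (2 : ℝ≥0∞) = ENNReal.ofReal 2 by simp, ← ENNReal.ofReal_mul (by norm_num),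
          ← ENNReal.ofReal_mul (by positivity), ← ENNReal.ofReal_mul hS0,
          ← ENNReal.ofReal_mul (by positivity), ← ENNReal.ofReal_mul hB0]
        congr 1
        field_simp
        ring

/-! ### The concatenated process -/

section
variable {α : Type*} [LinearOrder α] {f : ℕ → α} {t : α}

lemma sSup_lt_eq (hf : Monotone f) {m : ℕ} (h1 : f m < t) (h2 : t ≤ f (m + 1)) :
    sSup {m | f m < t} = m := by
  refine IsGreatest.csSup_eq ⟨h1, fun n hn => ?_⟩
  by_contra! h
  exact absurd (hn : f n < t) (not_lt.2 (h2.trans (hf h)))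

lemma sSup_le_eq (hf : Monotone f) {m : ℕ} (h1 : f m ≤ t) (h2 : t < f (m + 1)) :
    sSup {m | f m ≤ t} = m := by
  refine IsGreatest.csSup_eq ⟨h1, fun n hn => ?_⟩
  by_contra! h
  exact absurd (hn : f n ≤ t) (not_le.2 (h2.trans_le (hf h)))

lemma exists_lt_le_succ {N : ℕ} (h0 : f 0 < t) (hN : t ≤ f N) :
    ∃ m < N, f m < t ∧ t ≤ f (m + 1) := by
  induction N with
  | zero => exact absurd h0 (not_lt.2 hN)
  | succ N ih =>
    by_cases h : t ≤ f N
    · obtain ⟨m, hm, h1⟩ := ih h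
      exact ⟨m, by omega, h1⟩
    · exact ⟨N, Nat.lt_succ_self N, not_le.1 h, hN⟩

end

section
variable {r a : ℝ} {u : Pt} {ω : ℕ → Attempt}

lemma attemptTime_succ (ω : ℕ → Attempt) (n : ℕ) :
    attemptTime ω (n + 1) = attemptTime ω n + flightTime ω (n + 1) :=
  Finset.sum_Icc_succ_top (by omega) _

lemma attemptTime_zero (ω : ℕ → Attempt) : attemptTime ω 0 = 0 := by simp [attemptTime]

lemma Setting.strictMono_attemptTime (h : Setting r a u ω) : StrictMono (attemptTime ω) :=
  strictMono_nat_of_lt_succ fun n => by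
    rw [attemptTime_succ]; linarith [h.flightTime_pos (n + 1)]

/-- Each position in a leg belongs to one of its flights. -/
lemma GoodLeg.exists_legPos_eq (h : GoodLeg r a u ω) {t : ℝ} (ht : 0 < t)
    (htθ : t ≤ legDuration r u ω) : ∃ k < legCount r u ω, ∃ τ, 0 ≤ τ ∧ τ ≤ flightTime ω (k + 1) ∧
      legPos r u ω t = flightPos r (state r u ω k).scatterers (state r u ω k).pos
        (state r u ω k).vel τ := by
  have hmono := h.strictMono_attemptTime
  obtain ⟨k, hk, h1, h2⟩ := exists_lt_le_succ (f := attemptTime ω) (t := t)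
    (by rwa [attemptTime_zero]) htθ
  refine ⟨k, hk, ?_⟩
  rcases h2.lt_or_eq with h3 | h3
  · refine ⟨t - attemptTime ω k, by linarith, ?_, ?_⟩
    · rw [attemptTime_succ] at h2; linarith
    · simp only [legPos, sSup_le_eq hmono.monotone h1.le h3]
  · refine ⟨flightTime ω (k + 1), (h.flightTime_pos _).le, le_rfl, ?_⟩
    have e : sSup {n | attemptTime ω n ≤ t} = k + 1 := sSup_le_eq hmono.monotone h3.ge (by
      rw [h3]; exact hmono (Nat.lt_succ_self _))
    simp only [legPos, e]
    rw [h3, sub_self]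
    funext i
    have := abs_flightPos_sub_le r (state r u ω (k + 1)).scatterers (state r u ω (k + 1)).pos
      (state r u ω (k + 1)).vel le_rfl i
    rw [mul_zero] at this
    rw [sub_eq_zero.1 (abs_nonpos_iff.1 this)]
    rfl

lemma Setting.abs_flightPos_sub_line_le (h : Setting r a u ω) {k : ℕ} {τ : ℝ} (h0 : 0 ≤ τ)
    (h1 : τ ≤ flightTime ω (k + 1)) (i : Fin 3) :
    |flightPos r (state r u ω k).scatterers (state r u ω k).pos (state r u ω k).vel τ i -
      ((state r u ω (k + 1)).pos i - (flightTime ω (k + 1) - τ) *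
        (state r u ω k).velBefore r (ω (k + 1)) i)| ≤ 18 * r / a ^ 2 :=
  (h.goodFlight k).near_line h.r_pos h.a_pos
    (fun i => by rw [(state_isVel r u ω k).abs_eq]; exact h.abs_le i) h0 h1 i

lemma Setting.abs_velBefore_le (h : Setting r a u ω) (k : ℕ) (i : Fin 3) :
    |(state r u ω k).velBefore r (ω (k + 1)) i| ≤ 1 := by
  rw [(velBefore_isVel _ _).abs_eq, (state_isVel r u ω k).abs_eq]; exact h.abs_le i

lemma exists_nat_mul_le {x : ℝ} (hr : 0 < r) (hx : 0 ≤ x) : ∃ q : ℕ, q * r ≤ x ∧ x - q * r ≤ r := by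
  refine ⟨⌊x / r⌋₊, ?_, ?_⟩
  · rw [← le_div_iff₀ hr]; exact Nat.floor_le (by positivity)
  · have := (Nat.lt_floor_add_one (x / r)).le
    rw [div_le_iff₀ hr] at this; linarith

/-- A position in a leg, in terms of a discrete moment counted from the end of the flight. -/
lemma GoodLeg.exists_fwdVec (h : GoodLeg r a u ω) {t : ℝ} (ht : 0 < t)
    (htθ : t ≤ legDuration r u ω) : ∃ k < legCount r u ω, ∃ q : ℕ, q * r ≤ flightTime ω (k + 1) ∧
      ∀ i, |legPos r u ω t i - fwdVec r u ω k (q * r) i| ≤ 18 * r / a ^ 2 + r := by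
  obtain ⟨k, hk, τ, h0, h1, he⟩ := h.exists_legPos_eq ht htθ
  obtain ⟨q, hq, hq'⟩ := exists_nat_mul_le h.r_pos (sub_nonneg.2 h1)
  refine ⟨k, hk, q, by linarith, fun i => ?_⟩
  have h2 := h.abs_flightPos_sub_line_le h0 h1 i
  rw [← he] at h2
  have h3 : |(flightTime ω (k + 1) - τ - q * r) * (state r u ω k).velBefore r (ω (k + 1)) i| ≤ r := by
    rw [abs_mul, abs_of_nonneg (sub_nonneg.2 hq)]
    exact (mul_le_of_le_one_right (sub_nonneg.2 hq) (h.abs_velBefore_le k i)).trans hq'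
  have h4 : fwdVec r u ω k (q * r) i = (state r u ω (k + 1)).pos i -
    q * r * (state r u ω k).velBefore r (ω (k + 1)) i := rfl
  rw [h4]
  rw [abs_le] at *
  constructor <;> linarith [h2.1, h2.2, h3.1, h3.2]

/-- A position in a leg, in terms of a discrete moment counted from the start of the flight. -/
lemma GoodLeg.exists_backVec (h : GoodLeg r a u ω) {t : ℝ} (ht : 0 < t)
    (htθ : t ≤ legDuration r u ω) : ∃ k < legCount r u ω, ∃ q : ℕ, q * r ≤ flightTime ω (k + 1) ∧
      ∀ i, |legPos r u ω t i - (legEnd r u ω i - backVec r u ω (legCount r u ω) k (q * r) i)| ≤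
        18 * r / a ^ 2 + r := by
  obtain ⟨k, hk, τ, h0, h1, he⟩ := h.exists_legPos_eq ht htθ
  obtain ⟨q, hq, hq'⟩ := exists_nat_mul_le h.r_pos h0
  refine ⟨k, hk, q, by linarith, fun i => ?_⟩
  have h2 := h.abs_flightPos_sub_line_le h0 h1 i
  rw [← he] at h2
  have h3 : |(τ - q * r) * (state r u ω k).velBefore r (ω (k + 1)) i| ≤ r := by
    rw [abs_mul, abs_of_nonneg (sub_nonneg.2 hq)]
    exact (mul_le_of_le_one_right (sub_nonneg.2 hq) (h.abs_velBefore_le k i)).trans hq'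
  have h4 : backVec r u ω (legCount r u ω) k (q * r) i = legEnd r u ω i -
    (state r u ω (k + 1)).pos i + (flightTime ω (k + 1) - q * r) *
      (state r u ω k).velBefore r (ω (k + 1)) i := by rw [backVec, if_pos hk]; rfl
  rw [h4]
  rw [abs_le] at *
  constructor <;> linarith [h2.1, h2.2, h3.1, h3.2]

lemma Setting.abs_cur_sub_pos_le (h : Setting r a u ω) {n : ℕ} {c : Pt}
    (hc : (state r u ω (n + 1)).cur = some c) (i : Fin 3) :
    |c i - (state r u ω (n + 1)).pos i| ≤ r / 2 := by
  by_cases hs : (state r u ω n).Shadowed r (ω (n + 1))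
  · rw [state, step_cur_of_shadowed hs] at hc; exact absurd hc (by simp)
  · rw [state, step_cur_of_not hs, Option.some_inj] at hc
    have h1 := abs_impactParam_le h.r_pos (v := (state r u ω n).velBefore r (ω (n + 1)))
      (((state_isVel r u ω n).trans (velBefore_isVel _ _)).ne_zero h.ne_zero)
      (h.generic.unit (n + 1)) (ω (n + 1)).2.1 i
    have h2 : c i - (state r u ω (n + 1)).pos i = impactParam r ((state r u ω n).velBefore r
        (ω (n + 1))) (ω (n + 1)).2.1 (ω (n + 1)).2.2 i := by
      rw [← hc, state, step_pos]
      simp [State.newCentre]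
    rwa [h2]

/-- A scatterer of a leg is close to the start of the next flight. -/
lemma GoodLeg.abs_cur_sub_le (h : GoodLeg r a u ω) {k : ℕ} (h0 : k ≠ 0) (hk : k ≤ legCount r u ω)
    {c : Pt} (hc : (state r u ω k).cur = some c) (i : Fin 3) :
    |c i - (legEnd r u ω i - backVec r u ω (legCount r u ω) k 0 i)| ≤ 18 * r / a ^ 2 + r / 2 := by
  obtain ⟨n, rfl⟩ := Nat.exists_eq_succ_of_ne_zero h0
  have h1 := h.abs_cur_sub_pos_le hc i
  have hr := h.r_pos
  have hra : 0 < 18 * r / a ^ 2 := div_pos (by linarith) (pow_pos h.a_pos 2)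
  rcases hk.lt_or_eq with hlt | he
  · have h2 := h.abs_flightPos_sub_line_le (k := n + 1) le_rfl (h.flightTime_pos (n + 1 + 1)).le i
    have h3 := abs_flightPos_sub_le r (state r u ω (n + 1)).scatterers (state r u ω (n + 1)).pos
      (state r u ω (n + 1)).vel le_rfl i
    rw [mul_zero] at h3
    rw [sub_eq_zero.1 (abs_nonpos_iff.1 h3), sub_zero] at h2
    have h4 : backVec r u ω (legCount r u ω) (n + 1) 0 i = legEnd r u ω i -
      (state r u ω (n + 1 + 1)).pos i + flightTime ω (n + 1 + 1) *
        (state r u ω (n + 1)).velBefore r (ω (n + 1 + 1)) i := by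
      rw [backVec, if_pos hlt, sub_zero]; rfl
    rw [Nat.succ_eq_add_one, h4]
    rw [abs_le] at *
    constructor <;> linarith [h2.1, h2.2, h1.1, h1.2]
  · rw [backVec, if_neg (by omega), legEnd, ← he]
    simp only [Pi.zero_apply, sub_zero]
    exact h1.trans (by linarith)

end

section
variable {r a : ℝ} {u β : Pt} {ϖ : ℕ → ℕ → Attempt}

/-- The data of all legs as one family. -/
def grid (ϖ : ℕ → ℕ → Attempt) : ℕ × ℕ → Attempt := fun c => ϖ c.1 c.2

lemma leg_grid (ϖ : ℕ → ℕ → Attempt) (l : ℕ) : leg (grid ϖ) l = ϖ l := rfl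

lemma totalCount_succ (r : ℝ) (u : Pt) (ϖ : ℕ → ℕ → Attempt) (n : ℕ) :
    totalCount r u ϖ (n + 1) = totalCount r u ϖ n + legCount r u (ϖ (n + 1)) :=
  Finset.sum_Icc_succ_top (by omega) _

lemma totalTime_succ (r : ℝ) (u : Pt) (ϖ : ℕ → ℕ → Attempt) (n : ℕ) :
    totalTime r u ϖ (n + 1) = totalTime r u ϖ n + legDuration r u (ϖ (n + 1)) :=
  Finset.sum_Icc_succ_top (by omega) _

lemma legsEnd_succ (r : ℝ) (u : Pt) (ϖ : ℕ → ℕ → Attempt) (n : ℕ) :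
    legsEnd r u ϖ (n + 1) = legsEnd r u ϖ n + legEnd r u (ϖ (n + 1)) :=
  Finset.sum_Icc_succ_top (by omega) _

lemma monotone_totalCount : Monotone (totalCount r u ϖ) :=
  monotone_nat_of_le_succ fun n => by rw [totalCount_succ]; omega

lemma monotone_totalTime (h : ∀ l, GoodLeg r a u (ϖ l)) : Monotone (totalTime r u ϖ) :=
  monotone_nat_of_le_succ fun n => by
    rw [totalTime_succ]
    have : 0 ≤ legDuration r u (ϖ (n + 1)) := by
      unfold legDuration attemptTime
      exact Finset.sum_nonneg fun k _ => ((h (n + 1)).flightTime_pos k).le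
    linarith

lemma position_eq (h : ∀ l, GoodLeg r a u (ϖ l)) {m : ℕ} {t : ℝ} (h1 : totalTime r u ϖ m < t)
    (h2 : t ≤ totalTime r u ϖ (m + 1)) :
    position r u ϖ t = legsEnd r u ϖ m + legPos r u (ϖ (m + 1)) (t - totalTime r u ϖ m) := by
  simp only [position, sSup_lt_eq (monotone_totalTime h) h1 h2]

lemma scatterer_eq {m k : ℕ} (h1 : totalCount r u ϖ m < k) (h2 : k ≤ totalCount r u ϖ (m + 1)) :
    scatterer r u β ϖ k =
      (state r u (ϖ (m + 1)) (k - totalCount r u ϖ m)).cur.map (legsEnd r u ϖ m + ·) := by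
  simp only [scatterer, if_neg (show k ≠ 0 by omega), sSup_lt_eq monotone_totalCount h1 h2]

/-- The displacement is the remainder of leg `x.i`, the legs in between, and the beginning of leg
`x.j`. -/
lemma Sample.disp_eq (x : Sample) : x.disp r u (grid ϖ) = backVec r u (ϖ x.i) x.g x.k x.s +
    (legsEnd r u ϖ (x.j - 1) - legsEnd r u ϖ x.i) + fwdVec r u (ϖ x.j) x.k' x.s' := by
  have hlt := x.lt
  have h1 : Finset.Icc x.i x.j = insert x.i (insert x.j (Finset.Ioo x.i x.j)) := by
    ext l; simp only [Finset.mem_Icc, Finset.mem_insert, Finset.mem_Ioo]; omega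
  have h2 : Finset.Icc 1 (x.j - 1) = Finset.Icc 1 x.i ∪ Finset.Ioo x.i x.j := by
    ext l; simp only [Finset.mem_Icc, Finset.mem_union, Finset.mem_Ioo]; omega
  have h3 : Disjoint (Finset.Icc 1 x.i) (Finset.Ioo x.i x.j) :=
    Finset.disjoint_left.2 fun l hl hl' => by
      rw [Finset.mem_Icc] at hl; rw [Finset.mem_Ioo] at hl'; omega
  have h4 : ∀ l ∈ Finset.Ioo x.i x.j, x.vec r u (grid ϖ) l = legEnd r u (ϖ l) := fun l hl => by
    rw [Finset.mem_Ioo] at hl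
    rw [vec, if_neg hl.1.ne', if_neg hl.2.ne, leg_grid]
  rw [disp, h1, Finset.sum_insert (by simp [hlt.ne]), Finset.sum_insert (by simp),
    Finset.sum_congr rfl h4, legsEnd, legsEnd, h2, Finset.sum_union h3, vec, vec, if_pos rfl,
    if_neg hlt.ne', if_pos rfl, leg_grid, leg_grid]
  abel

/-- Two points that meet give a small displacement: each of them is `18 * r / a ^ 2 + r` away from
its position in the sample, and `2 * (18 + 1) + 1 / 2 ≤ 40`. -/
lemma mem_encounter {G : Set (ℕ × ℕ → Attempt)} (hr : 0 < r) (ha : 0 < a) (ha1 : a ≤ 1)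
    (hϖ : grid ϖ ∈ G) (x : Sample)
    (hq : ∃ q : ℕ, x.s + x.s' = q * r) (hg : legCount r u (ϖ x.i) = x.g)
    (hk' : x.k' < legCount r u (ϖ x.j)) (hs : x.s ≤ flightTime (ϖ x.i) (x.k + 1))
    (hs' : x.s' ≤ flightTime (ϖ x.j) (x.k' + 1)) {z z' : Pt}
    (hz : ∀ t, |z t - (legsEnd r u ϖ x.i t - backVec r u (ϖ x.i) x.g x.k x.s t)| ≤
      18 * r / a ^ 2 + r)
    (hz' : ∀ t, |z' t - (legsEnd r u ϖ (x.j - 1) t + fwdVec r u (ϖ x.j) x.k' x.s' t)| ≤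
      18 * r / a ^ 2 + r) (hzz : ∀ t, |z t - z' t| ≤ r / 2) :
    grid ϖ ∈ encounter G r a u x.j := by
  refine ⟨x, rfl, hq, hϖ, hg, hk', hs, hs', fun t => ?_⟩
  have h1 := hz t
  have h2 := hz' t
  have h3 := hzz t
  have h4 : x.disp r u (grid ϖ) t = backVec r u (ϖ x.i) x.g x.k x.s t +
    (legsEnd r u ϖ (x.j - 1) t - legsEnd r u ϖ x.i t) + fwdVec r u (ϖ x.j) x.k' x.s' t := by
    rw [x.disp_eq]; rfl
  have h5 : r ≤ r / a ^ 2 := by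
    rw [le_div_iff₀ (by positivity)]
    exact mul_le_of_le_one_right hr.le (pow_le_one₀ ha.le ha1)
  have h6 : 40 * r / a ^ 2 = 40 * (r / a ^ 2) := by ring
  have h7 : 18 * r / a ^ 2 = 18 * (r / a ^ 2) := by ring
  rw [h4, h6]
  rw [h7] at h1 h2
  rw [abs_le] at *
  constructor <;> linarith [h1.1, h1.2, h2.1, h2.2, h3.1, h3.2]

/-- In a shadowing event the later moment is that of an attempt, and the earlier one is discretized. -/
theorem grid_mem_encounter_of_shadow {G : Set (ℕ × ℕ → Attempt)}
    (hϖ : grid ϖ ∈ G) (h : ∀ l, GoodLeg r a u (ϖ l)) {j : ℕ} (hj : 1 ≤ j)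
    (hE : ϖ ∈ shadowEvent r u β j) : grid ϖ ∈ encounter G r a u j := by
  obtain ⟨t, k, c, ht0, ht, hk, hk', hc, hzc⟩ := hE
  have hr := (h 0).r_pos
  have ha := (h 0).a_pos
  obtain ⟨m, rfl⟩ := Nat.exists_eq_add_of_le' hj
  rw [Nat.add_sub_cancel] at ht hk
  obtain ⟨n, hn, h1, h2⟩ := exists_lt_le_succ (f := totalTime r u ϖ) (N := m)
    (by simpa [totalTime] using ht0) ht.le
  rw [scatterer_eq hk hk'] at hc
  obtain ⟨c', hc', rfl⟩ := Option.map_eq_some_iff.1 hc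
  obtain ⟨k', hk1⟩ : ∃ k', k - totalCount r u ϖ m = k' + 1 := ⟨k - totalCount r u ϖ m - 1, by omega⟩
  rw [hk1] at hc'
  rw [totalCount_succ] at hk'
  have h2' := h2
  rw [totalTime_succ] at h2'
  obtain ⟨kk, hkk, q, hq, hz⟩ := (h (n + 1)).exists_backVec (t := t - totalTime r u ϖ n)
    (by linarith) (by linarith)
  refine mem_encounter (z := position r u ϖ t) (z' := legsEnd r u ϖ m + c') hr ha (h 0).a_le hϖ
    { i := n + 1, j := m + 1, g := legCount r u (ϖ (n + 1)), k := kk, k' := k', s := q * r, s' := 0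
      lt := by omega
      le := hkk.le
      eq_zero := fun h => absurd hkk (not_lt.2 h)
      lt_of_adjacent := fun _ => hkk
      s_nonneg := by positivity
      s'_nonneg := le_rfl
      or_eq_zero := Or.inr rfl } ⟨q, add_zero _⟩ rfl (by simp only; omega) hq
    ((h (m + 1)).flightTime_pos _).le (fun i => ?_) (fun i => ?_) (fun i => ?_)
  · have e : position r u ϖ t i = legsEnd r u ϖ n i + legPos r u (ϖ (n + 1)) (t - totalTime r u ϖ n) i := by
      rw [position_eq h h1 h2]; rfl
    have e' : legsEnd r u ϖ (n + 1) i = legsEnd r u ϖ n i + legEnd r u (ϖ (n + 1)) i := by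
      rw [legsEnd_succ]; rfl
    rw [e, e']
    convert hz i using 2
    ring
  · have h3 := (h (m + 1)).abs_cur_sub_pos_le hc' i
    have h4 : 0 < 18 * r / a ^ 2 := by positivity
    have e : fwdVec r u (ϖ (m + 1)) k' 0 i = (state r u (ϖ (m + 1)) (k' + 1)).pos i := by
      simp [fwdVec]
    simp only [Nat.add_sub_cancel, e, Pi.add_apply, add_sub_add_left_eq_sub]
    linarith
  · exact hzc i

/-- In a recollision event the earlier moment is that of an attempt, and the later one is
discretized. The scatterer at the origin of the process counts as placed at the end of leg `0`. -/
theorem grid_mem_encounter_of_recollision {G : Set (ℕ × ℕ → Attempt)}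
    (hϖ : grid ϖ ∈ G) (h : ∀ l, GoodLeg r a u (ϖ l)) (hβ : ∀ i, |β i| ≤ r / 2) {j : ℕ} (hj : 1 ≤ j)
    (hE : ϖ ∈ recollisionEvent r u β j) : grid ϖ ∈ encounter G r a u j := by
  obtain ⟨t, k, c, hk, ht, ht', hc, hzc⟩ := hE
  have hr := (h 0).r_pos
  have ha := (h 0).a_pos
  obtain ⟨m, rfl⟩ := Nat.exists_eq_add_of_le' hj
  rw [Nat.add_sub_cancel] at hk ht
  have hpos := position_eq h ht ht'.le
  rw [totalTime_succ] at ht'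
  obtain ⟨k', hk', q, hq, hz'⟩ := (h (m + 1)).exists_fwdVec (t := t - totalTime r u ϖ m)
    (by linarith) (by linarith)
  have h18 : 0 < 18 * r / a ^ 2 := by positivity
  -- the scatterer in terms of its leg; `β` plays the role of a scatterer at the end of leg `0`
  obtain ⟨i, kk, hi, hkk, hadj, hzi⟩ : ∃ i kk, i < m + 1 ∧ kk ≤ legCount r u (ϖ i) ∧
      (m + 1 = i + 1 → kk < legCount r u (ϖ i)) ∧
      ∀ t, |c t - (legsEnd r u ϖ i t - backVec r u (ϖ i) (legCount r u (ϖ i)) kk 0 t)| ≤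
        18 * r / a ^ 2 + r := by
    rcases Nat.eq_zero_or_pos k with rfl | hk0
    · refine ⟨0, legCount r u (ϖ 0), by omega, le_rfl, fun h0 => ?_, fun t => ?_⟩
      · obtain rfl : m = 0 := by omega
        simp [totalCount] at hk
      · obtain rfl : β = c := by simpa [scatterer] using hc
        rw [backVec, if_neg (lt_irrefl _)]
        simp only [legsEnd, zero_lt_one, Finset.Icc_eq_empty_of_lt, Finset.sum_empty, Pi.zero_apply,
          sub_zero]
        linarith [hβ t]
    · obtain ⟨n, hn, h1, h2⟩ := exists_lt_le_succ (f := totalCount r u ϖ) (N := m)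
        (by simpa [totalCount] using hk0) hk.le
      rw [scatterer_eq h1 h2] at hc
      obtain ⟨c', hc', rfl⟩ := Option.map_eq_some_iff.1 hc
      rw [totalCount_succ] at h2
      refine ⟨n + 1, k - totalCount r u ϖ n, by omega, by omega, fun h0 => ?_, fun t => ?_⟩
      · obtain rfl : m = n + 1 := by omega
        rw [totalCount_succ] at hk; omega
      · have h3 := (h (n + 1)).abs_cur_sub_le (by omega) (by omega) hc' t
        have e' : legsEnd r u ϖ (n + 1) t = legsEnd r u ϖ n t + legEnd r u (ϖ (n + 1)) t := by
          rw [legsEnd_succ]; rfl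
        rw [e', Pi.add_apply]
        refine le_trans (le_of_eq ?_) (h3.trans (by linarith))
        congr 1
        ring
  refine mem_encounter (z := c) (z' := position r u ϖ t) hr ha (h 0).a_le hϖ
    { i := i, j := m + 1, g := legCount r u (ϖ i), k := kk, k' := k', s := 0, s' := q * r
      lt := hi
      le := hkk
      eq_zero := fun _ => rfl
      lt_of_adjacent := hadj
      s_nonneg := le_rfl
      s'_nonneg := by positivity
      or_eq_zero := Or.inl rfl } ⟨q, zero_add _⟩ rfl hk'
    ((h i).flightTime_pos _).le hq hzi (fun i => ?_) (fun i => ?_)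
  · have h3 := hz' i
    rw [hpos]
    simpa only [Nat.add_sub_cancel, Pi.add_apply, add_sub_add_left_eq_sub] using h3
  · exact hzc i

end

/-- Up to a null set, a sequence of legs may be replaced with the family of all attempts. -/
theorem measure_le_of_curry {p : Fin 3 → ℝ} (hp : IsProbVec p) [IsProbabilityMeasure (markLaw p)]
    {E : Set (ℕ → ℕ → Attempt)} {G F : Set (ℕ × ℕ → Attempt)} (hG : gridLaw p Gᶜ = 0)
    (h : ∀ ϖ ∈ E, grid ϖ ∈ G → grid ϖ ∈ F) : processLaw p E ≤ gridLaw p F := by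
  rw [processLaw_eq hp, MeasurableEquiv.map_apply]
  have hsub : (MeasurableEquiv.curry ℕ ℕ Attempt) ⁻¹' E ⊆ Gᶜ ∪ F := by
    intro ω hω
    by_cases hg : ω ∈ G
    · exact Or.inr (h _ hω hg)
    · exact Or.inl hg
  refine (measure_mono hsub).trans ((measure_union_le _ _).trans ?_)
  rw [hG, zero_add]

end WindTree

end

theorem proposition4 (p : Fin 3 → ℝ) (hp : WindTree.IsProbVec p)
    (v₀ : WindTree.Pt) (hv₀ : v₀ ∈ WindTree.velocities p) :
    ∃ C : ℝ, ∀ r : ℝ, 0 < r →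
      ∀ u₀ ∈ WindTree.accessible p v₀, ∀ β₀ : WindTree.Pt,
        -β₀ ∈ WindTree.faceBetween r u₀ v₀ →
        ∀ j : ℕ, 1 ≤ j →
          WindTree.processLaw p (WindTree.recollisionEvent r v₀ β₀ j) ≤
              ENNReal.ofReal (C * r ^ 2) ∧
          WindTree.processLaw p (WindTree.shadowEvent r v₀ β₀ j) ≤
              ENNReal.ofReal (C * r ^ 2) := by
  have h1 := WindTree.isProbabilityMeasure_markLaw hp
  have h2 := WindTree.isProbabilityMeasure_processLaw hp
  obtain ⟨κ, -, hκ⟩ := Finset.exists_min_image Finset.univ (fun i => |v₀ i|) Finset.univ_nonempty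
  set a := |v₀ κ| with ha
  have hnorm : 0 < Real.sqrt (∑ k, p k ^ 2) := Real.sqrt_pos.2
    (Finset.sum_pos (fun k _ => pow_pos (hp.1 k) 2) Finset.univ_nonempty)
  have ha0 : 0 < a := by rw [ha, hv₀.2 κ]; exact div_pos (hp.1 κ) hnorm
  have hle : ∀ i, |v₀ i| ≤ 1 := fun i => by
    rw [← sq_le_one_iff_abs_le_one, ← hv₀.1]
    exact Finset.single_le_sum (fun k _ => sq_nonneg (v₀ k)) (Finset.mem_univ i)
  have hge : ∀ i, a ≤ |v₀ i| := fun i => hκ i (Finset.mem_univ i)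
  obtain ⟨C, hC0, hC⟩ := WindTree.exists_measure_encounter_le hp ha0 hge
  refine ⟨C + (41 / a ^ 3) ^ 2, fun r hr u₀ _ β₀ hβ₀ j hj => ?_⟩
  by_cases hsmall : 41 * r / a ^ 3 < 1
  · have hr1 : r ≤ 1 := by
      rw [div_lt_one (by positivity)] at hsmall
      have : a ^ 3 ≤ 1 := pow_le_one₀ ha0.le (hle κ)
      linarith
    obtain ⟨N, hN, hNm, hN0⟩ := MeasureTheory.exists_measurable_superset_of_null
      (MeasureTheory.ae_iff.1 (WindTree.ae_goodLeg hp hr ha0 (hle κ) hge hle hsmall))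
    have hG : ∀ ω ∈ Nᶜ, ∀ l, WindTree.GoodLeg r a v₀ (WindTree.leg ω l) := fun ω hω => by
      by_contra h; exact hω (hN h)
    have hbound := (hC r hr hr1 Nᶜ hNm.compl hG j).trans (ENNReal.ofReal_le_ofReal
      (mul_le_mul_of_nonneg_right (le_add_of_nonneg_right (sq_nonneg (41 / a ^ 3))) (sq_nonneg r)))
    have hβ : ∀ i, |β₀ i| ≤ r / 2 := fun i => by
      obtain ⟨k, -, hk⟩ := hβ₀
      simpa using hk.1 i
    exact ⟨(WindTree.measure_le_of_curry hp (G := Nᶜ) (by rwa [compl_compl]) fun ϖ hϖ hg =>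
        WindTree.grid_mem_encounter_of_recollision hg (hG _ hg) hβ hj hϖ).trans hbound,
      (WindTree.measure_le_of_curry hp (G := Nᶜ) (by rwa [compl_compl]) fun ϖ hϖ hg =>
        WindTree.grid_mem_encounter_of_shadow hg (hG _ hg) hj hϖ).trans hbound⟩
  · have hbig : 1 ≤ (C + (41 / a ^ 3) ^ 2) * r ^ 2 := by
      have h3 : 1 ≤ (41 / a ^ 3 * r) ^ 2 := one_le_pow₀ (by
        rw [not_lt] at hsmall
        rwa [div_mul_eq_mul_div])
      rw [mul_pow] at h3
      have := mul_nonneg hC0 (sq_nonneg r)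
      linarith
    have h4 : ∀ E, WindTree.processLaw p E ≤ ENNReal.ofReal ((C + (41 / a ^ 3) ^ 2) * r ^ 2) :=
      fun E => MeasureTheory.prob_le_one.trans (ENNReal.one_le_ofReal.2 hbig)
    exact ⟨h4 _, h4 _⟩
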